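/- **Model.** Computations are on a random access machine with unit-cost instructions. Its integer cells and registers hold words; its real cells and registers hold exact real numbers. The basic operations are arithmetic and comparison of words, indirect addressing, conversion of a word to a real, and multiplication, division and comparison of reals. A computation gets stuck when an integer operation produces a value of absolute value exceeding the word bound $B$. Memory is initially zero except for the input. Fix any set $X$ (possibly empty) of additional unit-cost operations of the forms $\mathbb Z^2\to\mathbb Z$, $\mathbb R^2\to\mathbb R$, $\mathbb R\to\mathbb Z$; for example, real addition and subtraction give the usual real RAM. Both algorithms below run on the machine equipped with $X$. **SCFG parsing.** A stochastic context-free grammar $(G,\mathbf p)$ is a context-free grammar $G=(\mathcal N,\Sigma,\mathcal P,S)$ with a real probability $p(P)>0$ for each production $P\in\mathcal P$, such that for every $A\in\mathcal N$ the probabilities of the productions with left-hand side $A$ sum to $1$. Grammars are in Chomsky normal form (productions $A\to BC$, $A\to x$, $S\to\varepsilon$), and every nonterminal occurs in a derivation from $S$ of some string of the language. Let $|G|=|\mathcal N|+|\Sigma|+\sum_{A\to\alpha}(1+|\alpha|)$. The probability of a parse is the product of the probabilities of the productions applied. Write $L(\mathbf p)=\max\{1,\max_{p\in\mathbf p}\log_2\frac1p\}$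 (this differs from $\max_{p\in\mathbf p}\log_2\frac1p$ only if all probabilities are $1$). The SCFG parsing problem is solved in time $T$ if there are a parsing program, a query program and constants $t,c$ such that, for every such $(G,\mathbf p)$ and every nonempty $s\in\Sigma^*$ with $|s|=n$, and every word bound $B\ge(|G|+n+2^{L(\mathbf p)})^c$, the parsing program builds within $T$ steps an oracle $\mathcal F$ with the following property. Any number of queries $(A,i,j)$ with $A\in\mathcal N$, $1\le i\le j\le n$ can be made one after the other; each is answered by the query program in at most $t$ steps, with $\mathcal F(A,i,j)=q$, provided that $A$ consistently derives $s_i^j=s_i\cdots s_j$ (that is, $A\Rightarrow^* s_i^j$ and $S\Rightarrow^* s_1^{i-1}As_{j+1}^n$), where $q$ is the maximum probability of a parse of $s_i^j$ from $A$. **APSP.** Given a digraph on $m\ge1$ vertices with integer edge weights in $[-W,W]$ and no negative cycle, compute for every ordered pair $(i,j)$ of vertices whether $j$ is reachable from $i$ and, if so, the minimum weight of a walk from $i$ to $j$. The problem is solved in time $T'(m,W)$ if there are a program and a constant $c$ such that for every such input and every word bound $B\ge(m+W+2)^c$ the program halts with the correct output within $T'(m,W)$ steps. **Theorem.** Let $\delta>0$.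 If the SCFG parsing problem can be solved in $O\bigl(|G|\,n^{3-\delta}\,L(\mathbf p)\bigr)$ time, then APSP can be solved in $\tilde O(m^{3-\delta/3}\log W)$ time; that is, there are constants $C$ and $e$ such that APSP can be solved in at most $C\,m^{3-\delta/3}\,(\log_2(m+1))^{e}\,\log_2(W+2)$ steps. -/

import Mathlib

namespace StochasticParsing

/-! ## The machine model

A random access machine with integer words and real cells, programmed by structured programs in
three-address code. Every instruction and every test has unit cost. Integers are words: a
computation in which an integer operation produces a value of absolute value larger than the
word bound `B` gets stuck. Addresses are integer words. Real cells (used for probabilities) hold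
exact real numbers; the basic instructions on them are conversion of a word, multiplication,
division and comparison. -/

/-- Additional unit-cost operations with which the machine may be equipped: binary operations on
words, binary operations on reals, and operations that turn a real into a word. For instance
`realOps = {(· + ·), (· - ·)}` gives the usual real RAM, and empty sets give the basic machine. -/
structure Extension where
  intOps : Set (ℤ → ℤ → ℤ)
  realOps : Set (ℝ → ℝ → ℝ)
  roundOps : Set (ℝ → ℤ)

/-- Binary operations on words. -/
inductive IntOp (X : Extension) where
  | add | sub | mul | div | mod
  | extra (f : X.intOps)

noncomputable def IntOp.eval {X : Extension} : IntOp X → ℤ → ℤ → ℤ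
  | add, a, b => a + b
  | sub, a, b => a - b
  | mul, a, b => a * b
  | div, a, b => a / b
  | mod, a, b => a % b
  | extra f, a, b => f.1 a b

/-- Binary operations on reals. -/
inductive RealOp (X : Extension) where
  | mul | div
  | extra (f : X.realOps)

noncomputable def RealOp.eval {X : Extension} : RealOp X → ℝ → ℝ → ℝ
  | mul, a, b => a * b
  | div, a, b => a / b
  | extra f, a, b => f.1 a b

/-- Tests: comparison of two word registers or of two real registers. -/
inductive Test where
  | intLe (x y : ℕ)
  | realLe (x y : ℕ)

/-- Programs. Registers and arrays are named by natural numbers (a program mentions only finitely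
many); `x`, `y`, `z` are registers and `a` is an array. -/
inductive Program (X : Extension) where
  | skip
  | intConst (x : ℕ) (c : ℤ)               -- x := c
  | intOp (o : IntOp X) (x y z : ℕ)        -- x := y o z
  | intLoad (x a y : ℕ)                    -- x := a[y]
  | intStore (a x y : ℕ)                   -- a[x] := y
  | realCast (x y : ℕ)                     -- x := y, where x is real and y is a word
  | realOp (o : RealOp X) (x y z : ℕ)      -- x := y o z
  | realLoad (x a y : ℕ)                   -- x := a[y], where the address y is a word
  | realStore (a x y : ℕ)                  -- a[x] := y, where the address x is a word
  | round (f : X.roundOps) (x y : ℕ)       -- x := f y, where x is a word and y is real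
  | seq (p q : Program X)
  | ite (t : Test) (p q : Program X)
  | while (t : Test) (p : Program X)

/-- Memory contents: word registers, word arrays, real registers, real arrays. -/
structure State where
  int : ℕ → ℤ
  intArr : ℕ → ℤ → ℤ
  real : ℕ → ℝ
  realArr : ℕ → ℤ → ℝ

namespace State

def setInt (σ : State) (x : ℕ) (v : ℤ) : State :=
  { σ with int := Function.update σ.int x v }

def setReal (σ : State) (x : ℕ) (v : ℝ) : State :=
  { σ with real := Function.update σ.real x v }

def setIntArr (σ : State) (a : ℕ) (i v : ℤ) : State :=
  { σ with intArr := Function.update σ.intArr a (Function.update (σ.intArr a) i v) }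

def setRealArr (σ : State) (a : ℕ) (i : ℤ) (v : ℝ) : State :=
  { σ with realArr := Function.update σ.realArr a (Function.update (σ.realArr a) i v) }

end State

def Test.holds (σ : State) : Test → Prop
  | intLe x y => σ.int x ≤ σ.int y
  | realLe x y => σ.real x ≤ σ.real y

/-- `Exec B p σ τ k`: with word bound `B`, the program `p` started in `σ` halts in `τ` after `k`
steps. -/
inductive Exec {X : Extension} (B : ℕ) : Program X → State → State → ℕ → Prop
  | skip (σ : State) : Exec B .skip σ σ 1
  | intConst (σ : State) (x : ℕ) (c : ℤ) (h : |c| ≤ B) :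
      Exec B (.intConst x c) σ (σ.setInt x c) 1
  | intOp (σ : State) (o : IntOp X) (x y z : ℕ) (h : |o.eval (σ.int y) (σ.int z)| ≤ B) :
      Exec B (.intOp o x y z) σ (σ.setInt x (o.eval (σ.int y) (σ.int z))) 1
  | intLoad (σ : State) (x a y : ℕ) :
      Exec B (.intLoad x a y) σ (σ.setInt x (σ.intArr a (σ.int y))) 1
  | intStore (σ : State) (a x y : ℕ) :
      Exec B (.intStore a x y) σ (σ.setIntArr a (σ.int x) (σ.int y)) 1
  | realCast (σ : State) (x y : ℕ) :
      Exec B (.realCast x y) σ (σ.setReal x (σ.int y)) 1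
  | realOp (σ : State) (o : RealOp X) (x y z : ℕ) :
      Exec B (.realOp o x y z) σ (σ.setReal x (o.eval (σ.real y) (σ.real z))) 1
  | realLoad (σ : State) (x a y : ℕ) :
      Exec B (.realLoad x a y) σ (σ.setReal x (σ.realArr a (σ.int y))) 1
  | realStore (σ : State) (a x y : ℕ) :
      Exec B (.realStore a x y) σ (σ.setRealArr a (σ.int x) (σ.real y)) 1
  | round (σ : State) (f : X.roundOps) (x y : ℕ) (h : |f.1 (σ.real y)| ≤ B) :
      Exec B (.round f x y) σ (σ.setInt x (f.1 (σ.real y))) 1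
  | seq {p q : Program X} {σ τ υ : State} {k l : ℕ} :
      Exec B p σ τ k → Exec B q τ υ l → Exec B (.seq p q) σ υ (k + l)
  | iteTrue {t : Test} {p q : Program X} {σ τ : State} {k : ℕ} :
      t.holds σ → Exec B p σ τ k → Exec B (.ite t p q) σ τ (k + 1)
  | iteFalse {t : Test} {p q : Program X} {σ τ : State} {k : ℕ} :
      ¬ t.holds σ → Exec B q σ τ k → Exec B (.ite t p q) σ τ (k + 1)
  | whileTrue {t : Test} {p : Program X} {σ τ υ : State} {k l : ℕ} :
      t.holds σ → Exec B p σ τ k → Exec B (.while t p) τ υ l →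
        Exec B (.while t p) σ υ (k + l + 1)
  | whileFalse {t : Test} {p : Program X} {σ : State} :
      ¬ t.holds σ → Exec B (.while t p) σ σ 1

/-! ## Stochastic context-free grammars -/

/-- A stochastic context-free grammar, with its nonterminals and terminals numbered. -/
structure SCFG where
  numNT : ℕ
  numT : ℕ
  start : Fin numNT
  rules : Finset (ContextFreeRule (Fin numT) (Fin numNT))
  prob : ContextFreeRule (Fin numT) (Fin numNT) → ℝ
  prob_pos : ∀ r ∈ rules, 0 < prob r
  sum_prob : ∀ A : Fin numNT, ∑ r ∈ rules with r.input = A, prob r = 1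

namespace SCFG

/-- Symbols of the grammar. -/
abbrev Sym (g : SCFG) : Type := Symbol (Fin g.numT) (Fin g.numNT)

/-- The underlying context-free grammar. -/
def toCFG (g : SCFG) : ContextFreeGrammar (Fin g.numT) where
  NT := Fin g.numNT
  initial := g.start
  rules := g.rules

/-- `u ⇒* v` by means of the productions of the grammar. -/
def Derives (g : SCFG) (u v : List g.Sym) : Prop := g.toCFG.Derives u v

/-- A terminal string as a string of symbols. -/
def word (g : SCFG) (s : List (Fin g.numT)) : List g.Sym := s.map Symbol.terminal

/-- The productions in `P`, applied successively (the first one first), derive `v` from `u`. -/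
inductive Parse (g : SCFG) :
    List g.Sym → List (ContextFreeRule (Fin g.numT) (Fin g.numNT)) → List g.Sym → Prop
  | nil (u : List g.Sym) : Parse g u [] u
  | cons {u v w : List g.Sym} {r : ContextFreeRule (Fin g.numT) (Fin g.numNT)}
      {P : List (ContextFreeRule (Fin g.numT) (Fin g.numNT))} :
      r ∈ g.rules → r.Rewrites u v → Parse g v P w → Parse g u (r :: P) w

/-- The probabilities of all parses of the terminal string `s` from the nonterminal `A`. -/
def parseProbs (g : SCFG) (A : Fin g.numNT) (s : List (Fin g.numT)) : Set ℝ :=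
  {q | ∃ P, g.Parse [.nonterminal A] P (g.word s) ∧ q = (P.map g.prob).prod}

/-- Chomsky normal form: every production is `A → BC`, `A → x` or `S → ε`. -/
def IsCNF (g : SCFG) : Prop :=
  ∀ r ∈ g.rules, (∃ A C, r.output = [.nonterminal A, .nonterminal C]) ∨
    (∃ x, r.output = [.terminal x]) ∨ (r.input = g.start ∧ r.output = [])

/-- Every nonterminal occurs in a derivation, from the start symbol, of a string of the language. -/
def AllReachable (g : SCFG) : Prop :=
  ∀ A : Fin g.numNT, ∃ (u v : List g.Sym) (s : List (Fin g.numT)),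
    g.Derives [.nonterminal g.start] (u ++ [.nonterminal A] ++ v) ∧
      g.Derives (u ++ [.nonterminal A] ++ v) (g.word s)

/-- The grammar size `|G|`: the number of nonterminals, of terminals, and the total length of the
productions. -/
def size (g : SCFG) : ℕ := g.numNT + g.numT + ∑ r ∈ g.rules, (1 + r.output.length)

/-- The maximum of `log₂ (1 / p)` over the probabilities `p` of the productions. It is replaced by
`1` if it is smaller than `1`, which happens only if all probabilities are `1`: otherwise some
probability is at most `1 / 2`. -/
noncomputable def maxLog (g : SCFG) : ℝ :=
  g.rules.fold max 1 fun r => Real.logb 2 (1 / g.prob r)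

/-- The substring of `s` that consists of the letters numbered `i`, ..., `j - 1` (from `0`). -/
def substring {α : Type} (s : List α) (i j : ℕ) : List α := (s.take j).drop i

/-- `A` consistently derives the substring of `s` between `i` and `j`. -/
def ConsistentlyDerives (g : SCFG) (s : List (Fin g.numT)) (A : Fin g.numNT) (i j : ℕ) : Prop :=
  g.Derives [.nonterminal A] (g.word (substring s i j)) ∧
    g.Derives [.nonterminal g.start]
      (g.word (s.take i) ++ [.nonterminal A] ++ g.word (s.drop j))

/-- The number of a symbol (`0` if there is none). -/
def symCode (g : SCFG) : Option g.Sym → ℤ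
  | some (.terminal x) => (x : ℕ)
  | some (.nonterminal A) => (A : ℕ)
  | none => 0

/-- The initial memory of a parser for a grammar in Chomsky normal form, the productions of which
are listed in `l`, and the string `s`. Production number `k` is given by its left-hand side, the
length of its right-hand side and the (at most two) symbols there, and its probability. All other
cells hold `0`. -/
noncomputable def input (g : SCFG) (l : List (ContextFreeRule (Fin g.numT) (Fin g.numNT)))
    (s : List (Fin g.numT)) : State where
  int x := match x with
    | 0 => g.numNT
    | 1 => g.numT
    | 2 => (g.start : ℕ)
    | 3 => l.length
    | 4 => s.length
    | _ => 0
  intArr a i := if i < 0 then 0 else match a with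
    | 0 => (l[i.toNat]?.map fun r => ((r.input : ℕ) : ℤ)).getD 0
    | 1 => (l[i.toNat]?.map fun r => (r.output.length : ℤ)).getD 0
    | 2 => (l[i.toNat]?.map fun r => g.symCode r.output[0]?).getD 0
    | 3 => (l[i.toNat]?.map fun r => g.symCode r.output[1]?).getD 0
    | 4 => (s[i.toNat]?.map fun x => ((x : ℕ) : ℤ)).getD 0
    | _ => 0
  real _ := 0
  realArr a i := if i < 0 then 0 else match a with
    | 0 => (l[i.toNat]?.map g.prob).getD 0
    | _ => 0

/-- The memory `σ` holds an oracle for `g` and `s`, queried by the program `qry` in at most `t`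
steps: if `A` consistently derives the substring of `s` between `i` and `j`, and the maximum
probability of a parse of that substring from `A` is `q`, then the query `(A, i, j)` returns `q`.
Any number of such queries may be made one after the other (`I` consists of the states of the
memory that can occur between queries). -/
def IsOracle {X : Extension} (B : ℕ) (qry : Program X) (t : ℕ) (g : SCFG)
    (s : List (Fin g.numT)) (σ : State) : Prop :=
  ∃ I : Set State, σ ∈ I ∧ ∀ τ ∈ I, ∀ (A : Fin g.numNT) (i j : ℕ), i < j → j ≤ s.length →
    g.ConsistentlyDerives s A i j → ∀ q, IsGreatest (g.parseProbs A (substring s i j)) q →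
      ∃ υ ∈ I, ∃ k ≤ t,
        Exec B qry (((τ.setInt 0 (A : ℕ)).setInt 1 i).setInt 2 j) υ k ∧ υ.real 0 = q

end SCFG

/-- The machine with additional operations `X` solves the SCFG parsing problem in time `T g n`:
there are a parsing program, which for each stochastic grammar `g` and each nonempty string of
length `n` builds an oracle within `T g n` steps, and a query program which answers the queries to
this oracle in constant time. Words have `O(log |G| + log n + max log (1 / p))` bits. -/
def SolvesParsing (X : Extension) (T : SCFG → ℕ → ℝ) : Prop :=
  ∃ (pre qry : Program X) (t c : ℕ), ∀ g : SCFG, g.IsCNF → g.AllReachable →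
    ∀ l : List (ContextFreeRule (Fin g.numT) (Fin g.numNT)), l.Nodup → (∀ r, r ∈ l ↔ r ∈ g.rules) →
    ∀ s : List (Fin g.numT), s ≠ [] →
    ∀ B : ℕ, (g.size + s.length + (2 : ℝ) ^ g.maxLog) ^ c ≤ (B : ℝ) →
      ∃ (σ : State) (k : ℕ), Exec B pre (g.input l s) σ k ∧ (k : ℝ) ≤ T g s.length ∧
        g.IsOracle B qry t s σ

/-! ## All-pairs shortest paths -/

/-- A digraph on `m` vertices with integer edge weights: `w i j` is the weight of the edge from `i`
to `j`, or `none` if there is no such edge. -/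
abbrev WeightedDigraph (m : ℕ) : Type := Fin m → Fin m → Option ℤ

namespace WeightedDigraph

variable {m : ℕ}

/-- There is a walk from `i` to `j` of total weight `x`. -/
inductive Walk (w : WeightedDigraph m) : Fin m → Fin m → ℤ → Prop
  | nil (i : Fin m) : Walk w i i 0
  | cons {i j k : Fin m} {x y : ℤ} : w i j = some x → Walk w j k y → Walk w i k (x + y)

/-- All edge weights lie in `[-W, W]`. -/
def WeightsBounded (w : WeightedDigraph m) (W : ℕ) : Prop :=
  ∀ i j x, w i j = some x → |x| ≤ W

def NoNegativeCycle (w : WeightedDigraph m) : Prop := ∀ i x, Walk w i i x → 0 ≤ x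

/-- The initial memory: register `0` holds `m`; array `0` holds the matrix of edge weights and
array `1` the adjacency matrix, row by row. All other cells hold `0`. -/
def input (w : WeightedDigraph m) : State where
  int x := match x with
    | 0 => m
    | _ => 0
  intArr a p := if h : 0 ≤ p ∧ p < m * m then
      let e := w ⟨(p / m).toNat, (Int.toNat_lt (Int.ediv_nonneg h.1 (by positivity))).2
          (Int.ediv_lt_of_lt_mul (by nlinarith [h.1, h.2]) h.2)⟩
        ⟨(p % m).toNat, (Int.toNat_lt (Int.emod_nonneg _ (by rintro hm; simp [hm] at h; omega))).2
          (Int.emod_lt_of_pos _ (by nlinarith [h.1, h.2]))⟩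
      match a with
      | 0 => e.getD 0
      | 1 => if e.isSome then 1 else 0
      | _ => 0
    else 0
  real _ := 0
  realArr _ _ := 0

/-- The memory `σ` holds the solution: array `3` is the reachability matrix, and array `2` holds
the distance from `i` to `j` for each `j` that is reachable from `i`, row by row. -/
def IsSolution (w : WeightedDigraph m) (σ : State) : Prop :=
  ∀ i j : Fin m,
    ((∃ x, Walk w i j x) → σ.intArr 3 ((i : ℕ) * m + (j : ℕ)) = 1 ∧
      IsLeast {x | Walk w i j x} (σ.intArr 2 ((i : ℕ) * m + (j : ℕ)))) ∧
    ((¬ ∃ x, Walk w i j x) → σ.intArr 3 ((i : ℕ) * m + (j : ℕ)) = 0)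

end WeightedDigraph

/-- The machine with additional operations `X` solves the all-pairs shortest path problem, on
digraphs with `m ≥ 1` vertices, integer weights in `[-W, W]` and no negative cycle, in time
`T m W`. Words have `O(log m + log W)` bits. -/
def SolvesAPSP (X : Extension) (T : ℕ → ℕ → ℝ) : Prop :=
  ∃ (prog : Program X) (c : ℕ), ∀ (m W : ℕ) (w : WeightedDigraph m), 1 ≤ m →
    w.WeightsBounded W → w.NoNegativeCycle → ∀ B : ℕ, (m + W + 2) ^ c ≤ B →
      ∃ (σ : State) (k : ℕ), Exec B prog w.input σ k ∧ (k : ℝ) ≤ T m W ∧ w.IsSolution σ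

end StochasticParsing

/-! Distances between `m` vertices arise from about `log₂ m` min-plus squarings of a matrix. Each
squaring is turned into a single parsing problem with a grammar of size `O(m²)` and a string of
length `O(m^(1/3))`. A parser that runs in time `|G| n^(3-δ) L` then spends `m² · m^(1-δ/3) · L =
m^(3-δ/3) · L` on it, and `L` is bounded by a constant times `log m · log W`. This is a stochastic
variant of Lee's reduction of Boolean matrix multiplication to parsing.

The matrix has `D = d³` rows, where `d` is least with `m ≤ d³`. An index `i` is split into a high
part `i / d < d²` and a low part `i % d < d`. High parts go into nonterminals: `M k` stands for a
block of the matrix, where `k` codes a pair of high parts, and `C k → M k' M k''` multiplies blocks.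
Low parts go into positions: the text is a marker, the letters `0, ..., d-1`, the interleaved pairs
`d+z, z`, and the letters `d, ..., 2d-1`. A parse from `M` without the marker fixes only the first
letter `x` and the last letter `d+z` of its word, and has probability proportional to `Q - a`, with
`a` the matrix entry selected by the block and by `x`, `z`. The factor for the other letters depends
on the length alone. Where two words from `M` meet inside the text, the letters are `d+z` and `z'`;
adjacency forces `z = z'` (`eq_of_letterAt`), so both factors use the same middle index `l`. Hence
the largest probability of a parse of the segment for `(x, y)` from `C k` is a known scale times the
maximum over `l` of `(Q - a i l)(Q - a l j)` (`isGreatest`).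

For `Q` larger than every product of two entries, this product is `Q² - (a i l + a l j) Q` up to an
error in `[0, Q)`. So its maximum is at least `(Q - s) Q` exactly if the min-plus entry is at most
`s` (`exists_threshold`), and a binary search with real comparisons recovers the entry; neither
logarithms nor real subtraction are needed. Probabilities sum to `1` because each production of
weight `Q - a` has a companion of weight `a` whose right-hand side contains the start symbol; words
derived through it contain the marker, which lies outside all segments.

Distances are stored with an offset `o` in the role of `0`, and `4 * o` in the role of infinity. All
relevant walks weigh less than `o` in absolute value, so finite and infinite sums stay separated and
the encoding survives a squaring (`Encodes.sq`). Without negative cycles shortest walks may be taken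
simple, so squaring until `2 ^ s ≥ m` suffices.

The parser is an arbitrary program that expects zero memory. Its memory cannot be cleared cheaply
between calls, so call number `c` uses the addresses `i * m + c`; there are fewer than `m` calls,
and the residue modulo `m` separates them. `Simulates.exec` shows that this relocation costs a
factor `3` in time and a factor of about `m` in word size. The remaining work is a Hoare logic with
time bounds (`Run`) and the verification of the program that writes grammars, queries the oracle and
squares.

Memory layout: the word registers `0` to `8` hold `m, d, d², d⁴, D, o, Q`, the largest weight and
the current power of two; register `15` holds the number of the call, `20` and `21` count the
productions and letters written, `22` to `26` are working variables, `30` to `63` are temporary, and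
the parser lives from `64` on. Word array `4` is the matrix, real array `0` the table of scales, and
the parser's arrays begin at `8`. -/

namespace StochasticParsing

/-! ## Structured programs over expressions -/

/-- The basic binary operations on words. -/
inductive Arith where
  | add | sub | mul | div | mod

def Arith.toIntOp (X : Extension) : Arith → IntOp X
  | add => .add
  | sub => .sub
  | mul => .mul
  | div => .div
  | mod => .mod

def Arith.eval : Arith → ℤ → ℤ → ℤ
  | add, a, b => a + b
  | sub, a, b => a - b
  | mul, a, b => a * b
  | div, a, b => a / b
  | mod, a, b => a % b

@[simp] theorem Arith.eval_toIntOp {X : Extension} (o : Arith) (a b : ℤ) :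
    (o.toIntOp X).eval a b = o.eval a b := by cases o <;> rfl

/-- For bounds at least `2` the sum is at most the product, so one multiplicative estimate covers
all operations. It makes the size of a word expression exponential only in the number of its leaves
and array accesses. -/
theorem Arith.abs_eval_le (o : Arith) {a b x y : ℤ} (ha : |a| ≤ x) (hb : |b| ≤ y) (hx : 2 ≤ x)
    (hy : 2 ≤ y) : |o.eval a b| ≤ x * y := by
  have hxy : x + y ≤ x * y := by nlinarith
  cases o with
  | add => exact (abs_add_le a b).trans (by linarith)
  | sub => exact (abs_sub a b).trans (by linarith)
  | mul =>
    simp only [Arith.eval, abs_mul]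
    exact mul_le_mul ha hb (abs_nonneg _) (by linarith)
  | div => exact (Int.abs_ediv_le_abs a b).trans (by linarith)
  | mod =>
    simp only [Arith.eval]
    by_cases h : b = 0
    · subst h; rw [Int.emod_zero]; linarith
    · rw [abs_of_nonneg (Int.emod_nonneg a h)]
      have := Int.emod_lt_abs a h
      linarith

/-- Word expressions over registers and arrays. -/
inductive Ex where
  | const (c : ℤ)
  | reg (x : ℕ)
  | bin (o : Arith) (e f : Ex)
  | get (a : ℕ) (e : Ex)

namespace Ex

instance : Add Ex := ⟨bin .add⟩
instance : Sub Ex := ⟨bin .sub⟩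
instance : Mul Ex := ⟨bin .mul⟩
instance : Div Ex := ⟨bin .div⟩
instance : Mod Ex := ⟨bin .mod⟩
instance (n : ℕ) : OfNat Ex n := ⟨const n⟩

def eval (σ : State) : Ex → ℤ
  | const c => c
  | reg x => σ.int x
  | bin o e f => o.eval (e.eval σ) (f.eval σ)
  | get a e => σ.intArr a (e.eval σ)

@[simp] theorem eval_reg (σ : State) (x : ℕ) : (reg x).eval σ = σ.int x := rfl
@[simp] theorem eval_get (σ : State) (a : ℕ) (e : Ex) :
    (get a e).eval σ = σ.intArr a (e.eval σ) := rfl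
@[simp] theorem eval_add (σ : State) (e f : Ex) : (e + f).eval σ = e.eval σ + f.eval σ := rfl
@[simp] theorem eval_sub (σ : State) (e f : Ex) : (e - f).eval σ = e.eval σ - f.eval σ := rfl
@[simp] theorem eval_mul (σ : State) (e f : Ex) : (e * f).eval σ = e.eval σ * f.eval σ := rfl
@[simp] theorem eval_div (σ : State) (e f : Ex) : (e / f).eval σ = e.eval σ / f.eval σ := rfl
@[simp] theorem eval_mod (σ : State) (e f : Ex) : (e % f).eval σ = e.eval σ % f.eval σ := rfl
@[simp] theorem eval_zero (σ : State) : (0 : Ex).eval σ = 0 := rfl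
@[simp] theorem eval_one (σ : State) : (1 : Ex).eval σ = 1 := rfl
@[simp] theorem eval_ofNat (σ : State) (n : ℕ) [n.AtLeastTwo] :
    (ofNat(n) : Ex).eval σ = (ofNat(n) : ℤ) := rfl

def size : Ex → ℕ
  | const _ => 1
  | reg _ => 1
  | bin _ e f => e.size + f.size
  | get _ e => e.size + 1

/-- The expression can be evaluated with the registers `r`, ..., `63` as temporary ones. -/
def okAt : Ex → ℕ → Bool
  | const c, r => decide (c.natAbs ≤ 64) && decide (r < 64)
  | reg x, r => decide (x < 30) && decide (r < 64)
  | bin _ e f, r => e.okAt r && f.okAt (r + 1)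
  | get a e, r => decide (a < 8) && e.okAt r

def ok (e : Ex) (r : ℕ) : Bool := e.okAt r && decide (e.size ≤ 40)

theorem one_le_size (e : Ex) : 1 ≤ e.size := by
  induction e with
  | const | reg => exact le_rfl
  | bin o e f he hf => simp only [size]; omega
  | get a e he => simp only [size]; omega

theorem okAt_lt (e : Ex) {r : ℕ} (h : e.okAt r = true) : r < 64 := by
  induction e generalizing r with
  | const | reg => simp [okAt] at h; omega
  | bin o e f he hf => simp [okAt] at h; exact he h.1
  | get a e he => simp [okAt] at h; exact he h.2

end Ex

/-- The registers `30`, ..., `63` are used as temporary ones. -/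
def Equiv (σ τ : State) : Prop :=
  (∀ x, x < 30 ∨ 64 ≤ x → σ.int x = τ.int x) ∧ (∀ x, 64 ≤ x → σ.real x = τ.real x) ∧
    σ.intArr = τ.intArr ∧ σ.realArr = τ.realArr

theorem Equiv.refl (σ : State) : Equiv σ σ := ⟨fun _ _ => rfl, fun _ _ => rfl, rfl, rfl⟩

theorem Equiv.symm {σ τ : State} (h : Equiv σ τ) : Equiv τ σ :=
  ⟨fun x hx => (h.1 x hx).symm, fun x hx => (h.2.1 x hx).symm, h.2.2.1.symm, h.2.2.2.symm⟩

/-- The registers below `30` and the arrays below `8` hold words of absolute value at most `β`. -/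
def Bounded (β : ℤ) (σ : State) : Prop :=
  (∀ x, x < 30 → |σ.int x| ≤ β) ∧ ∀ a, a < 8 → ∀ i, |σ.intArr a i| ≤ β

theorem Bounded.congr {β : ℤ} {σ τ : State} (h : Bounded β σ) (e : Equiv σ τ) : Bounded β τ :=
  ⟨fun x hx => e.1 x (.inl hx) ▸ h.1 x hx, fun a ha i => e.2.2.1 ▸ h.2 a ha i⟩

/-- The word bound `B` is large enough for expressions over words of absolute value at
most `β`. -/
structure Ample (β : ℤ) (B : ℕ) : Prop where
  base : 64 ≤ β
  pow : β ^ 40 ≤ B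

namespace Ample

variable {β : ℤ} {B : ℕ}

theorem pow_le (h : Ample β B) {n : ℕ} (hn : n ≤ 40) : β ^ n ≤ B :=
  (pow_le_pow_right₀ (by linarith [h.base]) hn).trans h.pow

theorem le (h : Ample β B) : β ≤ B := by simpa using h.pow_le (n := 1) (by norm_num)

end Ample

namespace Ex

theorem eval_congr {e : Ex} {r : ℕ} (h : e.okAt r = true) {σ τ : State}
    (hi : ∀ x, x < 30 → σ.int x = τ.int x) (ha : σ.intArr = τ.intArr) :
    e.eval σ = e.eval τ := by
  induction e generalizing r with
  | const c => rfl
  | reg x => simp [okAt] at h; exact hi x h.1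
  | bin o e f he hf => simp [okAt] at h; simp [eval, he h.1, hf h.2]
  | get a e he => simp [okAt] at h; simp [eval, he h.2, ha]

theorem eval_equiv {e : Ex} {r : ℕ} (h : e.okAt r = true) {σ τ : State} (hE : Equiv σ τ) :
    e.eval σ = e.eval τ :=
  eval_congr h (fun x hx => hE.1 x (.inl hx)) hE.2.2.1

theorem abs_eval_le {β : ℤ} {e : Ex} {r : ℕ} (h : e.okAt r = true) {σ : State}
    (hβ : 64 ≤ β) (hσ : Bounded β σ) : |e.eval σ| ≤ β ^ e.size := by
  have two : ∀ e : Ex, 2 ≤ β ^ e.size := fun e => by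
    have := pow_le_pow_right₀ (show (1 : ℤ) ≤ β by linarith) e.one_le_size
    linarith [pow_one β]
  induction e generalizing r with
  | const c =>
    simp only [okAt, Bool.and_eq_true, decide_eq_true_eq] at h
    simp only [eval, size, pow_one, Int.abs_eq_natAbs]
    omega
  | reg x => simp [okAt] at h; simpa [eval, size] using hσ.1 x h.1
  | bin o e f he hf =>
    simp [okAt] at h
    simp only [eval, size, pow_add]
    exact o.abs_eval_le (he h.1) (hf h.2) (two e) (two f)
  | get a e he =>
    simp [okAt] at h
    refine (hσ.2 a h.1 _).trans ?_
    simpa [size] using pow_le_pow_right₀ (show (1 : ℤ) ≤ β by linarith) (show 1 ≤ e.size + 1 by omega)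

/-- Code that evaluates an expression into the register `r`. -/
def comp (X : Extension) : Ex → ℕ → Program X
  | const c, r => .intConst r c
  -- The machine has no move instruction; a register is copied by adding zero.
  | reg x, r => .seq (.intConst r 0) (.intOp .add r x r)
  | bin o e f, r => .seq (e.comp X r) (.seq (f.comp X (r + 1)) (.intOp (o.toIntOp X) r r (r + 1)))
  | get a e, r => .seq (e.comp X r) (.intLoad r a r)

def cost : Ex → ℕ
  | const _ => 1
  | reg _ => 2
  | bin _ e f => e.cost + (f.cost + 1)
  | get _ e => e.cost + 1

theorem cost_le (e : Ex) : e.cost + 1 ≤ 3 * e.size := by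
  induction e with
  | const | reg => simp [cost, size]
  | bin o e f he hf => simp only [cost, size]; omega
  | get a e he => simp only [cost, size]; omega

/-- The temporary registers form a stack: everything below `r` survives, so the left operand stays
in `r` while the right one is computed from `r + 1` on. All intermediate results are subexpressions
and hence fit into words. -/
theorem exec_comp {X : Extension} {β : ℤ} {B : ℕ} (hB : Ample β B) {e : Ex} {r : ℕ}
    (h : e.okAt r = true) (hs : e.size ≤ 40) (hr : 30 ≤ r) {σ : State} (hσ : Bounded β σ) :
    ∃ g : ℕ → ℤ, Exec B (e.comp X r) σ { σ with int := g } e.cost ∧ g r = e.eval σ ∧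
      ∀ x, x < r ∨ 64 ≤ x → g x = σ.int x := by
  induction e generalizing r σ with
  | const c =>
    simp only [okAt, Bool.and_eq_true, decide_eq_true_eq] at h
    refine ⟨_, Exec.intConst σ r c ?_, by simp [eval], fun x hx => ?_⟩
    · have := hB.base
      have := hB.le
      rw [Int.abs_eq_natAbs]
      omega
    · exact Function.update_of_ne (by omega) _ _
  | reg x =>
    simp [okAt] at h
    have h1 : Exec B (X := X) (.intConst r 0) σ (σ.setInt r 0) 1 := Exec.intConst σ r 0 (by simp)
    have hx : (σ.setInt r 0).int x = σ.int x := Function.update_of_ne (by omega) _ _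
    have hr0 : (σ.setInt r 0).int r = 0 := Function.update_self ..
    have h2 := Exec.intOp (X := X) (B := B) (σ.setInt r 0) .add r x r (by
      simp only [IntOp.eval, hx, hr0, add_zero]
      exact (hσ.1 x h.1).trans hB.le)
    refine ⟨_, h1.seq h2, ?_, fun y hy => ?_⟩
    · simp [State.setInt, IntOp.eval, eval, Function.update_of_ne (show x ≠ r by omega)]
    · simp [State.setInt, Function.update_of_ne (show y ≠ r by omega)]
  | bin o e f he hf =>
    have hsz : (bin o e f).size = e.size + f.size := rfl
    have hob := abs_eval_le h hB.base hσ
    simp [okAt] at h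
    have hf64 := f.okAt_lt h.2
    obtain ⟨g, hg, hgr, hg'⟩ := he h.1 (by omega) hr hσ
    obtain ⟨g₂, hg₂, hgr₂, hg₂'⟩ := hf h.2 (by omega) (by omega : 30 ≤ r + 1)
      (σ := { σ with int := g })
      ⟨fun x hx => by simpa [hg' x (by omega)] using hσ.1 x hx, hσ.2⟩
    have hev : f.eval { σ with int := g } = f.eval σ :=
      eval_congr h.2 (fun x hx => hg' x (by omega)) rfl
    have e1 : g₂ r = e.eval σ := by rw [hg₂' r (by omega)]; exact hgr
    rw [hev] at hgr₂
    have h3 := Exec.intOp (X := X) (B := B) { σ with int := g₂ } (o.toIntOp X) r r (r + 1) (by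
      simp only [Arith.eval_toIntOp, e1, hgr₂]
      exact hob.trans (hB.pow_le hs))
    refine ⟨_, hg.seq (hg₂.seq h3), ?_, fun y hy => ?_⟩
    · simp [eval, e1, hgr₂]
    · rw [Function.update_of_ne (by omega)]
      exact (hg₂' y (by omega)).trans (hg' y (by omega))
  | get a e he =>
    simp [okAt] at h
    have hsz : (get a e).size = e.size + 1 := rfl
    have h64 := e.okAt_lt h.2
    obtain ⟨g, hg, hgr, hg'⟩ := he h.2 (by omega) hr hσ
    refine ⟨_, hg.seq (Exec.intLoad _ r a r), ?_, fun y hy => ?_⟩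
    · simp [eval, hgr]
    · rw [Function.update_of_ne (by omega)]
      exact hg' y (by omega)

end Ex

/-- Real expressions. -/
inductive RealEx where
  | cast (e : Ex)
  | reg (x : ℕ)
  | get (a : ℕ) (e : Ex)
  | mul (r s : RealEx)
  | div (r s : RealEx)

namespace RealEx


noncomputable def eval (σ : State) : RealEx → ℝ
  | cast e => (e.eval σ : ℤ)
  | reg x => σ.real x
  | get a e => σ.realArr a (e.eval σ)
  | mul r s => r.eval σ * s.eval σ
  | div r s => r.eval σ / s.eval σ

@[simp] theorem eval_cast (σ : State) (e : Ex) : (cast e).eval σ = (e.eval σ : ℤ) := rfl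
@[simp] theorem eval_reg (σ : State) (x : ℕ) : (reg x).eval σ = σ.real x := rfl
@[simp] theorem eval_get (σ : State) (a : ℕ) (e : Ex) :
    (get a e).eval σ = σ.realArr a (e.eval σ) := rfl

/-- The expression can be evaluated with the real registers `r`, ..., `63` as temporary ones. -/
def okAt : RealEx → ℕ → Bool
  | cast e, r => e.ok 30 && decide (r < 64)
  | reg x, r => decide (64 ≤ x) && decide (r < 63)
  | get _ e, r => e.ok 30 && decide (r < 64)
  | mul p q, r => p.okAt r && q.okAt (r + 1)
  | div p q, r => p.okAt r && q.okAt (r + 1)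

/-- A real register is copied by multiplying it with the constant `1`, which is cast from a word
into the register `r + 1`; this is why `okAt` demands `r < 63` there. -/
def comp (X : Extension) : RealEx → ℕ → Program X
  | cast e, r => .seq (e.comp X 30) (.realCast r 30)
  | reg x, r => .seq (.intConst 30 1) (.seq (.realCast (r + 1) 30) (.realOp .mul r x (r + 1)))
  | get a e, r => .seq (e.comp X 30) (.realLoad r a 30)
  | mul p q, r => .seq (p.comp X r) (.seq (q.comp X (r + 1)) (.realOp .mul r r (r + 1)))
  | div p q, r => .seq (p.comp X r) (.seq (q.comp X (r + 1)) (.realOp .div r r (r + 1)))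

def cost : RealEx → ℕ
  | cast e => e.cost + 1
  | reg _ => 3
  | get _ e => e.cost + 1
  | mul p q => p.cost + (q.cost + 1)
  | div p q => p.cost + (q.cost + 1)

theorem okAt_lt (e : RealEx) {r : ℕ} (h : e.okAt r = true) : r < 64 := by
  induction e generalizing r with
  | cast | get | reg => simp [okAt] at h; omega
  | mul e f he hf => simp [okAt] at h; exact he h.1
  | div e f he hf => simp [okAt] at h; exact he h.1

theorem eval_congr {e : RealEx} {r : ℕ} (h : e.okAt r = true) {σ τ : State}
    (hi : ∀ x, x < 30 → σ.int x = τ.int x) (hr : ∀ x, 64 ≤ x → σ.real x = τ.real x)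
    (ha : σ.intArr = τ.intArr) (hra : σ.realArr = τ.realArr) : e.eval σ = e.eval τ := by
  induction e generalizing r with
  | cast e => simp [okAt, Ex.ok] at h; simp [Ex.eval_congr h.1.1 hi ha]
  | reg x => simp [okAt] at h; exact hr x h.1
  | get a e => simp [okAt, Ex.ok] at h; simp [Ex.eval_congr h.1.1 hi ha, hra]
  | mul e f he hf => simp [okAt] at h; simp [eval, he h.1, hf h.2]
  | div e f he hf => simp [okAt] at h; simp [eval, he h.1, hf h.2]

theorem eval_equiv {e : RealEx} {r : ℕ} (h : e.okAt r = true) {σ τ : State} (hE : Equiv σ τ) :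
    e.eval σ = e.eval τ :=
  eval_congr h (fun x hx => hE.1 x (.inl hx)) hE.2.1 hE.2.2.1 hE.2.2.2

theorem exec_comp {X : Extension} {β : ℤ} {B : ℕ} (hB : Ample β B) {e : RealEx} {r : ℕ}
    (h : e.okAt r = true) {σ : State} (hσ : Bounded β σ) :
    ∃ (g : ℕ → ℤ) (f : ℕ → ℝ), Exec B (e.comp X r) σ { σ with int := g, real := f } e.cost ∧
      f r = e.eval σ ∧ (∀ x, x < 30 ∨ 64 ≤ x → g x = σ.int x) ∧
      ∀ x, x < r ∨ 64 ≤ x → f x = σ.real x := by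
  -- The common part of the cases of multiplication and division, with the induction hypotheses as
  -- arguments.
  have bin : ∀ (p q : RealEx) (o : RealOp X),
      (∀ {r : ℕ} (_ : p.okAt r = true) {σ : State} (_ : Bounded β σ),
        ∃ (g : ℕ → ℤ) (f : ℕ → ℝ), Exec B (p.comp X r) σ { σ with int := g, real := f } p.cost ∧
        f r = p.eval σ ∧ (∀ x, x < 30 ∨ 64 ≤ x → g x = σ.int x) ∧
        ∀ x, x < r ∨ 64 ≤ x → f x = σ.real x) →
      (∀ {r : ℕ} (_ : q.okAt r = true) {σ : State} (_ : Bounded β σ),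
        ∃ (g : ℕ → ℤ) (f : ℕ → ℝ), Exec B (q.comp X r) σ { σ with int := g, real := f } q.cost ∧
        f r = q.eval σ ∧ (∀ x, x < 30 ∨ 64 ≤ x → g x = σ.int x) ∧
        ∀ x, x < r ∨ 64 ≤ x → f x = σ.real x) →
      ∀ {r : ℕ} {σ : State}, p.okAt r = true → q.okAt (r + 1) = true → Bounded β σ →
        ∃ (g : ℕ → ℤ) (f : ℕ → ℝ),
        Exec B (.seq (p.comp X r) (.seq (q.comp X (r + 1)) (.realOp o r r (r + 1)))) σ
          { σ with int := g, real := f } (p.cost + (q.cost + 1)) ∧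
        f r = o.eval (p.eval σ) (q.eval σ) ∧ (∀ x, x < 30 ∨ 64 ≤ x → g x = σ.int x) ∧
        ∀ x, x < r ∨ 64 ≤ x → f x = σ.real x := by
    intro p q o hp hq r σ h1 h2 hσ
    have h64 := q.okAt_lt h2
    obtain ⟨g, f, hg, hf, hg', hf'⟩ := hp h1 hσ
    obtain ⟨g₂, f₂, hg₂, hf₂, hg₂', hf₂'⟩ := hq h2 (σ := { σ with int := g, real := f })
      (hσ.congr ⟨fun x hx => (hg' x (by omega)).symm, fun x hx => (hf' x (by omega)).symm,
        rfl, rfl⟩)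
    have hev : q.eval { σ with int := g, real := f } = q.eval σ :=
      eval_congr h2 (fun x hx => hg' x (by omega)) (fun x hx => hf' x (by omega)) rfl rfl
    have e1 : f₂ r = p.eval σ := by rw [hf₂' r (by omega)]; exact hf
    rw [hev] at hf₂
    refine ⟨_, _, hg.seq (hg₂.seq (Exec.realOp _ o r r (r + 1))), ?_, fun y hy => ?_,
      fun y hy => ?_⟩
    · simp [e1, hf₂]
    · exact (hg₂' y hy).trans (hg' y hy)
    · rw [Function.update_of_ne (by omega)]
      exact (hf₂' y (by omega)).trans (hf' y (by omega))
  induction e generalizing r σ with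
  | cast e =>
    have h64 := okAt_lt _ h
    simp [okAt, Ex.ok] at h
    obtain ⟨g, hg, hgr, hg'⟩ := Ex.exec_comp (X := X) hB h.1.1 h.1.2 le_rfl hσ
    refine ⟨_, _, hg.seq (Exec.realCast _ r 30), ?_, fun y hy => hg' y hy, fun y hy => ?_⟩
    · simp [eval, hgr]
    · rw [Function.update_of_ne (by omega)]
  | get a e =>
    have h64 := okAt_lt _ h
    simp [okAt, Ex.ok] at h
    obtain ⟨g, hg, hgr, hg'⟩ := Ex.exec_comp (X := X) hB h.1.1 h.1.2 le_rfl hσ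
    refine ⟨_, _, hg.seq (Exec.realLoad _ r a 30), ?_, fun y hy => hg' y hy, fun y hy => ?_⟩
    · simp [eval, hgr]
    · rw [Function.update_of_ne (by omega)]
  | reg x =>
    simp [okAt] at h
    have h1 : Exec B (X := X) (.intConst 30 1) σ (σ.setInt 30 1) 1 :=
      Exec.intConst σ 30 1 (by have := hB.base; have := hB.le; simp; omega)
    refine ⟨_, _, h1.seq ((Exec.realCast _ (r + 1) 30).seq (Exec.realOp _ .mul r x (r + 1))), ?_,
      fun y hy => ?_, fun y hy => ?_⟩
    · simp [State.setInt, State.setReal, RealOp.eval, eval,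
        Function.update_of_ne (show x ≠ r + 1 by omega)]
    · exact Function.update_of_ne (by omega) _ _
    · simp [State.setInt, State.setReal, Function.update_of_ne (show y ≠ r by omega),
        Function.update_of_ne (show y ≠ r + 1 by omega)]
  | mul p q hp hq =>
    simp [okAt] at h
    exact bin p q .mul (fun h σ hσ => hp h hσ) (fun h σ hσ => hq h hσ) h.1 h.2 hσ
  | div p q hp hq =>
    simp [okAt] at h
    exact bin p q .div (fun h σ hσ => hp h hσ) (fun h σ hσ => hq h hσ) h.1 h.2 hσ

end RealEx

end StochasticParsing

/-! ### Timed Hoare logic for structured programs -/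

namespace StochasticParsing

def RealEx.ok (e : RealEx) (r : ℕ) : Bool := e.okAt r && decide (e.cost ≤ 200)

theorem Ex.ok_cost_le {e : Ex} {r : ℕ} (h : e.ok r = true) : e.cost ≤ 119 := by
  simp [Ex.ok] at h
  have := e.cost_le
  omega

theorem Bounded.setInt {β : ℤ} {σ : State} (h : Bounded β σ) {x : ℕ} {v : ℤ} (hv : |v| ≤ β) :
    Bounded β (σ.setInt x v) := by
  refine ⟨fun y hy => ?_, h.2⟩
  by_cases e : y = x
  · subst e; simpa [State.setInt] using hv
  · simpa [State.setInt, Function.update_of_ne e] using h.1 y hy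

theorem Bounded.setRealArr {β : ℤ} {σ : State} (h : Bounded β σ) {a : ℕ} {i : ℤ} {v : ℝ} :
    Bounded β (σ.setRealArr a i v) := h

theorem Bounded.setIntArr {β : ℤ} {σ : State} (h : Bounded β σ) {a : ℕ} {i v : ℤ}
    (hv : |v| ≤ β ∨ 8 ≤ a) : Bounded β (σ.setIntArr a i v) := by
  refine ⟨h.1, fun b hb j => ?_⟩
  by_cases e : b = a
  · subst e
    by_cases e' : j = i
    · subst e'; simpa [State.setIntArr] using hv.resolve_right (by omega)
    · simpa [State.setIntArr, Function.update_of_ne e'] using h.2 b hb j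
  · simpa [State.setIntArr, Function.update_of_ne e] using h.2 b hb j

theorem Equiv.setInt {σ τ : State} (h : Equiv σ τ) (x : ℕ) (v : ℤ) :
    Equiv (σ.setInt x v) (τ.setInt x v) := by
  refine ⟨fun y hy => ?_, h.2⟩
  by_cases e : y = x
  · subst e; simp [State.setInt]
  · simpa [State.setInt, Function.update_of_ne e] using h.1 y hy

/-- Started in any state that differs from `σ` only in the temporary registers, `p` halts within
`K` steps in a state that, up to these registers, satisfies `Q`. -/
def Run {X : Extension} (B : ℕ) (p : Program X) (σ : State) (K : ℕ) (Q : State → Prop) : Prop :=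
  ∀ σ₁, Equiv σ₁ σ → ∃ (τ₁ : State) (k : ℕ), k ≤ K ∧ Exec B p σ₁ τ₁ k ∧ ∃ τ, Equiv τ₁ τ ∧ Q τ

namespace Run

variable {X : Extension} {B : ℕ} {β : ℤ} {σ : State} {Q : State → Prop}

theorem mono {p : Program X} {K K' : ℕ} {Q' : State → Prop} (h : Run B p σ K Q') (hK : K ≤ K')
    (hQ : ∀ τ, Q' τ → Q τ) : Run B p σ K' Q := by
  intro σ₁ e
  obtain ⟨τ₁, k, hk, hx, τ, hτ, hQτ⟩ := h σ₁ e
  exact ⟨τ₁, k, hk.trans hK, hx, τ, hτ, hQ τ hQτ⟩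

/-- Since `Run` tolerates any contents of the temporary registers, the second program may be
analysed from the idealised state `τ` rather than from the state actually reached. -/
theorem seq {p q : Program X} {K L : ℕ} (h : Run B p σ K fun τ => Run B q τ L Q) :
    Run B (.seq p q) σ (K + L) Q := by
  intro σ₁ e
  obtain ⟨τ₁, k, hk, hx, τ, hτ, hr⟩ := h σ₁ e
  obtain ⟨υ₁, l, hl, hy, υ, hυ, hQ⟩ := hr τ₁ hτ
  exact ⟨υ₁, k + l, by omega, hx.seq hy, υ, hυ, hQ⟩

theorem skip (h : Q σ) : Run B (.skip : Program X) σ 1 Q :=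
  fun σ₁ e => ⟨σ₁, 1, le_rfl, .skip σ₁, σ, e, h⟩

end Run

/-- `x := e`. -/
def assign (X : Extension) (x : ℕ) (e : Ex) : Program X :=
  .seq (e.comp X 30) (.seq (.intConst 31 0) (.intOp .add x 30 31))

/-- `a[e] := f`. -/
def store (X : Extension) (a : ℕ) (e f : Ex) : Program X :=
  .seq (e.comp X 30) (.seq (f.comp X 31) (.intStore a 30 31))

/-- `a[e] := r`, where `r` is a real expression. -/
def storeReal (X : Extension) (a : ℕ) (e : Ex) (r : RealEx) : Program X :=
  .seq (r.comp X 0) (.seq (e.comp X 30) (.realStore a 30 0))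

def ifLe {X : Extension} (e f : Ex) (p q : Program X) : Program X :=
  .seq (e.comp X 30) (.seq (f.comp X 31) (.ite (.intLe 30 31) p q))

def ifRealLe {X : Extension} (r s : RealEx) (p q : Program X) : Program X :=
  .seq (r.comp X 0) (.seq (s.comp X 1) (.ite (.realLe 0 1) p q))

def whileLe {X : Extension} (e f : Ex) (p : Program X) : Program X :=
  .seq (e.comp X 30) (.seq (f.comp X 31)
    (.while (.intLe 30 31) (.seq p (.seq (e.comp X 30) (f.comp X 31)))))

/-- Run `p` for each value of the register `x` from `0` to `e - 1`. -/
def forLt {X : Extension} (x : ℕ) (e : Ex) (p : Program X) : Program X :=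
  .seq (assign X x 0) (whileLe (.reg x + 1) e (.seq p (assign X x (.reg x + 1))))

namespace Run

variable {X : Extension} {B : ℕ} {β : ℤ} {σ : State} {Q : State → Prop}

theorem assign (hB : Ample β B) (hσ : Bounded β σ) {x : ℕ} {e : Ex} (he : e.ok 30 = true)
    (h : Q (σ.setInt x (e.eval σ))) : Run B (assign X x e) σ 130 Q := by
  intro σ₁ hE
  have hc := Ex.ok_cost_le he
  simp [Ex.ok] at he
  obtain ⟨g, hg, hr, hg'⟩ := Ex.exec_comp (X := X) hB he.1 he.2 le_rfl (hσ.congr hE.symm)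
  have hv : |e.eval σ| ≤ B := (Ex.abs_eval_le he.1 hB.base hσ).trans (hB.pow_le he.2)
  rw [Ex.eval_equiv he.1 hE] at hr
  have h1 := Exec.intConst (X := X) (B := B) { σ₁ with int := g } 31 0 (by simp)
  have h2 := Exec.intOp (X := X) (B := B) (({ σ₁ with int := g } : State).setInt 31 0) .add x 30 31
    (by simpa [State.setInt, IntOp.eval, hr] using hv)
  refine ⟨_, _, ?_, hg.seq (h1.seq h2), _, ?_, h⟩
  · omega
  · have e1 : IntOp.eval (X := X) .add ((({ σ₁ with int := g } : State).setInt 31 0).int 30)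
        ((({ σ₁ with int := g } : State).setInt 31 0).int 31) = e.eval σ := by
      simp [State.setInt, IntOp.eval, hr]
    rw [e1]
    have h3 : Equiv (({ σ₁ with int := g } : State).setInt 31 0) σ := by
      refine ⟨fun y hy => ?_, hE.2⟩
      rw [← hE.1 y hy]
      simp only [State.setInt]
      rw [Function.update_of_ne (by omega)]
      exact hg' y hy
    exact h3.setInt _ _

theorem eval2 (hB : Ample β B) (hσ : Bounded β σ) {e f : Ex} (he : e.ok 30 = true)
    (hf : f.ok 31 = true) {σ₁ : State} (hE : Equiv σ₁ σ) :
    ∃ (g : ℕ → ℤ) (k l : ℕ), Exec B (e.comp X 30) σ₁ { σ₁ with int := g } k ∧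
      ∃ g' : ℕ → ℤ, Exec B (f.comp X 31) { σ₁ with int := g } { σ₁ with int := g' } l ∧
      k + l ≤ 240 ∧ g' 30 = e.eval σ ∧ g' 31 = f.eval σ ∧
      Equiv { σ₁ with int := g' } σ := by
  have hc := Ex.ok_cost_le he
  have hc' := Ex.ok_cost_le hf
  simp [Ex.ok] at he hf
  obtain ⟨g, hg, hr, hg'⟩ := Ex.exec_comp (X := X) hB he.1 he.2 le_rfl (hσ.congr hE.symm)
  have hE1 : Equiv { σ₁ with int := g } σ :=
    ⟨fun y hy => (hg' y hy).trans (hE.1 y hy), hE.2⟩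
  obtain ⟨g₂, hg₂, hr₂, hg₂'⟩ := Ex.exec_comp (X := X) hB hf.1 hf.2 (by norm_num : 30 ≤ 31)
    (hσ.congr hE1.symm)
  refine ⟨g, _, _, hg, g₂, hg₂, by omega, ?_, ?_, ?_⟩
  · rw [hg₂' 30 (by norm_num), ← Ex.eval_equiv he.1 hE]; exact hr
  · rw [hr₂, Ex.eval_equiv hf.1 hE1]
  · exact ⟨fun y hy => (hg₂' y (by omega)).trans (hE1.1 y hy), hE.2⟩

theorem store (hB : Ample β B) (hσ : Bounded β σ) {a : ℕ} {e f : Ex} (he : e.ok 30 = true)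
    (hf : f.ok 31 = true) (h : Q (σ.setIntArr a (e.eval σ) (f.eval σ))) :
    Run B (store X a e f) σ 250 Q := by
  intro σ₁ hE
  obtain ⟨g, k, l, h1, g', h2, hkl, e1, e2, hE'⟩ := eval2 (X := X) hB hσ he hf hE
  refine ⟨_, _, ?_, h1.seq (h2.seq (Exec.intStore _ a 30 31)), _, ?_, h⟩
  · omega
  · simp only [e1, e2]
    refine ⟨hE'.1, hE'.2.1, ?_, hE'.2.2.2⟩
    simp only [State.setIntArr, hE.2.2.1]

theorem storeReal (hB : Ample β B) (hσ : Bounded β σ) {a : ℕ} {e : Ex} {r : RealEx}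
    (he : e.ok 30 = true) (hr : r.ok 0 = true)
    (h : Q (σ.setRealArr a (e.eval σ) (r.eval σ))) : Run B (storeReal X a e r) σ 350 Q := by
  intro σ₁ hE
  have hc := Ex.ok_cost_le he
  simp [Ex.ok] at he
  simp [RealEx.ok] at hr
  obtain ⟨g, f, h1, e1, hg, hf⟩ := RealEx.exec_comp (X := X) hB hr.1 (hσ.congr hE.symm)
  have hE1 : Equiv { σ₁ with int := g, real := f } σ :=
    ⟨fun y hy => (hg y hy).trans (hE.1 y hy), fun y hy => (hf y (.inr hy)).trans (hE.2.1 y hy),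
      hE.2.2⟩
  obtain ⟨g₂, h2, e2, hg₂⟩ := Ex.exec_comp (X := X) hB he.1 he.2 le_rfl (hσ.congr hE1.symm)
  refine ⟨_, _, ?_, h1.seq (h2.seq (Exec.realStore _ a 30 0)), _, ?_, h⟩
  · omega
  · simp only [e2, e1, Ex.eval_equiv he.1 hE1, RealEx.eval_equiv hr.1 hE]
    refine ⟨fun y hy => (hg₂ y hy).trans (hE1.1 y hy), hE1.2.1, hE1.2.2.1, ?_⟩
    simp only [State.setRealArr, hE.2.2.2]

theorem ifLe (hB : Ample β B) (hσ : Bounded β σ) {e f : Ex} {p q : Program X} {K : ℕ}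
    (he : e.ok 30 = true) (hf : f.ok 31 = true) (hp : e.eval σ ≤ f.eval σ → Run B p σ K Q)
    (hq : f.eval σ < e.eval σ → Run B q σ K Q) : Run B (ifLe e f p q) σ (K + 250) Q := by
  intro σ₁ hE
  obtain ⟨g, k, l, h1, g', h2, hkl, e1, e2, hE'⟩ := eval2 (X := X) hB hσ he hf hE
  by_cases c : e.eval σ ≤ f.eval σ
  · obtain ⟨τ₁, n, hn, hx, hτ⟩ := hp c _ hE'
    refine ⟨τ₁, _, ?_, h1.seq (h2.seq (Exec.iteTrue ?_ hx)), hτ⟩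
    · omega
    · simpa [Test.holds, e1, e2] using c
  · obtain ⟨τ₁, n, hn, hx, hτ⟩ := hq (not_le.1 c) _ hE'
    refine ⟨τ₁, _, ?_, h1.seq (h2.seq (Exec.iteFalse ?_ hx)), hτ⟩
    · omega
    · simpa [Test.holds, e1, e2] using c

theorem ifRealLe (hB : Ample β B) (hσ : Bounded β σ) {e f : RealEx} {p q : Program X} {K : ℕ}
    (he : e.ok 0 = true) (hf : f.ok 1 = true) (hp : e.eval σ ≤ f.eval σ → Run B p σ K Q)
    (hq : f.eval σ < e.eval σ → Run B q σ K Q) : Run B (ifRealLe e f p q) σ (K + 450) Q := by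
  intro σ₁ hE
  simp [RealEx.ok] at he hf
  obtain ⟨g, r, h1, e1, hg, hr⟩ := RealEx.exec_comp (X := X) hB he.1 (hσ.congr hE.symm)
  have hE1 : Equiv { σ₁ with int := g, real := r } σ :=
    ⟨fun y hy => (hg y hy).trans (hE.1 y hy), fun y hy => (hr y (.inr hy)).trans (hE.2.1 y hy),
      hE.2.2⟩
  obtain ⟨g₂, r₂, h2, e2, hg₂, hr₂⟩ := RealEx.exec_comp (X := X) hB hf.1 (hσ.congr hE1.symm)
  have hE' : Equiv { σ₁ with int := g₂, real := r₂ } σ :=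
    ⟨fun y hy => (hg₂ y hy).trans (hE1.1 y hy),
      fun y hy => (hr₂ y (.inr hy)).trans (hE1.2.1 y hy), hE.2.2⟩
  have e1' : r₂ 0 = e.eval σ := by
    rw [← RealEx.eval_equiv he.1 hE, ← e1]; exact hr₂ 0 (by norm_num)
  rw [RealEx.eval_equiv hf.1 hE1] at e2
  by_cases c : e.eval σ ≤ f.eval σ
  · obtain ⟨τ₁, n, hn, hx, hτ⟩ := hp c _ hE'
    refine ⟨τ₁, _, ?_, h1.seq (h2.seq (Exec.iteTrue ?_ hx)), hτ⟩
    · omega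
    · simpa [Test.holds, e1', e2] using c
  · obtain ⟨τ₁, n, hn, hx, hτ⟩ := hq (not_le.1 c) _ hE'
    refine ⟨τ₁, _, ?_, h1.seq (h2.seq (Exec.iteFalse ?_ hx)), hτ⟩
    · omega
    · simpa [Test.holds, e1', e2] using c

/-- A loop with the invariant `I n`, where `n` bounds the number of the remaining iterations. -/
theorem whileLe (hB : Ample β B) {e f : Ex} {p : Program X} {K : ℕ} (I : ℕ → State → Prop)
    (he : e.ok 30 = true) (hf : f.ok 31 = true) (hI : ∀ n τ, I n τ → Bounded β τ)
    (hp : ∀ n τ, I n τ → e.eval τ ≤ f.eval τ → ∃ n', n = n' + 1 ∧ Run B p τ K (I n'))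
    (hQ : ∀ n τ, I n τ → f.eval τ < e.eval τ → Q τ) {n : ℕ} (h0 : I n σ) :
    Run B (whileLe e f p) σ (n * (K + 250) + 250) Q := by
  -- The test reads the registers `30` and `31`, about which `Equiv` says nothing; so the induction
  -- carries their contents in the actual state `σ₁` alongside the invariant of `σ`.
  have key : ∀ n σ, I n σ → ∀ σ₁, Equiv σ₁ σ → σ₁.int 30 = e.eval σ → σ₁.int 31 = f.eval σ →
      ∃ τ₁ k, k ≤ n * (K + 250) + 1 ∧ Exec B (.while (.intLe 30 31)
        (.seq p (.seq (e.comp X 30) (f.comp X 31)))) σ₁ τ₁ k ∧ ∃ τ, Equiv τ₁ τ ∧ Q τ := by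
    intro n
    induction n with
    | zero =>
      intro σ h σ₁ hE e1 e2
      by_cases c : e.eval σ ≤ f.eval σ
      · obtain ⟨n', hn, -⟩ := hp _ _ h c
        omega
      · exact ⟨σ₁, 1, by omega, .whileFalse (by simpa [Test.holds, e1, e2] using c), σ, hE,
          hQ _ _ h (not_le.1 c)⟩
    | succ n ih =>
      intro σ h σ₁ hE e1 e2
      by_cases c : e.eval σ ≤ f.eval σ
      · obtain ⟨n', hn, hr⟩ := hp _ _ h c
        obtain rfl : n = n' := by omega
        obtain ⟨τ₁, k, hk, hx, τ, hτ, hIτ⟩ := hr σ₁ hE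
        obtain ⟨g, k', l', h1, g', h2, hkl, e1', e2', hE'⟩ :=
          eval2 (X := X) hB (hI _ _ hIτ) he hf hτ
        obtain ⟨υ₁, m, hm, hy, hυ⟩ := ih τ hIτ _ hE' e1' e2'
        refine ⟨υ₁, _, ?_, .whileTrue (by simpa [Test.holds, e1, e2] using c)
          (hx.seq (h1.seq h2)) hy, hυ⟩
        rw [Nat.add_mul, one_mul]
        omega
      · exact ⟨σ₁, 1, by omega, .whileFalse (by simpa [Test.holds, e1, e2] using c), σ, hE,
          hQ _ _ h (not_le.1 c)⟩
  intro σ₁ hE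
  obtain ⟨g, k', l', h1, g', h2, hkl, e1', e2', hE'⟩ := eval2 (X := X) hB (hI _ _ h0) he hf hE
  obtain ⟨υ₁, m, hm, hy, hυ⟩ := key n σ h0 _ hE' e1' e2'
  exact ⟨υ₁, _, by omega, h1.seq (h2.seq hy), hυ⟩

theorem forLt (hB : Ample β B) {x : ℕ} {e : Ex} {p : Program X} {K N : ℕ}
    (I : ℕ → State → Prop) (hx : x < 30) (he : e.ok 31 = true) (hσ : Bounded β σ)
    (h0 : I 0 (σ.setInt x 0))
    (hI : ∀ k ≤ N, ∀ τ, I k τ → Bounded β τ ∧ e.eval τ = N ∧ τ.int x = k)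
    (hp : ∀ k < N, ∀ τ, I k τ → Run B p τ K fun υ =>
      Bounded β υ ∧ υ.int x = k ∧ I (k + 1) (υ.setInt x (k + 1)))
    (hQ : ∀ τ, I N τ → Q τ) : Run B (forLt x e p) σ ((N + 1) * (K + 400)) Q := by
  have h1 : (0 : Ex).ok 30 = true := by decide
  have h2 : (Ex.reg x + 1).ok 30 = true := by
    change (decide (x < 30) && decide (30 < 64) && (decide ((1 : ℤ).natAbs ≤ 64) && decide (30 + 1 < 64)) &&
      decide (1 + 1 ≤ 40)) = true
    simp [hx]
  refine Run.mono (K := 130 + (N * (K + 130 + 250) + 250)) ?_ (by ring_nf; omega) fun _ h => h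
  refine seq (assign hB hσ h1 ?_)
  -- The loop rule counts the remaining iterations, the invariant `I` counts those already done.
  refine whileLe hB (fun n τ => ∃ k, k + n = N ∧ I k τ) h2 he ?_ ?_ ?_ ⟨0, by omega, h0⟩
  · rintro n τ ⟨k, hk, h⟩
    exact (hI k (by omega) τ h).1
  · rintro n τ ⟨k, hk, h⟩ c
    obtain ⟨hb, e1, e2⟩ := hI k (by omega) τ h
    simp only [Ex.eval_add, Ex.eval_reg, Ex.eval_one, e1, e2] at c
    have hkN : k < N := by omega
    refine ⟨n - 1, by omega, seq ((hp k hkN τ h).mono le_rfl ?_)⟩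
    rintro υ ⟨hbυ, hυ, hIυ⟩
    refine assign hB hbυ h2 ⟨k + 1, by omega, ?_⟩
    simpa [hυ] using hIυ
  · rintro n τ ⟨k, hk, h⟩ c
    obtain ⟨hb, e1, e2⟩ := hI k (by omega) τ h
    simp only [Ex.eval_add, Ex.eval_reg, Ex.eval_one, e1, e2] at c
    obtain rfl : k = N := by omega
    exact hQ τ h

end Run

end StochasticParsing

namespace StochasticParsing

/-! ## Relocation of programs -/

namespace Program

variable {X : Extension}

/-- All registers of the program have numbers below `b`. -/
def Below (b : ℕ) : Program X → Prop
  | skip => True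
  | intConst x _ => x < b
  | intOp _ x y z => x < b ∧ y < b ∧ z < b
  | intLoad x _ y => x < b ∧ y < b
  | intStore _ x y => x < b ∧ y < b
  | realCast x y => x < b ∧ y < b
  | realOp _ x y z => x < b ∧ y < b ∧ z < b
  | realLoad x _ y => x < b ∧ y < b
  | realStore _ x y => x < b ∧ y < b
  | round _ x y => x < b ∧ y < b
  | seq p q => p.Below b ∧ q.Below b
  | ite (.intLe x y) p q => x < b ∧ y < b ∧ p.Below b ∧ q.Below b
  | ite (.realLe x y) p q => x < b ∧ y < b ∧ p.Below b ∧ q.Below b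
  | .while (.intLe x y) p => x < b ∧ y < b ∧ p.Below b
  | .while (.realLe x y) p => x < b ∧ y < b ∧ p.Below b

theorem Below.mono {b b' : ℕ} (hb : b ≤ b') {p : Program X} (h : p.Below b) : p.Below b' := by
  induction p with
  | skip => trivial
  | seq p q hp hq => exact ⟨hp h.1, hq h.2⟩
  | ite t p q hp hq =>
    cases t <;> exact ⟨by have := h.1; omega, by have := h.2.1; omega, hp h.2.2.1, hq h.2.2.2⟩
  | intConst | intOp | intLoad | intStore | realCast | realOp | realLoad | realStore | round =>
    simp only [Below] at h ⊢; omega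
  | _ =>
    rename_i t p hp
    cases t <;> exact ⟨by have := h.1; omega, by have := h.2.1; omega, hp h.2.2⟩

theorem exists_below (p : Program X) : ∃ b, p.Below b := by
  induction p with
  | skip => exact ⟨0, trivial⟩
  | intConst x c => exact ⟨x + 1, Nat.lt_succ_self x⟩
  | intOp o x y z => exact ⟨x + y + z + 1, by simp only [Below]; omega⟩
  | realOp o x y z => exact ⟨x + y + z + 1, by simp only [Below]; omega⟩
  | seq p q hp hq =>
    obtain ⟨b, hb⟩ := hp
    obtain ⟨c, hc⟩ := hq
    exact ⟨b + c, hb.mono (by omega), hc.mono (by omega)⟩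
  | ite t p q hp hq =>
    obtain ⟨b, hb⟩ := hp
    obtain ⟨c, hc⟩ := hq
    cases t with
    | intLe x y =>
      exact ⟨b + c + x + y + 1, by omega, by omega, hb.mono (by omega), hc.mono (by omega)⟩
    | realLe x y =>
      exact ⟨b + c + x + y + 1, by omega, by omega, hb.mono (by omega), hc.mono (by omega)⟩
  | intLoad x a y => exact ⟨x + y + 1, by simp only [Below]; omega⟩
  | realLoad x a y => exact ⟨x + y + 1, by simp only [Below]; omega⟩
  | intStore a x y => exact ⟨x + y + 1, by simp only [Below]; omega⟩
  | realStore a x y => exact ⟨x + y + 1, by simp only [Below]; omega⟩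
  | realCast x y => exact ⟨x + y + 1, by simp only [Below]; omega⟩
  | round f x y => exact ⟨x + y + 1, by simp only [Below]; omega⟩
  | _ =>
    rename_i t p hp
    obtain ⟨b, hb⟩ := hp
    cases t with
    | intLe x y => exact ⟨b + x + y + 1, by omega, by omega, hb.mono (by omega)⟩
    | realLe x y => exact ⟨b + x + y + 1, by omega, by omega, hb.mono (by omega)⟩

/-- Compute in register `30` the address of cell number `x` (a register of the relocated program)
of copy number `15` (a register) of the memory. -/
def address (X : Extension) (x : ℕ) : Program X :=
  .seq (.intOp .mul 30 (64 + x) 0) (.intOp .add 30 30 15)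

/-- The program with its registers and arrays renamed, and with every address `i` replaced by
`i * m + c`, where `m` and `c` are the contents of the registers `0` and `15`. -/
def relocate : Program X → Program X
  | skip => skip
  | intConst x c => intConst (64 + x) c
  | intOp o x y z => intOp o (64 + x) (64 + y) (64 + z)
  | intLoad x a y => seq (address X y) (intLoad (64 + x) (8 + a) 30)
  | intStore a x y => seq (address X x) (intStore (8 + a) 30 (64 + y))
  | realCast x y => realCast (64 + x) (64 + y)
  | realOp o x y z => realOp o (64 + x) (64 + y) (64 + z)
  | realLoad x a y => seq (address X y) (realLoad (64 + x) (8 + a) 30)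
  | realStore a x y => seq (address X x) (realStore (8 + a) 30 (64 + y))
  | round f x y => round f (64 + x) (64 + y)
  | seq p q => seq p.relocate q.relocate
  | ite (.intLe x y) p q => ite (.intLe (64 + x) (64 + y)) p.relocate q.relocate
  | ite (.realLe x y) p q => ite (.realLe (64 + x) (64 + y)) p.relocate q.relocate
  | .while (.intLe x y) p => .while (.intLe (64 + x) (64 + y)) p.relocate
  | .while (.realLe x y) p => .while (.realLe (64 + x) (64 + y)) p.relocate

end Program

/-- The relocated registers below `b` and copy number `c` (of `m`) of the memory in `σ` agree
with `τ`, which holds words of absolute value at most `B`. -/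
structure Simulates (b B m c : ℕ) (σ τ : State) : Prop where
  copies : σ.int 0 = m
  copy : σ.int 15 = c
  int : ∀ x < b, σ.int (64 + x) = τ.int x
  real : ∀ x < b, σ.real (64 + x) = τ.real x
  intArr : ∀ (a : ℕ) (i : ℤ), σ.intArr (8 + a) (i * m + c) = τ.intArr a i
  realArr : ∀ (a : ℕ) (i : ℤ), σ.realArr (8 + a) (i * m + c) = τ.realArr a i
  abs_int_le : ∀ x, |τ.int x| ≤ B
  abs_intArr_le : ∀ a i, |τ.intArr a i| ≤ B

/-- The states agree outside the temporary registers, the registers of relocated programs, and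
copy number `c` of their memory. -/
structure Frame (m c : ℕ) (σ τ : State) : Prop where
  int : ∀ x < 30, τ.int x = σ.int x
  intArr : ∀ a < 8, τ.intArr a = σ.intArr a
  realArr : ∀ a < 8, τ.realArr a = σ.realArr a
  intCopy : ∀ (a : ℕ) (j : ℤ), j % m ≠ c → τ.intArr (8 + a) j = σ.intArr (8 + a) j
  realCopy : ∀ (a : ℕ) (j : ℤ), j % m ≠ c → τ.realArr (8 + a) j = σ.realArr (8 + a) j

namespace Frame

variable {m c : ℕ} {σ τ υ : State}

theorem refl (σ : State) : Frame m c σ σ :=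
  ⟨fun _ _ => rfl, fun _ _ => rfl, fun _ _ => rfl, fun _ _ _ => rfl, fun _ _ _ => rfl⟩

theorem trans (h : Frame m c σ τ) (h' : Frame m c τ υ) : Frame m c σ υ :=
  ⟨fun x hx => (h'.int x hx).trans (h.int x hx),
    fun x hx => (h'.intArr x hx).trans (h.intArr x hx),
    fun x hx => (h'.realArr x hx).trans (h.realArr x hx),
    fun a j hj => (h'.intCopy a j hj).trans (h.intCopy a j hj),
    fun a j hj => (h'.realCopy a j hj).trans (h.realCopy a j hj)⟩

theorem setInt (h : Frame m c σ τ) {x : ℕ} (hx : 30 ≤ x) (v : ℤ) :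
    Frame m c σ (τ.setInt x v) := by
  refine ⟨fun y hy => ?_, h.2, h.3, h.4, h.5⟩
  rw [← h.int y hy]
  exact Function.update_of_ne (by omega) _ _

theorem setReal (h : Frame m c σ τ) (x : ℕ) (v : ℝ) : Frame m c σ (τ.setReal x v) :=
  ⟨h.1, h.2, h.3, h.4, h.5⟩

/-- The residue modulo `m` identifies the copy to which an address belongs; this makes different
copies disjoint, also at negative addresses. -/
theorem emod_copy (hc : c < m) (i : ℤ) : (i * m + c) % (m : ℤ) = c := by
  rw [add_comm, Int.add_mul_emod_self_right]
  exact Int.emod_eq_of_lt (by positivity) (by exact_mod_cast hc)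

theorem setIntArr (h : Frame m c σ τ) (hc : c < m) (a : ℕ) (i v : ℤ) :
    Frame m c σ (τ.setIntArr (8 + a) (i * m + c) v) := by
  refine ⟨h.1, fun b hb => ?_, h.3, fun b j hj => ?_, h.5⟩
  · rw [← h.intArr b hb]
    exact Function.update_of_ne (by omega) _ _
  · rw [← h.intCopy b j hj]
    by_cases e : b = a
    · subst e
      have : j ≠ i * m + c := fun e => hj (e ▸ emod_copy hc i)
      simp [State.setIntArr, Function.update_of_ne this]
    · simp [State.setIntArr, Function.update_of_ne (show 8 + b ≠ 8 + a by omega)]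

theorem setRealArr (h : Frame m c σ τ) (hc : c < m) (a : ℕ) (i : ℤ) (v : ℝ) :
    Frame m c σ (τ.setRealArr (8 + a) (i * m + c) v) := by
  refine ⟨h.1, h.2, fun b hb => ?_, h.4, fun b j hj => ?_⟩
  · rw [← h.realArr b hb]
    exact Function.update_of_ne (by omega) _ _
  · rw [← h.realCopy b j hj]
    by_cases e : b = a
    · subst e
      have : j ≠ i * m + c := fun e => hj (e ▸ emod_copy hc i)
      simp [State.setRealArr, Function.update_of_ne this]
    · simp [State.setRealArr, Function.update_of_ne (show 8 + b ≠ 8 + a by omega)]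

end Frame

theorem copy_injective {m c : ℕ} (hc : c < m) {i j : ℤ} (h : i * m + c = j * m + c) : i = j := by
  have hm : (m : ℤ) ≠ 0 := by omega
  exact mul_right_cancel₀ hm (by linarith)

namespace Simulates

variable {b B m c : ℕ} {σ τ : State}

theorem setInt (h : Simulates b B m c σ τ) (x : ℕ) {v : ℤ} (hv : |v| ≤ B) :
    Simulates b B m c (σ.setInt (64 + x) v) (τ.setInt x v) := by
  refine ⟨?_, ?_, fun y hy => ?_, h.4, h.5, h.6, fun y => ?_, h.8⟩
  · rw [← h.1]; exact Function.update_of_ne (by omega) _ _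
  · rw [← h.2]; exact Function.update_of_ne (by omega) _ _
  · by_cases e : y = x
    · subst e; simp [State.setInt]
    · simpa [State.setInt, Function.update_of_ne (show 64 + y ≠ 64 + x by omega),
        Function.update_of_ne e] using h.int y hy
  · by_cases e : y = x
    · subst e; simpa [State.setInt] using hv
    · simpa [State.setInt, Function.update_of_ne e] using h.abs_int_le y

theorem setReal (h : Simulates b B m c σ τ) (x : ℕ) (v : ℝ) :
    Simulates b B m c (σ.setReal (64 + x) v) (τ.setReal x v) := by
  refine ⟨h.1, h.2, h.3, fun y hy => ?_, h.5, h.6, h.7, h.8⟩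
  by_cases e : y = x
  · subst e; simp [State.setReal]
  · simpa [State.setReal, Function.update_of_ne (show 64 + y ≠ 64 + x by omega),
      Function.update_of_ne e] using h.real y hy

theorem setTemp (h : Simulates b B m c σ τ) (v : ℤ) :
    Simulates b B m c (σ.setInt 30 v) τ := by
  refine ⟨h.1, h.2, fun y hy => ?_, h.4, h.5, h.6, h.7, h.8⟩
  rw [← h.int y hy]
  exact Function.update_of_ne (by omega) _ _

theorem setIntArr (h : Simulates b B m c σ τ) (hc : c < m) (a : ℕ) (i : ℤ) {v : ℤ}
    (hv : |v| ≤ B) :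
    Simulates b B m c (σ.setIntArr (8 + a) (i * m + c) v) (τ.setIntArr a i v) := by
  refine ⟨h.1, h.2, h.3, h.4, fun a' j => ?_, h.6, h.7, fun a' j => ?_⟩
  · by_cases e : a' = a
    · subst e
      by_cases e' : j = i
      · subst e'; simp [State.setIntArr]
      · simpa [State.setIntArr, Function.update_of_ne e',
          Function.update_of_ne (fun e => e' (copy_injective hc e))] using h.intArr a' j
    · simpa [State.setIntArr, Function.update_of_ne e,
        Function.update_of_ne (show 8 + a' ≠ 8 + a by omega)] using h.intArr a' j
  · by_cases e : a' = a
    · subst e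
      by_cases e' : j = i
      · subst e'; simpa [State.setIntArr] using hv
      · simpa [State.setIntArr, Function.update_of_ne e'] using h.abs_intArr_le a' j
    · simpa [State.setIntArr, Function.update_of_ne e] using h.abs_intArr_le a' j

theorem setRealArr (h : Simulates b B m c σ τ) (hc : c < m) (a : ℕ) (i : ℤ) (v : ℝ) :
    Simulates b B m c (σ.setRealArr (8 + a) (i * m + c) v) (τ.setRealArr a i v) := by
  refine ⟨h.1, h.2, h.3, h.4, h.5, fun a' j => ?_, h.7, h.8⟩
  by_cases e : a' = a
  · subst e
    by_cases e' : j = i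
    · subst e'; simp [State.setRealArr]
    · simpa [State.setRealArr, Function.update_of_ne e',
        Function.update_of_ne (fun e => e' (copy_injective hc e))] using h.realArr a' j
  · simpa [State.setRealArr, Function.update_of_ne e,
      Function.update_of_ne (show 8 + a' ≠ 8 + a by omega)] using h.realArr a' j

/-- Registers of the simulated state hold words of absolute value at most `B`, so the address
computation stays within `B * m + m`. For this reason `Simulates` records bounds on all words. -/
theorem exec_address {X : Extension} {B' : ℕ} (h : Simulates b B m c σ τ) (hc : c < m)
    (hB : B * m + m ≤ B') {x : ℕ} (hx : x < b) :
    Exec B' (Program.address X x) σ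
      ((σ.setInt 30 (τ.int x * m)).setInt 30 (τ.int x * m + c)) 2 := by
  have h0 : |τ.int x * m| ≤ B * m := by
    rw [abs_mul, Nat.abs_cast]
    exact mul_le_mul_of_nonneg_right (h.abs_int_le x) (by positivity)
  have hB' : (B : ℤ) * m + m ≤ B' := by exact_mod_cast hB
  have e1 : (IntOp.mul (X := X)).eval (σ.int (64 + x)) (σ.int 0) = τ.int x * m := by
    simp [IntOp.eval, h.int x hx, h.copies]
  have h1 := Exec.intOp (X := X) (B := B') σ .mul 30 (64 + x) 0 (by rw [e1]; linarith)
  rw [e1] at h1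
  have e2 : (IntOp.add (X := X)).eval ((σ.setInt 30 (τ.int x * m)).int 30)
      ((σ.setInt 30 (τ.int x * m)).int 15) = τ.int x * m + c := by
    simp [IntOp.eval, State.setInt, h.copy]
  have h2 := Exec.intOp (X := X) (B := B') (σ.setInt 30 (τ.int x * m)) .add 30 30 15 (by
    rw [e2]
    refine (abs_add_le _ _).trans ?_
    rw [Nat.abs_cast]
    have : (c : ℤ) ≤ m := by exact_mod_cast hc.le
    linarith)
  rw [e2] at h2
  exact h1.seq h2

/-- A relocated program simulates the original one. -/
theorem exec {X : Extension} {B' : ℕ} (hc : c < m) (hB : B * m + m ≤ B') {p : Program X}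
    {τ' : State} {k : ℕ} (hx : Exec B p τ τ' k) (hb : p.Below b) (h : Simulates b B m c σ τ) :
    ∃ σ' k', k' ≤ 3 * k ∧ Exec B' p.relocate σ σ' k' ∧ Simulates b B m c σ' τ' ∧
      Frame m c σ σ' := by
  have hBB : (B : ℤ) ≤ B' := by
    have : B ≤ B' := by nlinarith
    exact_mod_cast this
  -- A memory access becomes three instructions, namely a multiplication, an addition and the access
  -- itself; all other instructions and tests keep their cost. Hence the factor `3`.
  induction hx generalizing σ with
  | skip τ => exact ⟨σ, 1, by omega, .skip σ, h, .refl σ⟩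
  | intConst τ x v hv =>
    exact ⟨_, 1, by omega, .intConst σ (64 + x) v (hv.trans hBB), h.setInt x hv,
      (Frame.refl σ).setInt (by omega) _⟩
  | intOp τ o x y z hv =>
    have e : o.eval (σ.int (64 + y)) (σ.int (64 + z)) = o.eval (τ.int y) (τ.int z) := by
      rw [h.int y hb.2.1, h.int z hb.2.2]
    refine ⟨_, 1, by omega, .intOp σ o (64 + x) (64 + y) (64 + z) ?_, ?_,
      (Frame.refl σ).setInt (by omega) _⟩
    · rw [e]; exact hv.trans hBB
    · rw [e]; exact h.setInt x hv
  | intLoad τ x a y =>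
    refine ⟨_, _, by omega, (h.exec_address hc hB hb.2).seq (.intLoad _ (64 + x) (8 + a) 30), ?_,
      (((Frame.refl σ).setInt (by omega) _).setInt (by omega) _).setInt (by omega) _⟩
    have e : ((σ.setInt 30 (τ.int y * m)).setInt 30 (τ.int y * m + c)).intArr (8 + a)
        (((σ.setInt 30 (τ.int y * m)).setInt 30 (τ.int y * m + c)).int 30)
        = τ.intArr a (τ.int y) := by
      simpa [State.setInt] using h.intArr a (τ.int y)
    rw [e]
    exact ((h.setTemp _).setTemp _).setInt x (h.abs_intArr_le _ _)
  | intStore τ a x y =>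
    have e1 : ((σ.setInt 30 (τ.int x * m)).setInt 30 (τ.int x * m + c)).int 30
        = τ.int x * m + c := by simp [State.setInt]
    have e2 : ((σ.setInt 30 (τ.int x * m)).setInt 30 (τ.int x * m + c)).int (64 + y)
        = τ.int y := ((h.setTemp _).setTemp _).int y hb.2
    refine ⟨_, _, by omega, (h.exec_address hc hB hb.1).seq (.intStore _ (8 + a) 30 (64 + y)), ?_,
      ?_⟩
    · rw [e1, e2]
      exact ((h.setTemp _).setTemp _).setIntArr hc a _ (h.abs_int_le _)
    · rw [e1]
      exact (((Frame.refl σ).setInt (by omega) _).setInt (by omega) _).setIntArr hc _ _ _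
  | realCast τ x y =>
    refine ⟨_, 1, by omega, .realCast σ (64 + x) (64 + y), ?_, (Frame.refl σ).setReal _ _⟩
    rw [h.int y hb.2]; exact h.setReal x _
  | realOp τ o x y z =>
    refine ⟨_, 1, by omega, .realOp σ o (64 + x) (64 + y) (64 + z), ?_,
      (Frame.refl σ).setReal _ _⟩
    rw [h.real y hb.2.1, h.real z hb.2.2]; exact h.setReal x _
  | realLoad τ x a y =>
    refine ⟨_, _, by omega, (h.exec_address hc hB hb.2).seq (.realLoad _ (64 + x) (8 + a) 30), ?_,
      (((Frame.refl σ).setInt (by omega) _).setInt (by omega) _).setReal _ _⟩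
    have e : ((σ.setInt 30 (τ.int y * m)).setInt 30 (τ.int y * m + c)).realArr (8 + a)
        (((σ.setInt 30 (τ.int y * m)).setInt 30 (τ.int y * m + c)).int 30)
        = τ.realArr a (τ.int y) := by
      simpa [State.setInt] using h.realArr a (τ.int y)
    rw [e]
    exact ((h.setTemp _).setTemp _).setReal x _
  | realStore τ a x y =>
    have e1 : ((σ.setInt 30 (τ.int x * m)).setInt 30 (τ.int x * m + c)).int 30
        = τ.int x * m + c := by simp [State.setInt]
    have e2 : ((σ.setInt 30 (τ.int x * m)).setInt 30 (τ.int x * m + c)).real (64 + y)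
        = τ.real y := h.real y hb.2
    refine ⟨_, _, by omega, (h.exec_address hc hB hb.1).seq (.realStore _ (8 + a) 30 (64 + y)), ?_,
      ?_⟩
    · rw [e1, e2]
      exact ((h.setTemp _).setTemp _).setRealArr hc a _ _
    · rw [e1]
      exact (((Frame.refl σ).setInt (by omega) _).setInt (by omega) _).setRealArr hc _ _ _
  | round τ f x y hv =>
    have e : f.1 (σ.real (64 + y)) = f.1 (τ.real y) := by rw [h.real y hb.2]
    refine ⟨_, 1, by omega, .round σ f (64 + x) (64 + y) ?_, ?_,
      (Frame.refl σ).setInt (by omega) _⟩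
    · rw [e]; exact hv.trans hBB
    · rw [e]; exact h.setInt x hv
  | seq h1 h2 ih1 ih2 =>
    obtain ⟨σ₁, k₁, hk₁, hx₁, hs₁, hf₁⟩ := ih1 hb.1 h
    obtain ⟨σ₂, k₂, hk₂, hx₂, hs₂, hf₂⟩ := ih2 hb.2 hs₁
    exact ⟨σ₂, _, by omega, hx₁.seq hx₂, hs₂, hf₁.trans hf₂⟩
  | @iteTrue t p q τ τ' k ht _ ih =>
    cases t with
    | intLe x y =>
      obtain ⟨σ₁, k₁, hk₁, hx₁, hs₁, hf₁⟩ := ih hb.2.2.1 h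
      refine ⟨σ₁, _, by omega, .iteTrue ?_ hx₁, hs₁, hf₁⟩
      simpa [Test.holds, h.int x hb.1, h.int y hb.2.1] using ht
    | realLe x y =>
      obtain ⟨σ₁, k₁, hk₁, hx₁, hs₁, hf₁⟩ := ih hb.2.2.1 h
      refine ⟨σ₁, _, by omega, .iteTrue ?_ hx₁, hs₁, hf₁⟩
      simpa [Test.holds, h.real x hb.1, h.real y hb.2.1] using ht
  | @iteFalse t p q τ τ' k ht _ ih =>
    cases t with
    | intLe x y =>
      obtain ⟨σ₁, k₁, hk₁, hx₁, hs₁, hf₁⟩ := ih hb.2.2.2 h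
      refine ⟨σ₁, _, by omega, .iteFalse ?_ hx₁, hs₁, hf₁⟩
      simpa [Test.holds, h.int x hb.1, h.int y hb.2.1] using ht
    | realLe x y =>
      obtain ⟨σ₁, k₁, hk₁, hx₁, hs₁, hf₁⟩ := ih hb.2.2.2 h
      refine ⟨σ₁, _, by omega, .iteFalse ?_ hx₁, hs₁, hf₁⟩
      simpa [Test.holds, h.real x hb.1, h.real y hb.2.1] using ht
  | @whileTrue t p τ τ' τ'' k l ht _ _ ih1 ih2 =>
    cases t with
    | intLe x y =>
      obtain ⟨σ₁, k₁, hk₁, hx₁, hs₁, hf₁⟩ := ih1 hb.2.2 h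
      obtain ⟨σ₂, k₂, hk₂, hx₂, hs₂, hf₂⟩ := ih2 hb hs₁
      refine ⟨σ₂, _, by omega, .whileTrue ?_ hx₁ hx₂, hs₂, hf₁.trans hf₂⟩
      simpa [Test.holds, h.int x hb.1, h.int y hb.2.1] using ht
    | realLe x y =>
      obtain ⟨σ₁, k₁, hk₁, hx₁, hs₁, hf₁⟩ := ih1 hb.2.2 h
      obtain ⟨σ₂, k₂, hk₂, hx₂, hs₂, hf₂⟩ := ih2 hb hs₁
      refine ⟨σ₂, _, by omega, .whileTrue ?_ hx₁ hx₂, hs₂, hf₁.trans hf₂⟩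
      simpa [Test.holds, h.real x hb.1, h.real y hb.2.1] using ht
  | @whileFalse t p τ ht =>
    cases t with
    | intLe x y =>
      refine ⟨σ, 1, by omega, .whileFalse ?_, h, .refl σ⟩
      simpa [Test.holds, h.int x hb.1, h.int y hb.2.1] using ht
    | realLe x y =>
      refine ⟨σ, 1, by omega, .whileFalse ?_, h, .refl σ⟩
      simpa [Test.holds, h.real x hb.1, h.real y hb.2.1] using ht

theorem congr {σ₁ : State} (h : Simulates b B m c σ τ) (e : Equiv σ₁ σ) :
    Simulates b B m c σ₁ τ := by
  refine ⟨by rw [e.1 _ (by omega), h.1], by rw [e.1 _ (by omega), h.2],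
    fun x hx => by rw [e.1 _ (by omega), h.3 x hx],
    fun x hx => by rw [e.2.1 _ (by omega), h.4 x hx],
    fun a i => by rw [e.2.2.1, h.5], fun a i => by rw [e.2.2.2, h.6], h.7, h.8⟩

theorem run {X : Extension} {B' : ℕ} (hc : c < m) (hB : B * m + m ≤ B') {p : Program X}
    {τ' : State} {k K : ℕ} (hx : Exec B p τ τ' k) (hK : 3 * k ≤ K) (hb : p.Below b)
    (h : Simulates b B m c σ τ) {Q : State → Prop}
    (hQ : ∀ σ', Simulates b B m c σ' τ' → Frame m c σ σ' → Q σ') :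
    Run B' p.relocate σ K Q := by
  intro σ₁ e
  obtain ⟨σ', k', hk', hx', hs, hf⟩ := (h.congr e).exec hc hB hx hb
  refine ⟨σ', k', hk'.trans hK, hx', σ', .refl σ', hQ σ' hs (Frame.trans ?_ hf)⟩
  exact ⟨fun x hx => e.1 x (.inl hx), fun a _ => by rw [e.2.2.1], fun a _ => by rw [e.2.2.2],
    fun a j _ => by rw [e.2.2.1], fun a j _ => by rw [e.2.2.2]⟩

end Simulates

end StochasticParsing

namespace StochasticParsing

/-! ## Probabilities of parses by structural recursion -/

/-- `Yields ρ u q w`: the string `u` of symbols has a parse of probability `q` into the word `w`,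
where `ρ r p` says that there is a production `r` of probability `p`. -/
inductive Yields {T N : Type} (ρ : ContextFreeRule T N → ℝ → Prop) :
    List (Symbol T N) → ℝ → List T → Prop
  | nil : Yields ρ [] 1 []
  | terminal {x : T} {u : List (Symbol T N)} {q : ℝ} {w : List T} :
      Yields ρ u q w → Yields ρ (.terminal x :: u) q (x :: w)
  | nonterminal {r : ContextFreeRule T N} {p q q' : ℝ} {u : List (Symbol T N)} {w w' : List T} :
      ρ r p → Yields ρ r.output q w → Yields ρ u q' w' →
      Yields ρ (.nonterminal r.input :: u) (p * q * q') (w ++ w')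

namespace Yields

variable {T N T' N' : Type} {ρ : ContextFreeRule T N → ℝ → Prop}

theorem append {u v : List (Symbol T N)} {q q' : ℝ} {w w' : List T} (h : Yields ρ u q w)
    (h' : Yields ρ v q' w') : Yields ρ (u ++ v) (q * q') (w ++ w') := by
  induction h with
  | nil => simpa using h'
  | terminal _ ih => exact .terminal ih
  | nonterminal hr h1 _ _ ih =>
    have := Yields.nonterminal hr h1 ih
    simpa [mul_assoc] using this

/-- The advantage over sequences of rewriting steps: a tree-like parse splits along any
concatenation without reordering of productions. -/
theorem of_append {u v : List (Symbol T N)} {q : ℝ} {w : List T} (h : Yields ρ (u ++ v) q w) :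
    ∃ q₁ q₂ w₁ w₂, Yields ρ u q₁ w₁ ∧ Yields ρ v q₂ w₂ ∧ q = q₁ * q₂ ∧ w = w₁ ++ w₂ := by
  induction u generalizing q w with
  | nil => exact ⟨1, q, [], w, .nil, h, by simp, rfl⟩
  | cons s u ih =>
    cases h with
    | terminal h =>
      obtain ⟨q₁, q₂, w₁, w₂, h1, h2, rfl, rfl⟩ := ih h
      exact ⟨_, _, _, _, .terminal h1, h2, rfl, rfl⟩
    | nonterminal hr h1 h =>
      obtain ⟨q₁, q₂, w₁, w₂, h2, h3, rfl, rfl⟩ := ih h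
      exact ⟨_, _, _, _, .nonterminal hr h1 h2, h3, by ring, by simp⟩

theorem word (w : List T) : Yields ρ (w.map .terminal) 1 w := by
  induction w with
  | nil => exact .nil
  | cons x w ih => exact .terminal ih

theorem single {r : ContextFreeRule T N} {p q : ℝ} {w : List T} (hr : ρ r p)
    (h : Yields ρ r.output q w) : Yields ρ [.nonterminal r.input] (p * q) w := by
  simpa using Yields.nonterminal hr h .nil

theorem of_single {A : N} {q : ℝ} {w : List T} (h : Yields ρ [.nonterminal A] q w) :
    ∃ r p q', ρ r p ∧ r.input = A ∧ Yields ρ r.output q' w ∧ q = p * q' := by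
  cases h with
  | nonterminal hr h1 h2 =>
    cases h2
    exact ⟨_, _, _, hr, rfl, by simpa using h1, by simp⟩

theorem of_terminal {x : T} {q : ℝ} {w : List T} (h : Yields ρ [.terminal x] q w) :
    q = 1 ∧ w = [x] := by
  cases h with
  | terminal h => cases h; exact ⟨rfl, rfl⟩

theorem of_pair {s s' : Symbol T N} {q : ℝ} {w : List T} (h : Yields ρ [s, s'] q w) :
    ∃ q₁ q₂ w₁ w₂, Yields ρ [s] q₁ w₁ ∧ Yields ρ [s'] q₂ w₂ ∧ q = q₁ * q₂ ∧ w = w₁ ++ w₂ :=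
  of_append (u := [s]) (v := [s']) h

end Yields

def mapSymbol {T N T' N' : Type} (f : T → T') (h : N → N') : Symbol T N → Symbol T' N'
  | .terminal x => .terminal (f x)
  | .nonterminal A => .nonterminal (h A)

def mapRule {T N T' N' : Type} (f : T → T') (h : N → N') (r : ContextFreeRule T N) :
    ContextFreeRule T' N' :=
  ⟨h r.input, r.output.map (mapSymbol f h)⟩

/-- Renaming of symbols. It is applied in both directions, between symbols in `Fin` and symbols that
are plain natural numbers. -/
theorem Yields.map {T N T' N' : Type} {ρ : ContextFreeRule T N → ℝ → Prop}
    {ρ' : ContextFreeRule T' N' → ℝ → Prop} {f : T → T'} {h : N → N'}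
    (hρ : ∀ r p, ρ r p → ρ' (mapRule f h r) p) {u : List (Symbol T N)} {q : ℝ} {w : List T}
    (hy : Yields ρ u q w) : Yields ρ' (u.map (mapSymbol f h)) q (w.map f) := by
  induction hy with
  | nil => exact .nil
  | terminal _ ih => exact .terminal ih
  | nonterminal hr _ _ ih1 ih2 =>
    rw [List.map_append]
    exact Yields.nonterminal (hρ _ _ hr) ih1 ih2

namespace SCFG

variable {g : SCFG}

/-- The productions with their probabilities. -/
def HasProb (g : SCFG) (r : ContextFreeRule (Fin g.numT) (Fin g.numNT)) (p : ℝ) : Prop :=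
  r ∈ g.rules ∧ p = g.prob r

theorem Parse.append_context {u v : List g.Sym}
    {P : List (ContextFreeRule (Fin g.numT) (Fin g.numNT))} (h : g.Parse u P v)
    (a b : List g.Sym) : g.Parse (a ++ u ++ b) P (a ++ v ++ b) := by
  induction h with
  | nil u => exact .nil _
  | cons hr hw _ ih => exact .cons hr ((hw.append_left a).append_right b) ih

theorem Parse.trans {u v w : List g.Sym}
    {P Q : List (ContextFreeRule (Fin g.numT) (Fin g.numNT))} (h : g.Parse u P v)
    (h' : g.Parse v Q w) : g.Parse u (P ++ Q) w := by
  induction h with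
  | nil u => exact h'
  | cons hr hw _ ih => exact .cons hr hw (ih h')

/-- By induction from the first production on: it rewrites one symbol in the middle of the string,
so the parse of the new string is cut into three pieces, and the middle one is put below the
nonterminal. -/
theorem yields_of_parse {u v : List g.Sym}
    {P : List (ContextFreeRule (Fin g.numT) (Fin g.numNT))} (h : g.Parse u P v)
    {s : List (Fin g.numT)} (hv : v = g.word s) :
    Yields g.HasProb u (P.map g.prob).prod s := by
  induction h with
  | nil u => subst hv; exact Yields.word s
  | @cons u v w r P hr hw _ ih =>
    obtain ⟨a, b, rfl, rfl⟩ := hw.exists_parts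
    obtain ⟨q₁, q₂, w₁, w₂, h1, h2, e, rfl⟩ := (ih hv).of_append
    obtain ⟨q₃, q₄, w₃, w₄, h3, h4, rfl, rfl⟩ := h1.of_append
    have := (h3.append (Yields.single (⟨hr, rfl⟩ : g.HasProb r (g.prob r)) h4)).append h2
    rw [List.map_cons, List.prod_cons, e]
    convert this using 1
    ring

/-- The productions are listed as in a leftmost derivation: first the production of the leading
nonterminal, then those of its subtree, then the rest. -/
theorem exists_parse {u : List g.Sym} {q : ℝ} {s : List (Fin g.numT)}
    (h : Yields g.HasProb u q s) : ∃ P, g.Parse u P (g.word s) ∧ q = (P.map g.prob).prod := by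
  induction h with
  | nil => exact ⟨[], .nil _, by simp⟩
  | @terminal x u q w _ ih =>
    obtain ⟨P, hP, rfl⟩ := ih
    exact ⟨P, by simpa [word] using hP.append_context [.terminal x] [], rfl⟩
  | @nonterminal r p q q' u w w' hr _ _ ih1 ih2 =>
    obtain ⟨P, hP, rfl⟩ := ih1
    obtain ⟨P', hP', rfl⟩ := ih2
    obtain ⟨hr, rfl⟩ := hr
    have h1 := hP.append_context [] u
    have h2 := hP'.append_context (g.word w) []
    simp only [List.append_nil, List.nil_append] at h1 h2
    refine ⟨r :: (P ++ P'), .cons hr (.head u) ?_, by simp [mul_assoc]⟩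
    simpa [word] using h1.trans h2

theorem mem_parseProbs {A : Fin g.numNT} {s : List (Fin g.numT)} {q : ℝ} :
    q ∈ g.parseProbs A s ↔ Yields g.HasProb [.nonterminal A] q s := by
  constructor
  · rintro ⟨P, hP, rfl⟩
    exact yields_of_parse hP rfl
  · exact exists_parse

end SCFG

/-! ## Grammars given by lists of numbered productions -/

/-- A production `A → x` or `A → b c` in Chomsky normal form, with its probability. -/
inductive RawRule where
  | unit (A x : ℕ) (p : ℝ)
  | bin (A b c : ℕ) (p : ℝ)

namespace RawRule

def lhs : RawRule → ℕ
  | unit A _ _ => A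
  | bin A _ _ _ => A

def prob : RawRule → ℝ
  | unit _ _ p => p
  | bin _ _ _ p => p

def rhs : RawRule → List (Symbol ℕ ℕ)
  | unit _ x _ => [.terminal x]
  | bin _ b c _ => [.nonterminal b, .nonterminal c]

def fst : RawRule → ℕ
  | unit _ x _ => x
  | bin _ b _ _ => b

def snd : RawRule → ℕ
  | unit _ _ _ => 0
  | bin _ _ c _ => c

def rule (R : RawRule) : ContextFreeRule ℕ ℕ := ⟨R.lhs, R.rhs⟩

end RawRule

/-- A list of productions over nonterminals `0` (the start symbol), ..., `numNT - 1` and terminals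
`0`, ..., `numT - 1`, with probabilities that form a stochastic grammar. -/
structure RawGrammar where
  numNT : ℕ
  numT : ℕ
  rules : List RawRule
  numNT_pos : 0 < numNT
  numT_pos : 0 < numT
  lhs_lt : ∀ R ∈ rules, R.lhs < numNT
  fst_lt : ∀ A x p, RawRule.unit A x p ∈ rules → x < numT
  snd_lt : ∀ A b c p, RawRule.bin A b c p ∈ rules → b < numNT ∧ c < numNT
  prob_pos : ∀ R ∈ rules, 0 < R.prob
  nodup : (rules.map RawRule.rule).Nodup
  sum_prob : ∀ A < numNT, ((rules.filter fun R => R.lhs = A).map RawRule.prob).sum = 1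

namespace RawGrammar

variable (G : RawGrammar)

/-- The reduction only makes the function total; it is the identity on the numbers that occur in the
grammar. -/
def nt (A : ℕ) : Fin G.numNT := ⟨A % G.numNT, Nat.mod_lt _ G.numNT_pos⟩

def letter (x : ℕ) : Fin G.numT := ⟨x % G.numT, Nat.mod_lt _ G.numT_pos⟩

theorem val_nt {A : ℕ} (h : A < G.numNT) : (G.nt A : ℕ) = A := Nat.mod_eq_of_lt h

theorem val_letter {x : ℕ} (h : x < G.numT) : (G.letter x : ℕ) = x := Nat.mod_eq_of_lt h

def finRule (R : RawRule) : ContextFreeRule (Fin G.numT) (Fin G.numNT) :=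
  mapRule G.letter G.nt R.rule

theorem mapRule_val_finRule {R : RawRule} (hR : R ∈ G.rules) :
    mapRule Fin.val Fin.val (G.finRule R) = R.rule := by
  have h := G.lhs_lt R hR
  cases R with
  | unit A x p =>
    simp [finRule, mapRule, mapSymbol, RawRule.rule, RawRule.rhs, G.val_nt h,
      G.val_letter (G.fst_lt A x p hR)]
  | bin A b c p =>
    simp [finRule, mapRule, mapSymbol, RawRule.rule, RawRule.rhs, G.val_nt h,
      G.val_nt (G.snd_lt A b c p hR).1, G.val_nt (G.snd_lt A b c p hR).2]

/-- The productions, as a list without repetitions. -/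
def ruleList : List (ContextFreeRule (Fin G.numT) (Fin G.numNT)) := G.rules.map G.finRule

/-- The numbers in a listed production are in range and so can be read off from its `Fin` version;
by `nodup` the production also determines its probability. -/
theorem finRule_injOn {R R' : RawRule} (hR : R ∈ G.rules) (hR' : R' ∈ G.rules)
    (h : G.finRule R = G.finRule R') : R = R' := by
  refine List.inj_on_of_nodup_map G.nodup hR hR' ?_
  rw [← G.mapRule_val_finRule hR, ← G.mapRule_val_finRule hR', h]

theorem ruleList_nodup : G.ruleList.Nodup :=
  (List.Nodup.of_map _ G.nodup).map_on fun _ hR _ hR' => G.finRule_injOn hR hR'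

-- A grammar needs the probability as a function of the production. It is looked up in the list; by
-- `finRule_injOn` the production found is the only possible one.
open Classical in
noncomputable def probOf (r : ContextFreeRule (Fin G.numT) (Fin G.numNT)) : ℝ :=
  ((G.rules.find? fun R => G.finRule R = r).map RawRule.prob).getD 0

theorem probOf_finRule {R : RawRule} (hR : R ∈ G.rules) : G.probOf (G.finRule R) = R.prob := by
  classical
  unfold probOf
  cases h : G.rules.find? fun R' => G.finRule R' = G.finRule R with
  | none =>
    rw [List.find?_eq_none] at h
    exact absurd (by simp) (h R hR)
  | some R' =>
    have h1 := List.mem_of_find?_eq_some h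
    have h2 := List.find?_some h
    simp only [decide_eq_true_eq] at h2
    rw [G.finRule_injOn h1 hR h2]
    rfl

theorem val_finRule_input {R : RawRule} (hR : R ∈ G.rules) : ((G.finRule R).input : ℕ) = R.lhs :=
  G.val_nt (G.lhs_lt R hR)

@[reducible] noncomputable def scfg : SCFG where
  numNT := G.numNT
  numT := G.numT
  start := G.nt 0
  rules := G.ruleList.toFinset
  prob := G.probOf
  prob_pos r hr := by
    rw [List.mem_toFinset, ruleList, List.mem_map] at hr
    obtain ⟨R, hR, rfl⟩ := hr
    rw [G.probOf_finRule hR]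
    exact G.prob_pos R hR
  sum_prob A := by
    have e : (G.ruleList.toFinset.filter fun r => r.input = A)
        = (G.ruleList.filter fun r => r.input = A).toFinset := by ext r; simp
    rw [e, List.sum_toFinset _ (G.ruleList_nodup.filter _), ruleList,
      List.filter_map, List.map_map, ← G.sum_prob A A.2]
    congr 1
    have e' : List.filter ((fun r => decide (r.input = A)) ∘ G.finRule) G.rules
        = List.filter (fun R => decide (R.lhs = (A : ℕ))) G.rules := by
      refine List.filter_congr fun R hR => ?_
      simp [Fin.ext_iff, G.val_finRule_input hR]
    rw [e']
    refine List.map_congr_left fun R hR => ?_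
    exact G.probOf_finRule (List.mem_of_mem_filter hR)

theorem mem_scfg_rules {r : ContextFreeRule (Fin G.numT) (Fin G.numNT)} :
    r ∈ G.scfg.rules ↔ ∃ R ∈ G.rules, G.finRule R = r := by
  simp only [scfg, ruleList, List.mem_toFinset, List.mem_map]

theorem mem_ruleList_iff (r : ContextFreeRule (Fin G.numT) (Fin G.numNT)) :
    r ∈ G.ruleList ↔ r ∈ G.scfg.rules :=
  List.mem_toFinset.symm

theorem isCNF : G.scfg.IsCNF := by
  intro r hr
  obtain ⟨R, hR, rfl⟩ := G.mem_scfg_rules.1 hr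
  cases R with
  | unit A x p => exact .inr (.inl ⟨_, rfl⟩)
  | bin A b c p => exact .inl ⟨_, _, rfl⟩

/-- The productions with their probabilities. -/
def HasProb (r : ContextFreeRule ℕ ℕ) (p : ℝ) : Prop := ∃ R ∈ G.rules, R.rule = r ∧ R.prob = p

/-- From here on parses can be analysed with natural numbers as symbols, where the arithmetic of
indices is available to `omega`. -/
theorem mem_parseProbs {A : ℕ} (hA : A < G.numNT) {s : List ℕ} (hs : ∀ x ∈ s, x < G.numT) {q : ℝ} :
    q ∈ G.scfg.parseProbs (G.nt A) (s.map G.letter) ↔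
      Yields G.HasProb [.nonterminal A] q s := by
  rw [SCFG.mem_parseProbs]
  constructor
  · intro h
    have h1 := h.map (ρ' := G.HasProb) (f := Fin.val) (h := Fin.val) (by
      rintro r p ⟨hr, rfl⟩
      obtain ⟨R, hR, rfl⟩ := G.mem_scfg_rules.1 hr
      exact ⟨R, hR, (G.mapRule_val_finRule hR).symm, (G.probOf_finRule hR).symm⟩)
    have e : (s.map G.letter).map Fin.val = s := by
      rw [List.map_map]
      conv_rhs => rw [← List.map_id s]
      exact List.map_congr_left fun x hx => G.val_letter (hs x hx)
    have e' : (G.nt A : ℕ) = A := G.val_nt hA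
    erw [e] at h1
    simpa [mapSymbol, e'] using h1
  · intro h
    refine h.map (ρ' := G.scfg.HasProb) (f := G.letter) (h := G.nt) ?_
    rintro r p ⟨R, hR, rfl, rfl⟩
    exact ⟨G.mem_scfg_rules.2 ⟨R, hR, rfl⟩, (G.probOf_finRule hR).symm⟩

/-- Derivations between strings of numbered symbols. -/
def Derives (u v : List (Symbol ℕ ℕ)) : Prop :=
  G.scfg.Derives (u.map (mapSymbol G.letter G.nt)) (v.map (mapSymbol G.letter G.nt))

variable {G}

theorem Derives.refl (u : List (Symbol ℕ ℕ)) : G.Derives u u := Relation.ReflTransGen.refl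

theorem Derives.trans {u v w : List (Symbol ℕ ℕ)} (h : G.Derives u v) (h' : G.Derives v w) :
    G.Derives u w := Relation.ReflTransGen.trans h h'

theorem Derives.context {u v : List (Symbol ℕ ℕ)} (h : G.Derives u v) (a b : List (Symbol ℕ ℕ)) :
    G.Derives (a ++ u ++ b) (a ++ v ++ b) := by
  unfold Derives
  simp only [List.map_append]
  exact (ContextFreeGrammar.Derives.append_left h _).append_right _

theorem derives_of_mem {R : RawRule} (hR : R ∈ G.rules) :
    G.Derives [.nonterminal R.lhs] R.rhs :=
  Relation.ReflTransGen.single ⟨G.finRule R, G.mem_scfg_rules.2 ⟨R, hR, rfl⟩,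
    ContextFreeRule.Rewrites.input_output⟩

theorem derives_unit {A x : ℕ} {p : ℝ} (h : RawRule.unit A x p ∈ G.rules) :
    G.Derives [.nonterminal A] [.terminal x] := derives_of_mem h

theorem derives_bin {A b c : ℕ} {p : ℝ} (h : RawRule.bin A b c p ∈ G.rules) :
    G.Derives [.nonterminal A] [.nonterminal b, .nonterminal c] := derives_of_mem h

theorem map_terminal_letter (s : List ℕ) :
    (s.map (Symbol.terminal : ℕ → Symbol ℕ ℕ)).map (mapSymbol G.letter G.nt)
      = G.scfg.word (s.map G.letter) := by
  simp only [SCFG.word, List.map_map]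
  rfl

/-- If every nonterminal is reachable from the start symbol and derives some word, then every
nonterminal occurs in a derivation of a word. -/
theorem allReachable
    (hr : ∀ A < G.numNT, ∃ u v, G.Derives [.nonterminal 0] (u ++ [.nonterminal A] ++ v))
    (hg : ∀ A < G.numNT, ∃ s : List ℕ, G.Derives [.nonterminal A] (s.map .terminal)) :
    G.scfg.AllReachable := by
  have gen : ∀ u : List G.scfg.Sym, ∃ s, G.scfg.Derives u (G.scfg.word s) := by
    intro u
    induction u with
    | nil => exact ⟨[], Relation.ReflTransGen.refl⟩
    | cons x u ih =>
      obtain ⟨s, hs⟩ := ih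
      have h1 : ∃ s', G.scfg.Derives [x] (G.scfg.word s') := by
        cases x with
        | terminal x => exact ⟨[x], Relation.ReflTransGen.refl⟩
        | nonterminal A =>
          obtain ⟨s', hs'⟩ := hg A A.2
          refine ⟨s'.map G.letter, ?_⟩
          have e : G.nt A = A := Fin.ext (G.val_nt A.2)
          unfold Derives at hs'
          rw [map_terminal_letter] at hs'
          simp only [List.map_cons, List.map_nil, mapSymbol, e] at hs'
          exact hs'
      obtain ⟨s', hs'⟩ := h1
      refine ⟨s' ++ s, ?_⟩
      have h2 := ContextFreeGrammar.Derives.append_right hs' u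
      have h3 := ContextFreeGrammar.Derives.append_left hs (G.scfg.word s')
      have := h2.trans h3
      unfold SCFG.word at this ⊢
      rw [List.map_append]
      exact this
  intro A
  obtain ⟨u, v, h⟩ := hr A A.2
  have e : G.nt A = A := Fin.ext (G.val_nt A.2)
  obtain ⟨s, hs⟩ := gen (u.map (mapSymbol G.letter G.nt) ++ [.nonterminal A] ++
    v.map (mapSymbol G.letter G.nt))
  refine ⟨_, _, s, ?_, hs⟩
  unfold Derives at h
  simpa [mapSymbol, e, scfg] using h

variable (G)

theorem size_scfg_le : G.scfg.size ≤ G.numNT + G.numT + 3 * G.rules.length := by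
  have h1 : ∑ r ∈ G.scfg.rules, (1 + r.output.length) ≤ ∑ r ∈ G.scfg.rules, 3 := by
    refine Finset.sum_le_sum fun r hr => ?_
    obtain ⟨R, hR, rfl⟩ := G.mem_scfg_rules.1 hr
    cases R
    · exact (by norm_num : 1 + 1 ≤ 3)
    · exact le_rfl
  have h2 : G.scfg.rules.card ≤ G.rules.length := by
    refine (List.toFinset_card_le _).trans (le_of_eq ?_)
    exact List.length_map _
  have h3 : G.scfg.size = G.numNT + G.numT + ∑ r ∈ G.scfg.rules, (1 + r.output.length) := rfl
  rw [Finset.sum_const, smul_eq_mul] at h1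
  omega

theorem maxLog_scfg_le {P : ℝ} (hP : 2 ≤ P) (h : ∀ R ∈ G.rules, 1 ≤ R.prob * P) :
    G.scfg.maxLog ≤ Real.logb 2 P := by
  unfold SCFG.maxLog
  rw [Finset.fold_max_le]
  constructor
  · rw [Real.le_logb_iff_rpow_le (by norm_num) (by linarith)]
    simpa using hP
  · intro r hr
    obtain ⟨R, hR, rfl⟩ := G.mem_scfg_rules.1 hr
    have e : G.scfg.prob (G.finRule R) = R.prob := G.probOf_finRule hR
    have h0 := G.prob_pos R hR
    rw [e]
    refine Real.logb_le_logb_of_le (by norm_num) (by positivity) ?_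
    rw [div_le_iff₀ h0, mul_comm]
    exact h R hR

theorem one_le_maxLog (g : SCFG) : 1 ≤ g.maxLog := by
  unfold SCFG.maxLog
  rw [Finset.le_fold_max]
  exact .inl le_rfl

end RawGrammar

end StochasticParsing

namespace StochasticParsing

/-! ## The grammar of a min-plus square -/

/-- A `d ^ 3` by `d ^ 3` matrix with entries between `1` and `Q - 1`. -/
structure MatrixInstance where
  d : ℕ
  Q : ℕ
  a : ℕ → ℕ → ℕ
  d_pos : 1 ≤ d
  a_pos : ∀ i j, 0 < a i j
  a_lt : ∀ i j, a i j < Q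

namespace MatrixInstance

variable (I : MatrixInstance)

/-- An index below `D` is `p * d + x` with `p < d2` and `x < d`. So `d4` counts pairs of high parts,
and `d2` counts both the high parts and the pairs of low parts. -/
def d2 : ℕ := I.d * I.d
def d4 : ℕ := I.d2 * I.d2
def D : ℕ := I.d2 * I.d

theorem d2_pos : 0 < I.d2 := Nat.mul_pos I.d_pos I.d_pos
theorem d4_pos : 0 < I.d4 := Nat.mul_pos I.d2_pos I.d2_pos
theorem D_pos : 0 < I.D := Nat.mul_pos I.d2_pos I.d_pos
theorem Q_pos : 0 < I.Q := (Nat.zero_le _).trans_lt (I.a_lt 0 0)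
theorem d2_le_d4 : I.d2 ≤ I.d4 := Nat.le_mul_of_pos_left _ I.d2_pos

/-- The entry that production number `t` of nonterminal `M k` stands for. -/
def entry (k t : ℕ) : ℕ := I.a (k / I.d2 * I.d + t / I.d) (k % I.d2 * I.d + t % I.d)

/-! The nonterminals are `S = 0` (start), `V = 1` (any letter), `X x = 2 + x` (words that begin
with `x`), `Z z = 2 + d + z` (words that end in `d + z`), `M k = 2 + 2 d + k` (the matrix) and
`C k = 2 + 2 d + d ^ 4 + k` (its square). -/

def offM : ℕ := 2 + 2 * I.d
def offC : ℕ := 2 + 2 * I.d + I.d4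

/-- The start symbol places the marker `2 * d` first and then appends single letters and squares `C
k`, so every `C k` can be placed in any context within a text that begins with the marker. -/
noncomputable def rulesS : List RawRule :=
  [.unit 0 (2 * I.d) (1 / (I.d4 + 2)), .bin 0 0 1 (1 / (I.d4 + 2))] ++
    (List.range I.d4).flatMap fun k => [.bin 0 0 (I.offC + k) (1 / (I.d4 + 2))]

noncomputable def rulesV : List RawRule :=
  (List.range (2 * I.d + 1)).flatMap fun y => [.unit 1 y (1 / (2 * I.d + 1))]

/-- Every additional letter, whichever it is, costs the same factor: `1 / 2` for the extension and
the uniform probability for the letter. The probability thus reveals only the length of the word. -/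
noncomputable def rulesX : List RawRule :=
  (List.range I.d).flatMap fun x => [.unit (2 + x) x (1 / 2), .bin (2 + x) (2 + x) 1 (1 / 2)]

noncomputable def rulesZ : List RawRule :=
  (List.range I.d).flatMap fun z =>
    [.unit (2 + I.d + z) (I.d + z) (1 / 2), .bin (2 + I.d + z) 1 (2 + I.d + z) (1 / 2)]

/-- The second production absorbs the remaining probability, so that the two together have
probability `1 / d2`. Its second symbol is the start symbol, which brings in the marker; its first
symbol `t` only serves to keep the productions distinct. -/
noncomputable def rulesM : List RawRule :=
  (List.range I.d4).flatMap fun k => (List.range I.d2).flatMap fun t =>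
    [.bin (I.offM + k) (2 + t / I.d) (2 + I.d + t % I.d)
      (((I.Q : ℝ) - I.entry k t) / (I.d2 * I.Q)),
      .bin (I.offM + k) t 0 ((I.entry k t : ℝ) / (I.d2 * I.Q))]

/-- Block multiplication: `k` codes the pair `(k / d2, k % d2)` of high parts, and `r` runs over the
high parts of the middle index. -/
noncomputable def rulesC : List RawRule :=
  (List.range I.d4).flatMap fun k => (List.range I.d2).flatMap fun r =>
    [.bin (I.offC + k) (I.offM + (k / I.d2 * I.d2 + r)) (I.offM + (r * I.d2 + k % I.d2)) (1 / I.d2)]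

noncomputable def rules : List RawRule :=
  I.rulesS ++ (I.rulesV ++ (I.rulesX ++ (I.rulesZ ++ (I.rulesM ++ I.rulesC))))

theorem mem_rules {R : RawRule} : R ∈ I.rules ↔
    (R = .unit 0 (2 * I.d) (1 / (I.d4 + 2)) ∨ R = .bin 0 0 1 (1 / (I.d4 + 2)) ∨
      ∃ k < I.d4, R = .bin 0 0 (I.offC + k) (1 / (I.d4 + 2))) ∨
    (∃ y < 2 * I.d + 1, R = .unit 1 y (1 / (2 * I.d + 1))) ∨
    (∃ x < I.d, R = .unit (2 + x) x (1 / 2) ∨ R = .bin (2 + x) (2 + x) 1 (1 / 2)) ∨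
    (∃ z < I.d, R = .unit (2 + I.d + z) (I.d + z) (1 / 2) ∨
      R = .bin (2 + I.d + z) 1 (2 + I.d + z) (1 / 2)) ∨
    (∃ k < I.d4, ∃ t < I.d2, R = .bin (I.offM + k) (2 + t / I.d) (2 + I.d + t % I.d)
      (((I.Q : ℝ) - I.entry k t) / (I.d2 * I.Q)) ∨
      R = .bin (I.offM + k) t 0 ((I.entry k t : ℝ) / (I.d2 * I.Q))) ∨
    ∃ k < I.d4, ∃ r < I.d2, R = .bin (I.offC + k) (I.offM + (k / I.d2 * I.d2 + r))
      (I.offM + (r * I.d2 + k % I.d2)) (1 / I.d2) := by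
  simp only [rules, rulesS, rulesV, rulesX, rulesZ, rulesM, rulesC, List.mem_append,
    List.mem_flatMap, List.mem_range, List.mem_cons, List.not_mem_nil, or_false, or_assoc]

theorem div_lt {t : ℕ} (ht : t < I.d2) : t / I.d < I.d := Nat.div_lt_of_lt_mul ht
theorem mod_lt (t : ℕ) : t % I.d < I.d := Nat.mod_lt _ I.d_pos
theorem div_d2_lt {k : ℕ} (hk : k < I.d4) : k / I.d2 < I.d2 := Nat.div_lt_of_lt_mul hk
theorem mod_d2_lt (k : ℕ) : k % I.d2 < I.d2 := Nat.mod_lt _ I.d2_pos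

theorem pair_lt {p r : ℕ} (hp : p < I.d2) (hr : r < I.d2) : p * I.d2 + r < I.d4 := by
  unfold d4
  nlinarith

theorem sum_filter_lhs (A : ℕ) (L : List RawRule) :
    ((L.filter fun R => R.lhs = A).map RawRule.prob).sum
      = (L.map fun R => if R.lhs = A then R.prob else 0).sum := by
  induction L with
  | nil => rfl
  | cons R L ih =>
    by_cases h : R.lhs = A
    · simp [h, ih]
    · simp [h, ih]

theorem sum_flatMap_range {α : Type} (n : ℕ) (f : ℕ → List α) (g : α → ℝ) :
    (((List.range n).flatMap f).map g).sum = ∑ k ∈ Finset.range n, ((f k).map g).sum := by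
  induction n with
  | zero => simp
  | succ n ih => simp [List.range_succ, Finset.sum_range_succ, ih]

theorem sum_range_ite (n b A : ℕ) (c : ℝ) :
    ∑ k ∈ Finset.range n, (if b + k = A then c else 0) = if b ≤ A ∧ A < b + n then c else 0 := by
  by_cases h : b ≤ A ∧ A < b + n
  · obtain ⟨k, rfl⟩ := Nat.exists_eq_add_of_le h.1
    rw [if_pos h, Finset.sum_eq_single k]
    · simp
    · intro j _ hj
      rw [if_neg (by omega)]
    · intro hk
      exact absurd (Finset.mem_range.2 (by omega)) hk
  · rw [if_neg h]
    refine Finset.sum_eq_zero fun k hk => ?_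
    rw [Finset.mem_range] at hk
    rw [if_neg (by omega)]

theorem sum_prob (A : ℕ) (hA : A < I.offC + I.d4) :
    ((I.rules.filter fun R => R.lhs = A).map RawRule.prob).sum = 1 := by
  have hd2 : (I.d2 : ℝ) ≠ 0 := by exact_mod_cast I.d2_pos.ne'
  have hQ : (I.Q : ℝ) ≠ 0 := by exact_mod_cast I.Q_pos.ne'
  rw [sum_filter_lhs]
  simp only [rules, List.map_append, List.sum_append]
  have eS : (I.rulesS.map fun R => if R.lhs = A then R.prob else 0).sum
      = if A = 0 then 1 else 0 := by
    have h2 : (I.d4 : ℝ) + 2 ≠ 0 := by positivity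
    simp only [rulesS, List.map_append, List.sum_append, sum_flatMap_range]
    by_cases h : A = 0
    · subst h
      simp [RawRule.lhs, RawRule.prob]
      field_simp
      ring
    · simp [RawRule.lhs, Ne.symm h, h]
  have eV : (I.rulesV.map fun R => if R.lhs = A then R.prob else 0).sum
      = if A = 1 then 1 else 0 := by
    have h2 : 2 * (I.d : ℝ) + 1 ≠ 0 := by positivity
    simp only [rulesV, sum_flatMap_range]
    by_cases h : A = 1
    · subst h
      simp [RawRule.lhs, RawRule.prob]
      field_simp
    · simp [RawRule.lhs, Ne.symm h, h]
  have eX : (I.rulesX.map fun R => if R.lhs = A then R.prob else 0).sum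
      = if 2 ≤ A ∧ A < 2 + I.d then 1 else 0 := by
    simp only [rulesX, sum_flatMap_range]
    rw [← sum_range_ite]
    refine Finset.sum_congr rfl fun x _ => ?_
    by_cases h : 2 + x = A
    · simp [RawRule.lhs, RawRule.prob, h]; norm_num
    · simp [RawRule.lhs, h]
  have eZ : (I.rulesZ.map fun R => if R.lhs = A then R.prob else 0).sum
      = if 2 + I.d ≤ A ∧ A < 2 + I.d + I.d then 1 else 0 := by
    simp only [rulesZ, sum_flatMap_range]
    rw [← sum_range_ite]
    refine Finset.sum_congr rfl fun x _ => ?_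
    by_cases h : 2 + I.d + x = A
    · simp [RawRule.lhs, RawRule.prob, h]; norm_num
    · simp [RawRule.lhs, h]
  have eM : (I.rulesM.map fun R => if R.lhs = A then R.prob else 0).sum
      = if I.offM ≤ A ∧ A < I.offM + I.d4 then 1 else 0 := by
    simp only [rulesM, sum_flatMap_range]
    rw [← sum_range_ite]
    refine Finset.sum_congr rfl fun k _ => ?_
    by_cases h : I.offM + k = A
    · simp only [RawRule.lhs, RawRule.prob, h, List.map_cons, List.map_nil, if_true,
        List.sum_cons, List.sum_nil, add_zero]
      -- The numerators `Q - a` and `a` of a production and its companion add up to `Q`.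
      have : ∀ t ∈ Finset.range I.d2, ((I.Q : ℝ) - I.entry k t) / (I.d2 * I.Q)
          + (I.entry k t : ℝ) / (I.d2 * I.Q) = 1 / I.d2 := by
        intro t _
        field_simp
        ring
      rw [Finset.sum_congr rfl this]
      simp [hd2]
    · simp [RawRule.lhs, h]
  have eC : (I.rulesC.map fun R => if R.lhs = A then R.prob else 0).sum
      = if I.offC ≤ A ∧ A < I.offC + I.d4 then 1 else 0 := by
    simp only [rulesC, sum_flatMap_range]
    rw [← sum_range_ite]
    refine Finset.sum_congr rfl fun k _ => ?_
    by_cases h : I.offC + k = A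
    · simp [RawRule.lhs, RawRule.prob, h, hd2]
    · simp [RawRule.lhs, h]
  rw [eS, eV, eX, eZ, eM, eC]
  have h1 : I.offM = 2 + 2 * I.d := rfl
  have h2 : I.offC = 2 + 2 * I.d + I.d4 := rfl
  rcases Nat.lt_or_ge A 1 with h | h
  · rw [if_pos (by omega), if_neg (by omega), if_neg (by omega), if_neg (by omega),
      if_neg (by omega), if_neg (by omega)]; norm_num
  rcases Nat.lt_or_ge A 2 with h | h
  · rw [if_neg (by omega), if_pos (by omega), if_neg (by omega), if_neg (by omega),
      if_neg (by omega), if_neg (by omega)]; norm_num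
  rcases Nat.lt_or_ge A (2 + I.d) with h | h
  · rw [if_neg (by omega), if_neg (by omega), if_pos (by omega), if_neg (by omega),
      if_neg (by omega), if_neg (by omega)]; norm_num
  rcases Nat.lt_or_ge A (2 + 2 * I.d) with h | h
  · rw [if_neg (by omega), if_neg (by omega), if_neg (by omega), if_pos (by omega),
      if_neg (by omega), if_neg (by omega)]; norm_num
  rcases Nat.lt_or_ge A I.offC with h | h
  · rw [if_neg (by omega), if_neg (by omega), if_neg (by omega), if_neg (by omega),
      if_pos (by omega), if_neg (by omega)]; norm_num
  · rw [if_neg (by omega), if_neg (by omega), if_neg (by omega), if_neg (by omega),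
      if_neg (by omega), if_pos (by omega)]; norm_num

theorem pairwise_range {r : ℕ → ℕ → Prop} {n : ℕ} (h : ∀ a b, a < b → b < n → r a b) :
    (List.range n).Pairwise r := by
  refine List.Pairwise.imp_of_mem ?_ (List.pairwise_lt_range (n := n))
  intro a b _ hb hab
  exact h a b hab (List.mem_range.1 hb)

theorem nodup_rules : (I.rules.map RawRule.rule).Nodup := by
  have key : ∀ R R' : RawRule, R.rule ≠ R'.rule ↔ (R.lhs = R'.lhs → R.rhs ≠ R'.rhs) := by
    intro R R'
    simp [RawRule.rule]
  unfold List.Nodup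
  rw [List.pairwise_map]
  simp only [key]
  have h1 : I.offM = 2 + 2 * I.d := rfl
  have h2 : I.offC = 2 + 2 * I.d + I.d4 := rfl
  simp only [rules, List.pairwise_append]
  have lhsS : ∀ R ∈ I.rulesS, R.lhs = 0 := by
    intro R hR
    simp only [rulesS, List.mem_append, List.mem_cons, List.mem_flatMap, List.not_mem_nil,
      or_false] at hR
    rcases hR with (rfl | rfl) | ⟨k, -, rfl⟩ <;> rfl
  have lhsV : ∀ R ∈ I.rulesV, R.lhs = 1 := by
    intro R hR
    simp only [rulesV, List.mem_cons, List.mem_flatMap, List.not_mem_nil, or_false] at hR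
    obtain ⟨k, -, rfl⟩ := hR
    rfl
  have lhsX : ∀ R ∈ I.rulesX, 2 ≤ R.lhs ∧ R.lhs < 2 + I.d := by
    intro R hR
    simp only [rulesX, List.mem_cons, List.mem_flatMap, List.mem_range, List.not_mem_nil,
      or_false] at hR
    obtain ⟨k, hk, rfl | rfl⟩ := hR <;> simp only [RawRule.lhs] <;> omega
  have lhsZ : ∀ R ∈ I.rulesZ, 2 + I.d ≤ R.lhs ∧ R.lhs < 2 + 2 * I.d := by
    intro R hR
    simp only [rulesZ, List.mem_cons, List.mem_flatMap, List.mem_range, List.not_mem_nil,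
      or_false] at hR
    obtain ⟨k, hk, rfl | rfl⟩ := hR <;> simp only [RawRule.lhs] <;> omega
  have lhsM : ∀ R ∈ I.rulesM, 2 + 2 * I.d ≤ R.lhs ∧ R.lhs < I.offC := by
    intro R hR
    simp only [rulesM, List.mem_cons, List.mem_flatMap, List.mem_range, List.not_mem_nil,
      or_false] at hR
    obtain ⟨k, hk, t, -, rfl | rfl⟩ := hR <;> simp only [RawRule.lhs] <;> omega
  have lhsC : ∀ R ∈ I.rulesC, I.offC ≤ R.lhs := by
    intro R hR
    simp only [rulesC, List.mem_cons, List.mem_flatMap, List.mem_range, List.not_mem_nil,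
      or_false] at hR
    obtain ⟨k, hk, t, -, rfl⟩ := hR
    simp only [RawRule.lhs]; omega
  refine ⟨?_, ⟨?_, ⟨?_, ⟨?_, ⟨?_, ?_, ?_⟩, ?_⟩, ?_⟩, ?_⟩, ?_⟩
  · simp only [rulesS, List.pairwise_append, List.pairwise_flatMap]
    refine ⟨by simp [RawRule.rhs], ⟨fun k _ => List.pairwise_singleton _ _,
      pairwise_range fun k k' hk _ => ?_⟩, ?_⟩
    · simp [RawRule.rhs]; omega
    · intro R hR R' hR' _
      simp only [List.mem_cons, List.mem_flatMap, List.not_mem_nil, or_false] at hR hR'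
      obtain ⟨k, -, rfl⟩ := hR'
      rcases hR with rfl | rfl
      · simp [RawRule.rhs]
      · simp [RawRule.rhs]; omega
  · simp only [rulesV, List.pairwise_flatMap]
    refine ⟨fun k _ => List.pairwise_singleton _ _, pairwise_range fun k k' hk _ => ?_⟩
    simp [RawRule.rhs]; omega
  · simp only [rulesX, List.pairwise_flatMap]
    refine ⟨fun k _ => by simp [RawRule.rhs], pairwise_range fun k k' hk _ => ?_⟩
    simp [RawRule.lhs]; omega
  · simp only [rulesZ, List.pairwise_flatMap]
    refine ⟨fun k _ => by simp [RawRule.rhs], pairwise_range fun k k' hk _ => ?_⟩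
    simp [RawRule.lhs]; omega
  · simp only [rulesM, List.pairwise_flatMap]
    refine ⟨fun k _ => ⟨fun t _ => by simp [RawRule.rhs], pairwise_range fun t t' ht _ => ?_⟩,
      pairwise_range fun k k' hk _ => ?_⟩
    -- Quotient and remainder determine `t`, so the main productions differ; they differ from the
    -- companions in the second symbol, which is the start symbol only in the latter.
    · have : t / I.d = t' / I.d → t % I.d ≠ t' % I.d := by
        intro h h'
        have h3 := Nat.div_add_mod t I.d
        rw [h, h', Nat.div_add_mod] at h3
        omega
      simp [RawRule.rhs]; refine ⟨?_, by omega⟩; omega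
    · intro R hR R' hR' h
      simp only [List.mem_cons, List.mem_flatMap, List.not_mem_nil, or_false] at hR hR'
      obtain ⟨t, -, rfl | rfl⟩ := hR <;> obtain ⟨t', -, rfl | rfl⟩ := hR' <;>
        simp only [RawRule.lhs] at h <;> omega
  · simp only [rulesC, List.pairwise_flatMap]
    refine ⟨fun k _ => ⟨fun t _ => by simp, pairwise_range fun t t' ht _ => ?_⟩,
      pairwise_range fun k k' hk _ => ?_⟩
    · simp [RawRule.rhs]; omega
    · intro R hR R' hR' h
      simp only [List.mem_cons, List.mem_flatMap, List.not_mem_nil, or_false] at hR hR'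
      obtain ⟨t, -, rfl⟩ := hR
      obtain ⟨t', -, rfl⟩ := hR'
      simp only [RawRule.lhs] at h
      omega
  · intro R hR R' hR' h
    have := lhsM R hR
    have := lhsC R' hR'
    omega
  · intro R hR R' hR' h
    have := lhsZ R hR
    rcases List.mem_append.1 hR' with hR' | hR'
    · have := lhsM R' hR'; omega
    · have := lhsC R' hR'; omega
  · intro R hR R' hR' h
    have := lhsX R hR
    simp only [List.mem_append] at hR'
    rcases hR' with hR' | hR' | hR'
    · have := lhsZ R' hR'; omega
    · have := lhsM R' hR'; omega
    · have := lhsC R' hR'; omega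
  · intro R hR R' hR' h
    have := lhsV R hR
    simp only [List.mem_append] at hR'
    rcases hR' with hR' | hR' | hR' | hR'
    · have := lhsX R' hR'; omega
    · have := lhsZ R' hR'; omega
    · have := lhsM R' hR'; omega
    · have := lhsC R' hR'; omega
  · intro R hR R' hR' h
    have := lhsS R hR
    simp only [List.mem_append] at hR'
    rcases hR' with hR' | hR' | hR' | hR' | hR'
    · have := lhsV R' hR'; omega
    · have := lhsX R' hR'; omega
    · have := lhsZ R' hR'; omega
    · have := lhsM R' hR'; omega
    · have := lhsC R' hR'; omega

/-- The stochastic grammar of the matrix. -/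
noncomputable def grammar : RawGrammar where
  numNT := I.offC + I.d4
  numT := 2 * I.d + 1
  rules := I.rules
  numNT_pos := Nat.add_pos_right _ I.d4_pos
  numT_pos := Nat.succ_pos _
  lhs_lt R hR := by
    have h1 : I.offM = 2 + 2 * I.d := rfl
    have h2 : I.offC = 2 + 2 * I.d + I.d4 := rfl
    rcases I.mem_rules.1 hR with (rfl | rfl | ⟨k, hk, rfl⟩) | ⟨y, hy, rfl⟩ | ⟨x, hx, rfl | rfl⟩ |
      ⟨z, hz, rfl | rfl⟩ | ⟨k, hk, t, ht, rfl | rfl⟩ | ⟨k, hk, r, hr, rfl⟩ <;>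
      simp only [RawRule.lhs] <;> omega
  fst_lt A x p hR := by
    rcases I.mem_rules.1 hR with (h | h | ⟨k, hk, h⟩) | ⟨y, hy, h⟩ | ⟨x, hx, h | h⟩ |
      ⟨z, hz, h | h⟩ | ⟨k, hk, t, ht, h | h⟩ | ⟨k, hk, r, hr, h⟩ <;> cases h <;> omega
  snd_lt A b c p hR := by
    have h1 : I.offM = 2 + 2 * I.d := rfl
    have h2 : I.offC = 2 + 2 * I.d + I.d4 := rfl
    rcases I.mem_rules.1 hR with (h | h | ⟨k, hk, h⟩) | ⟨y, hy, h⟩ | ⟨x, hx, h | h⟩ |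
      ⟨z, hz, h | h⟩ | ⟨k, hk, t, ht, h | h⟩ | ⟨k, hk, r, hr, h⟩ <;> cases h
    · omega
    · omega
    · omega
    · omega
    · have := I.div_lt ht
      have := I.mod_lt t
      omega
    · have := I.d2_le_d4
      omega
    · have := I.pair_lt (I.div_d2_lt hk) hr
      have := I.pair_lt hr (I.mod_d2_lt k)
      omega
  prob_pos R hR := by
    have hd2 : (0 : ℝ) < I.d2 := by exact_mod_cast I.d2_pos
    have hQ : (0 : ℝ) < I.Q := by exact_mod_cast I.Q_pos
    rcases I.mem_rules.1 hR with (rfl | rfl | ⟨k, hk, rfl⟩) | ⟨y, hy, rfl⟩ | ⟨x, hx, rfl | rfl⟩ |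
      ⟨z, hz, rfl | rfl⟩ | ⟨k, hk, t, ht, rfl | rfl⟩ | ⟨k, hk, r, hr, rfl⟩ <;>
      simp only [RawRule.prob] <;> try positivity
    · have : (I.entry k t : ℝ) < I.Q := by exact_mod_cast I.a_lt _ _
      exact div_pos (by linarith) (by positivity)
    · have : (0 : ℝ) < I.entry k t := by exact_mod_cast I.a_pos _ _
      positivity
  nodup := I.nodup_rules
  sum_prob A hA := I.sum_prob A hA

end MatrixInstance

end StochasticParsing

/-! ### Parses of segments and the min-plus product -/

namespace StochasticParsing

namespace RawGrammar

variable {G : RawGrammar}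

/-- There are no empty right-hand sides. Hence both halves of a binary production derive strictly
shorter words, which justifies the inductions on the length below. -/
theorem Yields.length_le {u : List (Symbol ℕ ℕ)} {q : ℝ} {w : List ℕ}
    (h : Yields G.HasProb u q w) : u.length ≤ w.length := by
  induction h with
  | nil => exact le_rfl
  | terminal _ ih => simpa using ih
  | nonterminal hr _ _ ih1 ih2 =>
    obtain ⟨R, -, rfl, -⟩ := hr
    have : 1 ≤ R.rule.output.length := by cases R <;> simp [RawRule.rule, RawRule.rhs]
    simp only [List.length_cons, List.length_append]
    omega

theorem Yields.exists_rule {A : ℕ} {q : ℝ} {w : List ℕ}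
    (h : Yields G.HasProb [.nonterminal A] q w) :
    ∃ R ∈ G.rules, R.lhs = A ∧ ∃ q', Yields G.HasProb R.rhs q' w ∧ q = R.prob * q' := by
  obtain ⟨r, p, q', ⟨R, hR, rfl, rfl⟩, h1, h2, rfl⟩ := h.of_single
  exact ⟨R, hR, h1, q', h2, rfl⟩

theorem yields_unit {A x : ℕ} {p : ℝ} (h : RawRule.unit A x p ∈ G.rules) :
    Yields G.HasProb [.nonterminal A] p [x] := by
  have h1 : G.HasProb (RawRule.unit A x p).rule p := ⟨_, h, rfl, rfl⟩
  have h2 : Yields G.HasProb (RawRule.unit A x p).rule.output 1 [x] := Yields.word [x]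
  have := Yields.single h1 h2
  rwa [mul_one] at this

theorem yields_bin {A b c : ℕ} {p q q' : ℝ} {w w' : List ℕ} (h : RawRule.bin A b c p ∈ G.rules)
    (hb : Yields G.HasProb [.nonterminal b] q w) (hc : Yields G.HasProb [.nonterminal c] q' w') :
    Yields G.HasProb [.nonterminal A] (p * (q * q')) (w ++ w') := by
  have h1 : G.HasProb (RawRule.bin A b c p).rule p := ⟨_, h, rfl, rfl⟩
  exact Yields.single h1 (hb.append hc)

end RawGrammar

theorem map_range'_eq {f : ℕ → ℕ} {s n a b : ℕ} {t : List ℕ}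
    (h : (List.range' s n).map f = a :: (t ++ [b])) :
    n = t.length + 2 ∧ f s = a ∧ f (s + n - 1) = b := by
  have hn : n = t.length + 2 := by simpa using congrArg List.length h
  refine ⟨hn, ?_, ?_⟩
  · rw [hn, List.range'_succ, List.map_cons] at h
    exact (List.cons.inj h).1
  · have h1 : n = (t.length + 1) + 1 := hn
    rw [h1, List.range'_concat, List.map_append, ← List.cons_append] at h
    have := List.append_inj_right' h (by simp)
    rw [h1]
    simpa using this

theorem mul_add_mod_eq {a b c : ℕ} (h : c < b) : (a * b + c) % b = c := by
  rw [Nat.mul_add_mod', Nat.mod_eq_of_lt h]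

namespace MatrixInstance

variable (I : MatrixInstance)

/-- The probability that a letter contributes to a parse. -/
noncomputable def step : ℝ := 1 / 2 * (1 / (2 * I.d + 1))

/-- The letters of the string that is parsed. -/
def letterAt (i : ℕ) : ℕ :=
  if i = 0 then 2 * I.d else if i ≤ I.d then i - 1 else if i ≤ 3 * I.d then
    (if (i - I.d - 1) % 2 = 0 then I.d + (i - I.d - 1) / 2 else (i - I.d - 1) / 2)
  else I.d + (i - 3 * I.d - 1)

theorem letterAt_lt {i : ℕ} (hi : i < 4 * I.d + 1) : I.letterAt i < 2 * I.d + 1 := by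
  have := I.d_pos
  unfold letterAt
  split_ifs <;> omega

theorem letterAt_lt' {i : ℕ} (hi : i < 4 * I.d + 1) (h0 : 0 < i) : I.letterAt i < 2 * I.d := by
  have := I.d_pos
  unfold letterAt
  split_ifs <;> omega

theorem letterAt_left {x : ℕ} (hx : x < I.d) : I.letterAt (1 + x) = x := by
  unfold letterAt
  split_ifs <;> omega

theorem letterAt_right (y : ℕ) : I.letterAt (3 * I.d + 1 + y) = I.d + y := by
  unfold letterAt
  split_ifs <;> omega

theorem letterAt_mid_left {z : ℕ} (hz : z < I.d) : I.letterAt (I.d + 1 + 2 * z) = I.d + z := by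
  unfold letterAt
  split_ifs <;> omega

theorem letterAt_mid_right {z : ℕ} (hz : z < I.d) : I.letterAt (I.d + 2 + 2 * z) = z := by
  unfold letterAt
  split_ifs <;> omega

/-- Only in the interleaved part of the text is a letter that is at least `d` followed by one below
`d`, and there the two belong to the same pair. This is what synchronises the middle indices of the
two factors. -/
theorem eq_of_letterAt {i z z' : ℕ} (hi : 0 < i) (hz : z < I.d) (hz' : z' < I.d)
    (h : I.letterAt i = I.d + z) (h' : I.letterAt (i + 1) = z') : z = z' := by
  unfold letterAt at h h'
  split_ifs at h h' <;> omega

local notation "𝒴" => Yields (RawGrammar.HasProb (MatrixInstance.grammar I))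

theorem yieldsV {q : ℝ} {w : List ℕ} (h : 𝒴 [.nonterminal 1] q w) :
    ∃ y, w = [y] ∧ q = 1 / (2 * I.d + 1) := by
  have hM : I.offM = 2 + 2 * I.d := rfl
  have hC : I.offC = 2 + 2 * I.d + I.d4 := rfl
  obtain ⟨R, hR, hA, q', hq', rfl⟩ := RawGrammar.Yields.exists_rule h
  rcases I.mem_rules.1 hR with (rfl | rfl | ⟨k, hk, rfl⟩) | ⟨y, hy, rfl⟩ | ⟨x, hx, rfl | rfl⟩ |
    ⟨z, hz, rfl | rfl⟩ | ⟨k, hk, t, ht, rfl | rfl⟩ | ⟨k, hk, r, hr, rfl⟩ <;>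
    simp only [RawRule.lhs] at hA <;> try omega
  obtain ⟨rfl, rfl⟩ := hq'.of_terminal
  exact ⟨y, rfl, by simp [RawRule.prob]⟩

/-- Every binary production of the start symbol keeps a start symbol in front, and the only way to
get rid of it is to turn it into the marker. -/
theorem yieldsS {n : ℕ} {q : ℝ} {w : List ℕ} (hn : w.length ≤ n) (h : 𝒴 [.nonterminal 0] q w) :
    2 * I.d ∈ w := by
  have hM : I.offM = 2 + 2 * I.d := rfl
  have hC : I.offC = 2 + 2 * I.d + I.d4 := rfl
  induction n generalizing q w with
  | zero =>
    have := RawGrammar.Yields.length_le h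
    simp at this; omega
  | succ n ih =>
    have bin : ∀ A q', 𝒴 [.nonterminal 0, .nonterminal A] q' w → 2 * I.d ∈ w := by
      intro A q' hq'
      obtain ⟨q₁, q₂, w₁, w₂, h1, h2, -, rfl⟩ := hq'.of_pair
      have := RawGrammar.Yields.length_le h2
      simp only [List.length_append, List.length_singleton] at hn this
      exact List.mem_append_left _ (ih (by omega) h1)
    obtain ⟨R, hR, hA, q', hq', rfl⟩ := RawGrammar.Yields.exists_rule h
    rcases I.mem_rules.1 hR with (rfl | rfl | ⟨k, hk, rfl⟩) | ⟨y, hy, rfl⟩ | ⟨x, hx, rfl | rfl⟩ |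
      ⟨z, hz, rfl | rfl⟩ | ⟨k, hk, t, ht, rfl | rfl⟩ | ⟨k, hk, r, hr, rfl⟩ <;>
      simp only [RawRule.lhs] at hA <;> try omega
    · obtain ⟨rfl, rfl⟩ := hq'.of_terminal
      simp
    · exact bin _ _ hq'
    · exact bin _ _ hq'

/-- The last letter comes from `V` and the rest from the same nonterminal again, so the length of
the word determines the probability of its parse. -/
theorem yieldsX {x : ℕ} (hx : x < I.d) {n : ℕ} {q : ℝ} {w : List ℕ} (hn : w.length ≤ n)
    (h : 𝒴 [.nonterminal (2 + x)] q w) :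
    ∃ w', w = x :: w' ∧ q = 1 / 2 * I.step ^ w'.length := by
  have hM : I.offM = 2 + 2 * I.d := rfl
  have hC : I.offC = 2 + 2 * I.d + I.d4 := rfl
  induction n generalizing q w with
  | zero =>
    have := RawGrammar.Yields.length_le h
    simp at this; omega
  | succ n ih =>
    obtain ⟨R, hR, hA, q', hq', rfl⟩ := RawGrammar.Yields.exists_rule h
    rcases I.mem_rules.1 hR with (rfl | rfl | ⟨k, hk, rfl⟩) | ⟨y, hy, rfl⟩ | ⟨x', hx, rfl | rfl⟩ |
      ⟨z, hz, rfl | rfl⟩ | ⟨k, hk, t, ht, rfl | rfl⟩ | ⟨k, hk, r, hr, rfl⟩ <;>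
      simp only [RawRule.lhs] at hA <;> try omega
    · obtain rfl : x' = x := by omega
      obtain ⟨rfl, rfl⟩ := hq'.of_terminal
      exact ⟨[], rfl, by simp [RawRule.prob]⟩
    · obtain rfl : x' = x := by omega
      obtain ⟨q₁, q₂, w₁, w₂, h1, h2, rfl, rfl⟩ := hq'.of_pair
      obtain ⟨y, rfl, rfl⟩ := I.yieldsV h2
      simp only [List.length_append, List.length_singleton] at hn
      obtain ⟨w', rfl, rfl⟩ := ih (by omega) h1
      refine ⟨w' ++ [y], rfl, ?_⟩
      simp only [RawRule.prob, List.length_append, List.length_singleton, pow_succ]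
      unfold step
      ring

theorem yieldsZ {z : ℕ} (hz : z < I.d) {n : ℕ} {q : ℝ} {w : List ℕ} (hn : w.length ≤ n)
    (h : 𝒴 [.nonterminal (2 + I.d + z)] q w) :
    ∃ w', w = w' ++ [I.d + z] ∧ q = 1 / 2 * I.step ^ w'.length := by
  have hM : I.offM = 2 + 2 * I.d := rfl
  have hC : I.offC = 2 + 2 * I.d + I.d4 := rfl
  induction n generalizing q w with
  | zero =>
    have := RawGrammar.Yields.length_le h
    simp at this; omega
  | succ n ih =>
    obtain ⟨R, hR, hA, q', hq', rfl⟩ := RawGrammar.Yields.exists_rule h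
    rcases I.mem_rules.1 hR with (rfl | rfl | ⟨k, hk, rfl⟩) | ⟨y, hy, rfl⟩ | ⟨x', hx, rfl | rfl⟩ |
      ⟨z', hz, rfl | rfl⟩ | ⟨k, hk, t, ht, rfl | rfl⟩ | ⟨k, hk, r, hr, rfl⟩ <;>
      simp only [RawRule.lhs] at hA <;> try omega
    · obtain rfl : z' = z := by omega
      obtain ⟨rfl, rfl⟩ := hq'.of_terminal
      exact ⟨[], rfl, by simp [RawRule.prob]⟩
    · obtain rfl : z' = z := by omega
      obtain ⟨q₁, q₂, w₁, w₂, h1, h2, rfl, rfl⟩ := hq'.of_pair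
      obtain ⟨y, rfl, rfl⟩ := I.yieldsV h1
      simp only [List.length_append, List.length_singleton] at hn
      obtain ⟨w', rfl, rfl⟩ := ih (by omega) h2
      refine ⟨y :: w', rfl, ?_⟩
      simp only [RawRule.prob, List.length_cons, pow_succ]
      unfold step
      ring

/-- A word without the marker excludes the companion productions, by `yieldsS`. The factor `1 / 4`
comes from the terminating productions of `X` and `Z`. -/
theorem yieldsM {k : ℕ} (hk : k < I.d4) {q : ℝ} {w : List ℕ} (hw : 2 * I.d ∉ w)
    (h : 𝒴 [.nonterminal (I.offM + k)] q w) :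
    ∃ x < I.d, ∃ z < I.d, ∃ w', w = x :: (w' ++ [I.d + z]) ∧
      q = ((I.Q : ℝ) - I.a (k / I.d2 * I.d + x) (k % I.d2 * I.d + z)) / (I.d2 * I.Q) *
        (1 / 4 * I.step ^ w'.length) := by
  have hM : I.offM = 2 + 2 * I.d := rfl
  have hC : I.offC = 2 + 2 * I.d + I.d4 := rfl
  obtain ⟨R, hR, hA, q', hq', rfl⟩ := RawGrammar.Yields.exists_rule h
  rcases I.mem_rules.1 hR with (rfl | rfl | ⟨k, hk, rfl⟩) | ⟨y, hy, rfl⟩ | ⟨x', hx, rfl | rfl⟩ |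
    ⟨z', hz, rfl | rfl⟩ | ⟨k', hk', t, ht, rfl | rfl⟩ | ⟨k, hk, r, hr, rfl⟩ <;>
    simp only [RawRule.lhs] at hA <;> try omega
  · obtain rfl : k' = k := by omega
    obtain ⟨q₁, q₂, w₁, w₂, h1, h2, rfl, rfl⟩ := hq'.of_pair
    obtain ⟨w', rfl, rfl⟩ := I.yieldsX (I.div_lt ht) le_rfl h1
    obtain ⟨w'', rfl, rfl⟩ := I.yieldsZ (I.mod_lt t) le_rfl h2
    refine ⟨t / I.d, I.div_lt ht, t % I.d, I.mod_lt t, w' ++ w'', by simp, ?_⟩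
    simp only [RawRule.prob, List.length_append, pow_add, entry]
    ring
  · obtain ⟨q₁, q₂, w₁, w₂, h1, h2, rfl, rfl⟩ := hq'.of_pair
    exact absurd (List.mem_append_right _ (I.yieldsS le_rfl h2)) hw

/-- The letters `z` and `x'` at the seam are still independent here; only the text makes them equal,
in `yields_segment_le`. -/
theorem yieldsC {k : ℕ} (hk : k < I.d4) {q : ℝ} {w : List ℕ} (hw : 2 * I.d ∉ w)
    (h : 𝒴 [.nonterminal (I.offC + k)] q w) :
    ∃ r < I.d2, ∃ x < I.d, ∃ z < I.d, ∃ x' < I.d, ∃ z' < I.d, ∃ w' w'',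
      w = (x :: (w' ++ [I.d + z])) ++ (x' :: (w'' ++ [I.d + z'])) ∧
      q = 1 / I.d2 * (1 / 16) / (I.d2 * I.Q) ^ 2 * I.step ^ (w'.length + w''.length) *
        (((I.Q : ℝ) - I.a (k / I.d2 * I.d + x) (r * I.d + z)) *
          (I.Q - I.a (r * I.d + x') (k % I.d2 * I.d + z'))) := by
  have hM : I.offM = 2 + 2 * I.d := rfl
  have hC : I.offC = 2 + 2 * I.d + I.d4 := rfl
  obtain ⟨R, hR, hA, q', hq', rfl⟩ := RawGrammar.Yields.exists_rule h
  rcases I.mem_rules.1 hR with (rfl | rfl | ⟨k, hk, rfl⟩) | ⟨y, hy, rfl⟩ | ⟨x', hx, rfl | rfl⟩ |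
    ⟨z', hz, rfl | rfl⟩ | ⟨k', hk', t, ht, rfl | rfl⟩ | ⟨k', hk', r, hr, rfl⟩ <;>
    simp only [RawRule.lhs] at hA <;> try omega
  obtain rfl : k' = k := by omega
  obtain ⟨q₁, q₂, w₁, w₂, h1, h2, rfl, rfl⟩ := hq'.of_pair
  rw [List.mem_append, not_or] at hw
  have hp := I.div_d2_lt hk
  have hq := I.mod_d2_lt k'
  obtain ⟨x, hx, z, hz, w', rfl, rfl⟩ := I.yieldsM (I.pair_lt hp hr) hw.1 h1
  obtain ⟨x', hx', z', hz', w'', rfl, rfl⟩ := I.yieldsM (I.pair_lt hr hq) hw.2 h2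
  refine ⟨r, hr, x, hx, z, hz, x', hx', z', hz', w', w'', rfl, ?_⟩
  have e1 : (k' / I.d2 * I.d2 + r) / I.d2 = k' / I.d2 := by
    rw [add_comm, Nat.add_mul_div_right _ _ I.d2_pos, Nat.div_eq_of_lt hr, zero_add]
  have e2 : (k' / I.d2 * I.d2 + r) % I.d2 = r := by
    rw [mul_add_mod_eq hr]
  have e3 : (r * I.d2 + k' % I.d2) / I.d2 = r := by
    rw [add_comm, Nat.add_mul_div_right _ _ I.d2_pos, Nat.div_eq_of_lt hq, zero_add]
  have e4 : (r * I.d2 + k' % I.d2) % I.d2 = k' % I.d2 := by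
    rw [mul_add_mod_eq hq]
  rw [e1, e2, e3, e4]
  simp only [RawRule.prob, pow_add]
  ring

theorem yieldsV_of_lt {y : ℕ} (hy : y < 2 * I.d + 1) :
    𝒴 [.nonterminal 1] (1 / (2 * I.d + 1)) [y] :=
  RawGrammar.yields_unit (I.mem_rules.2 (.inr (.inl ⟨y, hy, rfl⟩)))

theorem yieldsX_cons {x : ℕ} (hx : x < I.d) {w : List ℕ} (hw : ∀ y ∈ w, y < 2 * I.d + 1) :
    𝒴 [.nonterminal (2 + x)] (1 / 2 * I.step ^ w.length) (x :: w) := by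
  induction w using List.reverseRecOn with
  | nil =>
    simpa using RawGrammar.yields_unit (G := I.grammar)
      (I.mem_rules.2 (.inr (.inr (.inl ⟨x, hx, .inl rfl⟩))))
  | append_singleton w y ih =>
    have h1 := ih fun y hy => hw y (by simp [hy])
    have h2 := RawGrammar.yields_bin (G := I.grammar)
      (I.mem_rules.2 (.inr (.inr (.inl ⟨x, hx, .inr rfl⟩)))) h1 (I.yieldsV_of_lt (hw y (by simp)))
    rw [List.cons_append] at h2
    convert h2 using 1
    simp only [List.length_append, List.length_singleton, pow_succ]
    unfold step
    ring

theorem yieldsM_cons {k x z : ℕ} (hk : k < I.d4) (hx : x < I.d) (hz : z < I.d) {w : List ℕ}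
    (hw : ∀ y ∈ w, y < 2 * I.d + 1) :
    𝒴 [.nonterminal (I.offM + k)]
      (((I.Q : ℝ) - I.a (k / I.d2 * I.d + x) (k % I.d2 * I.d + z)) / (I.d2 * I.Q) *
        (1 / 4 * I.step ^ w.length)) (x :: (w ++ [I.d + z])) := by
  have h1 := I.yieldsX_cons hx hw
  have h2 := RawGrammar.yields_unit (G := I.grammar)
      (I.mem_rules.2 (.inr (.inr (.inr (.inl ⟨z, hz, .inl rfl⟩)))))
  have ht : x * I.d + z < I.d2 := by unfold d2; nlinarith
  have e1 : (x * I.d + z) / I.d = x := by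
    rw [add_comm, Nat.add_mul_div_right _ _ I.d_pos, Nat.div_eq_of_lt hz, zero_add]
  have e2 : (x * I.d + z) % I.d = z := by
    rw [mul_add_mod_eq hz]
  have h3 : RawRule.bin (I.offM + k) (2 + x) (2 + I.d + z)
      (((I.Q : ℝ) - I.a (k / I.d2 * I.d + x) (k % I.d2 * I.d + z)) / (I.d2 * I.Q)) ∈ I.rules := by
    -- The low parts `x` and `z` are coded as `t = x * d + z`.
    refine I.mem_rules.2 (.inr (.inr (.inr (.inr (.inl ⟨k, hk, x * I.d + z, ht, .inl ?_⟩)))))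
    simp only [entry, e1, e2]
  have := RawGrammar.yields_bin (G := I.grammar) h3 h1 h2
  rw [List.cons_append] at this
  convert this using 1
  ring

theorem yieldsC_cons {k r x z y : ℕ} (hk : k < I.d4) (hr : r < I.d2) (hx : x < I.d)
    (hz : z < I.d) (hy : y < I.d) {w w' : List ℕ} (hw : ∀ y ∈ w, y < 2 * I.d + 1)
    (hw' : ∀ y ∈ w', y < 2 * I.d + 1) :
    𝒴 [.nonterminal (I.offC + k)]
      (1 / I.d2 * (1 / 16) / (I.d2 * I.Q) ^ 2 * I.step ^ (w.length + w'.length) *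
        (((I.Q : ℝ) - I.a (k / I.d2 * I.d + x) (r * I.d + z)) *
          (I.Q - I.a (r * I.d + z) (k % I.d2 * I.d + y))))
      ((x :: (w ++ [I.d + z])) ++ (z :: (w' ++ [I.d + y]))) := by
  have hp := I.div_d2_lt hk
  have hq := I.mod_d2_lt k
  have h1 := I.yieldsM_cons (I.pair_lt hp hr) hx hz hw
  have h2 := I.yieldsM_cons (I.pair_lt hr hq) hz hy hw'
  have h3 : RawRule.bin (I.offC + k) (I.offM + (k / I.d2 * I.d2 + r))
      (I.offM + (r * I.d2 + k % I.d2)) (1 / I.d2) ∈ I.rules :=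
    I.mem_rules.2 (.inr (.inr (.inr (.inr (.inr ⟨k, hk, r, hr, rfl⟩)))))
  have := RawGrammar.yields_bin (G := I.grammar) h3 h1 h2
  convert this using 1
  have e1 : (k / I.d2 * I.d2 + r) / I.d2 = k / I.d2 := by
    rw [add_comm, Nat.add_mul_div_right _ _ I.d2_pos, Nat.div_eq_of_lt hr, zero_add]
  have e2 : (k / I.d2 * I.d2 + r) % I.d2 = r := by
    rw [mul_add_mod_eq hr]
  have e3 : (r * I.d2 + k % I.d2) / I.d2 = r := by
    rw [add_comm, Nat.add_mul_div_right _ _ I.d2_pos, Nat.div_eq_of_lt hq, zero_add]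
  have e4 : (r * I.d2 + k % I.d2) % I.d2 = k % I.d2 := by
    rw [mul_add_mod_eq hq]
  rw [e1, e2, e3, e4]
  simp only [pow_add]
  ring

/-- The string that is parsed. -/
def text : List ℕ := (List.range (4 * I.d + 1)).map I.letterAt

/-- The part of the text that stands for the row `x` and the column `y` within a block. -/
def segment (x y : ℕ) : List ℕ := (List.range' (1 + x) (3 * I.d + 1 + y - x)).map I.letterAt

/-- The factor by which the probability of a parse exceeds the product of two matrix entries. -/
noncomputable def scale (n : ℕ) : ℝ := 1 / I.d2 * (1 / 16) / (I.d2 * I.Q) ^ 2 * I.step ^ n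

theorem segment_lt {x y : ℕ} (hy : y < I.d) :
    ∀ c ∈ I.segment x y, c < 2 * I.d := by
  intro c hc
  simp only [segment, List.mem_map, List.mem_range'_1] at hc
  obtain ⟨i, hi, rfl⟩ := hc
  exact I.letterAt_lt' (by omega) (by omega)

/-- The segment is cut inside the pair `d + z, z` of the middle part. The exponent in `scale` is the
length of the segment less the four letters at the ends of the two pieces, and so does not depend on
the cut. -/
theorem yields_segment {k r x z y : ℕ} (hk : k < I.d4) (hr : r < I.d2) (hx : x < I.d)
    (hz : z < I.d) (hy : y < I.d) :
    𝒴 [.nonterminal (I.offC + k)] (I.scale (3 * I.d + y - x - 3) *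
        (((I.Q : ℝ) - I.a (k / I.d2 * I.d + x) (r * I.d + z)) *
          (I.Q - I.a (r * I.d + z) (k % I.d2 * I.d + y)))) (I.segment x y) := by
  have hd := I.d_pos
  set w := (List.range' (2 + x) (I.d + 2 * z - x - 1)).map I.letterAt with hw
  set w' := (List.range' (I.d + 3 + 2 * z) (2 * I.d + y - 2 * z - 2)).map I.letterAt with hw'
  have e : I.segment x y = (x :: (w ++ [I.d + z])) ++ (z :: (w' ++ [I.d + y])) := by
    have e1 : x :: (w ++ [I.d + z])
        = (List.range' (1 + x) (I.d + 2 * z - x + 1)).map I.letterAt := by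
      rw [List.range'_succ, List.map_cons, I.letterAt_left hx,
        show I.d + 2 * z - x = (I.d + 2 * z - x - 1) + 1 by omega, List.range'_concat,
        List.map_append, List.map_singleton, one_mul,
        show 1 + x + 1 + (I.d + 2 * z - x - 1) = I.d + 1 + 2 * z by omega,
        I.letterAt_mid_left hz, hw, show 1 + x + 1 = 2 + x by omega]
    have e2 : z :: (w' ++ [I.d + y])
        = (List.range' (I.d + 2 + 2 * z) (2 * I.d + y - 2 * z - 2 + 1 + 1)).map I.letterAt := by
      rw [List.range'_succ, List.map_cons, I.letterAt_mid_right hz, List.range'_concat,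
        List.map_append, List.map_singleton, one_mul,
        show I.d + 2 + 2 * z + 1 + (2 * I.d + y - 2 * z - 2) = 3 * I.d + 1 + y by omega,
        I.letterAt_right, hw', show I.d + 2 + 2 * z + 1 = I.d + 3 + 2 * z by omega]
    rw [e1, e2, ← List.map_append, segment,
      show I.d + 2 + 2 * z = 1 + x + 1 * (I.d + 2 * z - x + 1) by omega, List.range'_append]
    congr 2
    omega
  have h := I.yieldsC_cons hk hr hx hz hy (w := w) (w' := w')
    (fun c hc => (I.segment_lt hy c (by rw [e]; simp [hc])).trans (Nat.lt_succ_self _))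
    (fun c hc => (I.segment_lt hy c (by rw [e]; simp [hc])).trans (Nat.lt_succ_self _))
  rw [e]
  convert h using 2
  unfold scale
  congr 2
  simp only [hw, hw', List.length_map, List.length_range']
  omega

/-- The marker does not occur in a segment, so `yieldsC` applies. Comparing the end letters of the
two pieces with the text identifies `x` and `y` and, at the seam, `z` with `z'`. -/
theorem yields_segment_le {k x y : ℕ} (hk : k < I.d4) (hx : x < I.d) (hy : y < I.d) {q : ℝ}
    (h : 𝒴 [.nonterminal (I.offC + k)] q (I.segment x y)) :
    ∃ r < I.d2, ∃ z < I.d, q = I.scale (3 * I.d + y - x - 3) *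
      (((I.Q : ℝ) - I.a (k / I.d2 * I.d + x) (r * I.d + z)) *
        (I.Q - I.a (r * I.d + z) (k % I.d2 * I.d + y))) := by
  obtain ⟨r, hr, x₁, hx₁, z, hz, z', hz', y₁, hy₁, w', w'', hw, rfl⟩ :=
    I.yieldsC hk (fun hc => absurd (I.segment_lt hy _ hc) (lt_irrefl _)) h
  -- The lengths fix where the segment is cut, so each piece is a contiguous range of positions
  -- whose first and last letters can be read off.
  have hlen : 3 * I.d + 1 + y - x = (w'.length + 2) + (w''.length + 2) := by
    simpa [segment, add_assoc, add_comm, add_left_comm] using congrArg List.length hw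
  have hs : (List.range' (1 + x) (w'.length + 2)).map I.letterAt ++
      (List.range' (1 + x + 1 * (w'.length + 2)) (w''.length + 2)).map I.letterAt
      = (x₁ :: (w' ++ [I.d + z])) ++ (z' :: (w'' ++ [I.d + y₁])) := by
    rw [← List.map_append, List.range'_append, ← hlen]
    exact hw
  obtain ⟨h1, h2⟩ := List.append_inj hs (by simp)
  obtain ⟨-, e1, e2⟩ := map_range'_eq h1
  obtain ⟨-, e3, e4⟩ := map_range'_eq h2
  rw [I.letterAt_left hx] at e1
  have e5 : 1 + x + 1 * (w'.length + 2) + (w''.length + 2) - 1 = 3 * I.d + 1 + y := by omega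
  rw [e5, I.letterAt_right] at e4
  obtain rfl : x = x₁ := e1
  obtain rfl : y = y₁ := by omega
  obtain rfl : z = z' := by
    refine I.eq_of_letterAt (i := 1 + x + (w'.length + 2) - 1) (by omega) hz hz' e2 ?_
    rw [← e3]
    congr 1
    omega
  refine ⟨r, hr, z, hz, ?_⟩
  unfold scale
  rw [show 3 * I.d + y - x - 3 = w'.length + w''.length by omega]

theorem scale_pos (n : ℕ) : 0 < I.scale n := by
  have hd2 : (0 : ℝ) < I.d2 := by exact_mod_cast I.d2_pos
  have hQ : (0 : ℝ) < I.Q := by exact_mod_cast I.Q_pos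
  unfold scale step
  positivity

theorem text_lt : ∀ c ∈ I.text, c < I.grammar.numT := by
  intro c hc
  simp only [text, List.mem_map, List.mem_range] at hc
  obtain ⟨i, hi, rfl⟩ := hc
  exact I.letterAt_lt hi

/-- The parsed string, over the terminals of the grammar. -/
noncomputable def input : List (Fin I.grammar.numT) := I.text.map I.grammar.letter

theorem substring_input {x y : ℕ} (hx : x < I.d) (hy : y < I.d) :
    SCFG.substring I.input (1 + x) (3 * I.d + 2 + y) = (I.segment x y).map I.grammar.letter := by
  unfold SCFG.substring input text segment
  rw [← List.map_take, ← List.map_drop, ← List.map_take, ← List.map_drop,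
    List.take_range, List.range_eq_range', List.drop_range',
    Nat.min_eq_left (by omega)]
  congr 3
  · omega
  · omega

/-- The largest probability of a parse encodes the min-plus square of the matrix. -/
theorem isGreatest {k x y : ℕ} (hk : k < I.d4) (hx : x < I.d) (hy : y < I.d) {M : ℝ}
    (hM : ∀ l < I.D, ((I.Q : ℝ) - I.a (k / I.d2 * I.d + x) l) *
      (I.Q - I.a l (k % I.d2 * I.d + y)) ≤ M)
    (hM' : ∃ l < I.D, ((I.Q : ℝ) - I.a (k / I.d2 * I.d + x) l) *
      (I.Q - I.a l (k % I.d2 * I.d + y)) = M) :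
    IsGreatest (I.grammar.scfg.parseProbs (I.grammar.nt (I.offC + k))
      (SCFG.substring I.input (1 + x) (3 * I.d + 2 + y))) (I.scale (3 * I.d + y - x - 3) * M) := by
  have hmem : ∀ q, q ∈ I.grammar.scfg.parseProbs (I.grammar.nt (I.offC + k))
      (SCFG.substring I.input (1 + x) (3 * I.d + 2 + y)) ↔
      𝒴 [.nonterminal (I.offC + k)] q (I.segment x y) := by
    intro q
    rw [I.substring_input hx hy]
    exact I.grammar.mem_parseProbs (Nat.add_lt_add_left hk _)
      fun c hc => (I.segment_lt hy c hc).trans (Nat.lt_succ_self _)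
  constructor
  · obtain ⟨l, hl, rfl⟩ := hM'
    rw [hmem]
    -- The high part of the middle index selects the production of `C k`, the low part selects the
    -- cut.
    have := I.yields_segment hk (r := l / I.d) (z := l % I.d)
      (Nat.div_lt_of_lt_mul (by rw [mul_comm]; exact hl)) hx (I.mod_lt l) hy
    rwa [Nat.div_add_mod'] at this
  · intro q hq
    obtain ⟨r, hr, z, hz, rfl⟩ := I.yields_segment_le hk hx hy ((hmem q).1 hq)
    refine mul_le_mul_of_nonneg_left (hM _ ?_) (I.scale_pos _).le
    unfold D
    nlinarith

end MatrixInstance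

end StochasticParsing

/-! ### Reachability, consistency and size of the grammar -/

namespace StochasticParsing

namespace RawGrammar

variable {G : RawGrammar}

theorem _root_.StochasticParsing.Yields.derives {u : List (Symbol ℕ ℕ)} {q : ℝ} {w : List ℕ}
    (h : Yields G.HasProb u q w) : G.Derives u (w.map .terminal) := by
  induction h with
  | nil => exact .refl _
  | terminal _ ih => simpa using ih.context [.terminal _] []
  | @nonterminal r p q q' u w w' hr _ _ ih1 ih2 =>
    obtain ⟨R, hR, rfl, -⟩ := hr
    have h1 := ((derives_of_mem hR).trans ih1).context [] u
    have h2 := ih2.context (w.map .terminal) []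
    simp only [List.nil_append, List.append_nil, List.singleton_append] at h1 h2
    rw [List.map_append]
    exact h1.trans h2

/-- The nonterminal `A` occurs in a string derived from the start symbol. -/
def Reachable (G : RawGrammar) (A : ℕ) : Prop :=
  ∃ u v, G.Derives [.nonterminal 0] (u ++ [.nonterminal A] ++ v)

theorem Reachable.bin {A b c : ℕ} {p : ℝ} (h : G.Reachable A)
    (hR : RawRule.bin A b c p ∈ G.rules) : G.Reachable b ∧ G.Reachable c := by
  obtain ⟨u, v, h⟩ := h
  have h1 := h.trans ((derives_bin hR).context u v)
  refine ⟨⟨u, .nonterminal c :: v, ?_⟩, ⟨u ++ [.nonterminal b], v, ?_⟩⟩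
  · simpa using h1
  · simpa using h1

end RawGrammar

namespace MatrixInstance

variable (I : MatrixInstance)

theorem allReachable : I.grammar.scfg.AllReachable := by
  have hM : I.offM = 2 + 2 * I.d := rfl
  have hC : I.offC = 2 + 2 * I.d + I.d4 := rfl
  have hd := I.d_pos
  have r0 : I.grammar.Reachable 0 := ⟨[], [], .refl _⟩
  have r1 : I.grammar.Reachable 1 :=
    (r0.bin (I.mem_rules.2 (.inl (.inr (.inl rfl))))).2
  have rC : ∀ k < I.d4, I.grammar.Reachable (I.offC + k) := fun k hk =>
    (r0.bin (I.mem_rules.2 (.inl (.inr (.inr ⟨k, hk, rfl⟩))))).2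
  have rM : ∀ k < I.d4, I.grammar.Reachable (I.offM + k) := fun k hk => by
    -- With `r = k % d2` the left factor of the production of `C k` is `M k` itself.
    have := ((rC k hk).bin (I.mem_rules.2 (.inr (.inr (.inr (.inr (.inr
      ⟨k, hk, k % I.d2, I.mod_d2_lt k, rfl⟩))))))).1
    rwa [Nat.div_add_mod'] at this
  have rXZ : ∀ t < I.d2, I.grammar.Reachable (2 + t / I.d) ∧
      I.grammar.Reachable (2 + I.d + t % I.d) := fun t ht =>
    (rM 0 I.d4_pos).bin (I.mem_rules.2 (.inr (.inr (.inr (.inr (.inl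
      ⟨0, I.d4_pos, t, ht, .inl rfl⟩))))))
  have cases : ∀ A < I.grammar.numNT, A = 0 ∨ A = 1 ∨ (∃ x < I.d, A = 2 + x) ∨
      (∃ z < I.d, A = 2 + I.d + z) ∨ (∃ k < I.d4, A = I.offM + k) ∨
      ∃ k < I.d4, A = I.offC + k := by
    intro A hA
    have hA' : A < I.offC + I.d4 := hA
    by_cases h0 : A = 0
    · exact .inl h0
    by_cases h1 : A = 1
    · exact .inr (.inl h1)
    by_cases h2 : A < 2 + I.d
    · exact .inr (.inr (.inl ⟨A - 2, by omega, by omega⟩))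
    by_cases h3 : A < I.offM
    · exact .inr (.inr (.inr (.inl ⟨A - (2 + I.d), by omega, by omega⟩)))
    by_cases h4 : A < I.offC
    · exact .inr (.inr (.inr (.inr (.inl ⟨A - I.offM, by omega, by omega⟩))))
    · exact .inr (.inr (.inr (.inr (.inr ⟨A - I.offC, by omega, by omega⟩))))
  refine RawGrammar.allReachable ?_ ?_
  · intro A hA
    rcases cases A hA with rfl | rfl | ⟨x, hx, rfl⟩ | ⟨z, hz, rfl⟩ | ⟨k, hk, rfl⟩ | ⟨k, hk, rfl⟩
    · exact r0
    · exact r1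
    -- The values `t = x * d` and, in the next case, `t = z` give productions of `M 0` that contain
    -- the wanted nonterminal.
    · have := (rXZ (x * I.d) (by unfold d2; exact Nat.mul_lt_mul_of_pos_right hx hd)).1
      rwa [Nat.mul_div_cancel _ hd] at this
    · have := (rXZ z (hz.trans_le (by unfold d2; exact Nat.le_mul_self _))).2
      rwa [Nat.mod_eq_of_lt hz] at this
    · exact rM k hk
    · exact rC k hk
  · intro A hA
    rcases cases A hA with rfl | rfl | ⟨x, hx, rfl⟩ | ⟨z, hz, rfl⟩ | ⟨k, hk, rfl⟩ | ⟨k, hk, rfl⟩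
    · exact ⟨[2 * I.d], RawGrammar.derives_unit (I.mem_rules.2 (.inl (.inl rfl)))⟩
    · exact ⟨_, (I.yieldsV_of_lt (Nat.succ_pos _)).derives⟩
    · exact ⟨[x], RawGrammar.derives_unit (I.mem_rules.2
        (.inr (.inr (.inl ⟨x, hx, .inl rfl⟩))))⟩
    · exact ⟨[I.d + z], RawGrammar.derives_unit (I.mem_rules.2
        (.inr (.inr (.inr (.inl ⟨z, hz, .inl rfl⟩)))))⟩
    · exact ⟨_, (I.yieldsM_cons hk hd hd (w := []) (by simp)).derives⟩
    · exact ⟨_, (I.yieldsC_cons hk I.d2_pos hd hd hd (w := []) (w' := []) (by simp)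
        (by simp)).derives⟩

theorem derives_suffix {v : List ℕ} (hv : ∀ c ∈ v, c < 2 * I.d + 1) :
    I.grammar.Derives [.nonterminal 0] (.nonterminal 0 :: v.map .terminal) := by
  induction v using List.reverseRecOn with
  | nil => exact .refl _
  | append_singleton v y ih =>
    have h1 : I.grammar.Derives [.nonterminal 0] [.nonterminal 0, .nonterminal 1] :=
      RawGrammar.derives_bin (I.mem_rules.2 (.inl (.inr (.inl rfl))))
    have h2 := (I.yieldsV_of_lt (hv y (by simp))).derives.context [.nonterminal 0] []
    have h3 := (ih fun c hc => hv c (by simp [hc])).context [] [.terminal y]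
    simpa using (h1.trans h2).trans h3

/-- The text is produced from the right: first the letters of `v`, then `C k`, then the letters of
`u`, and finally the marker replaces the start symbol. -/
theorem derives_context {u v : List ℕ} (hu : ∀ c ∈ u, c < 2 * I.d + 1)
    (hv : ∀ c ∈ v, c < 2 * I.d + 1) {k : ℕ} (hk : k < I.d4) :
    I.grammar.Derives [.nonterminal 0] ((2 * I.d :: u).map .terminal ++
      [.nonterminal (I.offC + k)] ++ v.map .terminal) := by
  have h1 := I.derives_suffix hv
  have h2 : I.grammar.Derives [.nonterminal 0] [.nonterminal 0, .nonterminal (I.offC + k)] :=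
    RawGrammar.derives_bin (I.mem_rules.2 (.inl (.inr (.inr ⟨k, hk, rfl⟩))))
  have h3 := h2.context [] (v.map .terminal)
  have h4 := (I.derives_suffix hu).context [] (.nonterminal (I.offC + k) :: v.map .terminal)
  have h5 : I.grammar.Derives [.nonterminal 0] [.terminal (2 * I.d)] :=
    RawGrammar.derives_unit (I.mem_rules.2 (.inl (.inl rfl)))
  have h6 := h5.context [] (u.map .terminal ++ .nonterminal (I.offC + k) :: v.map .terminal)
  simp only [List.nil_append, List.cons_append] at h3 h4 h6
  simpa using ((h1.trans h3).trans h4).trans h6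

/-- A segment starts after position `0`, so the prefix before it contains the marker with which the
context begins. That `C k` derives the segment is shown by the parse with middle index `0`. -/
theorem consistentlyDerives {k x y : ℕ} (hk : k < I.d4) (hx : x < I.d) (hy : y < I.d) :
    I.grammar.scfg.ConsistentlyDerives I.input (I.grammar.nt (I.offC + k)) (1 + x)
      (3 * I.d + 2 + y) := by
  constructor
  · rw [I.substring_input hx hy]
    have h := (I.yields_segment hk I.d2_pos hx I.d_pos hy).derives
    unfold RawGrammar.Derives at h
    rw [RawGrammar.map_terminal_letter] at h
    exact h
  · have e1 : I.text.take (1 + x) = 2 * I.d :: (I.text.tail.take x) := by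
      have : I.text = 2 * I.d :: I.text.tail := by
        unfold text
        rw [List.range_succ_eq_map]
        simp [letterAt]
      conv_lhs => rw [this, add_comm, List.take_succ_cons]
    have h := I.derives_context (u := I.text.tail.take x) (v := I.text.drop (3 * I.d + 2 + y))
      (fun c hc => I.text_lt c (List.mem_of_mem_tail (List.mem_of_mem_take hc)))
      (fun c hc => I.text_lt c (List.mem_of_mem_drop hc)) hk
    rw [← e1] at h
    unfold RawGrammar.Derives at h
    rw [List.map_append, List.map_append, RawGrammar.map_terminal_letter,
      RawGrammar.map_terminal_letter, List.map_take, List.map_drop] at h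
    exact h

theorem length_rules : I.rules.length = 3 + I.d4 + 6 * I.d + 3 * (I.d4 * I.d2) := by
  have key : ∀ {α : Type} (n c : ℕ) (f : ℕ → List α), (∀ k, (f k).length = c) →
      ((List.range n).flatMap f).length = n * c := by
    intro α n c f hf
    rw [List.length_flatMap]
    simp [hf]
  simp only [rules, List.length_append]
  unfold rulesS rulesV rulesX rulesZ rulesM rulesC
  rw [List.length_append, key I.d4 1 _ (fun _ => rfl), key (2 * I.d + 1) 1 _ (fun _ => rfl),
    key I.d 2 _ (fun _ => rfl), key I.d 2 _ (fun _ => rfl),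
    key I.d4 (I.d2 * 2) _ (fun k => key I.d2 2 _ (fun _ => rfl)),
    key I.d4 (I.d2 * 1) _ (fun k => key I.d2 1 _ (fun _ => rfl))]
  simp only [List.length_cons, List.length_nil]
  ring

/-- Both sides are `d⁶`: the pairs `(k, t)` enumerate the entries of the matrix. So the grammar has
a size linear in the number of entries. -/
theorem D_sq : I.D * I.D = I.d4 * I.d2 := by
  unfold D d4 d2
  ring

theorem d_le_d2 : I.d ≤ I.d2 := Nat.le_mul_self _

theorem size_le : I.grammar.scfg.size ≤ 48 * (I.D * I.D) := by
  refine I.grammar.size_scfg_le.trans ?_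
  have h1 : I.grammar.rules.length = _ := I.length_rules
  have h2 : I.grammar.numNT = 2 + 2 * I.d + I.d4 + I.d4 := rfl
  have h3 : I.grammar.numT = 2 * I.d + 1 := rfl
  rw [h1, h2, h3, I.D_sq]
  have h4 : I.d4 ≤ I.d4 * I.d2 := Nat.le_mul_of_pos_right _ I.d2_pos
  have h5 := I.d2_le_d4
  have h6 := I.d_le_d2
  have h7 := I.d_pos
  omega

/-- The numerators `a` and `Q - a` are at least `1`, so no probability is below `1 / (3 * d4 * Q)`.
The logarithm of this polynomial quantity is what makes the parsing time depend only logarithmically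
on the weights. -/
theorem maxLog_le : I.grammar.scfg.maxLog ≤ Real.logb 2 (3 * I.d4 * I.Q) := by
  have hd : (1 : ℝ) ≤ I.d := by exact_mod_cast I.d_pos
  have hd2 : (I.d : ℝ) ≤ I.d2 := by exact_mod_cast I.d_le_d2
  have hd4 : (I.d2 : ℝ) ≤ I.d4 := by exact_mod_cast I.d2_le_d4
  have hQ : (1 : ℝ) ≤ I.Q := by exact_mod_cast I.Q_pos
  have hP : 3 * (I.d4 : ℝ) ≤ 3 * I.d4 * I.Q := le_mul_of_one_le_right (by linarith) hQ
  have pQ : (0 : ℝ) < I.Q := by linarith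
  have pd2 : (0 : ℝ) < I.d2 := by linarith
  refine I.grammar.maxLog_scfg_le (by linarith) fun R hR => ?_
  rcases I.mem_rules.1 hR with (rfl | rfl | ⟨k, hk, rfl⟩) | ⟨y, hy, rfl⟩ | ⟨x, hx, rfl | rfl⟩ |
    ⟨z, hz, rfl | rfl⟩ | ⟨k, hk, t, ht, rfl | rfl⟩ | ⟨k, hk, r, hr, rfl⟩ <;>
    simp only [RawRule.prob] <;> rw [div_mul_eq_mul_div, one_le_div (by positivity)] <;>
    try linarith
  · have h : (1 : ℝ) ≤ I.Q - I.entry k t := by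
      have h1 : I.entry k t + 1 ≤ I.Q := I.a_lt _ _
      have h2 : (I.entry k t : ℝ) + 1 ≤ I.Q := by exact_mod_cast h1
      linarith
    nlinarith [mul_nonneg (sub_nonneg.2 h) (by positivity : (0 : ℝ) ≤ 3 * I.d4 * I.Q)]
  · have h : (1 : ℝ) ≤ I.entry k t := by exact_mod_cast I.a_pos _ _
    nlinarith [mul_nonneg (sub_nonneg.2 h) (by positivity : (0 : ℝ) ≤ 3 * I.d4 * I.Q)]

theorem length_input : I.input.length = 4 * I.d + 1 := by
  simp [input, text]

/-- The form in which the text is written by the program, as opposed to the closed form `letterAt`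
that serves the analysis of positions. -/
theorem text_eq : I.text = [2 * I.d] ++ (((List.range I.d).flatMap fun x => [x]) ++
    (((List.range I.d).flatMap fun u => [I.d + u, u]) ++
      (List.range I.d).flatMap fun y => [I.d + y])) := by
  have hmid : ∀ n ≤ I.d, ((List.range (2 * n)).map fun j => I.letterAt (1 + (I.d + j)))
      = (List.range n).flatMap fun u => [I.d + u, u] := by
    intro n hn
    induction n with
    | zero => simp
    | succ n ih =>
      have e1 := I.letterAt_mid_left (z := n) hn
      have e2 := I.letterAt_mid_right (z := n) hn
      rw [show 2 * (n + 1) = 2 * n + 1 + 1 by ring, List.range_succ, List.range_succ,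
        List.map_append, List.map_append, ih (by omega), List.range_succ, List.flatMap_append]
      simp only [List.map_cons, List.map_nil, List.flatMap_cons, List.flatMap_nil,
        List.append_assoc]
      rw [show 1 + (I.d + 2 * n) = I.d + 1 + 2 * n by ring,
        show 1 + (I.d + (2 * n + 1)) = I.d + 2 + 2 * n by ring, e1, e2]
      rfl
  unfold text
  rw [show 4 * I.d + 1 = 1 + (I.d + (2 * I.d + I.d)) by ring, List.range_add, List.map_append,
    List.map_map, List.range_add, List.map_append, List.map_map, List.range_add, List.map_append,
    List.map_map]
  congr 1
  congr 1
  · rw [List.flatMap_singleton']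
    conv_rhs => rw [← List.map_id (List.range I.d)]
    refine List.map_congr_left fun x hx => ?_
    exact I.letterAt_left (List.mem_range.1 hx)
  congr 1
  · exact hmid I.d le_rfl
  · rw [← List.map_eq_flatMap]
    refine List.map_congr_left fun y _ => ?_
    simp only [Function.comp_apply]
    rw [show 1 + (I.d + (2 * I.d + y)) = 3 * I.d + 1 + y by ring]
    exact I.letterAt_right y

end MatrixInstance

end StochasticParsing

namespace StochasticParsing

/-! ## Writing the input of the parser -/

theorem Ex.eval_congr_low {e : Ex} {r : ℕ} (h : e.okAt r = true) {σ τ : State}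
    (hi : ∀ x, x < 30 → σ.int x = τ.int x) (ha : ∀ a, a < 8 → σ.intArr a = τ.intArr a) :
    e.eval σ = e.eval τ := by
  induction e generalizing r with
  | const c => rfl
  | reg x => simp [okAt] at h; exact hi x h.1
  | bin o e f he hf => simp [okAt] at h; simp [eval, he h.1, hf h.2]
  | get a e he => simp [okAt] at h; simp [eval, he h.2, ha a h.1]

/-- `P L` says that the list `L` has been written. Loops can be nested because the counters below
`x`, which belong to the enclosing loops, are preserved. The bound `b` on the final length is handed
to every iteration, to keep the positions within words. -/
theorem Run.forAppend {X : Extension} {B : ℕ} {β : ℤ} {σ : State} (hB : Ample β B) {α : Type}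
    (P : List α → State → Prop) {x : ℕ} {e : Ex} {p : Program X} {K N b : ℕ} {f : ℕ → List α}
    {L : List α} (hx : 22 ≤ x) (hx' : x < 30) (he : e.ok 31 = true) (hN : (N : ℤ) ≤ β)
    (hb : ∀ L τ, P L τ → Bounded β τ) (hc : ∀ L τ, P L τ → e.eval τ = N)
    (hs : ∀ L τ v, P L τ → |v| ≤ β → P L (τ.setInt x v)) (hσ : P L σ)
    (hlen : (L ++ (List.range N).flatMap f).length ≤ b)
    (hp : ∀ k < N, ∀ L' τ, P L' τ → τ.int x = k → (∀ y < x, 22 ≤ y → τ.int y = σ.int y) →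
      (L' ++ f k).length ≤ b → Run B p τ K fun υ => P (L' ++ f k) υ ∧
        ∀ y ≤ x, 22 ≤ y → υ.int y = τ.int y) :
    Run B (StochasticParsing.forLt x e p) σ ((N + 1) * (K + 400)) fun υ =>
      P (L ++ (List.range N).flatMap f) υ ∧ ∀ y < x, 22 ≤ y → υ.int y = σ.int y := by
  have hβ := hB.base
  have hle : ∀ k ≤ N, ((List.range k).flatMap f).length ≤ ((List.range N).flatMap f).length := by
    intro k hk
    obtain ⟨j, rfl⟩ := Nat.exists_eq_add_of_le hk
    rw [List.range_add, List.flatMap_append, List.length_append]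
    omega
  refine Run.forLt hB (fun k τ => P (L ++ (List.range k).flatMap f) τ ∧ τ.int x = k ∧
    ∀ y < x, 22 ≤ y → τ.int y = σ.int y) hx' he (hb _ _ hσ) ?_ ?_ ?_ ?_
  · refine ⟨by simpa using hs _ _ 0 hσ (by simp; omega), by simp [State.setInt],
      fun y hy _ => Function.update_of_ne hy.ne _ _⟩
  · rintro k hk τ ⟨h1, h2, h3⟩
    exact ⟨hb _ _ h1, hc _ _ h1, h2⟩
  · rintro k hk τ ⟨h1, h2, h3⟩
    have e1 : (List.range (k + 1)).flatMap f = (List.range k).flatMap f ++ f k := by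
      rw [List.range_succ, List.flatMap_append]
      simp
    refine (hp k hk _ τ h1 h2 h3 ?_).mono le_rfl ?_
    · have := hle (k + 1) hk
      rw [e1] at this
      simp only [List.length_append] at this hlen ⊢
      omega
    · rintro υ ⟨h4, h5⟩
      refine ⟨hb _ _ h4, by rw [h5 x le_rfl hx, h2], ?_, by simp [State.setInt], fun y hy hy' => ?_⟩
      · rw [e1, ← List.append_assoc]
        refine hs _ _ _ h4 ?_
        rw [abs_le]
        constructor <;> omega
      · rw [← h3 y hy hy', ← h5 y hy.le hy']
        exact Function.update_of_ne hy.ne _ _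
  · rintro τ ⟨h1, -, h3⟩
    exact ⟨h1, h3⟩

/-- The contents of an array in which a list is stored. -/
def cells {α β : Type} [Zero β] (l : List α) (f : α → β) (i : ℤ) : β :=
  if i < 0 then 0 else (l[i.toNat]?.map f).getD 0

theorem cells_append {α β : Type} [Zero β] (l : List α) (f : α → β) (x : α) :
    cells (l ++ [x]) f = Function.update (cells l f) l.length (f x) := by
  funext i
  unfold cells
  by_cases h : i = l.length
  · subst h
    simp
  · rw [Function.update_of_ne h]
    by_cases h0 : i < 0
    · simp [h0]
    · simp only [h0, if_false]
      by_cases h1 : i.toNat < l.length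
      · rw [List.getElem?_append_left h1]
      · rw [List.getElem?_eq_none (by simp; omega), List.getElem?_eq_none (by omega)]

def RawRule.len : RawRule → ℕ
  | unit _ _ _ => 1
  | bin _ _ _ _ => 2

/-- The arrays of words that hold a list of productions and a string. -/
def inputArr (L : List RawRule) (s : List ℕ) : ℕ → ℤ → ℤ
  | 0 => cells L fun R => (R.lhs : ℤ)
  | 1 => cells L fun R => (R.len : ℤ)
  | 2 => cells L fun R => (R.fst : ℤ)
  | 3 => cells L fun R => (R.snd : ℤ)
  | 4 => cells s fun x => (x : ℤ)
  | _ => fun _ => 0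

/-- The arrays of reals that hold the probabilities of a list of productions. -/
noncomputable def inputReal (L : List RawRule) : ℕ → ℤ → ℝ
  | 0 => cells L RawRule.prob
  | _ => fun _ => 0

/-- The productions `L` and the string `s` have been written to copy `c` of the memory, and
nothing else has changed since the state `F`. -/
structure Written (β : ℤ) (m c : ℕ) (F : State) (L : List RawRule) (s : List ℕ) (σ : State) :
    Prop where
  bounded : Bounded β σ
  int : ∀ x < 20, σ.int x = F.int x
  pos : σ.int 20 = L.length
  textPos : σ.int 21 = s.length
  intArr : ∀ a < 8, σ.intArr a = F.intArr a
  realArr : ∀ a < 8, σ.realArr a = F.realArr a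
  intCopy : ∀ (a : ℕ) (j : ℤ), j % m ≠ c → σ.intArr (8 + a) j = F.intArr (8 + a) j
  realCopy : ∀ (a : ℕ) (j : ℤ), j % m ≠ c → σ.realArr (8 + a) j = F.realArr (8 + a) j
  intCells : ∀ a i, σ.intArr (8 + a) (i * m + c) = inputArr L s a i
  realCells : ∀ a i, σ.realArr (8 + a) (i * m + c) = inputReal L a i

theorem Written.setInt {β : ℤ} {m c : ℕ} {F : State} {L : List RawRule} {s : List ℕ} {σ : State}
    (h : Written β m c F L s σ) {x : ℕ} (hx : 22 ≤ x) {v : ℤ} (hv : |v| ≤ β) :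
    Written β m c F L s (σ.setInt x v) := by
  have e : ∀ y < 22, (σ.setInt x v).int y = σ.int y :=
    fun y hy => Function.update_of_ne (by omega) _ _
  exact ⟨h.bounded.setInt hv, fun y hy => (e y (by omega)).trans (h.int y hy),
    (e 20 (by omega)).trans h.pos, (e 21 (by omega)).trans h.textPos, h.5, h.6, h.7, h.8, h.9, h.10⟩

/-- Append a production. -/
def emitRule (X : Extension) (A len x y : Ex) (p : RealEx) : Program X :=
  .seq (storeReal X 8 (.reg 20 * .reg 0 + .reg 15) p) <|
  .seq (store X 8 (.reg 20 * .reg 0 + .reg 15) A) <|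
  .seq (store X 9 (.reg 20 * .reg 0 + .reg 15) len) <|
  .seq (store X 10 (.reg 20 * .reg 0 + .reg 15) x) <|
  .seq (store X 11 (.reg 20 * .reg 0 + .reg 15) y) <|
  assign X 20 (.reg 20 + 1)

/-- Append a letter. -/
def emitLetter (X : Extension) (x : Ex) : Program X :=
  .seq (store X 12 (.reg 21 * .reg 0 + .reg 15) x) (assign X 21 (.reg 21 + 1))

theorem update_copy {α : Type} {m c : ℕ} (hc : c < m) (g : ℤ → α) (i n : ℤ) (v : α) :
    Function.update g (n * m + c) v (i * m + c)
      = Function.update (fun i => g (i * m + c)) n v i := by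
  by_cases h : i = n
  · subst h; simp
  · rw [Function.update_of_ne h, Function.update_of_ne (fun e => h (copy_injective hc e))]

section Emit

variable {X : Extension} {B : ℕ} {β : ℤ} {m c : ℕ} {F : State} {L : List RawRule} {s : List ℕ}
  {σ : State}

theorem Run.emitRule (hB : Ample β B) (hc : c < m) (hF0 : F.int 0 = m) (hF15 : F.int 15 = c)
    (h : Written β m c F L s σ) {A len x y : Ex} {p : RealEx} (hA : A.ok 31 = true)
    (hlen : len.ok 31 = true) (hx : x.ok 31 = true) (hy : y.ok 31 = true) (hp : p.ok 0 = true)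
    (R : RawRule) (eA : A.eval σ = R.lhs) (elen : len.eval σ = R.len) (ex : x.eval σ = R.fst)
    (ey : y.eval σ = R.snd) (ep : p.eval σ = R.prob) (hL : (L.length : ℤ) + 1 ≤ β)
    {Q : State → Prop} (hQ : ∀ τ, Written β m c F (L ++ [R]) s τ →
      (∀ z, 22 ≤ z → τ.int z = σ.int z) → Q τ) :
    Run B (emitRule X A len x y p) σ 1500 Q := by
  have ok1 : (Ex.reg 20 * Ex.reg 0 + Ex.reg 15).ok 30 = true := by decide
  have ok2 : (Ex.reg 20 + 1).ok 30 = true := by decide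
  have addr : ∀ τ : State, τ.int = σ.int → (Ex.reg 20 * Ex.reg 0 + Ex.reg 15).eval τ
      = L.length * m + c := by
    intro τ hτ
    simp only [Ex.eval_add, Ex.eval_mul, Ex.eval_reg, hτ, h.pos, h.int 0 (by norm_num), hF0,
      h.int 15 (by norm_num), hF15]
  have ev : ∀ e : Ex, e.ok 31 = true → ∀ τ : State, τ.int = σ.int →
      (∀ a < 8, τ.intArr a = σ.intArr a) → e.eval τ = e.eval σ := by
    intro e he τ h1 h2
    simp [Ex.ok] at he
    exact Ex.eval_congr_low he.1 (fun x _ => by rw [h1]) h2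
  let τ₀ := σ.setRealArr 8 (L.length * m + c) R.prob
  let τ₁ := τ₀.setIntArr 8 (L.length * m + c) R.lhs
  let τ₂ := τ₁.setIntArr 9 (L.length * m + c) R.len
  let τ₃ := τ₂.setIntArr 10 (L.length * m + c) R.fst
  let τ₄ := τ₃.setIntArr 11 (L.length * m + c) R.snd
  refine Run.mono (K := 350 + (250 + (250 + (250 + (250 + 130))))) ?_ (by norm_num) fun _ h => h
  refine Run.seq (Run.storeReal hB h.bounded ok1 hp ?_)
  rw [addr σ rfl, ep]
  refine Run.seq (Run.store hB h.bounded.setRealArr ok1 hA ?_)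
  have b1 := h.bounded.setRealArr (a := 8) (i := L.length * m + c) (v := R.prob)
  rw [addr τ₀ rfl, ev A hA τ₀ rfl (fun a _ => rfl), eA]
  have b2 := b1.setIntArr (a := 8) (i := L.length * m + c) (v := R.lhs) (.inr le_rfl)
  refine Run.seq (Run.store hB b2 ok1 hlen ?_)
  -- The stores go to arrays from `8` on, while the expressions read only arrays below `8`; so all
  -- of them still have their values in `σ`.
  have low : ∀ (τ : State) (a : ℕ) (i v : ℤ), 8 ≤ a → (∀ a' < 8, τ.intArr a' = σ.intArr a') →
      ∀ a' < 8, (τ.setIntArr a i v).intArr a' = σ.intArr a' := by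
    intro τ a i v ha hτ a' ha'
    rw [← hτ a' ha']
    exact Function.update_of_ne (by omega) _ _
  have l0 : ∀ a' < 8, (σ.setRealArr 8 (L.length * m + c) R.prob).intArr a' = σ.intArr a' :=
    fun _ _ => rfl
  have l1 := low _ 8 (L.length * m + c) R.lhs (by norm_num) l0
  rw [addr τ₁ rfl, ev len hlen τ₁ rfl l1, elen]
  have b3 := b2.setIntArr (a := 9) (i := L.length * m + c) (v := R.len) (.inr (by norm_num))
  refine Run.seq (Run.store hB b3 ok1 hx ?_)
  have l2 := low _ 9 (L.length * m + c) R.len (by norm_num) l1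
  rw [addr τ₂ rfl, ev x hx τ₂ rfl l2, ex]
  have b4 := b3.setIntArr (a := 10) (i := L.length * m + c) (v := R.fst) (.inr (by norm_num))
  refine Run.seq (Run.store hB b4 ok1 hy ?_)
  have l3 := low _ 10 (L.length * m + c) R.fst (by norm_num) l2
  rw [addr τ₃ rfl, ev y hy τ₃ rfl l3, ey]
  have b5 := b4.setIntArr (a := 11) (i := L.length * m + c) (v := R.snd) (.inr (by norm_num))
  have l4 := low _ 11 (L.length * m + c) R.snd (by norm_num) l3
  refine Run.assign hB b5 ok2 ?_
  have e20 : ∀ τ : State, τ.int = σ.int → (Ex.reg 20 + 1).eval τ = L.length + 1 := by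
    intro τ hτ
    simp [hτ, h.pos]
  rw [e20 τ₄ rfl]
  have ne : ∀ j : ℤ, j % m ≠ c → j ≠ L.length * m + c :=
    fun j hj e => hj (e ▸ Frame.emod_copy hc _)
  refine hQ _ ⟨b5.setInt ?_, fun z hz => ?_, ?_, ?_, fun a ha => ?_, fun a ha => ?_,
    fun a j hj => ?_, fun a j hj => ?_, fun a i => ?_, fun a i => ?_⟩ fun z hz => ?_
  · rw [abs_le]; constructor <;> omega
  · rw [← h.int z hz]; exact Function.update_of_ne (by omega) _ _
  · simp [State.setInt]
  · simpa [State.setInt, State.setIntArr, State.setRealArr] using h.textPos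
  · rw [← h.intArr a ha]; exact l4 a ha
  · rw [← h.realArr a ha]; exact Function.update_of_ne (by omega) _ _
  · rw [← h.intCopy a j hj]
    have := ne j hj
    match a with
    | 0 | 1 | 2 | 3 => simp [State.setInt, State.setIntArr, State.setRealArr, this]
    | a + 4 =>
      simp [State.setInt, State.setIntArr, State.setRealArr,
        Function.update_of_ne (show 8 + (a + 4) ≠ 9 by omega),
        Function.update_of_ne (show 8 + (a + 4) ≠ 10 by omega),
        Function.update_of_ne (show 8 + (a + 4) ≠ 11 by omega)]
  · rw [← h.realCopy a j hj]
    have := ne j hj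
    match a with
    | 0 => simp [State.setInt, State.setIntArr, State.setRealArr, this]
    | a + 1 =>
      simp [State.setInt, State.setIntArr, State.setRealArr]
  · have hi := h.intCells a
    match a with
    | 0 | 1 | 2 | 3 =>
      simp only [inputArr] at hi ⊢
      simp [State.setInt, State.setIntArr, State.setRealArr, cells_append, update_copy hc, hi]
    | a + 4 =>
      have : inputArr (L ++ [R]) s (a + 4) i = inputArr L s (a + 4) i := by
        cases a <;> rfl
      rw [this, ← hi]
      simp [State.setInt, State.setIntArr, State.setRealArr,
        Function.update_of_ne (show 8 + (a + 4) ≠ 9 by omega),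
        Function.update_of_ne (show 8 + (a + 4) ≠ 10 by omega),
        Function.update_of_ne (show 8 + (a + 4) ≠ 11 by omega)]
  · have hi := h.realCells a
    match a with
    | 0 =>
      simp only [inputReal] at hi ⊢
      simp [State.setInt, State.setIntArr, State.setRealArr, cells_append, update_copy hc, hi]
    | a + 1 =>
      rw [show inputReal (L ++ [R]) (a + 1) i = inputReal L (a + 1) i from rfl, ← hi]
      simp [State.setInt, State.setIntArr, State.setRealArr]
  · exact Function.update_of_ne (by omega) _ _

theorem Run.emitLetter (hB : Ample β B) (hc : c < m) (hF0 : F.int 0 = m) (hF15 : F.int 15 = c)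
    (h : Written β m c F L s σ) {x : Ex} (hx : x.ok 31 = true) (y : ℕ) (ex : x.eval σ = y)
    (hs : (s.length : ℤ) + 1 ≤ β) {Q : State → Prop}
    (hQ : ∀ τ, Written β m c F L (s ++ [y]) τ → (∀ z, 22 ≤ z → τ.int z = σ.int z) → Q τ) :
    Run B (emitLetter X x) σ 400 Q := by
  have ok1 : (Ex.reg 21 * Ex.reg 0 + Ex.reg 15).ok 30 = true := by decide
  have ok2 : (Ex.reg 21 + 1).ok 30 = true := by decide
  have addr : (Ex.reg 21 * Ex.reg 0 + Ex.reg 15).eval σ = s.length * m + c := by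
    simp only [Ex.eval_add, Ex.eval_mul, Ex.eval_reg, h.textPos, h.int 0 (by norm_num), hF0,
      h.int 15 (by norm_num), hF15]
  refine Run.mono (K := 250 + 130) ?_ (by norm_num) fun _ h => h
  refine Run.seq (Run.store hB h.bounded ok1 hx ?_)
  rw [addr, ex]
  have b1 := h.bounded.setIntArr (a := 12) (i := s.length * m + c) (v := y) (.inr (by norm_num))
  refine Run.assign hB b1 ok2 ?_
  have e21 : (Ex.reg 21 + 1).eval (σ.setIntArr 12 (s.length * m + c) y) = s.length + 1 := by
    simp [State.setIntArr, h.textPos]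
  rw [e21]
  refine hQ _ ⟨b1.setInt ?_, fun z hz => ?_, ?_, ?_, fun a ha => ?_, h.6, fun a j hj => ?_,
    h.8, fun a i => ?_, h.10⟩ fun z hz => ?_
  · rw [abs_le]; constructor <;> linarith [hB.base]
  · rw [← h.int z hz]; exact Function.update_of_ne (by omega) _ _
  · simpa [State.setInt, State.setIntArr] using h.pos
  · simp [State.setInt]
  · rw [← h.intArr a ha]; exact Function.update_of_ne (by omega) _ _
  · rw [← h.intCopy a j hj]
    have : j ≠ s.length * m + c := fun e => hj (e ▸ Frame.emod_copy hc _)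
    by_cases ha : a = 4
    · subst ha; simp [State.setInt, State.setIntArr, this]
    · simp [State.setInt, State.setIntArr, Function.update_of_ne (show 8 + a ≠ 12 by omega)]
  · have hi := h.intCells a
    by_cases ha : a = 4
    · subst ha
      simp only [inputArr] at hi ⊢
      simp [State.setInt, State.setIntArr, cells_append, update_copy hc, hi]
    · have : inputArr L (s ++ [y]) a i = inputArr L s a i := by
        unfold inputArr
        split <;> first | rfl | omega
      rw [this, ← hi]
      simp [State.setInt, State.setIntArr, Function.update_of_ne (show 8 + a ≠ 12 by omega)]
  · exact Function.update_of_ne (by omega) _ _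

end Emit

end StochasticParsing

/-! ### Emission of the grammar of a matrix and of its string -/

namespace StochasticParsing

namespace MatrixInstance

/-- The state `F` holds the parameters of the grammar and the matrix. -/
structure Prepared (I : MatrixInstance) (β : ℤ) (m c : ℕ) (F : State) : Prop where
  int0 : F.int 0 = m
  int1 : F.int 1 = I.d
  int2 : F.int 2 = I.d2
  int3 : F.int 3 = I.d4
  int4 : F.int 4 = I.D
  int6 : F.int 6 = I.Q
  int15 : F.int 15 = c
  matrix : ∀ i < I.D, ∀ j < I.D, F.intArr 4 (i * I.D + j) = I.a i j
  copy_lt : c < m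
  length_le : (I.rules.length : ℤ) + I.text.length + 1 ≤ β

end MatrixInstance

def emitS (X : Extension) : Program X :=
  .seq (emitRule X 0 1 (2 * .reg 1) 0 (.div (.cast 1) (.cast (.reg 3 + 2)))) <|
  .seq (emitRule X 0 2 0 1 (.div (.cast 1) (.cast (.reg 3 + 2)))) <|
  forLt 22 (.reg 3) <|
    emitRule X 0 2 0 (2 + 2 * .reg 1 + .reg 3 + .reg 22) (.div (.cast 1) (.cast (.reg 3 + 2)))

def emitV (X : Extension) : Program X :=
  forLt 22 (2 * .reg 1 + 1) <|
    emitRule X 1 1 (.reg 22) 0 (.div (.cast 1) (.cast (2 * .reg 1 + 1)))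

def emitX (X : Extension) : Program X :=
  forLt 22 (.reg 1) <|
    .seq (emitRule X (2 + .reg 22) 1 (.reg 22) 0 (.div (.cast 1) (.cast 2)))
      (emitRule X (2 + .reg 22) 2 (2 + .reg 22) 1 (.div (.cast 1) (.cast 2)))

def emitZ (X : Extension) : Program X :=
  forLt 22 (.reg 1) <|
    .seq (emitRule X (2 + .reg 1 + .reg 22) 1 (.reg 1 + .reg 22) 0 (.div (.cast 1) (.cast 2)))
      (emitRule X (2 + .reg 1 + .reg 22) 2 1 (2 + .reg 1 + .reg 22) (.div (.cast 1) (.cast 2)))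

/-- The entry for production number `23` (a register) of matrix nonterminal number `22`. -/
def entryEx : Ex :=
  .get 4 ((.reg 22 / .reg 2 * .reg 1 + .reg 23 / .reg 1) * .reg 4 +
    (.reg 22 % .reg 2 * .reg 1 + .reg 23 % .reg 1))

def emitM (X : Extension) : Program X :=
  forLt 22 (.reg 3) <| forLt 23 (.reg 2) <|
    .seq (emitRule X (2 + 2 * .reg 1 + .reg 22) 2 (2 + .reg 23 / .reg 1)
        (2 + .reg 1 + .reg 23 % .reg 1)
        (.div (.cast (.reg 6 - entryEx)) (.cast (.reg 2 * .reg 6))))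
      (emitRule X (2 + 2 * .reg 1 + .reg 22) 2 (.reg 23) 0
        (.div (.cast entryEx) (.cast (.reg 2 * .reg 6))))

def emitC (X : Extension) : Program X :=
  forLt 22 (.reg 3) <| forLt 23 (.reg 2) <|
    emitRule X (2 + 2 * .reg 1 + .reg 3 + .reg 22) 2
      (2 + 2 * .reg 1 + (.reg 22 / .reg 2 * .reg 2 + .reg 23))
      (2 + 2 * .reg 1 + (.reg 23 * .reg 2 + .reg 22 % .reg 2))
      (.div (.cast 1) (.cast (.reg 2)))

def emitText (X : Extension) : Program X :=
  .seq (emitLetter X (2 * .reg 1)) <|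
  .seq (forLt 22 (.reg 1) (emitLetter X (.reg 22))) <|
  .seq (forLt 22 (.reg 1) (.seq (emitLetter X (.reg 1 + .reg 22)) (emitLetter X (.reg 22)))) <|
  forLt 22 (.reg 1) (emitLetter X (.reg 1 + .reg 22))

section Emit

variable {X : Extension} {B : ℕ} {β : ℤ} {m c : ℕ} {F : State} {L : List RawRule} {s : List ℕ}
  {σ : State} {I : MatrixInstance}

theorem Run.emitRule_keep (hB : Ample β B) (hF : I.Prepared β m c F)
    (h : Written β m c F L s σ) {A len x y : Ex} {p : RealEx} (hA : A.ok 31 = true)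
    (hlen : len.ok 31 = true) (hx : x.ok 31 = true) (hy : y.ok 31 = true) (hp : p.ok 0 = true)
    (R : RawRule) (hL : (L ++ [R]).length ≤ I.rules.length) (eA : A.eval σ = R.lhs)
    (elen : len.eval σ = R.len) (ex : x.eval σ = R.fst)
    (ey : y.eval σ = R.snd) (ep : p.eval σ = R.prob)  :
    Run B (StochasticParsing.emitRule X A len x y p) σ 1500 fun τ => Written β m c F (L ++ [R]) s τ ∧
      ∀ z, 22 ≤ z → τ.int z = σ.int z := by
  refine Run.emitRule hB hF.copy_lt hF.int0 hF.int15 h hA hlen hx hy hp R eA elen ex ey ep ?_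
    fun τ hτ hz => ⟨hτ, hz⟩
  have := hF.length_le
  simp at hL
  omega

theorem Run.emitLetter_keep (hB : Ample β B) (hF : I.Prepared β m c F)
    (h : Written β m c F L s σ) {x : Ex} (hx : x.ok 31 = true) (y : ℕ)
    (hs : (s ++ [y]).length ≤ I.text.length) (ex : x.eval σ = y) :
    Run B (StochasticParsing.emitLetter X x) σ 400 fun τ => Written β m c F L (s ++ [y]) τ ∧
      ∀ z, 22 ≤ z → τ.int z = σ.int z := by
  refine Run.emitLetter hB hF.copy_lt hF.int0 hF.int15 h hx y ex ?_ fun τ hτ hz => ⟨hτ, hz⟩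
  have := hF.length_le
  simp at hs
  omega

theorem MatrixInstance.Prepared.d4_le (hF : I.Prepared β m c F) : (I.d4 : ℤ) ≤ β := by
  have := hF.length_le
  rw [I.length_rules] at this
  push_cast at this
  have : (0 : ℤ) ≤ I.d4 * I.d2 := by positivity
  omega

theorem MatrixInstance.Prepared.d2_le (hF : I.Prepared β m c F) : (I.d2 : ℤ) ≤ β := by
  have := hF.d4_le
  have := I.d2_le_d4
  omega

theorem MatrixInstance.Prepared.d_le (hF : I.Prepared β m c F) : (I.d : ℤ) ≤ β := by
  have := hF.d2_le
  have := I.d_le_d2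
  omega

/-- The matrix is only known to be in memory for indices below `D`; the bounds on `k` and `t` place
the recombined high and low parts there. -/
theorem MatrixInstance.Prepared.eval_entry (hF : I.Prepared β m c F) (h : Written β m c F L s σ)
    {k t : ℕ} (hk : k < I.d4) (ht : t < I.d2) (e22 : σ.int 22 = k) (e23 : σ.int 23 = t) :
    entryEx.eval σ = I.entry k t := by
  have h1 : k / I.d2 * I.d + t / I.d < I.D := by
    have := I.div_d2_lt hk
    have := I.div_lt ht
    unfold MatrixInstance.D
    nlinarith
  have h2 : k % I.d2 * I.d + t % I.d < I.D := by
    have := I.mod_d2_lt k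
    have := I.mod_lt t
    unfold MatrixInstance.D
    nlinarith
  have := hF.matrix _ h1 _ h2
  unfold MatrixInstance.entry
  rw [← this]
  simp [entryEx, e22, e23, h.int, h.intArr, hF.int1, hF.int2, hF.int4]

theorem Run.emitS (hB : Ample β B) (hF : I.Prepared β m c F) (h : Written β m c F L s σ)
    (hL : (L ++ I.rulesS).length ≤ I.rules.length) :
    Run B (StochasticParsing.emitS X) σ (3000 + (I.d4 + 1) * 1900) (Written β m c F (L ++ I.rulesS) s) := by
  unfold MatrixInstance.rulesS at hL ⊢
  rw [← List.append_assoc] at hL ⊢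
  have hl := List.length_append ▸ hL
  simp only [List.length_append, List.length_cons, List.length_nil] at hl
  refine Run.mono (K := 1500 + (1500 + (I.d4 + 1) * 1900)) ?_ (by omega) fun _ h => h
  refine Run.seq ((Run.emitRule_keep hB hF h (by decide) (by decide) (by decide) (by decide)
    (by decide) (.unit 0 (2 * I.d) (1 / (I.d4 + 2))) (by simp; omega) ?_ ?_ ?_ ?_ ?_).mono
      le_rfl ?_)
  iterate 5
    simp [RawRule.lhs, RawRule.len, RawRule.fst, RawRule.snd, RawRule.prob, RealEx.eval, h.int,
      hF.int1, hF.int3]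
  rintro τ ⟨h1, -⟩
  refine Run.seq ((Run.emitRule_keep hB hF h1 (by decide) (by decide) (by decide) (by decide)
    (by decide) (.bin 0 0 1 (1 / (I.d4 + 2))) (by simp; omega) ?_ ?_ ?_ ?_ ?_).mono le_rfl ?_)
  iterate 5
    simp [RawRule.lhs, RawRule.len, RawRule.fst, RawRule.snd, RawRule.prob, RealEx.eval, h1.int,
      hF.int3]
  rintro τ ⟨h2, -⟩
  rw [List.append_assoc] at h2
  refine (Run.forAppend hB (fun L τ => Written β m c F L s τ) le_rfl (by norm_num) (by decide)
    hF.d4_le (fun _ _ h => h.bounded) (fun _ _ h => ?_) (fun _ _ _ h hv => h.setInt le_rfl hv) h2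
    hL (K := 1500) fun k hk L' τ h3 hτ _ hL' => ?_).mono le_rfl fun _ h => h.1
  · simp [h.int, hF.int3]
  refine (Run.emitRule_keep hB hF h3 (by decide) (by decide) (by decide) (by decide)
    (by decide) (.bin 0 0 (I.offC + k) (1 / (I.d4 + 2))) hL' ?_ ?_ ?_ ?_ ?_).mono le_rfl
      fun _ h => ⟨h.1, fun y _ hy => h.2 y hy⟩
  iterate 5
    simp [RawRule.lhs, RawRule.len, RawRule.fst, RawRule.snd, RawRule.prob, RealEx.eval, h3.int,
      hF.int1, hF.int3, hτ, MatrixInstance.offC]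

theorem Run.emitV (hB : Ample β B) (hF : I.Prepared β m c F) (h : Written β m c F L s σ)
    (hL : (L ++ I.rulesV).length ≤ I.rules.length) :
    Run B (StochasticParsing.emitV X) σ ((2 * I.d + 2) * 1900) (Written β m c F (L ++ I.rulesV) s) := by
  have hN : ((2 * I.d + 1 : ℕ) : ℤ) ≤ β := by
    have := hF.length_le
    rw [I.length_rules] at this
    push_cast at this ⊢
    have : (0 : ℤ) ≤ I.d4 * I.d2 := by positivity
    omega
  refine (Run.forAppend hB (fun L τ => Written β m c F L s τ) le_rfl (by norm_num) (by decide)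
    hN (fun _ _ h => h.bounded) (fun _ _ h => ?_) (fun _ _ _ h hv => h.setInt le_rfl hv) h
    hL (K := 1500) fun k hk L' τ h3 hτ _ hL' => ?_).mono le_rfl fun _ h => h.1
  · simp [h.int, hF.int1]
  refine (Run.emitRule_keep hB hF h3 (by decide) (by decide) (by decide) (by decide)
    (by decide) (.unit 1 k (1 / (2 * I.d + 1))) hL' ?_ ?_ ?_ ?_ ?_).mono le_rfl
      fun _ h => ⟨h.1, fun y _ hy => h.2 y hy⟩
  iterate 5
    simp [RawRule.lhs, RawRule.len, RawRule.fst, RawRule.snd, RawRule.prob, RealEx.eval, h3.int,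
      hF.int1, hτ]

theorem Run.emitX (hB : Ample β B) (hF : I.Prepared β m c F) (h : Written β m c F L s σ)
    (hL : (L ++ I.rulesX).length ≤ I.rules.length) :
    Run B (StochasticParsing.emitX X) σ ((I.d + 1) * 3400) (Written β m c F (L ++ I.rulesX) s) := by
  refine (Run.forAppend hB (fun L τ => Written β m c F L s τ) le_rfl (by norm_num) (by decide)
    hF.d_le (fun _ _ h => h.bounded) (fun _ _ h => ?_) (fun _ _ _ h hv => h.setInt le_rfl hv) h
    hL (K := 1500 + 1500) fun k hk L' τ h3 hτ _ hL' => ?_).mono le_rfl fun _ h => h.1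
  · simp [h.int, hF.int1]
  rw [← List.singleton_append, ← List.append_assoc] at hL' ⊢
  refine Run.seq ((Run.emitRule_keep hB hF h3 (by decide) (by decide) (by decide) (by decide)
    (by decide) (.unit (2 + k) k (1 / 2)) (by simp at hL' ⊢; omega) ?_ ?_ ?_ ?_ ?_).mono le_rfl ?_)
  iterate 5
    simp [RawRule.lhs, RawRule.len, RawRule.fst, RawRule.snd, RawRule.prob, RealEx.eval, hτ]
  rintro υ ⟨h4, h5⟩
  have hυ := (h5 22 le_rfl).trans hτ
  refine (Run.emitRule_keep hB hF h4 (by decide) (by decide) (by decide) (by decide)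
    (by decide) (.bin (2 + k) (2 + k) 1 (1 / 2)) hL' ?_ ?_ ?_ ?_ ?_).mono le_rfl
      fun _ h => ⟨h.1, fun y _ hy => (h.2 y hy).trans (h5 y hy)⟩
  iterate 5
    simp [RawRule.lhs, RawRule.len, RawRule.fst, RawRule.snd, RawRule.prob, RealEx.eval, hυ]

theorem Run.emitZ (hB : Ample β B) (hF : I.Prepared β m c F) (h : Written β m c F L s σ)
    (hL : (L ++ I.rulesZ).length ≤ I.rules.length) :
    Run B (StochasticParsing.emitZ X) σ ((I.d + 1) * 3400) (Written β m c F (L ++ I.rulesZ) s) := by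
  refine (Run.forAppend hB (fun L τ => Written β m c F L s τ) le_rfl (by norm_num) (by decide)
    hF.d_le (fun _ _ h => h.bounded) (fun _ _ h => ?_) (fun _ _ _ h hv => h.setInt le_rfl hv) h
    hL (K := 1500 + 1500) fun k hk L' τ h3 hτ _ hL' => ?_).mono le_rfl fun _ h => h.1
  · simp [h.int, hF.int1]
  rw [← List.singleton_append, ← List.append_assoc] at hL' ⊢
  refine Run.seq ((Run.emitRule_keep hB hF h3 (by decide) (by decide) (by decide) (by decide)
    (by decide) (.unit (2 + I.d + k) (I.d + k) (1 / 2)) (by simp at hL' ⊢; omega)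
      ?_ ?_ ?_ ?_ ?_).mono le_rfl ?_)
  iterate 5
    simp [RawRule.lhs, RawRule.len, RawRule.fst, RawRule.snd, RawRule.prob, RealEx.eval, h3.int,
      hF.int1, hτ]
  rintro υ ⟨h4, h5⟩
  have hυ := (h5 22 le_rfl).trans hτ
  refine (Run.emitRule_keep hB hF h4 (by decide) (by decide) (by decide) (by decide)
    (by decide) (.bin (2 + I.d + k) 1 (2 + I.d + k) (1 / 2)) hL' ?_ ?_ ?_ ?_ ?_).mono le_rfl
      fun _ h => ⟨h.1, fun y _ hy => (h.2 y hy).trans (h5 y hy)⟩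
  iterate 5
    simp [RawRule.lhs, RawRule.len, RawRule.fst, RawRule.snd, RawRule.prob, RealEx.eval, h4.int,
      hF.int1, hυ]

theorem Run.emitM (hB : Ample β B) (hF : I.Prepared β m c F) (h : Written β m c F L s σ)
    (hL : (L ++ I.rulesM).length ≤ I.rules.length) :
    Run B (StochasticParsing.emitM X) σ ((I.d4 + 1) * ((I.d2 + 1) * 3400 + 400))
      (Written β m c F (L ++ I.rulesM) s) := by
  refine (Run.forAppend hB (fun L τ => Written β m c F L s τ) le_rfl (by norm_num) (by decide)
    hF.d4_le (fun _ _ h => h.bounded) (fun _ _ h => ?_) (fun _ _ _ h hv => h.setInt le_rfl hv) h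
    hL fun k hk L' τ h3 hτ _ hL' => ?_).mono le_rfl fun _ h => h.1
  · simp [h.int, hF.int3]
  refine (Run.forAppend hB (fun L τ => Written β m c F L s τ) (by norm_num) (by norm_num)
    (by decide) hF.d2_le (fun _ _ h => h.bounded) (fun _ _ h => ?_)
    (fun _ _ _ h hv => h.setInt (by norm_num) hv) h3 hL' (K := 1500 + 1500)
    fun t ht L₂ υ h4 hυ h22 hL₂ => ?_).mono le_rfl
      fun _ h => ⟨h.1, fun y hy hy' => h.2 y (by omega) hy'⟩
  · simp [h.int, hF.int2]
  have h22' := (h22 22 (by norm_num) le_rfl).trans hτ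
  have he := hF.eval_entry h4 hk ht h22' hυ
  rw [← List.singleton_append, ← List.append_assoc] at hL₂ ⊢
  refine Run.seq ((Run.emitRule_keep hB hF h4 (by decide) (by decide) (by decide) (by decide)
    (by decide) (.bin (I.offM + k) (2 + t / I.d) (2 + I.d + t % I.d)
      (((I.Q : ℝ) - I.entry k t) / (I.d2 * I.Q))) (by simp at hL₂ ⊢; omega)
      ?_ ?_ ?_ ?_ ?_).mono le_rfl ?_)
  iterate 5
    simp [RawRule.lhs, RawRule.len, RawRule.fst, RawRule.snd, RawRule.prob, RealEx.eval, h4.int,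
      hF.int1, hF.int2, hF.int6, hυ, h22', he, MatrixInstance.offM]
  rintro ω ⟨h5, h6⟩
  have e22 := (h6 22 le_rfl).trans h22'
  have e23 := (h6 23 (by norm_num)).trans hυ
  have he := hF.eval_entry h5 hk ht e22 e23
  refine (Run.emitRule_keep hB hF h5 (by decide) (by decide) (by decide) (by decide)
    (by decide) (.bin (I.offM + k) t 0 ((I.entry k t : ℝ) / (I.d2 * I.Q))) hL₂
      ?_ ?_ ?_ ?_ ?_).mono le_rfl
      fun _ h => ⟨h.1, fun y _ hy => (h.2 y hy).trans (h6 y hy)⟩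
  iterate 5
    simp [RawRule.lhs, RawRule.len, RawRule.fst, RawRule.snd, RawRule.prob, RealEx.eval, h5.int,
      hF.int1, hF.int2, hF.int6, e22, e23, he, MatrixInstance.offM]

theorem Run.emitC (hB : Ample β B) (hF : I.Prepared β m c F) (h : Written β m c F L s σ)
    (hL : (L ++ I.rulesC).length ≤ I.rules.length) :
    Run B (StochasticParsing.emitC X) σ ((I.d4 + 1) * ((I.d2 + 1) * 1900 + 400))
      (Written β m c F (L ++ I.rulesC) s) := by
  refine (Run.forAppend hB (fun L τ => Written β m c F L s τ) le_rfl (by norm_num) (by decide)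
    hF.d4_le (fun _ _ h => h.bounded) (fun _ _ h => ?_) (fun _ _ _ h hv => h.setInt le_rfl hv) h
    hL fun k hk L' τ h3 hτ _ hL' => ?_).mono le_rfl fun _ h => h.1
  · simp [h.int, hF.int3]
  refine (Run.forAppend hB (fun L τ => Written β m c F L s τ) (by norm_num) (by norm_num)
    (by decide) hF.d2_le (fun _ _ h => h.bounded) (fun _ _ h => ?_)
    (fun _ _ _ h hv => h.setInt (by norm_num) hv) h3 hL' (K := 1500)
    fun t ht L₂ υ h4 hυ h22 hL₂ => ?_).mono le_rfl
      fun _ h => ⟨h.1, fun y hy hy' => h.2 y (by omega) hy'⟩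
  · simp [h.int, hF.int2]
  have h22' := (h22 22 (by norm_num) le_rfl).trans hτ
  refine (Run.emitRule_keep hB hF h4 (by decide) (by decide) (by decide) (by decide)
    (by decide) (.bin (I.offC + k) (I.offM + (k / I.d2 * I.d2 + t)) (I.offM + (t * I.d2 + k % I.d2))
      (1 / I.d2)) hL₂ ?_ ?_ ?_ ?_ ?_).mono le_rfl
      fun _ h => ⟨h.1, fun y _ hy => h.2 y hy⟩
  iterate 5
    simp [RawRule.lhs, RawRule.len, RawRule.fst, RawRule.snd, RawRule.prob, RealEx.eval, h4.int,
      hF.int1, hF.int2, hF.int3, hυ, h22', MatrixInstance.offM, MatrixInstance.offC]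

theorem Run.emitText (hB : Ample β B) (hF : I.Prepared β m c F) (h : Written β m c F L [] σ) :
    Run B (StochasticParsing.emitText X) σ (3000 * (I.d + 1)) (Written β m c F L I.text) := by
  have int1 : ∀ s τ, Written β m c F L s τ → (Ex.reg 1).eval τ = I.d := by
    intro s τ h
    simp [h.int, hF.int1]
  have hlen : I.text.length = 4 * I.d + 1 := by simp [MatrixInstance.text]
  have len1 : ∀ f : ℕ → ℕ, ((List.range I.d).flatMap fun x => [f x]).length = I.d := by
    intro f
    rw [List.length_flatMap]
    simp
  have len2 : ((List.range I.d).flatMap fun x => [I.d + x, x]).length = 2 * I.d := by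
    rw [List.length_flatMap]
    simp [mul_comm]
  have e := I.text_eq
  rw [← List.append_assoc, ← List.append_assoc, ← List.nil_append (α := ℕ) [2 * I.d]] at e
  rw [e]
  refine Run.mono (K := 400 + ((I.d + 1) * (400 + 400) + ((I.d + 1) * (800 + 400) +
    (I.d + 1) * (400 + 400)))) ?_ (by have := I.d_pos; ring_nf; omega) fun _ h => h
  refine Run.seq ((Run.emitLetter_keep hB hF h (by decide) (2 * I.d) (by rw [hlen]; simp)
    (by simp [h.int, hF.int1])).mono le_rfl ?_)
  rintro τ ⟨h1, -⟩
  refine Run.seq ((Run.forAppend hB (fun s τ => Written β m c F L s τ) le_rfl (by norm_num)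
    (by decide) hF.d_le (fun _ _ h => h.bounded) int1 (fun _ _ _ h hv => h.setInt le_rfl hv) h1
    (f := fun x => [x]) (b := I.text.length)
    (by rw [List.length_append, len1 fun x => x, hlen]; simp; omega)
    fun k hk L' τ h3 hτ _ hL' => ?_).mono le_rfl ?_)
  · exact (Run.emitLetter_keep hB hF h3 (by decide) k hL' (by simp [hτ])).mono le_rfl
      fun _ h => ⟨h.1, fun y _ hy => h.2 y hy⟩
  rintro τ ⟨h1, -⟩
  refine Run.seq ((Run.forAppend hB (fun s τ => Written β m c F L s τ) le_rfl (by norm_num)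
    (by decide) hF.d_le (fun _ _ h => h.bounded) int1 (fun _ _ _ h hv => h.setInt le_rfl hv) h1
    (f := fun x => [I.d + x, x]) (b := I.text.length)
    (by rw [List.length_append, List.length_append, len1 fun x => x, len2, hlen]; simp; omega)
    (K := 400 + 400)
    fun k hk L' τ h3 hτ _ hL' => ?_).mono le_rfl ?_)
  · rw [← List.singleton_append, ← List.append_assoc] at hL' ⊢
    refine Run.seq ((Run.emitLetter_keep hB hF h3 (by decide) (I.d + k)
      (by rw [List.length_append] at hL'; omega) (by simp [hτ, h3.int, hF.int1])).mono le_rfl ?_)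
    rintro υ ⟨h4, h5⟩
    refine (Run.emitLetter_keep hB hF h4 (by decide) k hL'
      (by simp [(h5 22 le_rfl).trans hτ])).mono le_rfl
      fun _ h => ⟨h.1, fun y _ hy => (h.2 y hy).trans (h5 y hy)⟩
  rintro τ ⟨h1, -⟩
  refine (Run.forAppend hB (fun s τ => Written β m c F L s τ) le_rfl (by norm_num)
    (by decide) hF.d_le (fun _ _ h => h.bounded) int1 (fun _ _ _ h hv => h.setInt le_rfl hv) h1
    (f := fun x => [I.d + x]) (b := I.text.length) (by rw [← e])
    fun k hk L' τ h3 hτ _ hL' => ?_).mono le_rfl fun _ h => h.1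
  exact (Run.emitLetter_keep hB hF h3 (by decide) (I.d + k) hL'
    (by simp [hτ, h3.int, hF.int1])).mono le_rfl fun _ h => ⟨h.1, fun y _ hy => h.2 y hy⟩

end Emit

/-- Write the grammar and the string to a fresh copy of the memory. -/
def emitInput (X : Extension) : Program X :=
  .seq (assign X 20 0) <| .seq (assign X 21 0) <|
  .seq (emitS X) <| .seq (emitV X) <| .seq (emitX X) <| .seq (emitZ X) <| .seq (emitM X) <|
  .seq (emitC X) (emitText X)

/-- Nothing has been written to copy `c` of the memory. -/
structure Fresh (m c : ℕ) (F : State) : Prop where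
  int : ∀ (a : ℕ) (i : ℤ), F.intArr (8 + a) (i * m + c) = 0
  real : ∀ (a : ℕ) (i : ℤ), F.realArr (8 + a) (i * m + c) = 0

section Emit

variable {X : Extension} {B : ℕ} {β : ℤ} {m c : ℕ} {F : State} {I : MatrixInstance}

theorem Run.emitInput (hB : Ample β B) (hF : I.Prepared β m c F) (hβ : Bounded β F)
    (hf : Fresh m c F) :
    Run B (StochasticParsing.emitInput X) F (100000 * (I.D * I.D)) (Written β m c F I.rules I.text) := by
  -- The zeros of a fresh copy are exactly the image of the empty lists.
  have h0 : Written β m c F [] [] ((F.setInt 20 0).setInt 21 0) := by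
    have b := hB.base
    refine ⟨(hβ.setInt (by simp; omega)).setInt (by simp; omega), fun x hx => ?_, ?_, ?_,
      fun _ _ => rfl, fun _ _ => rfl, fun _ _ _ => rfl, fun _ _ _ => rfl, fun a i => ?_,
      fun a i => ?_⟩
    · simp [State.setInt, Function.update_of_ne (show x ≠ 20 by omega),
        Function.update_of_ne (show x ≠ 21 by omega)]
    · simp [State.setInt]
    · simp [State.setInt]
    · refine (hf.int a i).trans ?_
      unfold inputArr
      split <;> simp [cells]
    · refine (hf.real a i).trans ?_
      unfold inputReal
      split <;> simp [cells]
  have K : 130 + (130 + ((3000 + (I.d4 + 1) * 1900) + ((2 * I.d + 2) * 1900 + ((I.d + 1) * 3400 +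
      ((I.d + 1) * 3400 + ((I.d4 + 1) * ((I.d2 + 1) * 3400 + 400) +
      ((I.d4 + 1) * ((I.d2 + 1) * 1900 + 400) + 3000 * (I.d + 1)))))))) ≤
      100000 * (I.D * I.D) := by
    rw [I.D_sq]
    have h1 := I.d_le_d2
    have h2 := I.d2_le_d4
    have h3 := I.d_pos
    have h4 : I.d4 ≤ I.d4 * I.d2 := Nat.le_mul_of_pos_right _ I.d2_pos
    ring_nf at h4 ⊢
    omega
  refine Run.mono ?_ K fun _ h => h
  refine Run.seq (Run.assign hB hβ (by decide) (Run.seq (Run.assign hB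
    (hβ.setInt (by have := hB.base; simp; omega)) (by decide) ?_)))
  have l : ∀ {A A' : List RawRule}, A ++ A' = I.rules → A.length ≤ I.rules.length := by
    intro A A' h
    rw [← h]
    simp
  refine Run.seq ((Run.emitS hB hF h0 ?_).mono le_rfl fun τ h => ?_)
  · exact l rfl
  refine Run.seq ((Run.emitV hB hF h ?_).mono le_rfl fun τ h => ?_)
  · exact l (A' := I.rulesX ++ (I.rulesZ ++ (I.rulesM ++ I.rulesC)))
      (by simp [MatrixInstance.rules])
  refine Run.seq ((Run.emitX hB hF h ?_).mono le_rfl fun τ h => ?_)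
  · exact l (A' := I.rulesZ ++ (I.rulesM ++ I.rulesC)) (by simp [MatrixInstance.rules])
  refine Run.seq ((Run.emitZ hB hF h ?_).mono le_rfl fun τ h => ?_)
  · exact l (A' := I.rulesM ++ I.rulesC) (by simp [MatrixInstance.rules])
  refine Run.seq ((Run.emitM hB hF h ?_).mono le_rfl fun τ h => ?_)
  · exact l (A' := I.rulesC) (by simp [MatrixInstance.rules])
  refine Run.seq ((Run.emitC hB hF h ?_).mono le_rfl fun τ h => ?_)
  · exact l (A' := []) (by simp [MatrixInstance.rules])
  have e : (((((([] ++ I.rulesS) ++ I.rulesV) ++ I.rulesX) ++ I.rulesZ) ++ I.rulesM) ++ I.rulesC)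
      = I.rules := by simp [MatrixInstance.rules]
  rw [e] at h
  exact Run.emitText hB hF h

theorem Written.setReal {L : List RawRule} {s : List ℕ} {σ : State} (h : Written β m c F L s σ)
    (x : ℕ) (v : ℝ) : Written β m c F L s (σ.setReal x v) :=
  ⟨h.1, h.2, h.3, h.4, h.5, h.6, h.7, h.8, h.9, h.10⟩

end Emit

/-- Clear the registers of a relocated program. -/
def clearRegs (X : Extension) : ℕ → Program X
  | 0 => .skip
  | b + 1 => .seq (clearRegs X b) (.seq (.intConst (64 + b) 0) (.realCast (64 + b) (64 + b)))

theorem Run.clearRegs {X : Extension} {B : ℕ} {β : ℤ} {m c : ℕ} {F σ : State} {L : List RawRule}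
    {s : List ℕ} (h : Written β m c F L s σ) (hβ : 0 ≤ β) (b : ℕ) :
    Run B (StochasticParsing.clearRegs X b) σ (2 * b + 1) fun τ => Written β m c F L s τ ∧
      ∀ x < b, τ.int (64 + x) = 0 ∧ τ.real (64 + x) = 0 := by
  induction b with
  | zero => exact Run.skip ⟨h, by simp⟩
  | succ b ih =>
    refine Run.mono (K := 2 * b + 1 + 2) (Run.seq (ih.mono le_rfl ?_)) (by omega) fun _ h => h
    rintro τ ⟨h1, h2⟩ τ₁ hE
    refine ⟨_, 2, le_rfl, (Exec.intConst τ₁ (64 + b) 0 (by simp)).seq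
      (Exec.realCast _ (64 + b) (64 + b)), (τ.setInt (64 + b) 0).setReal (64 + b) 0, ?_,
      (h1.setInt (by omega) (by simpa using hβ)).setReal _ _, fun x hx => ?_⟩
    · have := hE.setInt (64 + b) 0
      refine ⟨this.1, fun x hx => ?_, this.2.2⟩
      by_cases e : x = 64 + b
      · subst e; simp [State.setReal, State.setInt]
      · simpa [State.setReal, Function.update_of_ne e] using this.2.1 x hx
    · by_cases e : x = b
      · subst e; simp [State.setReal, State.setInt]
      · have := h2 x (by omega)
        simpa [State.setReal, State.setInt, e] using this

namespace RawGrammar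

variable (G : RawGrammar)

/-- What the program writes for the numbered productions is literally the input that the parser
expects for the `Fin`-typed grammar, with the productions in the order of `ruleList`. -/
theorem intArr_input {s : List ℕ} (hs : ∀ x ∈ s, x < G.numT) (a : ℕ) (i : ℤ) :
    (G.scfg.input G.ruleList (s.map G.letter)).intArr a i = inputArr G.rules s a i := by
  have key : ∀ (f : ContextFreeRule (Fin G.numT) (Fin G.numNT) → ℤ) (g : RawRule → ℤ),
      (∀ R ∈ G.rules, f (G.finRule R) = g R) → ∀ n : ℕ,
      (G.ruleList[n]?.map f).getD 0 = (G.rules[n]?.map g).getD 0 := by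
    intro f g h n
    rw [ruleList, List.getElem?_map, Option.map_map]
    cases e : G.rules[n]? with
    | none => rfl
    | some R => simp [h R (List.mem_of_getElem? e)]
  by_cases hi : i < 0
  · unfold SCFG.input inputArr
    simp only [hi, if_true]
    split <;> simp [cells, hi]
  match a with
  | 0 =>
    simp only [SCFG.input, inputArr, cells, hi, if_false]
    exact key _ _ (fun R hR => by rw [G.val_finRule_input hR]) _
  | 1 =>
    simp only [SCFG.input, inputArr, cells, hi, if_false]
    exact key _ _ (fun R hR => by cases R <;> rfl) _
  | 2 =>
    simp only [SCFG.input, inputArr, cells, hi, if_false]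
    refine key _ _ (fun R hR => ?_) _
    cases R with
    | unit A x p => exact congrArg Nat.cast (G.val_letter (G.fst_lt A x p hR))
    | bin A x y p => exact congrArg Nat.cast (G.val_nt (G.snd_lt A x y p hR).1)
  | 3 =>
    simp only [SCFG.input, inputArr, cells, hi, if_false]
    refine key _ _ (fun R hR => ?_) _
    cases R with
    | unit A x p => rfl
    | bin A x y p => exact congrArg Nat.cast (G.val_nt (G.snd_lt A x y p hR).2)
  | 4 =>
    simp only [SCFG.input, inputArr, cells, hi, if_false]
    rw [List.getElem?_map]
    cases e : s[i.toNat]? with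
    | none => rfl
    | some x => simp [G.val_letter (hs x (List.mem_of_getElem? e))]
  | a + 5 => simp [SCFG.input, inputArr]

theorem realArr_input (s : List (Fin G.numT)) (a : ℕ) (i : ℤ) :
    (G.scfg.input G.ruleList s).realArr a i = inputReal G.rules a i := by
  by_cases hi : i < 0
  · unfold SCFG.input inputReal
    simp only [hi, if_true]
    split <;> simp [cells, hi]
  match a with
  | 0 =>
    simp only [SCFG.input, inputReal, cells, hi, if_false]
    rw [ruleList, List.getElem?_map, Option.map_map]
    cases e : G.rules[i.toNat]? with
    | none => rfl
    | some R => simp [G.probOf_finRule (List.mem_of_getElem? e)]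
  | a + 1 => simp [SCFG.input, inputReal]

theorem abs_cells_le {α : Type} {l : List α} {f : α → ℤ} {B : ℤ} (hB : 0 ≤ B)
    (h : ∀ x ∈ l, |f x| ≤ B) (i : ℤ) : |cells l f i| ≤ B := by
  unfold cells
  split
  · simpa using hB
  · cases e : l[i.toNat]? with
    | none => simpa using hB
    | some x => simpa using h x (List.mem_of_getElem? e)

theorem abs_inputArr_le {s : List ℕ} (hs : ∀ x ∈ s, x < G.numT) {B : ℕ}
    (hB : G.numNT + G.numT + 2 ≤ B) (a : ℕ) (i : ℤ) : |inputArr G.rules s a i| ≤ B := by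
  unfold inputArr
  split
  · refine abs_cells_le (by omega) (fun R hR => ?_) i
    have := G.lhs_lt R hR
    rw [Nat.abs_cast]; omega
  · refine abs_cells_le (by omega) (fun R hR => ?_) i
    cases R <;> simp [RawRule.len] <;> omega
  · refine abs_cells_le (by omega) (fun R hR => ?_) i
    rw [Nat.abs_cast]
    cases R with
    | unit A x p => have := G.fst_lt A x p hR; simp [RawRule.fst]; omega
    | bin A x y p => have := G.snd_lt A x y p hR; simp [RawRule.fst]; omega
  · refine abs_cells_le (by omega) (fun R hR => ?_) i
    rw [Nat.abs_cast]
    cases R with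
    | unit A x p => simp [RawRule.snd]
    | bin A x y p => have := G.snd_lt A x y p hR; simp [RawRule.snd]; omega
  · refine abs_cells_le (by omega) (fun x hx => ?_) i
    have := hs x hx
    rw [Nat.abs_cast]; omega
  · simp

end RawGrammar

/-- Set up the registers of the parser, which uses registers below `b`. -/
def setupRegs (X : Extension) (b : ℕ) : Program X :=
  .seq (clearRegs X b) <| .seq (assign X 64 (2 + 2 * .reg 1 + .reg 3 + .reg 3)) <|
  .seq (assign X 65 (2 * .reg 1 + 1)) <| .seq (assign X 66 0) <| .seq (assign X 67 (.reg 20)) <|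
  assign X 68 (.reg 21)

/-- The registers left over from an earlier call are cleared first, since the parser may rely on
zeros; the arrays need no clearing because the copy is fresh. -/
theorem Run.setupRegs {X : Extension} {B B' : ℕ} {β : ℤ} {m c : ℕ} {F σ : State}
    {I : MatrixInstance} (hB : Ample β B) (hF : I.Prepared β m c F)
    (h : Written β m c F I.rules I.text σ) (b : ℕ)
    (hB' : I.grammar.numNT + I.grammar.numT + I.rules.length + I.text.length + 2 ≤ B') :
    Run B (StochasticParsing.setupRegs X b) σ (2 * b + 1000) fun τ => Written β m c F I.rules I.text τ ∧
      Simulates b B' m c τ (I.grammar.scfg.input I.grammar.ruleList I.input) := by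
  have hβ := hB.base
  have hl := hF.length_le
  have e1 : I.grammar.numNT = 2 + 2 * I.d + I.d4 + I.d4 := rfl
  have e2 : I.grammar.numT = 2 * I.d + 1 := rfl
  have hlr := I.length_rules
  have hlt : I.text.length = 4 * I.d + 1 := by simp [MatrixInstance.text]
  have h42 : I.d4 ≤ I.d4 * I.d2 := Nat.le_mul_of_pos_right _ I.d2_pos
  refine Run.mono (K := 2 * b + 1 + (130 + (130 + (130 + (130 + 130))))) ?_ (by omega)
    fun _ h => h
  refine Run.seq ((Run.clearRegs h (by omega) b).mono le_rfl ?_)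
  rintro τ ⟨hτ, hz⟩
  have b1 : |(2 + 2 * .reg 1 + .reg 3 + .reg 3 : Ex).eval τ| ≤ β := by
    simp [hτ.int, hF.int1, hF.int3]
    rw [abs_of_nonneg (by positivity)]
    omega
  have b2 : |(2 * .reg 1 + 1 : Ex).eval τ| ≤ β := by
    simp [hτ.int, hF.int1]
    rw [abs_of_nonneg (by positivity)]
    omega
  have w1 := hτ.setInt (x := 64) (by norm_num) b1
  refine Run.seq (Run.assign hB hτ.bounded (by decide) ?_)
  have v1 : (2 + 2 * .reg 1 + .reg 3 + .reg 3 : Ex).eval τ = I.grammar.numNT := by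
    simp [hτ.int, hF.int1, hF.int3, e1]
  rw [v1] at w1 ⊢
  refine Run.seq (Run.assign hB w1.bounded (by decide) ?_)
  have v2 : (2 * .reg 1 + 1 : Ex).eval (τ.setInt 64 I.grammar.numNT) = I.grammar.numT := by
    simp [w1.int, hF.int1, e2]
  rw [v2]
  have w2 := w1.setInt (x := 65) (v := I.grammar.numT) (by norm_num) (by
    rw [Nat.abs_cast]; omega)
  refine Run.seq (Run.assign hB w2.bounded (by decide) ?_)
  have w3 := w2.setInt (x := 66) (v := 0) (by norm_num) (by simp; omega)
  refine Run.seq (Run.assign hB w3.bounded (by decide) ?_)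
  have v4 : (Ex.reg 20).eval (((τ.setInt 64 I.grammar.numNT).setInt 65 I.grammar.numT).setInt 66 0)
      = I.rules.length := w3.pos
  have w4 := w3.setInt (x := 67) (v := I.rules.length) (by norm_num) (by
    rw [Nat.abs_cast]; omega)
  rw [v4]
  refine Run.assign hB w4.bounded (by decide) ?_
  have v5 : (Ex.reg 21).eval ((((τ.setInt 64 I.grammar.numNT).setInt 65 I.grammar.numT).setInt 66
      0).setInt 67 I.rules.length) = I.text.length := w4.textPos
  rw [v5]
  have w5 := w4.setInt (x := 68) (v := I.text.length) (by norm_num) (by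
    rw [Nat.abs_cast]; omega)
  refine ⟨w5, ⟨?_, ?_, fun x hx => ?_, fun x hx => ?_, fun a i => ?_, fun a i => ?_, fun x => ?_,
    fun a i => ?_⟩⟩
  · rw [w5.int 0 (by norm_num), hF.int0]
  · rw [w5.int 15 (by norm_num), hF.int15]
  · match x with
    | 0 => simp [State.setInt, SCFG.input]
    | 1 => simp [State.setInt, SCFG.input]
    | 2 => simp [State.setInt, SCFG.input, RawGrammar.nt]
    | 3 => simp [State.setInt, SCFG.input, RawGrammar.ruleList, MatrixInstance.grammar]
    | 4 => simp [State.setInt, SCFG.input, MatrixInstance.input]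
    | x + 5 =>
      have := (hz (x + 5) hx).1
      simpa [State.setInt, SCFG.input, Function.update_of_ne (show 64 + (x + 5) ≠ 65 by omega),
        Function.update_of_ne (show 64 + (x + 5) ≠ 66 by omega),
        Function.update_of_ne (show 64 + (x + 5) ≠ 67 by omega),
        Function.update_of_ne (show 64 + (x + 5) ≠ 68 by omega)] using this
  · exact (hz x hx).2
  · rw [w5.intCells a i, MatrixInstance.input, RawGrammar.intArr_input _ I.text_lt]
    rfl
  · rw [w5.realCells a i, RawGrammar.realArr_input]
    rfl
  · match x with
    | 0 => simp [SCFG.input]; omega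
    | 1 => simp [SCFG.input]; omega
    | 2 => simp [SCFG.input, RawGrammar.nt]
    | 3 => simp [SCFG.input, RawGrammar.ruleList, MatrixInstance.grammar]; omega
    | 4 => simp [SCFG.input, MatrixInstance.input]; omega
    | x + 5 => simp [SCFG.input]
  · rw [MatrixInstance.input, RawGrammar.intArr_input _ I.text_lt]
    exact RawGrammar.abs_inputArr_le _ I.text_lt (by omega) a i

end StochasticParsing

namespace StochasticParsing

/-! ## Squaring the matrix by means of the parser -/

namespace MatrixInstance

variable (I : MatrixInstance)

/-- The entries of the min-plus square. -/
def minSum (i j : ℕ) : ℕ :=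
  (Finset.range I.D).inf' ⟨0, Finset.mem_range.2 I.D_pos⟩ fun l => I.a i l + I.a l j

theorem minSum_le {i j l : ℕ} (hl : l < I.D) : I.minSum i j ≤ I.a i l + I.a l j :=
  Finset.inf'_le _ (Finset.mem_range.2 hl)

theorem exists_minSum (i j : ℕ) : ∃ l < I.D, I.minSum i j = I.a i l + I.a l j := by
  obtain ⟨l, hl, h⟩ := Finset.exists_mem_eq_inf' (s := Finset.range I.D)
    ⟨0, Finset.mem_range.2 I.D_pos⟩ fun l => I.a i l + I.a l j
  exact ⟨l, Finset.mem_range.1 hl, h⟩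

/-- The product of `Q - a` and `Q - a'` equals `Q² - (a + a') Q + a a'` with `0 ≤ a a' < Q`. The
error term is too small to make up for an excess of `1` in the sum, so the largest product has a
smallest sum, and comparing it with `(Q - s) Q` compares this sum with `s`. -/
theorem exists_threshold {b : ℕ} (hb : ∀ i j, I.a i j ≤ b) (hQ : b * b < I.Q) (i j : ℕ) :
    ∃ P : ℝ, (∀ l < I.D, ((I.Q : ℝ) - I.a i l) * (I.Q - I.a l j) ≤ P) ∧
      (∃ l < I.D, ((I.Q : ℝ) - I.a i l) * (I.Q - I.a l j) = P) ∧
      ∀ s : ℕ, ((I.Q : ℝ) - s) * I.Q ≤ P ↔ I.minSum i j ≤ s := by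
  obtain ⟨l₀, hl₀, h₀⟩ := Finset.exists_max_image (Finset.range I.D)
    (fun l => ((I.Q : ℝ) - I.a i l) * (I.Q - I.a l j)) ⟨0, Finset.mem_range.2 I.D_pos⟩
  refine ⟨_, fun l hl => h₀ l (Finset.mem_range.2 hl), ⟨l₀, Finset.mem_range.1 hl₀, rfl⟩,
    fun s => ⟨fun h => ?_, fun h => ?_⟩⟩
  · by_contra hs
    -- Integrality is used here: a sum larger than `s` exceeds it by at least `1`, which costs a
    -- full `Q`.
    have h1 : s + 1 ≤ I.a i l₀ + I.a l₀ j := by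
      have := I.minSum_le (i := i) (j := j) (Finset.mem_range.1 hl₀)
      omega
    have h2 : (s : ℝ) + 1 ≤ I.a i l₀ + I.a l₀ j := by exact_mod_cast h1
    have h3 : I.a i l₀ * I.a l₀ j < I.Q := (Nat.mul_le_mul (hb _ _) (hb _ _)).trans_lt hQ
    have h4 : (I.a i l₀ : ℝ) * I.a l₀ j < I.Q := by exact_mod_cast h3
    have h5 : (0 : ℝ) ≤ I.Q := by positivity
    nlinarith [mul_le_mul_of_nonneg_right h2 h5]
  · obtain ⟨l, hl, e⟩ := I.exists_minSum i j
    refine le_trans ?_ (h₀ l (Finset.mem_range.2 hl))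
    have h2 : (I.a i l : ℝ) + I.a l j ≤ s := by exact_mod_cast e ▸ h
    have h5 : (0 : ℝ) ≤ I.Q := by positivity
    have h6 : (0 : ℝ) ≤ I.a i l * I.a l j := by positivity
    nlinarith [mul_le_mul_of_nonneg_right h2 h5]

/-- The entries of the square, where `o` represents `0` and `4 * o` represents infinity. -/
def sq (o i j : ℕ) : ℕ := if I.minSum i j < 4 * o then I.minSum i j - o else 4 * o

end MatrixInstance

/-- Copy `c` of the memory holds an oracle. -/
def HoldsOracle {X : Extension} (qry : Program X) (t b B' m c : ℕ) (g : SCFG)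
    (s : List (Fin g.numT)) (σ : State) : Prop :=
  ∃ τ, Simulates b B' m c σ τ ∧ g.IsOracle B' qry t s τ

theorem Simulates.setLow {b B m c : ℕ} {σ τ : State} (h : Simulates b B m c σ τ) {x : ℕ}
    (hx : 20 ≤ x) (hx' : x < 64) (v : ℤ) : Simulates b B m c (σ.setInt x v) τ := by
  refine ⟨?_, ?_, fun y hy => ?_, h.4, h.5, h.6, h.7, h.8⟩
  · rw [← h.1]; exact Function.update_of_ne (by omega) _ _
  · rw [← h.2]; exact Function.update_of_ne (by omega) _ _
  · rw [← h.3 y hy]; exact Function.update_of_ne (by omega) _ _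

theorem Simulates.setLowArr {b B m c : ℕ} {σ τ : State} (h : Simulates b B m c σ τ) {a : ℕ}
    (ha : a < 8) (i v : ℤ) : Simulates b B m c (σ.setIntArr a i v) τ := by
  refine ⟨h.1, h.2, h.3, h.4, fun a' j => ?_, h.6, h.7, h.8⟩
  rw [← h.5 a' j]
  simp only [State.setIntArr]
  rw [Function.update_of_ne (by omega)]

/-- Query the oracle about the entry in row `22` and column `23` (registers). -/
def query {X : Extension} (qry : Program X) : Program X :=
  .seq (assign X 64 (2 + 2 * .reg 1 + .reg 3 + (.reg 22 / .reg 1 * .reg 2 + .reg 23 / .reg 1))) <|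
  .seq (assign X 65 (1 + .reg 22 % .reg 1)) <|
  .seq (assign X 66 (3 * .reg 1 + 2 + .reg 23 % .reg 1)) qry.relocate

/-- The state of the computation while the entries of the square are determined: `n` of them have
been stored. -/
structure Querying {X : Extension} (qry : Program X) (t b B' : ℕ) (I : MatrixInstance) (o : ℕ)
    (β : ℤ) (m c : ℕ) (F : State) (n : ℕ) (σ : State) : Prop where
  bounded : Bounded β σ
  int : ∀ x < 20, σ.int x = F.int x
  realArr : ∀ a < 8, σ.realArr a = F.realArr a
  intCopy : ∀ (a : ℕ) (j : ℤ), j % m ≠ c → σ.intArr (8 + a) j = F.intArr (8 + a) j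
  realCopy : ∀ (a : ℕ) (j : ℤ), j % m ≠ c → σ.realArr (8 + a) j = F.realArr (8 + a) j
  matrix : ∀ k < n, σ.intArr 4 k = I.sq o (k / I.D) (k % I.D)
  oracle : HoldsOracle qry t b B' m c I.grammar.scfg I.input σ

section Query

variable {X : Extension} {qry : Program X} {t b B' : ℕ} {I : MatrixInstance} {o : ℕ}
  {β : ℤ} {m c B : ℕ} {F σ : State} {n : ℕ}

theorem Querying.setInt (h : Querying qry t b B' I o β m c F n σ) {x : ℕ} (hx : 22 ≤ x)
    (hx' : x < 64) {v : ℤ} (hv : |v| ≤ β) :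
    Querying qry t b B' I o β m c F n (σ.setInt x v) := by
  obtain ⟨τ, h1, h2⟩ := h.oracle
  exact ⟨h.bounded.setInt hv, fun y hy => (Function.update_of_ne (by omega) _ _).trans (h.int y hy),
    h.3, h.4, h.5, h.6, τ, h1.setLow (by omega) hx' v, h2⟩

/-- The square overwrites the matrix in place. This is harmless because the oracle has been built
already and lives in the copy `c`, which a store to array `4` does not touch. -/
theorem Querying.store (h : Querying qry t b B' I o β m c F n σ) {v : ℤ}
    (hv : v = I.sq o (n / I.D) (n % I.D)) (hv' : |v| ≤ β) :
    Querying qry t b B' I o β m c F (n + 1) (σ.setIntArr 4 n v) := by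
  obtain ⟨τ, h1, h2⟩ := h.oracle
  refine ⟨h.bounded.setIntArr (.inl hv'), h.2, h.3, fun a j hj => ?_, h.5, fun k hk => ?_, τ,
    h1.setLowArr (by norm_num) _ _, h2⟩
  · rw [← h.4 a j hj]
    simp only [State.setIntArr]
    rw [Function.update_of_ne (by omega)]
  · by_cases e : k = n
    · subst e; simp [State.setIntArr, hv]
    · have := h.6 k (by omega)
      simpa [State.setIntArr, e] using this

/-- The state `F` holds the parameters of the grammar and the matrix, and the table of scales. -/
structure Tabled (I : MatrixInstance) (o : ℕ) (β : ℤ) (m c : ℕ) (F : State) : Prop where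
  prepared : I.Prepared β m c F
  int5 : F.int 5 = o
  table : ∀ n < 4 * I.d, F.realArr 0 n = I.scale n * I.Q
  offset_le : (8 * o : ℤ) ≤ β
  entry_le : ∀ i j, I.a i j ≤ 4 * o
  sq_lt : 4 * o * (4 * o) < I.Q

/-- The high parts of `i` and `j` select the nonterminal, the low parts the end points of the
substring. The answer is used only through comparisons with the thresholds for the candidates `s`.
-/
theorem Run.query (hB : Ample β B) (hF : Tabled I o β m c F)
    (h : Querying qry t b B' I o β m c F n σ) (hb : qry.Below b) (hb0 : 0 < b)
    (hBB : B' * m + m ≤ B)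
    (hB' : I.grammar.numNT + I.grammar.numT + I.rules.length + I.text.length + 2 ≤ B')
    {i j : ℕ} (hi : i < I.D) (hj : j < I.D) (ei : σ.int 22 = i) (ej : σ.int 23 = j) :
    Run B (query qry) σ (390 + 3 * t) fun τ => Querying qry t b B' I o β m c F n τ ∧
      (∀ x, 22 ≤ x → x < 30 → τ.int x = σ.int x) ∧
      ∀ s : ℕ, ((I.Q : ℝ) - s) * (I.scale (3 * I.d + j % I.d - i % I.d - 3) * I.Q) ≤ τ.real 64 ↔
        I.minSum i j ≤ s := by
  have hP := hF.prepared
  have hid : i / I.d < I.d2 := Nat.div_lt_of_lt_mul (by unfold MatrixInstance.D at hi; linarith)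
  have hjd : j / I.d < I.d2 := Nat.div_lt_of_lt_mul (by unfold MatrixInstance.D at hj; linarith)
  have hk := I.pair_lt hid hjd
  have hx := Nat.mod_lt i I.d_pos
  have hy := Nat.mod_lt j I.d_pos
  have hNT : I.grammar.numNT = I.offC + I.d4 := rfl
  have hC : I.offC = 2 + 2 * I.d + I.d4 := rfl
  have hlt : I.text.length = 4 * I.d + 1 := by simp [MatrixInstance.text]
  have hl := hP.length_le
  rw [I.length_rules, hlt] at hl
  have hp : (0 : ℤ) ≤ I.d4 * I.d2 := by positivity
  push_cast at hl
  let A := I.offC + (i / I.d * I.d2 + j / I.d)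
  obtain ⟨τ, hs, S, hτ, horacle⟩ := h.oracle
  have v1 : (2 + 2 * .reg 1 + .reg 3 + (.reg 22 / .reg 1 * .reg 2 + .reg 23 / .reg 1) : Ex).eval σ
      = A := by
    simp [h.int, hP.int1, hP.int2, hP.int3, ei, ej, A, hC]
  have v2 : (1 + .reg 22 % .reg 1 : Ex).eval (σ.setInt 64 A) = (1 + i % I.d : ℕ) := by
    simp [State.setInt, h.int, hP.int1, ei]
  have v3 : (3 * .reg 1 + 2 + .reg 23 % .reg 1 : Ex).eval
      ((σ.setInt 64 A).setInt 65 (1 + i % I.d : ℕ)) = (3 * I.d + 2 + j % I.d : ℕ) := by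
    simp [State.setInt, h.int, hP.int1, ej]
  have w : ∀ (σ : State), Bounded β σ → ∀ (x : ℕ) (v : ℤ), 30 ≤ x → Bounded β (σ.setInt x v) := by
    intro σ hσ x v hx
    refine ⟨fun y hy => ?_, hσ.2⟩
    have e : (σ.setInt x v).int y = σ.int y := Function.update_of_ne (by omega) _ _
    rw [e]
    exact hσ.1 y hy
  refine Run.mono (K := 130 + (130 + (130 + 3 * t))) ?_ (by omega) fun _ h => h
  refine Run.seq (Run.assign hB h.bounded (by decide) ?_)
  rw [v1]
  have b1 := w _ h.bounded 64 A (by norm_num)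
  refine Run.seq (Run.assign hB b1 (by decide) ?_)
  rw [v2]
  have b2 := w _ b1 65 (1 + i % I.d : ℕ) (by norm_num)
  refine Run.seq (Run.assign hB b2 (by decide) ?_)
  rw [v3]
  have s1 := hs.setInt 0 (v := A) (by rw [Nat.abs_cast]; omega)
  have s2 := s1.setInt 1 (v := (1 + i % I.d : ℕ)) (by rw [Nat.abs_cast]; omega)
  have s3 := s2.setInt 2 (v := (3 * I.d + 2 + j % I.d : ℕ)) (by rw [Nat.abs_cast]; omega)
  obtain ⟨P, hP1, hP2, hP3⟩ := I.exists_threshold hF.entry_le hF.sq_lt i j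
  have hcol : (i / I.d * I.d2 + j / I.d) % I.d2 = j / I.d := by
    rw [Nat.mul_add_mod_of_lt hjd]
  have hrow : (i / I.d * I.d2 + j / I.d) / I.d2 = i / I.d := by
    rw [Nat.mul_comm, Nat.mul_add_div I.d2_pos, Nat.div_eq_of_lt hjd, Nat.add_zero]
  have hg := I.isGreatest hk hx hy (M := P)
    (by rw [hrow, hcol, Nat.div_add_mod', Nat.div_add_mod']; exact hP1)
    (by rw [hrow, hcol, Nat.div_add_mod', Nat.div_add_mod']; exact hP2)
  -- The state after the query lies again in the set `S` of admissible states, so the oracle remains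
  -- usable.
  obtain ⟨υ, hυ, k, hkt, hx', hq⟩ := horacle τ hτ (I.grammar.nt A) (1 + i % I.d)
    (3 * I.d + 2 + j % I.d) (by omega) (by rw [I.length_input]; omega)
    (I.consistentlyDerives hk hx hy) _ hg
  have hval : ((I.grammar.nt A : Fin _) : ℕ) = A := I.grammar.val_nt (by omega)
  rw [hval] at hx'
  have hs' : I.scale (3 * I.d + j % I.d - i % I.d - 3) > 0 := I.scale_pos _
  refine Simulates.run (b := b) hP.copy_lt hBB hx' (by omega) hb s3 fun σ' hσ' hf => ?_
  have low : ∀ x < 30, σ'.int x = σ.int x := by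
    intro x hx
    rw [hf.int x hx]
    simp [State.setInt, Function.update_of_ne (show x ≠ 64 by omega),
      Function.update_of_ne (show x ≠ 65 by omega), Function.update_of_ne (show x ≠ 66 by omega)]
  refine ⟨⟨⟨fun x hx => ?_, fun a ha k => ?_⟩, fun x hx => ?_, fun a ha => ?_, fun a k hk => ?_,
    fun a k hk => ?_, fun k hk => ?_, ⟨υ, hσ', S, hυ, horacle⟩⟩, fun x _ hx => low x hx,
    fun s => ?_⟩
  · rw [low x hx]; exact h.bounded.1 x hx
  · rw [hf.intArr a ha]; exact h.bounded.2 a ha k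
  · rw [low x (by omega)]; exact h.int x hx
  · rw [hf.realArr a ha]; exact h.realArr a ha
  · rw [hf.intCopy a k hk]; exact h.intCopy a k hk
  · rw [hf.realCopy a k hk]; exact h.realCopy a k hk
  · rw [hf.intArr 4 (by norm_num)]; exact h.matrix k hk
  -- Real register `64` is the parser's output register `0`; it holds `scale * P`, and the positive
  -- scale cancels.
  · rw [← hP3 s, show (64 : ℕ) = 64 + 0 from rfl, hσ'.real 0 hb0, hq, mul_left_comm,
      mul_le_mul_iff_right₀ hs']

/-- Find by binary search the entry in row `22` and column `23` from the answer to the query, and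
store it. -/
def searchEntry (X : Extension) : Program X :=
  .seq (assign X 24 0) <| .seq (assign X 25 (8 * .reg 5)) <|
  .seq (whileLe (.reg 24 + 1) (.reg 25) <|
    .seq (assign X 26 ((.reg 24 + .reg 25) / 2)) <|
    ifRealLe (.mul (.cast (.reg 6 - .reg 26))
        (.get 0 (3 * .reg 1 + .reg 23 % .reg 1 - .reg 22 % .reg 1 - 3))) (.reg 64)
      (assign X 25 (.reg 26)) (assign X 24 (.reg 26 + 1))) <|
  ifLe (.reg 24 + 1) (4 * .reg 5) (store X 4 (.reg 22 * .reg 4 + .reg 23) (.reg 24 - .reg 5))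
    (store X 4 (.reg 22 * .reg 4 + .reg 23) (4 * .reg 5))

theorem Run.searchEntry (hB : Ample β B) (hF : Tabled I o β m c F) {i j : ℕ}
    (h : Querying qry t b B' I o β m c F (i * I.D + j) σ) (hj : j < I.D)
    (ei : σ.int 22 = i) (ej : σ.int 23 = j)
    (hq : ∀ s : ℕ, ((I.Q : ℝ) - s) * (I.scale (3 * I.d + j % I.d - i % I.d - 3) * I.Q)
      ≤ σ.real 64 ↔ I.minSum i j ≤ s)
    (ho : I.minSum i j < 4 * o → o ≤ I.minSum i j) {N : ℕ} (hN : 8 * o < 2 ^ N) :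
    Run B (searchEntry X) σ (1100 + 1000 * N) fun τ =>
      Querying qry t b B' I o β m c F (i * I.D + j + 1) τ ∧
      τ.int 22 = i ∧ τ.int 23 = j := by
  have hP := hF.prepared
  have hx := Nat.mod_lt i I.d_pos
  have hy := Nat.mod_lt j I.d_pos
  have hβ := hB.base
  have hoβ := hF.offset_le
  -- Entries are at most `4 * o`, so the search may start with the interval from `0` to `8 * o`.
  have h8 : I.minSum i j ≤ 8 * o := by
    have := I.minSum_le (i := i) (j := j) I.D_pos
    have := hF.entry_le i 0
    have := hF.entry_le 0 j
    omega
  refine Run.mono (K := 130 + (130 + ((N * (130 + (130 + 450) + 250) + 250) + (250 + 250)))) ?_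
    (by omega) fun _ h => h
  refine Run.seq (Run.assign hB h.bounded (by decide) ?_)
  have q1 := h.setInt (x := 24) (v := 0) (by norm_num) (by norm_num) (by simp; omega)
  refine Run.seq (Run.assign hB q1.bounded (by decide) ?_)
  have v1 : (8 * .reg 5 : Ex).eval (σ.setInt 24 0) = 8 * o := by
    simp [q1.int, hF.int5]
  rw [v1]
  have q2 := q1.setInt (x := 25) (v := 8 * o) (by norm_num) (by norm_num)
    (by rw [abs_of_nonneg (by positivity)]; exact hoβ)
  have hReal : ∀ τ : State, (∀ x < 20, τ.int x = F.int x) → τ.int 22 = i → τ.int 23 = j →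
      (∀ a < 8, τ.realArr a = F.realArr a) → ∀ s : ℕ, τ.int 26 = s →
      (RealEx.mul (.cast (.reg 6 - .reg 26))
        (.get 0 (3 * .reg 1 + .reg 23 % .reg 1 - .reg 22 % .reg 1 - 3))).eval τ
        = ((I.Q : ℝ) - s) * (I.scale (3 * I.d + j % I.d - i % I.d - 3) * I.Q) := by
    intro τ h1 h2 h3 h4 s h5
    -- The truncated subtraction is exact: `i % d ≤ d - 1` and `d ≥ 1` leave at least `2 * d - 2`.
    have e1 : (3 * I.d + (j % I.d : ℕ) - (i % I.d : ℕ) - 3 : ℤ)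
        = (3 * I.d + j % I.d - i % I.d - 3 : ℕ) := by omega
    have := hF.table (3 * I.d + j % I.d - i % I.d - 3) (by omega)
    rw [← this, ← e1]
    simp [RealEx.eval, h1, h2, h3, h4, h5, hP.int1, hP.int6]
  -- With `n` rounds left the interval from `lo` to `hi` contains the entry and satisfies `hi - lo <
  -- 2 ^ n`; each round halves it.
  let Inv : ℕ → State → Prop := fun n τ => Querying qry t b B' I o β m c F (i * I.D + j) τ ∧
    τ.int 22 = i ∧ τ.int 23 = j ∧ τ.real 64 = σ.real 64 ∧ ∃ lo hi : ℕ, τ.int 24 = lo ∧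
      τ.int 25 = hi ∧ lo ≤ I.minSum i j ∧ I.minSum i j ≤ hi ∧ hi ≤ 8 * o ∧ hi < lo + 2 ^ n
  refine Run.seq (Run.whileLe hB Inv (by decide) (by decide) (fun n τ h => h.1.bounded) ?_ ?_
    (n := N) ⟨q2, by simp [State.setInt, ei], by simp [State.setInt, ej], rfl, 0, 8 * o,
      by simp [State.setInt], by simp [State.setInt], by omega, h8, le_rfl, by omega⟩)
  · rintro n τ ⟨hq', e22, e23, e64, lo, hi, e24, e25, hlo, hhi, hhi', hlt⟩ hle
    simp [e24, e25] at hle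
    have hle' : lo + 1 ≤ hi := by exact_mod_cast hle
    obtain ⟨n, rfl⟩ : ∃ n', n = n' + 1 := by
      refine ⟨n - 1, ?_⟩
      have : n ≠ 0 := by rintro rfl; simp at hlt; omega
      omega
    refine ⟨n, rfl, Run.seq (Run.assign hB hq'.bounded (by decide) ?_)⟩
    have v26 : ((.reg 24 + .reg 25) / 2 : Ex).eval τ = ((lo + hi) / 2 : ℕ) := by
      simp [e24, e25]
    rw [v26]
    set mid := (lo + hi) / 2 with hmid
    have q3 := hq'.setInt (x := 26) (v := (mid : ℕ)) (by norm_num) (by norm_num)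
      (by rw [Nat.abs_cast]; omega)
    have r22 : (τ.setInt 26 mid).int 22 = i := e22
    have r23 : (τ.setInt 26 mid).int 23 = j := e23
    have r24 : (τ.setInt 26 mid).int 24 = lo := e24
    have r25 : (τ.setInt 26 mid).int 25 = hi := e25
    have r26 : (τ.setInt 26 mid).int 26 = mid := by simp [State.setInt]
    have hR := hReal _ q3.int r22 r23 q3.realArr mid r26
    have hpow : 2 ^ (n + 1) = 2 * 2 ^ n := pow_succ' 2 n
    refine Run.ifRealLe hB q3.bounded (by decide) (by decide) (fun hc => ?_) (fun hc => ?_)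
    · rw [hR] at hc
      have hc' : I.minSum i j ≤ mid := by
        rw [← hq mid, ← e64]; exact hc
      refine Run.assign hB q3.bounded (by decide) ?_
      rw [Ex.eval_reg, r26]
      refine ⟨q3.setInt (by norm_num) (by norm_num) (by rw [Nat.abs_cast]; omega), e22, e23, e64,
        lo, mid, e24, by simp [State.setInt], hlo, hc', by omega, by omega⟩
    · rw [hR] at hc
      have hc' : ¬ I.minSum i j ≤ mid := by
        rw [← hq mid, ← e64]; exact not_le.2 hc
      refine Run.assign hB q3.bounded (by decide) ?_
      have : (.reg 26 + 1 : Ex).eval (τ.setInt 26 mid) = (mid + 1 : ℕ) := by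
        simp [r26]
      rw [this]
      refine ⟨q3.setInt (by norm_num) (by norm_num) (by rw [Nat.abs_cast]; omega), e22, e23, e64,
        mid + 1, hi, by simp [State.setInt], e25, by omega, hhi, hhi', by omega⟩
  · rintro n τ ⟨hq', e22, e23, e64, lo, hi, e24, e25, hlo, hhi, hhi', -⟩ hle
    simp [e24, e25] at hle
    have hle' : hi ≤ lo := by exact_mod_cast hle
    have es : lo = I.minSum i j := by omega
    have e5 : τ.int 5 = o := by rw [hq'.int 5 (by norm_num), hF.int5]
    have e4 : τ.int 4 = I.D := by rw [hq'.int 4 (by norm_num), hP.int4]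
    have ad : (.reg 22 * .reg 4 + .reg 23 : Ex).eval τ = (i * I.D + j : ℕ) := by
      simp [e22, e23, e4]
    have d1 : (i * I.D + j) / I.D = i := by
      rw [Nat.mul_comm, Nat.mul_add_div I.D_pos, Nat.div_eq_of_lt hj, Nat.add_zero]
    have d2 : (i * I.D + j) % I.D = j := Nat.mul_add_mod_of_lt hj
    refine Run.ifLe hB hq'.bounded (by decide) (by decide) (fun hc => ?_) (fun hc => ?_)
    · simp [e24, e5] at hc
      have hc' : I.minSum i j < 4 * o := by omega
      refine Run.store hB hq'.bounded (by decide) (by decide) ?_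
      rw [ad]
      have v : (.reg 24 - .reg 5 : Ex).eval τ = lo - o := by simp [e24, e5]
      rw [v]
      refine ⟨hq'.store ?_ ?_, e22, e23⟩
      · rw [d1, d2, MatrixInstance.sq, if_pos hc', ← es]
        have := ho hc'
        omega
      · rw [abs_le]; omega
    · simp [e24, e5] at hc
      have hc' : ¬ I.minSum i j < 4 * o := by omega
      refine Run.store hB hq'.bounded (by decide) (by decide) ?_
      rw [ad]
      have v : (4 * .reg 5 : Ex).eval τ = 4 * o := by simp [e5]
      rw [v]
      refine ⟨hq'.store ?_ ?_, e22, e23⟩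
      · rw [d1, d2, MatrixInstance.sq, if_neg hc']
        simp
      · rw [abs_le]; omega

/-- Replace the matrix by its min-plus square. -/
def square (b : ℕ) (pre qry : Program X) : Program X :=
  .seq (emitInput X) <| .seq (setupRegs X b) <| .seq pre.relocate <|
  forLt 22 (.reg 4) <| forLt 23 (.reg 4) <| .seq (query qry) (searchEntry X)

theorem Run.square {pre : Program X} {Kp N : ℕ} (hB : Ample β B) (hF : Tabled I o β m c F)
    (hβ : Bounded β F) (hf : Fresh m c F) (hb : pre.Below b) (hb' : qry.Below b) (hb0 : 0 < b)
    (hBB : B' * m + m ≤ B)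
    (hB' : I.grammar.numNT + I.grammar.numT + I.rules.length + I.text.length + 2 ≤ B')
    (hpre : ∃ τ k, Exec B' pre (I.grammar.scfg.input I.grammar.ruleList I.input) τ k ∧ k ≤ Kp ∧
      I.grammar.scfg.IsOracle B' qry t I.input τ) (hN : 8 * o < 2 ^ N)
    (hD : (I.D : ℤ) ≤ β)
    (ho : ∀ i < I.D, ∀ j < I.D, I.minSum i j < 4 * o → o ≤ I.minSum i j) :
    Run B (StochasticParsing.square b pre qry) F (100000 * (I.D * I.D) + (2 * b + 1000 + (3 * Kp +
      (I.D + 1) * ((I.D + 1) * (390 + 3 * t + (1100 + 1000 * N) + 400) + 400))))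
      (Querying qry t b B' I o β m c F (I.D * I.D)) := by
  have hP := hF.prepared
  refine Run.seq ((Run.emitInput hB hP hβ hf).mono le_rfl fun τ hτ => ?_)
  refine Run.seq ((Run.setupRegs hB hP hτ b hB').mono le_rfl ?_)
  rintro υ ⟨hw, hs⟩
  obtain ⟨σp, k, hx, hk, ho'⟩ := hpre
  refine Run.seq (Simulates.run hP.copy_lt hBB hx (by omega) hb hs fun σ hσ hf' => ?_)
  have q0 : Querying qry t b B' I o β m c F 0 σ := by
    refine ⟨⟨fun x hx => ?_, fun a ha k => ?_⟩, fun x hx => ?_, fun a ha => ?_, fun a k hk => ?_,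
      fun a k hk => ?_, fun k hk => absurd hk (Nat.not_lt_zero k), σp, hσ, ho'⟩
    · rw [hf'.int x hx]; exact hw.bounded.1 x hx
    · rw [hf'.intArr a ha]; exact hw.bounded.2 a ha k
    · rw [hf'.int x (by omega)]; exact hw.int x hx
    · rw [hf'.realArr a ha]; exact hw.realArr a ha
    · rw [hf'.intCopy a k hk]; exact hw.intCopy a k hk
    · rw [hf'.realCopy a k hk]; exact hw.realCopy a k hk
  have e4 : ∀ {n σ}, Querying qry t b B' I o β m c F n σ → (Ex.reg 4).eval σ = I.D :=
    fun h => (h.int 4 (by norm_num)).trans hP.int4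
  have hβ0 := hB.base
  refine Run.forLt hB (fun i τ => Querying qry t b B' I o β m c F (i * I.D) τ ∧ τ.int 22 = i)
    (by norm_num) (by decide) q0.bounded ⟨?_, by simp [State.setInt]⟩
    (fun i _ τ h => ⟨h.1.bounded, e4 h.1, h.2⟩) (fun i hi τ h => ?_) fun τ h => h.1
  · rw [Nat.zero_mul]
    exact q0.setInt le_rfl (by norm_num) (by simp; omega)
  refine (Run.forLt hB (fun j τ => Querying qry t b B' I o β m c F (i * I.D + j) τ ∧
    τ.int 22 = i ∧ τ.int 23 = j) (by norm_num) (by decide) h.1.bounded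
    ⟨h.1.setInt (by norm_num) (by norm_num) (by simp; omega),
      by simpa [State.setInt] using h.2, by simp [State.setInt]⟩
    (fun j _ τ h => ⟨h.1.bounded, e4 h.1, h.2.2⟩) (fun j hj τ h => ?_) fun τ h => h).mono le_rfl ?_
  · obtain ⟨h1, h2, h3⟩ := h
    refine Run.seq ((Run.query hB hF h1 hb' hb0 hBB hB' hi hj h2 h3).mono le_rfl ?_)
    rintro υ ⟨h4, h5, h6⟩
    have e22 := (h5 22 le_rfl (by norm_num)).trans h2
    have e23 := (h5 23 (by norm_num) (by norm_num)).trans h3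
    refine (Run.searchEntry hB hF h4 hj e22 e23 h6 (ho i hi j hj) hN).mono le_rfl ?_
    rintro ω ⟨h7, h8, h9⟩
    refine ⟨h7.bounded, h9, h7.setInt (by norm_num) (by norm_num) ?_, h8, by simp [State.setInt]⟩
    rw [abs_le]; constructor <;> omega
  · rintro υ ⟨h1, h2, -⟩
    refine ⟨h1.bounded, h2, ?_, by simp [State.setInt]⟩
    rw [Nat.add_mul, Nat.one_mul]
    refine h1.setInt le_rfl (by norm_num) ?_
    rw [abs_le]; constructor <;> omega

end Query

end StochasticParsing

/-! ### Shortest walks by repeated min-plus squaring -/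

namespace StochasticParsing

namespace WeightedDigraph

variable {m : ℕ} {w : WeightedDigraph m}

/-- There is a walk of `n` edges from `i` to `j` of total weight `x`. -/
inductive WalkOfLength (w : WeightedDigraph m) : ℕ → Fin m → Fin m → ℤ → Prop
  | nil (i : Fin m) : WalkOfLength w 0 i i 0
  | cons {n : ℕ} {i j k : Fin m} {x y : ℤ} :
      w i j = some x → WalkOfLength w n j k y → WalkOfLength w (n + 1) i k (x + y)

theorem Walk.trans {i j k : Fin m} {x y : ℤ} (h : Walk w i j x) (h' : Walk w j k y) :
    Walk w i k (x + y) := by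
  induction h with
  | nil i => simpa using h'
  | cons e _ ih => rw [add_assoc]; exact .cons e (ih h')

theorem WalkOfLength.split {a b : ℕ} {i k : Fin m} {x : ℤ} (h : WalkOfLength w (a + b) i k x) :
    ∃ j y z, WalkOfLength w a i j y ∧ WalkOfLength w b j k z ∧ x = y + z := by
  induction a generalizing i x with
  | zero => exact ⟨i, 0, x, .nil i, by simpa using h, by simp⟩
  | succ a ih =>
    rw [Nat.add_right_comm] at h
    cases h with
    | cons e h =>
      obtain ⟨j, y, z, h1, h2, rfl⟩ := ih h
      exact ⟨j, _, z, .cons e h1, h2, by rw [add_assoc]⟩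

/-- There is a path through the distinct vertices in the list from `i` to `j` of weight `x`. -/
inductive Path (w : WeightedDigraph m) : List (Fin m) → Fin m → Fin m → ℤ → Prop
  | nil (i : Fin m) : Path w [i] i i 0
  | cons {L : List (Fin m)} {i j k : Fin m} {x y : ℤ} :
      w i j = some x → Path w L j k y → i ∉ L → Path w (i :: L) i k (x + y)

theorem Path.nodup {L : List (Fin m)} {i j : Fin m} {x : ℤ} (h : Path w L i j x) : L.Nodup := by
  induction h with
  | nil i => simp
  | cons _ _ hi ih => exact List.nodup_cons.2 ⟨hi, ih⟩

theorem Path.walkOfLength {L : List (Fin m)} {i j : Fin m} {x : ℤ} (h : Path w L i j x) :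
    ∃ n, L.length = n + 1 ∧ WalkOfLength w n i j x := by
  induction h with
  | nil i => exact ⟨0, rfl, .nil i⟩
  | cons e _ _ ih =>
    obtain ⟨n, hn, h⟩ := ih
    exact ⟨n + 1, by simp [hn], .cons e h⟩

/-- Cuts a path at a vertex it visits. If an edge from `i` to `j` is put in front, the first piece
closes to a cycle, which can then be dropped. -/
theorem Path.suffix {L : List (Fin m)} {i j k : Fin m} {x : ℤ} (h : Path w L j k x)
    (hi : i ∈ L) : ∃ L' y z, Walk w j i y ∧ Path w L' i k z ∧ x = y + z := by
  induction h with
  | nil j =>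
    obtain rfl : i = j := by simpa using hi
    exact ⟨[i], 0, 0, .nil i, .nil i, rfl⟩
  | @cons L j l k x y e h hj ih =>
    rcases List.mem_cons.1 hi with rfl | hi
    · exact ⟨_, 0, _, .nil i, .cons e h hj, by simp⟩
    · obtain ⟨L', y', z, h1, h2, rfl⟩ := ih hi
      exact ⟨L', _, z, .cons e h1, h2, by rw [add_assoc]⟩

theorem Walk.exists_path (hw : w.NoNegativeCycle) {i j : Fin m} {x : ℤ} (h : Walk w i j x) :
    ∃ L y, Path w L i j y ∧ y ≤ x := by
  induction h with
  | nil i => exact ⟨_, _, .nil i, le_rfl⟩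
  | @cons i j k x y e _ ih =>
    obtain ⟨L, y', h, hy⟩ := ih
    by_cases hi : i ∈ L
    · obtain ⟨L', y₁, y₂, h1, h2, rfl⟩ := h.suffix hi
      -- The cycle that is removed has nonnegative weight, so the remaining path is no heavier than
      -- the walk.
      have := hw i _ (.cons e h1)
      exact ⟨L', y₂, h2, by linarith⟩
    · exact ⟨_, _, .cons e h hi, by linarith⟩

theorem Walk.exists_short (hw : w.NoNegativeCycle) {i j : Fin m} {x : ℤ} (h : Walk w i j x) :
    ∃ n < m, ∃ y ≤ x, WalkOfLength w n i j y := by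
  obtain ⟨L, y, hL, hy⟩ := h.exists_path hw
  obtain ⟨n, hn, h'⟩ := hL.walkOfLength
  have := hL.nodup.length_le_card
  rw [Fintype.card_fin] at this
  exact ⟨n, by omega, y, hy, h'⟩

/-- The edge from `i` to `j` has weight `x`. -/
def Edge (w : WeightedDigraph m) (i j : ℕ) (x : ℤ) : Prop :=
  ∃ (hi : i < m) (hj : j < m), w ⟨i, hi⟩ ⟨j, hj⟩ = some x

/-- There is a walk of at most `2 ^ t` edges from `i` to `j` of total weight `x`. All numbers below
`D` are regarded as vertices. -/
def Reach (w : WeightedDigraph m) (D : ℕ) : ℕ → ℕ → ℕ → ℤ → Prop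
  | 0, i, j, x => (i = j ∧ x = 0) ∨ w.Edge i j x
  | t + 1, i, j, x => ∃ l < D, ∃ y z, w.Reach D t i l y ∧ w.Reach D t l j z ∧ x = y + z

variable {D : ℕ}

theorem Reach.abs_le {W : ℕ} (hW : w.WeightsBounded W) {t i j : ℕ} {x : ℤ}
    (h : w.Reach D t i j x) : |x| ≤ 2 ^ t * W := by
  induction t generalizing i j x with
  | zero =>
    rcases h with ⟨-, rfl⟩ | ⟨hi, hj, h⟩
    · simp
    · simpa using hW _ _ _ h
  | succ t ih =>
    obtain ⟨l, -, y, z, h1, h2, rfl⟩ := h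
    refine (abs_add_le y z).trans ?_
    have := ih h1
    have := ih h2
    rw [pow_succ]
    linarith

/-- The first alternative accounts for the numbers from `m` to `D - 1`: they are isolated dummy
vertices, joined only to themselves and with weight `0`. -/
theorem Reach.walk {t i j : ℕ} {x : ℤ} (h : w.Reach D t i j x) :
    (i = j ∧ x = 0) ∨ ∃ (hi : i < m) (hj : j < m), Walk w ⟨i, hi⟩ ⟨j, hj⟩ x := by
  induction t generalizing i j x with
  | zero =>
    rcases h with h | ⟨hi, hj, h⟩
    · exact .inl h
    · exact .inr ⟨hi, hj, by simpa using Walk.cons h (.nil _)⟩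
  | succ t ih =>
    obtain ⟨l, -, y, z, h1, h2, rfl⟩ := h
    rcases ih h1 with ⟨rfl, rfl⟩ | ⟨hi, hl, h1⟩
    · simpa using ih h2
    · rcases ih h2 with ⟨rfl, rfl⟩ | ⟨_, hj, h2⟩
      · exact .inr ⟨hi, hl, by simpa using h1⟩
      · exact .inr ⟨hi, hj, h1.trans h2⟩

theorem WalkOfLength.reach (hD : m ≤ D) {t n : ℕ} (hn : n ≤ 2 ^ t) {i j : Fin m} {x : ℤ}
    (h : WalkOfLength w n i j x) : w.Reach D t i j x := by
  induction t generalizing n i j x with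
  | zero =>
    cases h with
    | nil => exact .inl ⟨rfl, rfl⟩
    | @cons n _ k _ x y e h =>
      obtain rfl : n = 0 := by simp at hn; exact hn
      cases h
      exact .inr ⟨i.2, j.2, by simpa⟩
  | succ t ih =>
    -- A walk of at most `2 ^ (t + 1)` edges is cut into two halves of at most `2 ^ t` edges.
    obtain ⟨a, b, rfl, ha, hb⟩ : ∃ a b, n = a + b ∧ a ≤ 2 ^ t ∧ b ≤ 2 ^ t := by
      rw [pow_succ] at hn
      exact ⟨min n (2 ^ t), n - min n (2 ^ t), by omega, by omega, by omega⟩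
    obtain ⟨l, y, z, h1, h2, rfl⟩ := h.split
    exact ⟨l, l.2.trans_le hD, y, z, ih ha h1, ih hb h2, rfl⟩

/-- The matrix `a` represents the least numbers `x` with `S i j x`, with `o` in the role of `0`
and `4 * o` in the role of infinity. -/
def Encodes (o D : ℕ) (S : ℕ → ℕ → ℤ → Prop) (a : ℕ → ℕ → ℕ) : Prop :=
  ∀ i < D, ∀ j < D, (∃ x, IsLeast {x | S i j x} x ∧ (a i j : ℤ) = x + o) ∨
    ((∀ x, ¬ S i j x) ∧ a i j = 4 * o)

/-- Loops in the digraph may be ignored on the diagonal: without negative cycles they are no better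
than the empty walk. -/
theorem encodes_zero (hw : w.NoNegativeCycle) {o : ℕ} {a : ℕ → ℕ → ℕ} (hd : ∀ i < D, a i i = o)
    (he : ∀ i < D, ∀ j < D, i ≠ j → ∀ x, w.Edge i j x → (a i j : ℤ) = x + o)
    (hn : ∀ i < D, ∀ j < D, i ≠ j → (∀ x, ¬ w.Edge i j x) → a i j = 4 * o) :
    Encodes o D (w.Reach D 0) a := by
  intro i hi j hj
  by_cases hij : i = j
  · subst hij
    refine .inl ⟨0, ⟨.inl ⟨rfl, rfl⟩, ?_⟩, by simp [hd i hi]⟩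
    rintro x (⟨-, rfl⟩ | ⟨_, _, e⟩)
    · exact le_rfl
    · simpa using hw _ _ (.cons e (.nil _))
  · by_cases h : ∃ x, w.Edge i j x
    · obtain ⟨x, h⟩ := h
      refine .inl ⟨x, ⟨.inr h, ?_⟩, he i hi j hj hij x h⟩
      rintro y (⟨h', -⟩ | ⟨_, _, e⟩)
      · exact absurd h' hij
      · obtain ⟨_, _, e'⟩ := h
        rw [e] at e'
        exact (Option.some_injective _ e').ge
    · push Not at h
      refine .inr ⟨?_, hn i hi j hj hij h⟩
      rintro x (⟨h', -⟩ | h')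
      · exact hij h'
      · exact h x h'

theorem Encodes.pos {o : ℕ} {S : ℕ → ℕ → ℤ → Prop} {a : ℕ → ℕ → ℕ} (h : Encodes o D S a)
    (hS : ∀ i j x, S i j x → |x| < o) (ho : 0 < o) {i j : ℕ} (hi : i < D) (hj : j < D) :
    0 < a i j := by
  rcases h i hi j hj with ⟨x, hx, e⟩ | ⟨-, e⟩
  · have := abs_lt.1 (hS i j x hx.1)
    omega
  · omega

theorem Encodes.finite_iff {o : ℕ} {S : ℕ → ℕ → ℤ → Prop} {a : ℕ → ℕ → ℕ} (h : Encodes o D S a)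
    (hS : ∀ i j x, S i j x → |x| < o) {i j : ℕ} (hi : i < D) (hj : j < D) :
    (∃ x, IsLeast {x | S i j x} x ∧ (a i j : ℤ) = x + o ∧ a i j < 2 * o) ∨
      ((∀ x, ¬ S i j x) ∧ a i j = 4 * o) := by
  rcases h i hi j hj with ⟨x, hx, e⟩ | h
  · have := abs_lt.1 (hS i j x hx.1)
    exact .inl ⟨x, hx, e, by omega⟩
  · exact .inr h

/-- A sum of two finite entries carries the offset twice, and if it is minimal it equals the new
distance plus `2 * o`, which is less than `3 * o`. A sum that involves infinity is above `4 * o`,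
because entries are positive. So the test `minSum < 4 * o` recognises the finite distances, and
subtracting `o` restores the encoding. -/
theorem Encodes.sq {I : MatrixInstance} {o t : ℕ}
    (h : Encodes o I.D (w.Reach I.D t) I.a) (hS : ∀ i j x, w.Reach I.D t i j x → |x| < o)
    (hS' : ∀ i j x, w.Reach I.D (t + 1) i j x → |x| < o) :
    (∀ i < I.D, ∀ j < I.D, I.minSum i j < 4 * o → o ≤ I.minSum i j) ∧
      Encodes o I.D (w.Reach I.D (t + 1)) (I.sq o) := by
  -- An entry never exceeds the shifted weight of a walk between its indices; so `minSum` is at most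
  -- the doubly shifted weight of any composed walk.
  have lower : ∀ {i l j}, i < I.D → l < I.D → j < I.D → ∀ y z, w.Reach I.D t i l y →
      w.Reach I.D t l j z → (I.a i l : ℤ) + I.a l j ≤ y + z + 2 * o := by
    intro i l j hi hl hj y z hy hz
    have key : ∀ {i j x}, i < I.D → j < I.D → w.Reach I.D t i j x → (I.a i j : ℤ) ≤ x + o := by
      intro i j x hi hj hx
      rcases h i hi j hj with ⟨x', hx', e⟩ | ⟨h', -⟩
      · have := hx'.2 hx
        omega
      · exact absurd hx (h' x)
    have := key hi hl hy
    have := key hl hj hz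
    omega
  have key : ∀ i < I.D, ∀ j < I.D, (∃ x, IsLeast {x | w.Reach I.D (t + 1) i j x} x ∧
      (I.minSum i j : ℤ) = x + 2 * o) ∨ ((∀ x, ¬ w.Reach I.D (t + 1) i j x) ∧
        4 * o ≤ I.minSum i j) := by
    intro i hi j hj
    obtain ⟨l, hl, e⟩ := I.exists_minSum i j
    by_cases hx : ∃ x, w.Reach I.D (t + 1) i j x
    · left
      obtain ⟨x, l', hl', y', z', hy', hz', rfl⟩ := hx
      -- The existence of one walk gives `minSum < 3 * o`, so the minimising `l` cannot involve an
      -- infinite entry.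
      have h1 := abs_lt.1 (hS' i j _ ⟨l', hl', y', z', hy', hz', rfl⟩)
      have h2 := lower hi hl' hj _ _ hy' hz'
      have h3 := I.minSum_le (i := i) (j := j) hl'
      rcases h.finite_iff hS hi hl with ⟨y, hy, ey, -⟩ | ⟨-, ey⟩
      · rcases h.finite_iff hS hl hj with ⟨z, hz, ez, -⟩ | ⟨-, ez⟩
        · refine ⟨y + z, ⟨⟨l, hl, y, z, hy.1, hz.1, rfl⟩, ?_⟩, by omega⟩
          rintro _ ⟨l₂, hl₂, y₂, z₂, hy₂, hz₂, rfl⟩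
          have := lower hi hl₂ hj _ _ hy₂ hz₂
          have := I.minSum_le (i := i) (j := j) hl₂
          omega
        · omega
      · omega
    · right
      push Not at hx
      refine ⟨hx, ?_⟩
      rcases h.finite_iff hS hi hl with ⟨y, hy, ey, -⟩ | ⟨-, ey⟩
      · rcases h.finite_iff hS hl hj with ⟨z, hz, ez, -⟩ | ⟨-, ez⟩
        · exact absurd ⟨l, hl, y, z, hy.1, hz.1, rfl⟩ (hx (y + z))
        · omega
      · omega
  constructor
  · intro i hi j hj hlt
    rcases key i hi j hj with ⟨x, hx, e⟩ | ⟨-, e⟩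
    · have := abs_lt.1 (hS' i j x hx.1)
      omega
    · omega
  · intro i hi j hj
    rcases key i hi j hj with ⟨x, hx, e⟩ | ⟨hx, e⟩
    · have := abs_lt.1 (hS' i j x hx.1)
      refine .inl ⟨x, hx, ?_⟩
      rw [MatrixInstance.sq, if_pos (by omega)]
      omega
    · exact .inr ⟨hx, by rw [MatrixInstance.sq, if_neg (by omega)]⟩

/-- Every walk can be replaced by one that is no heavier and has fewer than `m ≤ 2 ^ t` edges, so
the distances over short walks are the true distances. -/
theorem Encodes.isSolution_entry (hw : w.NoNegativeCycle) {o t : ℕ} {a : ℕ → ℕ → ℕ} (hD : m ≤ D)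
    (ht : m ≤ 2 ^ t) (h : Encodes o D (w.Reach D t) a)
    (hS : ∀ i j x, w.Reach D t i j x → |x| < o) (i j : Fin m) :
    ((∃ x, Walk w i j x) → a i j < 4 * o ∧ IsLeast {x | Walk w i j x} ((a i j : ℤ) - o)) ∧
      ((¬ ∃ x, Walk w i j x) → a i j = 4 * o) := by
  have toReach : ∀ x, Walk w i j x → ∃ y ≤ x, w.Reach D t i j y := by
    intro x hx
    obtain ⟨n, hn, y, hy, h'⟩ := hx.exists_short hw
    exact ⟨y, hy, h'.reach hD (by omega)⟩
  have toWalk : ∀ x, w.Reach D t i j x → Walk w i j x := by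
    intro x hx
    rcases hx.walk with ⟨e, rfl⟩ | ⟨_, _, h⟩
    · obtain rfl : i = j := Fin.ext e
      exact .nil i
    · exact h
  rcases h.finite_iff hS (i.2.trans_le hD) (j.2.trans_le hD) with ⟨x, hx, e, hlt⟩ | ⟨hx, e⟩
  · refine ⟨fun _ => ⟨by omega, ?_⟩, fun h => absurd ⟨x, toWalk x hx.1⟩ h⟩
    rw [e, add_sub_cancel_right]
    refine ⟨toWalk x hx.1, fun y hy => ?_⟩
    obtain ⟨z, hz, hz'⟩ := toReach y hy
    exact (hx.2 hz').trans hz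
  · refine ⟨fun ⟨x, h⟩ => ?_, fun _ => e⟩
    obtain ⟨y, -, hy⟩ := toReach x h
    exact absurd hy (hx y)

end WeightedDigraph

end StochasticParsing

/-! ### Initial constants: cube root and largest weight -/

namespace StochasticParsing

namespace WeightedDigraph

variable {m : ℕ} {w : WeightedDigraph m}

theorem input_intArr_zero (i j : Fin m) :
    w.input.intArr 0 ((i : ℕ) * m + (j : ℕ)) = (w i j).getD 0 := by
  have hi := i.2
  have hj := j.2
  have h : (0 : ℤ) ≤ (i : ℕ) * m + (j : ℕ) ∧ ((i : ℕ) * m + (j : ℕ) : ℤ) < m * m := by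
    constructor
    · positivity
    · have : (i : ℕ) * m + (j : ℕ) < m * m := by nlinarith
      exact_mod_cast this
  have e1 : (((i : ℕ) * m + (j : ℕ) : ℤ) / m).toNat = i := by
    have : ((i : ℕ) * m + (j : ℕ) : ℤ) = ((i * m + j : ℕ) : ℤ) := by push_cast; rfl
    rw [this, ← Int.natCast_ediv, Int.toNat_natCast, Nat.mul_comm,
      Nat.mul_add_div (by omega), Nat.div_eq_of_lt hj, Nat.add_zero]
  have e2 : (((i : ℕ) * m + (j : ℕ) : ℤ) % m).toNat = j := by
    have : ((i : ℕ) * m + (j : ℕ) : ℤ) = ((i * m + j : ℕ) : ℤ) := by push_cast; rfl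
    rw [this, ← Int.natCast_emod, Int.toNat_natCast, Nat.mul_add_mod_of_lt hj]
  simp only [input, h, and_self, dif_pos]
  congr 1
  congr 1 <;> exact Fin.ext (by assumption)

theorem input_intArr_one (i j : Fin m) :
    w.input.intArr 1 ((i : ℕ) * m + (j : ℕ)) = if (w i j).isSome then 1 else 0 := by
  have hi := i.2
  have hj := j.2
  have h : (0 : ℤ) ≤ (i : ℕ) * m + (j : ℕ) ∧ ((i : ℕ) * m + (j : ℕ) : ℤ) < m * m := by
    constructor
    · positivity
    · have : (i : ℕ) * m + (j : ℕ) < m * m := by nlinarith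
      exact_mod_cast this
  have e1 : (((i : ℕ) * m + (j : ℕ) : ℤ) / m).toNat = i := by
    have : ((i : ℕ) * m + (j : ℕ) : ℤ) = ((i * m + j : ℕ) : ℤ) := by push_cast; rfl
    rw [this, ← Int.natCast_ediv, Int.toNat_natCast, Nat.mul_comm,
      Nat.mul_add_div (by omega), Nat.div_eq_of_lt hj, Nat.add_zero]
  have e2 : (((i : ℕ) * m + (j : ℕ) : ℤ) % m).toNat = j := by
    have : ((i : ℕ) * m + (j : ℕ) : ℤ) = ((i * m + j : ℕ) : ℤ) := by push_cast; rfl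
    rw [this, ← Int.natCast_emod, Int.toNat_natCast, Nat.mul_add_mod_of_lt hj]
  simp only [input, h, and_self, dif_pos]
  have e3 : (⟨_, e1 ▸ i.2⟩ : Fin m) = i := Fin.ext e1
  have e4 : (⟨_, e2 ▸ j.2⟩ : Fin m) = j := Fin.ext e2
  rw [e3, e4]

theorem abs_input_intArr_le {W : ℕ} (hW : w.WeightsBounded W) (a : ℕ) (p : ℤ) :
    |w.input.intArr a p| ≤ W + 1 := by
  simp only [input]
  split
  · split
    · generalize he : w _ _ = e
      cases e with
      | none => simp; omega
      | some x =>
        have := hW _ _ _ he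
        simp only [Option.getD_some]
        omega
    · split <;> simp; omega
    · simp; omega
  · simp; omega

/-- The entries of the matrix that represents the edges. -/
def edgeEntry (w : WeightedDigraph m) (o i j : ℕ) : ℕ :=
  if i = j then o else
    if h : i < m ∧ j < m then
      ((w ⟨i, h.1⟩ ⟨j, h.2⟩).map fun x : ℤ => (x + o).toNat).getD (4 * o)
    else 4 * o

theorem edgeEntry_of_edge {W o i j : ℕ} (hW : w.WeightsBounded W) (ho : W < o) (hij : i ≠ j)
    {x : ℤ} (h : w.Edge i j x) : (w.edgeEntry o i j : ℤ) = x + o := by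
  obtain ⟨hi, hj, e⟩ := h
  have := abs_le.1 (hW _ _ _ e)
  rw [edgeEntry, if_neg hij, dif_pos ⟨hi, hj⟩, e]
  simp
  omega

theorem edgeEntry_of_not_edge {o i j : ℕ} (hij : i ≠ j) (h : ∀ x, ¬ w.Edge i j x) :
    w.edgeEntry o i j = 4 * o := by
  rw [edgeEntry, if_neg hij]
  split
  · rename_i h'
    cases e : w ⟨i, h'.1⟩ ⟨j, h'.2⟩ with
    | none => rfl
    | some x => exact absurd ⟨h'.1, h'.2, e⟩ (h x)
  · rfl

theorem edgeEntry_cases {W o : ℕ} (hW : w.WeightsBounded W) (ho : W < o) (i j : ℕ) :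
    0 < w.edgeEntry o i j ∧ w.edgeEntry o i j ≤ 4 * o := by
  by_cases hij : i = j
  · rw [edgeEntry, if_pos hij]
    omega
  · by_cases h : ∃ x, w.Edge i j x
    · obtain ⟨x, h⟩ := h
      have e := edgeEntry_of_edge hW ho hij h
      obtain ⟨_, _, h⟩ := h
      have := abs_le.1 (hW _ _ _ h)
      omega
    · push Not at h
      rw [edgeEntry_of_not_edge hij h]
      omega

end WeightedDigraph

/-- The memory during the setup phase; the registers below `20` hold `f`. -/
structure Setup {m : ℕ} (w : WeightedDigraph m) (β : ℤ) (f : ℕ → ℤ) (σ : State) : Prop where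
  bounded : Bounded β σ
  int : ∀ x < 20, σ.int x = f x
  weights : σ.intArr 0 = w.input.intArr 0
  adjacency : σ.intArr 1 = w.input.intArr 1
  intCopy : ∀ a i, σ.intArr (8 + a) i = 0
  realCopy : ∀ a i, σ.realArr (8 + a) i = 0

/-- Set register `1` to the least `d` with `m ≤ d ^ 3`. -/
def findRoot (X : Extension) : Program X :=
  .seq (assign X 1 1) <|
    whileLe (.reg 1 * .reg 1 * .reg 1 + 1) (.reg 0) (assign X 1 (.reg 1 + 1))

/-- Set register `7` to the maximum absolute value of an edge weight. -/
def findMaxWeight (X : Extension) : Program X :=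
  .seq (assign X 7 0) <| forLt 22 (.reg 0 * .reg 0) <|
    .seq (ifLe (.reg 7) (.get 0 (.reg 22)) (assign X 7 (.get 0 (.reg 22))) .skip)
      (ifLe (.reg 7) (0 - .get 0 (.reg 22)) (assign X 7 (0 - .get 0 (.reg 22))) .skip)

section Setup

variable {X : Extension} {B : ℕ} {β : ℤ} {m : ℕ} {w : WeightedDigraph m} {f : ℕ → ℤ} {σ : State}

theorem Setup.setInt (h : Setup w β f σ) {x : ℕ} (hx : 20 ≤ x) {v : ℤ} (hv : |v| ≤ β) :
    Setup w β f (σ.setInt x v) :=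
  ⟨h.1.setInt hv, fun y hy => (Function.update_of_ne (by omega) _ _).trans (h.2 y hy), h.3, h.4,
    h.5, h.6⟩

theorem Setup.setConst (h : Setup w β f σ) (x : ℕ) {v : ℤ} (hv : |v| ≤ β) :
    Setup w β (Function.update f x v) (σ.setInt x v) := by
  refine ⟨h.1.setInt hv, fun y hy => ?_, h.3, h.4, h.5, h.6⟩
  by_cases e : y = x
  · subst e; simp [State.setInt]
  · simpa [State.setInt, Function.update_of_ne e] using h.2 y hy

theorem Setup.setIntArr (h : Setup w β f σ) {a : ℕ} (ha : 2 ≤ a) (ha' : a < 8) (i : ℤ) {v : ℤ}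
    (hv : |v| ≤ β) : Setup w β f (σ.setIntArr a i v) := by
  have e : ∀ b ≠ a, (σ.setIntArr a i v).intArr b = σ.intArr b :=
    fun b hb => Function.update_of_ne hb _ _
  exact ⟨h.1.setIntArr (.inl hv), h.2, by rw [e _ (by omega), h.3], by rw [e _ (by omega), h.4],
    fun b j => by rw [e _ (by omega), h.5], h.6⟩

theorem Setup.setRealArr (h : Setup w β f σ) {a : ℕ} (ha : a < 8) (i : ℤ) (v : ℝ) :
    Setup w β f (σ.setRealArr a i v) :=
  ⟨h.1, h.2, h.3, h.4, h.5, fun b j => by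
    rw [← h.6 b j]
    simp only [State.setRealArr]
    rw [Function.update_of_ne (by omega)]⟩

theorem setup_input {W : ℕ} (hW : w.WeightsBounded W) (hm : (m : ℤ) ≤ β) (hβ : (W : ℤ) + 1 ≤ β) :
    Setup w β w.input.int w.input := by
  refine ⟨⟨fun x _ => ?_, fun a _ i => (w.abs_input_intArr_le hW a i).trans hβ⟩, fun _ _ => rfl,
    rfl, rfl, fun a i => ?_, fun _ _ => rfl⟩
  · match x with
    | 0 => simpa [WeightedDigraph.input] using hm
    | x + 1 => simp [WeightedDigraph.input]; omega
  · simp only [WeightedDigraph.input]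
    split
    · split <;> first | rfl | omega
    · rfl

/-- A linear search suffices, as it takes fewer than `m` rounds. Rounding up to a cube loses at most
a factor `8`, because consecutive positive integers differ by at most a factor `2`. -/
theorem Run.findRoot (hB : Ample β B) (h : Setup w β f σ) (h0 : f 0 = m) (hm : 1 ≤ m) :
    Run B (findRoot X) σ (1000 * m) fun τ => ∃ d, 1 ≤ d ∧ m ≤ d * d * d ∧ d * d * d ≤ 8 * m ∧
      Setup w β (Function.update f 1 d) τ := by
  have hmβ : (m : ℤ) ≤ β := by
    have := h.bounded.1 0 (by norm_num)
    rwa [h.int 0 (by norm_num), h0, Nat.abs_cast] at this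
  refine Run.mono (K := 130 + ((m - 1) * (130 + 250) + 250)) ?_ (by omega) fun _ h => h
  refine Run.seq (Run.assign hB h.bounded (by decide) ?_)
  have h1 : Setup w β (Function.update f 1 (1 : ℕ)) (σ.setInt 1 1) :=
    h.setConst 1 (by have := hB.base; simp; omega)
  refine Run.whileLe hB (fun n τ => ∃ d, 1 ≤ d ∧ d + n = m ∧ (d = 1 ∨ ∃ d', d = d' + 1 ∧
    d' * d' * d' < m ∧ 1 ≤ d') ∧ Setup w β (Function.update f 1 d) τ) (by decide) (by decide)
    (fun n τ ⟨d, h⟩ => h.2.2.2.bounded) ?_ ?_ ⟨1, le_rfl, by omega, .inl rfl, h1⟩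
  · rintro n τ ⟨d, hd, hn, hd', hτ⟩ hle
    simp [hτ.int, h0] at hle
    have hle' : d * d * d + 1 ≤ m := by exact_mod_cast hle
    have hdd : d ≤ d * d * d := by
      rw [mul_assoc]
      exact Nat.le_mul_of_pos_right _ (by positivity)
    refine ⟨n - 1, by omega, Run.assign hB hτ.bounded (by decide) ⟨d + 1, by omega, by omega,
      .inr ⟨d, rfl, by omega, hd⟩, ?_⟩⟩
    have e : (.reg 1 + 1 : Ex).eval τ = (d + 1 : ℕ) := by simp [hτ.int]
    rw [e]
    have := hτ.setConst 1 (v := (d + 1 : ℕ)) (by rw [Nat.abs_cast]; omega)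
    rwa [Function.update_idem] at this
  · rintro n τ ⟨d, hd, hn, hd', hτ⟩ hlt
    simp [hτ.int, h0] at hlt
    have hlt' : m ≤ d * d * d := by
      have : (m : ℤ) < ((d * d * d + 1 : ℕ) : ℤ) := by push_cast; linarith
      have : m < d * d * d + 1 := by exact_mod_cast this
      omega
    refine ⟨d, hd, hlt', ?_, hτ⟩
    rcases hd' with rfl | ⟨e, rfl, he, he'⟩
    · omega
    · have : (e + 1) * (e + 1) * (e + 1) ≤ (2 * e) * (2 * e) * (2 * e) := by
        gcongr <;> omega
      nlinarith

/-- The bound `W` is not part of the input, so the program determines a bound of its own. Missing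
edges are stored as `0` and do no harm. -/
theorem Run.findMaxWeight (hB : Ample β B) (h : Setup w β f σ) (h0 : f 0 = m) {W : ℕ}
    (hW : w.WeightsBounded W) (hWβ : (W : ℤ) ≤ β) (hm : (m : ℤ) * m ≤ β) :
    Run B (findMaxWeight X) σ (2000 * (m * m + 1)) fun τ => ∃ W' ≤ W, w.WeightsBounded W' ∧
      Setup w β (Function.update f 7 W') τ := by
  have hβ0 := hB.base
  have hWin : ∀ p, |w.input.intArr 0 p| ≤ W := by
    intro p
    simp only [WeightedDigraph.input]
    split
    · generalize he : w _ _ = e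
      cases e with
      | none => simp
      | some x => exact hW _ _ _ he
    · simp
  refine Run.mono (K := 130 + (m * m + 1) * (760 + 400)) ?_ (by omega)
    fun _ h => h
  refine Run.seq (Run.assign hB h.bounded (by decide) ?_)
  have h1 : Setup w β (Function.update f 7 (0 : ℕ)) (σ.setInt 7 0) :=
    h.setConst 7 (by simp; omega)
  refine Run.forLt hB (fun k τ => τ.int 22 = k ∧ ∃ W' ≤ W, (∀ p < k, |w.input.intArr 0 p| ≤ W') ∧
    Setup w β (Function.update f 7 W') τ) (by norm_num) (by decide) h1.bounded
    ⟨by simp [State.setInt], 0, Nat.zero_le _, by omega, h1.setInt (by norm_num) (by simp; omega)⟩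
    ?_ ?_ ?_
  · rintro k hk τ ⟨e, W', hW', -, hτ⟩
    exact ⟨hτ.bounded, by simp [hτ.int, h0], e⟩
  · rintro k hk τ ⟨e, W', hW', hp, hτ⟩
    have hk' : (k : ℤ) + 1 ≤ β := by
      have : ((k + 1 : ℕ) : ℤ) ≤ (m * m : ℕ) := by exact_mod_cast hk
      push_cast at this
      linarith
    have e0 : (Ex.get 0 (.reg 22)).eval τ = w.input.intArr 0 k := by
      simp [e, hτ.weights]
    have step : ∀ (e' : Ex) (τ : State) (W' : ℕ) (v : ℤ), e'.ok 30 = true → e'.ok 31 = true →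
        (∀ τ : State, τ.int 22 = k → τ.intArr 0 = w.input.intArr 0 → e'.eval τ = v) → |v| ≤ W →
        W' ≤ W → τ.int 22 = k → Setup w β (Function.update f 7 W') τ →
        Run B (StochasticParsing.ifLe (.reg 7) e' (StochasticParsing.assign X 7 e') .skip) τ
          (130 + 250) fun υ => υ.int 22 = k ∧ ∃ W'' ≤ W, v ≤ W'' ∧ W' ≤ W'' ∧
            Setup w β (Function.update f 7 W'') υ := by
      intro e' τ W' v he' he'' hv hvW hW' e hτ
      have hev := hv τ e hτ.weights
      have e7 : (Ex.reg 7).eval τ = W' := by simp [hτ.int]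
      refine Run.ifLe hB hτ.bounded (by decide) he'' (fun hc => ?_) (fun hc => ?_)
      · rw [e7, hev] at hc
        refine Run.assign hB hτ.bounded he' ⟨by simpa [State.setInt] using e, v.toNat, ?_, ?_, ?_,
          ?_⟩
        · have := abs_le.1 hvW; omega
        · omega
        · omega
        · rw [hev]
          have := hτ.setConst 7 (v := v) (hvW.trans hWβ)
          rw [Function.update_idem] at this
          rwa [Int.toNat_of_nonneg (by omega)]
      · rw [e7, hev] at hc
        exact (Run.skip ⟨e, W', hW', by omega, le_rfl, hτ⟩).mono (by norm_num) fun _ h => h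
    have hv := hWin k
    refine Run.seq (K := 380) (L := 380) ((step (.get 0 (.reg 22)) τ W' _ (by decide) (by decide)
      (fun τ h1 h2 => by simp [h1, h2]) hv hW' e hτ).mono le_rfl ?_)
    rintro υ ⟨eυ, W₂, hW₂, h2, h3, hυ⟩
    refine (step (0 - .get 0 (.reg 22)) υ W₂ (-(w.input.intArr 0 k)) (by decide) (by decide)
      (fun τ h1 h2 => by simp [h1, h2]) (by rwa [abs_neg]) hW₂ eυ hυ).mono le_rfl ?_
    rintro ω ⟨eω, W₃, hW₃, h4, h5, hω⟩
    refine ⟨hω.bounded, eω, by simp [State.setInt], W₃, hW₃, fun p hp' => ?_,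
      hω.setInt (by norm_num) (by rw [abs_le]; constructor <;> omega)⟩
    rcases Nat.lt_succ_iff_lt_or_eq.1 hp' with hp' | rfl
    · have := hp p hp'
      omega
    · rw [abs_le]
      constructor <;> omega
  · rintro τ ⟨-, W', hW', hp, hτ⟩
    refine ⟨W', hW', fun i j x hx => ?_, hτ⟩
    have h1 := hp ((i : ℕ) * m + j) (by have := i.2; have := j.2; nlinarith)
    push_cast at h1
    rw [WeightedDigraph.input_intArr_zero, hx] at h1
    exact h1

end Setup

end StochasticParsing

/-! ### Table of scales and initial matrix -/

namespace StochasticParsing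

/-- Write the table of scales to the real array `0`. -/
def initTable (X : Extension) : Program X :=
  .seq (storeReal X 0 0 (.mul (.div (.div (.cast 1) (.cast (.reg 2 * 16)))
    (.mul (.cast (.reg 2 * .reg 6)) (.cast (.reg 2 * .reg 6)))) (.cast (.reg 6)))) <|
  forLt 22 (4 * .reg 1 - 1) <|
    storeReal X 0 (.reg 22 + 1) (.div (.get 0 (.reg 22)) (.cast (2 * (2 * .reg 1 + 1))))

/-- Write the entry for infinity in row `22` and column `23` of the matrix. -/
def storeInfinity (X : Extension) : Program X :=
  store X 4 (.reg 22 * .reg 4 + .reg 23) (4 * .reg 5)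

/-- Write the entry in row `22` and column `23` of the matrix, off the diagonal. -/
def initOffDiagonal (X : Extension) : Program X :=
  ifLe (.reg 22 + 1) (.reg 0)
    (ifLe (.reg 23 + 1) (.reg 0)
      (ifLe 1 (.get 1 (.reg 22 * .reg 0 + .reg 23))
        (store X 4 (.reg 22 * .reg 4 + .reg 23) (.get 0 (.reg 22 * .reg 0 + .reg 23) + .reg 5))
        (storeInfinity X))
      (storeInfinity X))
    (storeInfinity X)

/-- Write the entry in row `22` and column `23` of the matrix. -/
def initEntry (X : Extension) : Program X :=
  ifLe (.reg 22) (.reg 23)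
    (ifLe (.reg 23) (.reg 22) (store X 4 (.reg 22 * .reg 4 + .reg 23) (.reg 5))
      (initOffDiagonal X))
    (initOffDiagonal X)

def initMatrix (X : Extension) : Program X :=
  forLt 22 (.reg 4) (forLt 23 (.reg 4) (initEntry X))

def initConstants (X : Extension) : Program X :=
  .seq (findRoot X) <| .seq (findMaxWeight X) <| .seq (assign X 2 (.reg 1 * .reg 1)) <|
  .seq (assign X 3 (.reg 2 * .reg 2)) <| .seq (assign X 4 (.reg 2 * .reg 1)) <|
  .seq (assign X 5 (2 * .reg 0 * .reg 7 + 1)) <| .seq (assign X 6 (32 * .reg 5 * .reg 5)) <|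
  assign X 8 1

section Init

variable {X : Extension} {B : ℕ} {β : ℤ} {m : ℕ} {w : WeightedDigraph m} {f : ℕ → ℤ} {σ : State}

/-- The offset `o = 2 m W' + 1` exceeds the weight of all walks of at most `2 m` edges, and `Q = 32
o²` exceeds the product of two entries, each at most `4 o`. All constants are bounded by multiples
of the fourth power of `m + W + 2`. -/
theorem Run.initConstants (hB : Ample β B) {W : ℕ} (hW : w.WeightsBounded W) (hm : 1 ≤ m)
    (hβ : 1000000 * ((m : ℤ) + W + 2) ^ 4 ≤ β) :
    Run B (StochasticParsing.initConstants X) w.input (6000 * (m * m)) fun τ => ∃ d W' : ℕ, 1 ≤ d ∧ m ≤ d * d * d ∧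
      d * d * d ≤ 8 * m ∧ W' ≤ W ∧ w.WeightsBounded W' ∧ ∃ f : ℕ → ℤ, Setup w β f τ ∧ f 0 = m ∧
      f 1 = d ∧ f 2 = (d * d : ℕ) ∧ f 3 = (d * d * (d * d) : ℕ) ∧ f 4 = (d * d * d : ℕ) ∧
      f 5 = (2 * m * W' + 1 : ℕ) ∧ f 6 = (32 * (2 * m * W' + 1) * (2 * m * W' + 1) : ℕ) ∧
      f 8 = 1 ∧ f 15 = 0 := by
  have hm' : (1 : ℤ) ≤ m := by exact_mod_cast hm
  have hW0 : (0 : ℤ) ≤ W := by positivity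
  have N1 : (1 : ℤ) ≤ m + W + 2 := by linarith
  have p1 : (m : ℤ) + W + 2 ≤ ((m : ℤ) + W + 2) ^ 4 := le_self_pow₀ N1 (by norm_num)
  have p2 : ((m : ℤ) + W + 2) ^ 2 ≤ ((m : ℤ) + W + 2) ^ 4 := pow_le_pow_right₀ N1 (by norm_num)
  have p3 : (m : ℤ) * m ≤ ((m : ℤ) + W + 2) ^ 2 := by nlinarith
  have p4 : (0 : ℤ) < ((m : ℤ) + W + 2) ^ 4 := by positivity
  have hmm : m ≤ m * m := Nat.le_mul_of_pos_left _ hm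
  have h0 := setup_input hW (β := β) (by linarith) (by linarith)
  refine Run.mono (K := 1000 * m + (2000 * (m * m + 1) + (130 + (130 + (130 + (130 + (130 + 130))))))) ?_
    (by omega) fun _ h => h
  refine Run.seq ((Run.findRoot hB h0 rfl hm).mono le_rfl ?_)
  rintro τ ⟨d, hd, hd1, hd2, h1⟩
  refine Run.seq ((Run.findMaxWeight hB h1 (by simp [WeightedDigraph.input]) hW (by linarith)
    (by linarith)).mono le_rfl ?_)
  rintro τ ⟨W', hW', hWb, h2⟩
  have hdd : d ≤ d * d := Nat.le_mul_of_pos_left _ hd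
  have hd2' : d * d ≤ d * d * d := Nat.le_mul_of_pos_right _ hd
  have b2 : ((d * d : ℕ) : ℤ) ≤ β := by
    have : ((d * d : ℕ) : ℤ) ≤ ((8 * m : ℕ) : ℤ) := by exact_mod_cast hd2'.trans hd2
    push_cast at this ⊢
    linarith
  have b3 : ((d * d * (d * d) : ℕ) : ℤ) ≤ β := by
    have : ((d * d * (d * d) : ℕ) : ℤ) ≤ ((8 * m * (8 * m) : ℕ) : ℤ) := by
      exact_mod_cast Nat.mul_le_mul (hd2'.trans hd2) (hd2'.trans hd2)
    push_cast at this ⊢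
    nlinarith
  have b4 : ((d * d * d : ℕ) : ℤ) ≤ β := by
    have : ((d * d * d : ℕ) : ℤ) ≤ ((8 * m : ℕ) : ℤ) := by exact_mod_cast hd2
    push_cast at this ⊢
    linarith
  have hW'' : (W' : ℤ) ≤ W := by exact_mod_cast hW'
  have o1 : ((2 * m * W' + 1 : ℕ) : ℤ) ≤ ((m : ℤ) + W + 2) ^ 2 := by
    push_cast
    nlinarith [mul_le_mul_of_nonneg_left hW'' (by linarith : (0 : ℤ) ≤ m)]
  have b5 : ((2 * m * W' + 1 : ℕ) : ℤ) ≤ β := by linarith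
  have b6 : ((32 * (2 * m * W' + 1) * (2 * m * W' + 1) : ℕ) : ℤ) ≤ β := by
    have : ((2 * m * W' + 1 : ℕ) : ℤ) * ((2 * m * W' + 1 : ℕ) : ℤ)
        ≤ ((m : ℤ) + W + 2) ^ 2 * ((m : ℤ) + W + 2) ^ 2 :=
      mul_le_mul o1 o1 (by positivity) (by positivity)
    rw [← pow_add] at this
    push_cast at this ⊢
    linarith
  have key : ∀ (e : Ex) (x : ℕ) (v : ℕ) (τ : State) (f : ℕ → ℤ), Setup w β f τ → (v : ℤ) ≤ β →
      e.ok 30 = true → e.eval τ = v → ∀ (Q : State → Prop) (p : Program X) (K : ℕ),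
      (∀ τ, Setup w β (Function.update f x v) τ → Run B p τ K Q) →
      Run B (.seq (StochasticParsing.assign X x e) p) τ (130 + K) Q := by
    intro e x v τ f hτ hv he ev Q p K hp
    refine Run.seq (Run.assign hB hτ.bounded he ?_)
    rw [ev]
    exact hp _ (hτ.setConst x (by rwa [Nat.abs_cast]))
  refine key _ 2 (d * d) τ _ h2 b2 (by decide) (by simp [h2.int]) _ _ _ fun τ h3 => ?_
  refine key _ 3 (d * d * (d * d)) τ _ h3 b3 (by decide) (by simp [h3.int]) _ _ _ fun τ h4 => ?_
  refine key _ 4 (d * d * d) τ _ h4 b4 (by decide) (by simp [h4.int]) _ _ _ fun τ h5 => ?_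
  refine key _ 5 (2 * m * W' + 1) τ _ h5 b5 (by decide)
    (by simp [h5.int, WeightedDigraph.input]) _ _ _ fun τ h6 => ?_
  refine key _ 6 (32 * (2 * m * W' + 1) * (2 * m * W' + 1)) τ _ h6 b6 (by decide)
    (by simp [h6.int]) _ _ _ fun τ h7 => ?_
  have h8 := h7.setConst 8 (v := 1) (by have := hB.base; simp; omega)
  refine Run.assign hB h7.bounded (by decide) ⟨d, W', hd, hd1, hd2, hW', hWb, _, h8, ?_⟩
  simp [WeightedDigraph.input]

/-- Consecutive scales differ by the factor `step`, so one division yields the next; the additional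
factor `Q` is the one in the thresholds `(Q - s) Q`. -/
theorem Run.initTable (hB : Ample β B) (h : Setup w β f σ) (I : MatrixInstance) (h1 : f 1 = I.d)
    (h2 : f 2 = I.d2) (h6 : f 6 = I.Q) (hd : (4 * I.d : ℤ) ≤ β) :
    Run B (StochasticParsing.initTable X) σ (4000 * I.d) fun τ => Setup w β f τ ∧
      ∀ n < 4 * I.d, τ.realArr 0 n = I.scale n * I.Q := by
  have hd0 := I.d_pos
  refine Run.mono (K := 350 + (4 * I.d - 1 + 1) * (350 + 400)) ?_ (by omega) fun _ h => h
  refine Run.seq (Run.storeReal hB h.bounded (by decide) (by decide) ?_)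
  have hs := h.setRealArr (a := 0) (by norm_num) ((0 : Ex).eval σ)
    ((RealEx.mul (.div (.div (.cast 1) (.cast (.reg 2 * 16)))
    (.mul (.cast (.reg 2 * .reg 6)) (.cast (.reg 2 * .reg 6)))) (.cast (.reg 6))).eval σ)
  have pd2 : (I.d2 : ℝ) ≠ 0 := by exact_mod_cast I.d2_pos.ne'
  have pQ : (I.Q : ℝ) ≠ 0 := by exact_mod_cast I.Q_pos.ne'
  have hβ := hB.base
  refine Run.forLt hB (fun k τ => Setup w β f τ ∧ τ.int 22 = k ∧
    ∀ n ≤ k, τ.realArr 0 n = I.scale n * I.Q) (by norm_num) (by decide) hs.bounded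
    ⟨hs.setInt (by norm_num) (by simp; omega), by simp [State.setInt], ?_⟩ ?_ ?_ ?_
  · intro n hn
    obtain rfl : n = 0 := by omega
    simp [State.setInt, State.setRealArr, RealEx.eval, h.int, h2, h6, MatrixInstance.scale]
    left
    field_simp
  · rintro k hk τ ⟨hτ, e, -⟩
    refine ⟨hτ.bounded, ?_, e⟩
    simp [hτ.int, h1]
    omega
  · rintro k hk τ ⟨hτ, e, ht⟩
    refine Run.storeReal hB hτ.bounded (by decide) (by decide) ?_
    have hτ' := hτ.setRealArr (a := 0) (by norm_num) ((.reg 22 + 1 : Ex).eval τ)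
      ((RealEx.div (.get 0 (.reg 22)) (.cast (2 * (2 * .reg 1 + 1)))).eval τ)
    refine ⟨hτ'.bounded, by simpa [State.setRealArr] using e, hτ'.setInt (by norm_num)
      (by rw [abs_le]; constructor <;> omega), by simp [State.setInt], fun n hn => ?_⟩
    by_cases hn' : n = k + 1
    · subst hn'
      have := ht k le_rfl
      simp [State.setInt, State.setRealArr, RealEx.eval, hτ.int, h1, e, this,
        MatrixInstance.scale, MatrixInstance.step, pow_succ]
      field_simp
    · have h' : (n : ℤ) ≠ k + 1 := by exact_mod_cast hn'
      have := ht n (by omega)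
      simpa [State.setInt, State.setRealArr, e, h'] using this
  · rintro τ ⟨hτ, -, ht⟩
    exact ⟨hτ, fun n hn => ht n (by omega)⟩

theorem Run.initEntry (hB : Ample β B) (h : Setup w β f σ) {o D : ℕ} (h0 : f 0 = m)
    (h4 : f 4 = D) (h5 : f 5 = o) {W : ℕ} (hW : w.WeightsBounded W) (ho : W < o) {i j : ℕ}
    (ei : σ.int 22 = i) (ej : σ.int 23 = j) {Q : State → Prop}
    (hQ : Q (σ.setIntArr 4 (i * D + j : ℕ) (w.edgeEntry o i j))) :
    Run B (StochasticParsing.initEntry X) σ 1500 Q := by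
  have ad : (.reg 22 * .reg 4 + .reg 23 : Ex).eval σ = (i * D + j : ℕ) := by
    simp [ei, ej, h.int, h4]
  have eo : (4 * .reg 5 : Ex).eval σ = (4 * o : ℕ) := by simp [h.int, h5]
  have inf : w.edgeEntry o i j = 4 * o → Run B (storeInfinity X) σ 250 Q := by
    intro e
    refine Run.store hB h.bounded (by decide) (by decide) ?_
    rwa [ad, eo, ← e]
  have off : i ≠ j → Run B (initOffDiagonal X) σ (250 + 250 + 250 + 250) Q := by
    intro hij
    refine Run.ifLe hB h.bounded (by decide) (by decide) (fun hi => ?_) (fun hi => ?_)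
    · simp [ei, h.int, h0] at hi
      have hi' : i < m := by omega
      refine Run.ifLe hB h.bounded (by decide) (by decide) (fun hj => ?_) (fun hj => ?_)
      · simp [ej, h.int, h0] at hj
        have hj' : j < m := by omega
        have e0 := w.input_intArr_zero ⟨i, hi'⟩ ⟨j, hj'⟩
        have e1 := w.input_intArr_one ⟨i, hi'⟩ ⟨j, hj'⟩
        have g1 : (Ex.get 1 (.reg 22 * .reg 0 + .reg 23)).eval σ
            = if (w ⟨i, hi'⟩ ⟨j, hj'⟩).isSome then 1 else 0 := by
          rw [← e1]
          simp [ei, ej, h.int, h0, h.adjacency]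
        have g0 : (Ex.get 0 (.reg 22 * .reg 0 + .reg 23)).eval σ
            = (w ⟨i, hi'⟩ ⟨j, hj'⟩).getD 0 := by
          rw [← e0]
          simp [ei, ej, h.int, h0, h.weights]
        refine Run.ifLe hB h.bounded (by decide) (by decide) (fun hc => ?_) (fun hc => ?_)
        · rw [g1] at hc
          cases e : w ⟨i, hi'⟩ ⟨j, hj'⟩ with
          | none => simp [e] at hc
          | some x =>
            refine Run.store hB h.bounded (by decide) (by decide) ?_
            have v : (Ex.get 0 (.reg 22 * .reg 0 + .reg 23) + .reg 5).eval σ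
                = w.edgeEntry o i j := by
              rw [WeightedDigraph.edgeEntry_of_edge hW ho hij ⟨hi', hj', e⟩, Ex.eval_add, g0, e]
              simp [h.int, h5]
            rwa [ad, v]
        · rw [g1] at hc
          refine inf (WeightedDigraph.edgeEntry_of_not_edge hij ?_)
          rintro x ⟨_, _, e⟩
          simp [e] at hc
      · simp [ej, h.int, h0] at hj
        refine (inf (WeightedDigraph.edgeEntry_of_not_edge hij ?_)).mono (by norm_num) fun _ h => h
        rintro x ⟨_, _, _⟩
        omega
    · simp [ei, h.int, h0] at hi
      refine (inf (WeightedDigraph.edgeEntry_of_not_edge hij ?_)).mono (by norm_num) fun _ h => h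
      rintro x ⟨_, _, _⟩
      omega
  refine Run.ifLe (K := 1250) hB h.bounded (by decide) (by decide) (fun hi => ?_) (fun hi => ?_)
  · simp [ei, ej] at hi
    refine Run.ifLe (K := 1000) hB h.bounded (by decide) (by decide) (fun hj => ?_) (fun hj => ?_)
    · simp [ei, ej] at hj
      obtain rfl : i = j := by omega
      refine (Run.store hB h.bounded (by decide) (by decide) ?_).mono (by norm_num) fun _ h => h
      have e : w.edgeEntry o i i = o := by simp [WeightedDigraph.edgeEntry]
      rw [e] at hQ
      rw [ad]
      simpa [h.int, h5] using hQ
    · simp [ei, ej] at hj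
      exact off (by omega)
  · simp [ei, ej] at hi
    exact (off (by omega)).mono (by norm_num) fun _ h => h

/-- The invariant speaks of the first `n` cells in row-major order, so the ends of the inner loop
and of a row fit together without a case distinction. -/
theorem Run.initMatrix (hB : Ample β B) (h : Setup w β f σ) {o D : ℕ} (h0 : f 0 = m)
    (h4 : f 4 = D) (h5 : f 5 = o) {W : ℕ} (hW : w.WeightsBounded W) (ho : W < o)
    (hoβ : (4 * o : ℤ) ≤ β) (hD : (D : ℤ) ≤ β) :
    Run B (StochasticParsing.initMatrix X) σ ((D + 1) * ((D + 1) * (1500 + 400) + 400)) fun τ => Setup w β f τ ∧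
      τ.realArr = σ.realArr ∧ ∀ i < D, ∀ j < D, τ.intArr 4 (i * D + j) = w.edgeEntry o i j := by
  have hβ := hB.base
  let I : ℕ → State → Prop := fun n τ => Setup w β f τ ∧ τ.realArr = σ.realArr ∧
    ∀ k < n, τ.intArr 4 k = w.edgeEntry o (k / D) (k % D)
  have hI : ∀ n τ x v, I n τ → 22 ≤ x → |v| ≤ β → I n (τ.setInt x v) :=
    fun n τ x v h hx hv => ⟨h.1.setInt (by omega) hv, h.2.1, h.2.2⟩
  have e4 : ∀ n τ, I n τ → (Ex.reg 4).eval τ = D :=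
    fun n τ h => (h.1.int 4 (by norm_num)).trans h4
  refine Run.forLt hB (fun i τ => I (i * D) τ ∧ τ.int 22 = i) (by norm_num) (by decide) h.bounded
    ⟨⟨h.setInt (by norm_num) (by simp; omega), rfl, by simp⟩, by simp [State.setInt]⟩
    (fun i _ τ h => ⟨h.1.1.bounded, e4 _ _ h.1, h.2⟩) (fun i hi τ h => ?_) fun τ h => ?_
  · refine (Run.forLt hB (fun j τ => I (i * D + j) τ ∧ τ.int 22 = i ∧ τ.int 23 = j) (by norm_num)
      (by decide) h.1.1.bounded ⟨hI _ _ _ _ h.1 (by norm_num) (by simp; omega),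
        by simpa [State.setInt] using h.2, by simp [State.setInt]⟩
      (fun j _ τ h => ⟨h.1.1.bounded, e4 _ _ h.1, h.2.2⟩) (fun j hj τ h => ?_)
      fun τ h => h).mono le_rfl ?_
    · obtain ⟨⟨h1, h2, h3⟩, e22, e23⟩ := h
      have hent := WeightedDigraph.edgeEntry_cases hW ho i j
      have hs := h1.setIntArr (a := 4) (by norm_num) (by norm_num) (i * D + j : ℕ)
        (v := w.edgeEntry o i j) (by rw [Nat.abs_cast]; omega)
      refine Run.initEntry hB h1 h0 h4 h5 hW ho e22 e23 ⟨hs.bounded, e23, ?_,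
        by simpa [State.setInt, State.setIntArr] using e22, by simp [State.setInt]⟩
      refine hI _ _ _ _ ⟨hs, h2, fun k hk => ?_⟩ (by norm_num)
        (by rw [abs_le]; constructor <;> omega)
      by_cases e : k = i * D + j
      · subst e
        have d1 : (i * D + j) / D = i := by
          rw [Nat.mul_comm, Nat.mul_add_div (by omega), Nat.div_eq_of_lt hj, Nat.add_zero]
        have d2 : (i * D + j) % D = j := Nat.mul_add_mod_of_lt hj
        rw [d1, d2]
        simp [State.setIntArr]
      · rw [← h3 k (by omega)]
        simp only [State.setIntArr, Function.update_self]
        exact Function.update_of_ne (by exact_mod_cast e) _ _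
    · rintro τ ⟨h1, h2, -⟩
      refine ⟨h1.1.bounded, h2, ?_, by simp [State.setInt]⟩
      rw [Nat.add_mul, Nat.one_mul]
      exact hI _ _ _ _ h1 le_rfl (by rw [abs_le]; constructor <;> omega)
  · obtain ⟨⟨h1, h2, h3⟩, -⟩ := h
    refine ⟨h1, h2, fun i hi j hj => ?_⟩
    have := h3 (i * D + j) (by nlinarith)
    rw [Nat.mul_add_mod_of_lt hj, Nat.mul_comm, Nat.mul_add_div (by omega), Nat.div_eq_of_lt hj,
      Nat.add_zero, Nat.mul_comm] at this
    exact_mod_cast this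

end Init

end StochasticParsing

/-! ### The invariant of the repeated squaring -/

namespace StochasticParsing

/-- The memory after `t` squarings. -/
def Stage {m : ℕ} (w : WeightedDigraph m) (β : ℤ) (o t : ℕ) (I : MatrixInstance) (σ : State) :
    Prop :=
  Tabled I o β m t σ ∧ Bounded β σ ∧ (∀ c < m, t ≤ c → Fresh m c σ) ∧ σ.int 8 = (2 ^ t : ℕ) ∧
    2 ^ t ≤ 2 * m ∧ WeightedDigraph.Encodes o I.D (w.Reach I.D t) I.a

def setup (X : Extension) : Program X :=
  .seq (initConstants X) (.seq (initTable X) (initMatrix X))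

/-- Square the matrix, and count the call of the parser. -/
def squareStep {X : Extension} (b : ℕ) (pre qry : Program X) : Program X :=
  .seq (square b pre qry) (.seq (assign X 15 (.reg 15 + 1)) (assign X 8 (2 * .reg 8)))

def squareLoop {X : Extension} (b : ℕ) (pre qry : Program X) : Program X :=
  whileLe (.reg 8 + 1) (.reg 0) (squareStep b pre qry)

def output (X : Extension) : Program X :=
  forLt 22 (.reg 0) <| forLt 23 (.reg 0) <|
    ifLe (.get 4 (.reg 22 * .reg 4 + .reg 23) + 1) (4 * .reg 5)
      (.seq (store X 3 (.reg 22 * .reg 0 + .reg 23) 1)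
        (store X 2 (.reg 22 * .reg 0 + .reg 23) (.get 4 (.reg 22 * .reg 4 + .reg 23) - .reg 5)))
      (store X 3 (.reg 22 * .reg 0 + .reg 23) 0)

def apsp {X : Extension} (b : ℕ) (pre qry : Program X) : Program X :=
  .seq (setup X) (.seq (squareLoop b pre qry) (output X))

namespace MatrixInstance

variable (I : MatrixInstance)

theorem sq_le (o i j : ℕ) : I.sq o i j ≤ 4 * o := by
  unfold sq
  split <;> omega

/-- The instance for the square of the matrix. -/
def next (o : ℕ) (ho : 0 < o) (hQ : 4 * o * (4 * o) < I.Q)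
    (h : ∀ i < I.D, ∀ j < I.D, 0 < I.sq o i j) : MatrixInstance where
  d := I.d
  Q := I.Q
  -- The value outside the matrix is irrelevant to the grammar; it only preserves the bounds, which
  -- are stated for all indices.
  a i j := if i < I.D ∧ j < I.D then I.sq o i j else 4 * o
  d_pos := I.d_pos
  a_pos i j := by
    split
    · rename_i h'
      exact h i h'.1 j h'.2
    · omega
  a_lt i j := by
    refine lt_of_le_of_lt ?_ ((Nat.le_mul_of_pos_right (4 * o) (by omega)).trans_lt hQ)
    split
    · exact I.sq_le o i j
    · exact le_rfl

end MatrixInstance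

theorem MatrixInstance.length_add_le (I : MatrixInstance) :
    I.rules.length + I.text.length + 1 ≤ 20 * (I.D * I.D) := by
  have hlt : I.text.length = 4 * I.d + 1 := by simp [MatrixInstance.text]
  rw [I.length_rules, hlt, I.D_sq]
  have h1 := I.d_le_d2
  have h2 := I.d2_le_d4
  have h3 : I.d4 ≤ I.d4 * I.d2 := Nat.le_mul_of_pos_right _ I.d2_pos
  have h4 := I.d_pos
  omega

/-- The instance for the matrix of the edges. -/
def WeightedDigraph.instance {m : ℕ} (w : WeightedDigraph m) {W : ℕ} (hW : w.WeightsBounded W)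
    {o d : ℕ} (ho : W < o) (hd : 1 ≤ d) : MatrixInstance where
  d := d
  Q := 32 * o * o
  a := w.edgeEntry o
  d_pos := hd
  a_pos i j := (edgeEntry_cases hW ho i j).1
  a_lt i j := (edgeEntry_cases hW ho i j).2.trans_lt (by nlinarith)

section Main

variable {X : Extension} {B : ℕ} {β : ℤ} {m : ℕ} {w : WeightedDigraph m} {σ : State}

theorem Setup.stage {f : ℕ → ℤ} {W o d : ℕ} (hσ : Setup w β f σ) (hW : w.WeightsBounded W)
    (ho : W < o) (hd : 1 ≤ d) (hw : w.NoNegativeCycle) (hm : 1 ≤ m)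
    (hlen : 20 * ((d * d * d) * (d * d * d) : ℤ) ≤ β) (hoβ : (8 * o : ℤ) ≤ β) (f0 : f 0 = m)
    (f1 : f 1 = d) (f2 : f 2 = (d * d : ℕ)) (f3 : f 3 = (d * d * (d * d) : ℕ))
    (f4 : f 4 = (d * d * d : ℕ)) (f5 : f 5 = o) (f6 : f 6 = (32 * o * o : ℕ)) (f8 : f 8 = 1)
    (f15 : f 15 = 0)
    (htab : ∀ n < 4 * d, σ.realArr 0 n = (w.instance hW ho hd).scale n * (w.instance hW ho hd).Q)
    (hmat : ∀ i < d * d * d, ∀ j < d * d * d,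
      σ.intArr 4 (i * (d * d * d : ℕ) + j) = w.edgeEntry o i j) :
    Stage w β o 0 (w.instance hW ho hd) σ := by
  refine ⟨⟨⟨(hσ.int _ (by norm_num)).trans f0, (hσ.int _ (by norm_num)).trans f1,
    (hσ.int _ (by norm_num)).trans f2, (hσ.int _ (by norm_num)).trans f3,
    (hσ.int _ (by norm_num)).trans f4, (hσ.int _ (by norm_num)).trans f6,
    (hσ.int _ (by norm_num)).trans f15, hmat, hm, ?_⟩, (hσ.int _ (by norm_num)).trans f5, htab, hoβ,
    fun i j => (WeightedDigraph.edgeEntry_cases hW ho i j).2, ?_⟩, hσ.bounded,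
    fun c _ _ => ⟨fun a i => hσ.intCopy a _, fun a i => hσ.realCopy a _⟩,
    (hσ.int _ (by norm_num)).trans f8, by omega, ?_⟩
  · refine le_trans ?_ hlen
    have h : (w.instance hW ho hd).D = d * d * d := rfl
    have := (w.instance hW ho hd).length_add_le
    rw [h] at this
    exact_mod_cast this
  · change 4 * o * (4 * o) < 32 * o * o
    nlinarith
  · exact WeightedDigraph.encodes_zero hw (fun i _ => if_pos rfl)
      (fun i _ j _ hij x hx => WeightedDigraph.edgeEntry_of_edge hW ho hij hx)
      fun i _ j _ hij hx => WeightedDigraph.edgeEntry_of_not_edge hij hx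

theorem Run.setup (hB : Ample β B) {W : ℕ} (hW : w.WeightsBounded W) (hw : w.NoNegativeCycle)
    (hm : 1 ≤ m) (hβ : 1000000 * ((m : ℤ) + W + 2) ^ 4 ≤ β) :
    Run B (StochasticParsing.setup X) w.input (300000 * (m * m)) fun τ =>
      ∃ (W' : ℕ) (I : MatrixInstance), W' ≤ W ∧ w.WeightsBounded W' ∧ m ≤ I.D ∧ I.D ≤ 8 * m ∧
      I.Q = 32 * (2 * m * W' + 1) * (2 * m * W' + 1) ∧ Stage w β (2 * m * W' + 1) 0 I τ := by
  have hm' : (1 : ℤ) ≤ m := by exact_mod_cast hm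
  have hW0 : (0 : ℤ) ≤ W := by positivity
  have N1 : (1 : ℤ) ≤ m + W + 2 := by linarith
  have p1 : (m : ℤ) + W + 2 ≤ ((m : ℤ) + W + 2) ^ 4 := le_self_pow₀ N1 (by norm_num)
  have p2 : ((m : ℤ) + W + 2) ^ 2 ≤ ((m : ℤ) + W + 2) ^ 4 := pow_le_pow_right₀ N1 (by norm_num)
  have p3 : (m : ℤ) * m ≤ ((m : ℤ) + W + 2) ^ 2 := by nlinarith
  have b1 : 10000 * ((m : ℤ) * m) ≤ β := by linarith
  have b2 : 100 * (m : ℤ) ≤ β := by linarith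
  have hmm : m ≤ m * m := Nat.le_mul_of_pos_left _ hm
  refine Run.mono (K := 6000 * (m * m) + (32000 * (m * m) + 200000 * (m * m))) ?_ (by omega)
    fun _ h => h
  refine Run.seq ((Run.initConstants hB hW hm hβ).mono le_rfl ?_)
  rintro τ ⟨d, W', hd, hd1, hd2, hW', hWb, f, hτ, f0, f1, f2, f3, f4, f5, f6, f8, f15⟩
  have hW'' : (W' : ℤ) ≤ W := by exact_mod_cast hW'
  have hWo : W' < 2 * m * W' + 1 := by
    have : W' ≤ m * W' := Nat.le_mul_of_pos_left _ hm
    rw [mul_assoc]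
    omega
  have o1 : ((2 * m * W' + 1 : ℕ) : ℤ) ≤ ((m : ℤ) + W + 2) ^ 2 := by
    push_cast
    nlinarith [mul_le_mul_of_nonneg_left hW'' (by linarith : (0 : ℤ) ≤ m)]
  have b3 : 8 * ((2 * m * W' + 1 : ℕ) : ℤ) ≤ β := by linarith
  clear hβ p1 p2 p3 o1
  obtain ⟨o, ho⟩ : ∃ o, o = 2 * m * W' + 1 := ⟨_, rfl⟩
  rw [← ho] at hWo b3 f5 f6
  let I := w.instance hWb hWo hd
  have hdD : d ≤ d * d * d := Nat.le_mul_of_pos_left _ (by positivity)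
  have hDβ : ((d * d * d : ℕ) : ℤ) ≤ 8 * m := by exact_mod_cast hd2
  have hdm : 4000 * d ≤ 32000 * (m * m) := by omega
  have hdβ : (4 * d : ℤ) ≤ β := by
    have : (d : ℤ) ≤ (d * d * d : ℕ) := by exact_mod_cast hdD
    linarith
  refine Run.seq ((Run.initTable hB hτ I f1 f2 f6 hdβ).mono hdm ?_)
  rintro υ ⟨hυ, htab⟩
  refine (Run.initMatrix hB hυ (o := o) (D := d * d * d) f0 f4 f5 hWb hWo (by linarith)
    (by linarith)).mono ?_ ?_
  · have h9 : d * d * d + 1 ≤ 9 * m := by omega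
    calc (d * d * d + 1) * ((d * d * d + 1) * (1500 + 400) + 400)
        ≤ (9 * m) * ((9 * m) * (1500 + 400) + 400) := by gcongr
      _ = 153900 * (m * m) + 3600 * m := by ring
      _ ≤ 200000 * (m * m) := by omega
  · rintro ω ⟨hω, hreal, hmat⟩
    refine ⟨W', I, hW', hWb, hd1, hd2, by rw [← ho]; rfl, ho ▸ hω.stage hWb hWo hd hw hm ?_ b3 f0 f1
      f2 f3 f4 f5 f6 f8 f15 (by rw [hreal]; exact htab) hmat⟩
    have h3 : ((d * d * d : ℕ) : ℤ) * (d * d * d : ℕ) ≤ (8 * m) * (8 * m) :=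
      mul_le_mul hDβ hDβ (by positivity) (by positivity)
    push_cast at h3
    linarith

/-- Only the matrix, the number of the call and the power of two change between stages; since `d`
and `Q` stay the same, the table of scales remains valid. -/
theorem Querying.stage {qry : Program X} {t b B' o s : ℕ} {I I' : MatrixInstance} {τ : State}
    (h : Querying qry t b B' I o β m s σ (I.D * I.D) τ) (hs : Stage w β o s I σ)
    (hs' : s + 1 < m) (hpow : 2 ^ (s + 1) ≤ 2 * m) (hpβ : ((2 ^ (s + 1) : ℕ) : ℤ) ≤ β)
    (hm : (m : ℤ) ≤ β)
    (ed : I'.d = I.d) (eQ : I'.Q = I.Q) (ha : ∀ i < I.D, ∀ j < I.D, I'.a i j = I.sq o i j)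
    (ha' : ∀ i j, I'.a i j ≤ 4 * o)
    (henc : WeightedDigraph.Encodes o I.D (w.Reach I.D (s + 1)) (I.sq o)) :
    Stage w β o (s + 1) I' ((τ.setInt 15 (s + 1 : ℕ)).setInt 8 (2 ^ (s + 1) : ℕ)) := by
  obtain ⟨hT, hβσ, hfresh, h8, -, -⟩ := hs
  have hP := hT.prepared
  have ed2 : I'.d2 = I.d2 := by unfold MatrixInstance.d2; rw [ed]
  have ed4 : I'.d4 = I.d4 := by unfold MatrixInstance.d4; rw [ed2]
  have eD : I'.D = I.D := by unfold MatrixInstance.D; rw [ed2, ed]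
  have low : ∀ x < 20, x ≠ 8 → x ≠ 15 →
      ((τ.setInt 15 (s + 1 : ℕ)).setInt 8 (2 ^ (s + 1) : ℕ)).int x = σ.int x := by
    intro x hx h1 h2
    rw [← h.int x hx]
    simp [State.setInt, h1, h2]
  have len : I'.rules.length + I'.text.length = I.rules.length + I.text.length := by
    rw [I.length_rules, I'.length_rules, ed4, ed2, ed]
    simp [MatrixInstance.text, ed]
  refine ⟨⟨⟨?_, ?_, ?_, ?_, ?_, ?_, ?_, ?_, hs', ?_⟩, ?_, ?_, hT.offset_le, ha', ?_⟩, ?_, ?_, ?_,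
    hpow, ?_⟩
  · exact (low _ (by norm_num) (by norm_num) (by norm_num)).trans hP.int0
  · exact (low _ (by norm_num) (by norm_num) (by norm_num)).trans (ed ▸ hP.int1)
  · exact (low _ (by norm_num) (by norm_num) (by norm_num)).trans (ed2 ▸ hP.int2)
  · exact (low _ (by norm_num) (by norm_num) (by norm_num)).trans (ed4 ▸ hP.int3)
  · exact (low _ (by norm_num) (by norm_num) (by norm_num)).trans (eD ▸ hP.int4)
  · exact (low _ (by norm_num) (by norm_num) (by norm_num)).trans (eQ ▸ hP.int6)
  · simp [State.setInt]
  · intro i hi j hj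
    rw [eD] at hi hj ⊢
    have := h.matrix (i * I.D + j) (by nlinarith)
    rw [Nat.mul_add_mod_of_lt hj, Nat.mul_comm, Nat.mul_add_div I.D_pos, Nat.div_eq_of_lt hj,
      Nat.add_zero, Nat.mul_comm] at this
    rw [ha i hi j hj, ← this]
    push_cast
    rfl
  · have := hP.length_le
    omega
  · exact (low _ (by norm_num) (by norm_num) (by norm_num)).trans hT.int5
  · intro n hn
    have e : I'.scale n * I'.Q = I.scale n * I.Q := by
      simp only [MatrixInstance.scale, MatrixInstance.step, ed2, ed, eQ]
    rw [e]
    exact (congrFun (h.realArr 0 (by norm_num)) n).trans (hT.table n (ed ▸ hn))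
  · rw [eQ]; exact hT.sq_lt
  · exact (h.bounded.setInt (by rw [Nat.abs_cast]; omega)).setInt (by rw [Nat.abs_cast]; exact hpβ)
  · intro c hc hsc
    have hf := hfresh c hc (by omega)
    -- The call has written only to addresses of residue `s`, so the copies with larger numbers are
    -- still zero.
    have hne : ∀ i : ℤ, (i * m + c) % (m : ℤ) ≠ s := by
      intro i
      rw [Frame.emod_copy hc]
      exact_mod_cast (by omega : c ≠ s)
    exact ⟨fun a i => (h.intCopy a _ (hne i)).trans (hf.int a i),
      fun a i => (h.realCopy a _ (hne i)).trans (hf.real a i)⟩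
  · simp [State.setInt]
  · intro i hi j hj
    rw [eD] at hi hj ⊢
    rw [ha i hi j hj]
    exact henc i hi j hj

/-- The time for a squaring, if the parser runs in time `Kp` and the queries in time `t`. -/
def squareTime (m b Kp t N : ℕ) : ℕ :=
  (8000000 + 81 * (2300 + 3 * t + 1000 * N)) * (m * m) + 2 * b + 2000 + 3 * Kp

theorem le_squareTime {m D b Kp t N : ℕ} (hm : 1 ≤ m) (hD : D ≤ 8 * m) :
    (100000 * (D * D) + (2 * b + 1000 + (3 * Kp +
      (D + 1) * ((D + 1) * (390 + 3 * t + (1100 + 1000 * N) + 400) + 400)))) + (130 + 130)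
      ≤ squareTime m b Kp t N := by
  have h9 : D + 1 ≤ 9 * m := by omega
  have hmm : m ≤ m * m := Nat.le_mul_of_pos_left _ hm
  have e1 : (D + 1) * ((D + 1) * (390 + 3 * t + (1100 + 1000 * N) + 400) + 400) ≤
      (9 * m) * ((9 * m) * (390 + 3 * t + (1100 + 1000 * N) + 400) + 400) := by gcongr
  have e3 : D * D ≤ (8 * m) * (8 * m) := Nat.mul_le_mul hD hD
  unfold squareTime
  nlinarith

/-- This is the reason for the choice of the offset: the loop never looks at walks of more than `2
m` edges. -/
theorem Stage.reach_lt {W s : ℕ} {I : MatrixInstance} (hW : w.WeightsBounded W)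
    (hs : 2 ^ s ≤ 2 * m) {i j : ℕ} {x : ℤ} (hx : w.Reach I.D s i j x) :
    |x| < (2 * m * W + 1 : ℕ) := by
  refine (hx.abs_le hW).trans_lt ?_
  have h : 2 ^ s * W ≤ 2 * m * W := Nat.mul_le_mul_right _ hs
  have : ((2 ^ s * W : ℕ) : ℤ) < (2 * m * W + 1 : ℕ) := by exact_mod_cast (by omega)
  exact_mod_cast this

theorem Run.squareStep {pre qry : Program X} {b t B' Kp N W : ℕ} {I : MatrixInstance} {s : ℕ}
    (hB : Ample β B) (hW : w.WeightsBounded W) (hm : 1 ≤ m) (h : Stage w β (2 * m * W + 1) s I σ)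
    (hs : 2 ^ s < m) (hb : pre.Below b) (hb' : qry.Below b) (hb0 : 0 < b)
    (hBB : B' * m + m ≤ B) (hD : I.D ≤ 8 * m) (hmβ : 2 * (m : ℤ) ≤ β)
    (hB' : I.grammar.numNT + I.grammar.numT + I.rules.length + I.text.length + 2 ≤ B')
    (hpre : ∃ τ k, Exec B' pre (I.grammar.scfg.input I.grammar.ruleList I.input) τ k ∧ k ≤ Kp ∧
      I.grammar.scfg.IsOracle B' qry t I.input τ) (hN : 8 * (2 * m * W + 1) < 2 ^ N) :
    Run B (StochasticParsing.squareStep b pre qry) σ (squareTime m b Kp t N) fun τ =>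
      ∃ I' : MatrixInstance, I'.d = I.d ∧ I'.Q = I.Q ∧
        Stage w β (2 * m * W + 1) (s + 1) I' τ := by
  have hstage := h
  obtain ⟨hT, hβσ, hfresh, h8, -, henc⟩ := h
  have hP := hT.prepared
  have o0 : 0 < 2 * m * W + 1 := by omega
  have hpow : 2 ^ (s + 1) ≤ 2 * m := by
    rw [pow_succ]
    omega
  have hS : ∀ i j x, w.Reach I.D s i j x → |x| < (2 * m * W + 1 : ℕ) :=
    fun i j x hx => Stage.reach_lt hW (by omega) hx
  have hS' : ∀ i j x, w.Reach I.D (s + 1) i j x → |x| < (2 * m * W + 1 : ℕ) :=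
    fun i j x hx => Stage.reach_lt hW hpow hx
  obtain ⟨hmin, henc'⟩ := henc.sq hS hS'
  -- The value of the offset has served its purpose; treating it as an atom keeps the remaining
  -- arithmetic linear.
  generalize 2 * m * W + 1 = o at *
  have hDβ : (I.D : ℤ) ≤ β := by
    have := hβσ.1 4 (by norm_num)
    rwa [hP.int4, Nat.abs_cast] at this
  have hpβ : ((2 ^ (s + 1) : ℕ) : ℤ) ≤ β := by
    have : ((2 ^ (s + 1) : ℕ) : ℤ) ≤ ((2 * m : ℕ) : ℤ) := by exact_mod_cast hpow
    push_cast at this ⊢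
    linarith
  -- From `s < 2 ^ s < m`: there are always enough residues modulo `m` for the calls of the parser.
  have hs1 : s + 1 < m := by
    have := Nat.lt_two_pow_self (n := s)
    omega
  refine Run.mono ?_ (le_squareTime hm hD) fun _ h => h
  refine Run.seq ((Run.square hB hT hβσ (hfresh s hP.copy_lt le_rfl) hb hb' hb0 hBB hB' hpre hN
    hDβ hmin).mono le_rfl fun τ hτ => ?_)
  refine Run.seq (Run.assign hB hτ.bounded (by decide) ?_)
  have v15 : (.reg 15 + 1 : Ex).eval τ = (s + 1 : ℕ) := by
    simp [hτ.int, hP.int15]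
  rw [v15]
  have b15 := hτ.bounded.setInt (x := 15) (v := (s + 1 : ℕ)) (by rw [Nat.abs_cast]; omega)
  refine Run.assign hB b15 (by decide) ?_
  have v8 : (2 * .reg 8 : Ex).eval (τ.setInt 15 (s + 1 : ℕ)) = (2 ^ (s + 1) : ℕ) := by
    simp [State.setInt, hτ.int, h8, pow_succ, mul_comm]
  rw [v8]
  refine ⟨I.next o o0 hT.sq_lt fun i hi j hj => henc'.pos hS' o0 hi hj, rfl, rfl,
    hτ.stage hstage hs1 hpow hpβ (by linarith) rfl rfl (fun i hi j hj => if_pos ⟨hi, hj⟩)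
      (fun i j => ?_) henc'⟩
  change (if i < I.D ∧ j < I.D then I.sq o i j else 4 * o) ≤ 4 * o
  split
  · exact I.sq_le o i j
  · exact le_rfl

end Main

end StochasticParsing

/-! ### The complete program for shortest paths -/

namespace StochasticParsing

section Main

variable {X : Extension} {B : ℕ} {β : ℤ} {m : ℕ} {w : WeightedDigraph m} {σ : State}

theorem MatrixInstance.D_congr {I I' : MatrixInstance} (h : I'.d = I.d) : I'.D = I.D := by
  simp only [MatrixInstance.D, MatrixInstance.d2, h]

/-- With word bound `B`, the programs `pre` and `qry` parse the instance `I` in time `K`, with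
queries in time `t`. -/
def Parses (B : ℕ) (pre qry : Program X) (K t : ℕ) (I : MatrixInstance) : Prop :=
  I.grammar.numNT + I.grammar.numT + I.rules.length + I.text.length + 2 ≤ B ∧
    ∃ τ k, Exec B pre (I.grammar.scfg.input I.grammar.ruleList I.input) τ k ∧ k ≤ K ∧
      I.grammar.scfg.IsOracle B qry t I.input τ

theorem Run.squareLoop {pre qry : Program X} {b t B' Kp N W : ℕ} {I₀ : MatrixInstance}
    (hB : Ample β B) (hW : w.WeightsBounded W) (hm : 1 ≤ m)
    (h : Stage w β (2 * m * W + 1) 0 I₀ σ) (hb : pre.Below b) (hb' : qry.Below b) (hb0 : 0 < b)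
    (hBB : B' * m + m ≤ B) (hD : I₀.D ≤ 8 * m) (hmβ : 2 * (m : ℤ) ≤ β)
    (hpre : ∀ I : MatrixInstance, I.d = I₀.d → I.Q = I₀.Q → Parses B' pre qry Kp t I)
    (hN : 8 * (2 * m * W + 1) < 2 ^ N) :
    Run B (StochasticParsing.squareLoop b pre qry) σ
      (Nat.clog 2 m * (squareTime m b Kp t N + 250) + 250) fun τ =>
        ∃ s I, m ≤ 2 ^ s ∧ I.d = I₀.d ∧ Stage w β (2 * m * W + 1) s I τ := by
  have ev : ∀ s I τ, Stage w β (2 * m * W + 1) s I τ →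
      (Ex.reg 8 + 1).eval τ = (2 ^ s : ℕ) + 1 ∧ (Ex.reg 0).eval τ = m :=
    fun s I τ h => ⟨by simp [h.2.2.2.1], h.1.prepared.int0⟩
  -- The loop stops as soon as `m ≤ 2 ^ s`, hence after at most `Nat.clog 2 m` squarings.
  refine Run.whileLe hB (fun n τ => ∃ s I, s + n = Nat.clog 2 m ∧ I.d = I₀.d ∧ I.Q = I₀.Q ∧
    Stage w β (2 * m * W + 1) s I τ) (by decide) (by decide) ?_ ?_ ?_
    ⟨0, I₀, by omega, rfl, rfl, h⟩
  · rintro n τ ⟨s, I, -, -, -, hs⟩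
    exact hs.2.1
  · rintro n τ ⟨s, I, hn, ed, eQ, hs⟩ hle
    rw [(ev s I τ hs).1, (ev s I τ hs).2] at hle
    have hlt : 2 ^ s < m := by exact_mod_cast Int.lt_iff_add_one_le.2 hle
    have hc := (Nat.lt_clog_iff_pow_lt one_lt_two).2 hlt
    obtain ⟨hB', hp⟩ := hpre I ed eQ
    refine ⟨n - 1, by omega, (Run.squareStep hB hW hm hs hlt hb hb' hb0 hBB
      (MatrixInstance.D_congr ed ▸ hD) hmβ hB' hp hN).mono le_rfl ?_⟩
    rintro υ ⟨I', ed', eQ', hυ⟩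
    exact ⟨s + 1, I', by omega, ed'.trans ed, eQ'.trans eQ, hυ⟩
  · rintro n τ ⟨s, I, -, ed, -, hs⟩ hlt
    rw [(ev s I τ hs).1, (ev s I τ hs).2] at hlt
    refine ⟨s, I, ?_, ed, hs⟩
    exact_mod_cast Int.lt_add_one_iff.1 hlt

/-- The rows of the matrix have length `D`, those of the solution length `m`; the dummy vertices are
dropped and the offset is removed. -/
theorem Run.output (hB : Ample β B) (hσ : Bounded β σ) {D o : ℕ} {a : ℕ → ℕ → ℕ}
    (h0 : σ.int 0 = m) (h4 : σ.int 4 = D) (h5 : σ.int 5 = o) (hoβ : 8 * (o : ℤ) ≤ β)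
    (hmat : ∀ i < m, ∀ j < m, σ.intArr 4 (i * D + j) = a i j) (ha : ∀ i j, a i j ≤ 4 * o) :
    Run B (StochasticParsing.output X) σ ((m + 1) * ((m + 1) * (750 + 400) + 400)) fun τ =>
      ∀ i < m, ∀ j < m, (a i j < 4 * o → τ.intArr 3 (i * m + j) = 1 ∧
        τ.intArr 2 (i * m + j) = a i j - o) ∧ (4 * o ≤ a i j → τ.intArr 3 (i * m + j) = 0) := by
  have hβ := hB.base
  have hmβ : (m : ℤ) ≤ β := by simpa [h0] using hσ.1 0 (by norm_num)
  let P : ℤ → ℤ → ℕ → Prop := fun u v k => (a (k / m) (k % m) < 4 * o → u = 1 ∧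
    v = a (k / m) (k % m) - o) ∧ (4 * o ≤ a (k / m) (k % m) → u = 0)
  let I : ℕ → State → Prop := fun n τ => Bounded β τ ∧ (∀ x < 20, τ.int x = σ.int x) ∧
    τ.intArr 4 = σ.intArr 4 ∧ ∀ k < n, P (τ.intArr 3 k) (τ.intArr 2 k) k
  have hI : ∀ n τ x (v : ℤ), I n τ → 22 ≤ x → |v| ≤ β → I n (τ.setInt x v) :=
    fun n τ x v h hx hv => ⟨h.1.setInt hv, fun y hy => by
      rw [← h.2.1 y hy]; exact Function.update_of_ne (by omega) _ _, h.2.2⟩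
  have e0 : ∀ n τ, I n τ → (Ex.reg 0).eval τ = m := fun n τ h => (h.2.1 0 (by norm_num)).trans h0
  refine Run.forLt hB (fun i τ => I (i * m) τ ∧ τ.int 22 = i) (by norm_num) (by decide) hσ
    ⟨hI _ _ _ _ ⟨hσ, fun _ _ => rfl, rfl, by simp⟩ le_rfl (by simp; omega),
      by simp [State.setInt]⟩
    (fun i _ τ h => ⟨h.1.1, e0 _ _ h.1, h.2⟩) (fun i hi τ h => ?_) fun τ h => ?_
  · refine (Run.forLt hB (fun j τ => I (i * m + j) τ ∧ τ.int 22 = i ∧ τ.int 23 = j) (by norm_num)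
      (by decide) h.1.1 ⟨hI _ _ _ _ h.1 (by norm_num) (by simp; omega),
        by simpa [State.setInt] using h.2, by simp [State.setInt]⟩
      (fun j _ τ h => ⟨h.1.1, e0 _ _ h.1, h.2.2⟩) (fun j hj τ h => ?_) fun τ h => h).mono le_rfl ?_
    · obtain ⟨⟨h1, h2, h3, hP⟩, e22, e23⟩ := h
      have d1 : (i * m + j) / m = i := by
        rw [Nat.mul_comm, Nat.mul_add_div (by omega), Nat.div_eq_of_lt hj, Nat.add_zero]
      have d2 : (i * m + j) % m = j := Nat.mul_add_mod_of_lt hj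
      have r0 := (h2 0 (by norm_num)).trans h0
      have r4 := (h2 4 (by norm_num)).trans h4
      have r5 := (h2 5 (by norm_num)).trans h5
      have hget : τ.intArr 4 ((i : ℤ) * D + j) = a i j := by rw [h3]; exact hmat i hi j hj
      have haij := ha i j
      have fin : ∀ υ : State, Bounded β υ → υ.int = τ.int → υ.intArr 4 = τ.intArr 4 →
          (∀ k : ℕ, k ≠ i * m + j → υ.intArr 3 k = τ.intArr 3 k ∧ υ.intArr 2 k = τ.intArr 2 k) →
          P (υ.intArr 3 (i * m + j : ℕ)) (υ.intArr 2 (i * m + j : ℕ)) (i * m + j) →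
          Bounded β υ ∧ υ.int 23 = j ∧ I (i * m + (j + 1)) (υ.setInt 23 (j + 1)) ∧
            (υ.setInt 23 (j + 1)).int 22 = i ∧ (υ.setInt 23 (j + 1)).int 23 = (j + 1 : ℕ) := by
        intro υ hb hint h4' hk hnew
        refine ⟨hb, hint ▸ e23, hI _ _ _ _ ⟨hb, fun x hx => hint ▸ h2 x hx, h4'.trans h3, ?_⟩
          (by norm_num) (by rw [abs_le]; constructor <;> omega),
          by simp [State.setInt, hint, e22], by simp [State.setInt]⟩
        intro k hlt
        by_cases e : k = i * m + j
        · rw [e]; exact hnew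
        · rw [(hk k e).1, (hk k e).2]
          exact hP k (by omega)
      refine (Run.ifLe (K := 500) hB h1 (by decide) (by decide) (fun hc => ?_)
        (fun hc => ?_)).mono le_rfl fun _ h => h
      · simp [e22, e23, r4, r5, hget] at hc
        have b3 : |(1 : ℤ)| ≤ β := by simp; omega
        refine Run.seq (K := 250) (L := 250) (Run.store hB h1 (by decide) (by decide) ?_)
        simp only [Ex.eval_add, Ex.eval_mul, Ex.eval_reg, Ex.eval_one, e22, e23, r0]
        refine Run.store hB (h1.setIntArr (.inl b3)) (by decide) (by decide) ?_
        have hget' : (τ.setIntArr 3 (i * m + j) 1).intArr 4 (i * D + j) = a i j := by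
          simpa [State.setIntArr] using hget
        simp only [Ex.eval_add, Ex.eval_sub, Ex.eval_mul, Ex.eval_reg, Ex.eval_get,
          show ∀ u v, (τ.setIntArr 3 u v).int = τ.int from fun _ _ => rfl, e22, e23, r0, r4, r5,
          hget']
        refine fin _ ((h1.setIntArr (.inl b3)).setIntArr
          (.inl (by rw [abs_le]; constructor <;> omega))) rfl ?_ (fun k hk => ?_) ?_
        · simp [State.setIntArr]
        · have : (k : ℤ) ≠ i * m + j := by exact_mod_cast hk
          simp [State.setIntArr, this]
        · simp only [P, d1, d2]
          exact ⟨fun _ => by simp [State.setIntArr], fun h => by omega⟩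
      · simp [e22, e23, r4, r5, hget] at hc
        refine (Run.store hB h1 (by decide) (by decide) ?_).mono (by norm_num) fun _ h => h
        simp only [Ex.eval_add, Ex.eval_mul, Ex.eval_reg, Ex.eval_zero, e22, e23, r0]
        refine fin _ (h1.setIntArr (.inl (by simp; omega))) rfl ?_ (fun k hk => ?_) ?_
        · simp [State.setIntArr]
        · have : (k : ℤ) ≠ i * m + j := by exact_mod_cast hk
          simp [State.setIntArr, this]
        · simp only [P, d1, d2]
          exact ⟨fun h => by omega, fun _ => by simp [State.setIntArr]⟩
    · rintro τ ⟨h1, h2, -⟩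
      refine ⟨h1.1, h2, ?_, by simp [State.setInt]⟩
      rw [Nat.add_mul, Nat.one_mul]
      exact hI _ _ _ _ h1 le_rfl (by rw [abs_le]; constructor <;> omega)
  · intro i hi j hj
    have := h.1.2.2.2 (i * m + j) (by nlinarith)
    have d1 : (i * m + j) / m = i := by
      rw [Nat.mul_comm, Nat.mul_add_div (by omega), Nat.div_eq_of_lt hj, Nat.add_zero]
    simp only [P, d1, Nat.mul_add_mod_of_lt hj] at this
    exact_mod_cast this

/-- The time for the shortest paths, if the parser runs in time `Kp` and the queries in time `t`. -/
def apspTime (m b Kp t N : ℕ) : ℕ :=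
  300000 * (m * m) + ((Nat.clog 2 m * (squareTime m b Kp t N + 250) + 250) +
    (m + 1) * ((m + 1) * (750 + 400) + 400))

theorem exec_apsp {pre qry : Program X} {b t B' Kp N W : ℕ} (hB : Ample β B)
    (hW : w.WeightsBounded W) (hw : w.NoNegativeCycle) (hm : 1 ≤ m)
    (hβ : 1000000 * ((m : ℤ) + W + 2) ^ 4 ≤ β) (hb : pre.Below b) (hb' : qry.Below b)
    (hb0 : 0 < b) (hBB : B' * m + m ≤ B)
    (hpre : ∀ I : MatrixInstance, I.D ≤ 8 * m →
      I.Q ≤ 32 * (2 * m * W + 1) * (2 * m * W + 1) → Parses B' pre qry Kp t I)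
    (hN : 8 * (2 * m * W + 1) < 2 ^ N) :
    ∃ τ k, Exec B (apsp b pre qry) w.input τ k ∧ k ≤ apspTime m b Kp t N ∧ w.IsSolution τ := by
  have hmβ : 2 * (m : ℤ) ≤ β := by
    have p1 : (m : ℤ) + W + 2 ≤ ((m : ℤ) + W + 2) ^ 4 := le_self_pow₀ (by omega) (by norm_num)
    linarith [(by positivity : (0 : ℤ) ≤ W)]
  have key : Run B (apsp b pre qry) w.input (apspTime m b Kp t N) w.IsSolution := by
    refine Run.seq ((Run.setup hB hW hw hm hβ).mono le_rfl ?_)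
    rintro τ ⟨W', I₀, hW', hWb, hmD, hDm, hQ, h0⟩
    have hmW : 2 * m * W' ≤ 2 * m * W := Nat.mul_le_mul_left _ hW'
    -- The loop works with the computed bound `W'`, whereas the guarantees on the parser and on `N`
    -- are given in terms of `W`; they carry over because `W' ≤ W`.
    refine Run.seq ((Run.squareLoop hB hWb hm h0 hb hb' hb0 hBB hDm hmβ (fun I ed eQ =>
      hpre I (MatrixInstance.D_congr ed ▸ hDm) ?_) (by omega)).mono le_rfl ?_)
    · rw [eQ, hQ]
      gcongr
    · rintro υ ⟨s, I, hs, ed, hυ⟩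
      obtain ⟨hT, hβυ, -, -, hpow, henc⟩ := hυ
      have hP := hT.prepared
      have hmI : m ≤ I.D := MatrixInstance.D_congr ed ▸ hmD
      refine (Run.output hB hβυ hP.int0 hP.int4 hT.int5 hT.offset_le (a := I.a)
        (fun i hi j hj => hP.matrix i (by omega) j (by omega)) hT.entry_le).mono le_rfl ?_
      intro ω hω i j
      obtain ⟨p1, p2⟩ := henc.isSolution_entry hw hmI hs
        (fun i j x hx => Stage.reach_lt hWb hpow hx) i j
      obtain ⟨q1, q2⟩ := hω i i.2 j j.2
      refine ⟨fun h => ?_, fun h => q2 (p2 h).ge⟩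
      obtain ⟨hlt, hleast⟩ := p1 h
      exact ⟨(q1 hlt).1, (q1 hlt).2 ▸ hleast⟩
  obtain ⟨τ₁, k, hk, hx, τ, hE, hτ⟩ := key w.input (Equiv.refl _)
  refine ⟨τ₁, k, hx, hk, fun i j => ?_⟩
  rw [hE.2.2.1]
  exact hτ i j

end Main

end StochasticParsing

/-! ### Bounds on grammar parameters, word sizes and logarithms -/

namespace StochasticParsing

theorem Exec.one_le {X : Extension} {B : ℕ} {p : Program X} {σ τ : State} {k : ℕ}
    (h : Exec B p σ τ k) : 1 ≤ k := by
  induction h <;> omega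

/-- No parsing problem is solved in a time that tends to `0`. -/
theorem SolvesParsing.le_three {X : Extension} {C δ : ℝ}
    (h : SolvesParsing X fun g n => C * (g.size * (n : ℝ) ^ (3 - δ) * g.maxLog)) : δ ≤ 3 := by
  by_contra! hδ
  obtain ⟨pre, qry, t, c, h⟩ := h
  -- Any fixed grammar would do; it is parsed with longer and longer strings. If `δ > 3`, the time
  -- bound falls below `1`, but every computation takes at least one step.
  let I : MatrixInstance := ⟨1, 2, fun _ _ => 1, le_rfl, fun _ _ => one_pos, fun _ _ => one_lt_two⟩
  let g := I.grammar
  have lim : ∀ a b : ℝ, Filter.Tendsto (fun n : ℕ => C * (a * (n : ℝ) ^ (3 - δ) * b))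
      Filter.atTop (nhds 0) := by
    intro a b
    have h1 : Filter.Tendsto (fun n : ℕ => (n : ℝ) ^ (-(δ - 3))) Filter.atTop (nhds 0) :=
      (tendsto_rpow_neg_atTop (by linarith)).comp tendsto_natCast_atTop_atTop
    rw [neg_sub] at h1
    simpa using ((h1.const_mul a).mul_const b).const_mul C
  obtain ⟨n, hn, hlt⟩ := ((Filter.eventually_ge_atTop 1).and
    ((lim g.scfg.size g.scfg.maxLog).eventually (gt_mem_nhds one_pos))).exists
  obtain ⟨B, hB⟩ := exists_nat_ge ((g.scfg.size + n + (2 : ℝ) ^ g.scfg.maxLog) ^ c)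
  have hlen : (List.replicate n (g.letter 0)).length = n := List.length_replicate
  obtain ⟨σ, k, hx, hk, -⟩ := h g.scfg g.isCNF I.allReachable g.ruleList g.ruleList_nodup
    g.mem_ruleList_iff (List.replicate n (g.letter 0))
    (List.ne_nil_of_length_pos (by rw [hlen]; exact hn)) B (by rw [hlen]; exact hB)
  rw [hlen] at hk
  have : (1 : ℝ) ≤ k := by exact_mod_cast hx.one_le
  linarith

theorem MatrixInstance.d4_le (I : MatrixInstance) : I.d4 ≤ I.D * I.D := by
  rw [I.D_sq]
  exact Nat.le_mul_of_pos_right _ I.d2_pos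

section Bounds

variable {m W : ℕ} {I : MatrixInstance}

theorem D_mul_D_le (hD : I.D ≤ 8 * m) : I.D * I.D ≤ 64 * (m * m) :=
  (Nat.mul_le_mul hD hD).trans (le_of_eq (by ring))

theorem three_mul_d4_mul_Q_le (hD : I.D ≤ 8 * m)
    (hQ : I.Q ≤ 32 * (2 * m * W + 1) * (2 * m * W + 1)) :
    3 * I.d4 * I.Q ≤ 6144 * (m * m) * ((2 * m * W + 1) * (2 * m * W + 1)) := by
  calc 3 * I.d4 * I.Q
      ≤ 3 * (64 * (m * m)) * (32 * (2 * m * W + 1) * (2 * m * W + 1)) := by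
        gcongr
        exact I.d4_le.trans (D_mul_D_le hD)
    _ = _ := by ring

theorem two_rpow_maxLog_le : (2 : ℝ) ^ I.grammar.scfg.maxLog ≤ (3 * I.d4 * I.Q : ℕ) := by
  have h0 : (0 : ℝ) < 3 * I.d4 * I.Q := by
    have h4 : (0 : ℝ) < I.d4 := by exact_mod_cast I.d4_pos
    have hQ : (0 : ℝ) < I.Q := by exact_mod_cast I.Q_pos
    positivity
  rw [← Real.le_logb_iff_rpow_le (by norm_num) (by exact_mod_cast h0)]
  exact_mod_cast I.maxLog_le

/-- The quantity in the parser's demand on the word bound is polynomial in `m + W + 2`, because the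
reciprocals of all probabilities are. -/
theorem parser_bound (hm : 1 ≤ m) (hD : I.D ≤ 8 * m)
    (hQ : I.Q ≤ 32 * (2 * m * W + 1) * (2 * m * W + 1)) :
    I.grammar.scfg.size + I.input.length + (2 : ℝ) ^ I.grammar.scfg.maxLog ≤
      ((m + W + 2) ^ 15 : ℕ) := by
  have h1 : I.grammar.scfg.size ≤ 3072 * (m * m) :=
    I.size_le.trans (by have := D_mul_D_le hD; omega)
  have h2 : I.input.length ≤ 40 * (m * m) := by
    rw [I.length_input]
    have h3 : I.d ≤ I.D := Nat.le_mul_of_pos_left _ I.d2_pos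
    have h4 : m ≤ m * m := Nat.le_mul_of_pos_left _ hm
    omega
  have h3 := three_mul_d4_mul_Q_le hD hQ
  have key : I.grammar.scfg.size + I.input.length + 3 * I.d4 * I.Q ≤ (m + W + 2) ^ 15 := by
    have ho : 2 * m * W + 1 ≤ (m + W + 2) ^ 2 := by nlinarith
    have hmm : m * m ≤ (m + W + 2) ^ 2 := by nlinarith
    have h3N : 3 ≤ m + W + 2 := by omega
    generalize m + W + 2 = N at *
    -- Numerical constants are absorbed into powers of `N ≥ 3`; `3 ^ 8 = 6561` exceeds both `3112`
    -- and `6144`.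
    have e1 : 3072 * (m * m) + 40 * (m * m) ≤ 3 ^ 8 * (m * m) := by omega
    have e2 : 6144 * (m * m) * ((2 * m * W + 1) * (2 * m * W + 1)) ≤
        3 ^ 8 * (m * m) * ((2 * m * W + 1) * (2 * m * W + 1)) := by gcongr; norm_num
    calc I.grammar.scfg.size + I.input.length + 3 * I.d4 * I.Q
        ≤ 3 ^ 8 * (m * m) + 3 ^ 8 * (m * m) * ((2 * m * W + 1) * (2 * m * W + 1)) := by omega
      _ ≤ N ^ 8 * N ^ 2 + N ^ 8 * N ^ 2 * (N ^ 2 * N ^ 2) := by gcongr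
      _ = N ^ 10 + N ^ 14 := by ring
      _ ≤ N ^ 14 + N ^ 14 := by gcongr <;> omega
      _ = 2 * N ^ 14 := by ring
      _ ≤ N * N ^ 14 := by gcongr; omega
      _ = N ^ 15 := by ring
  calc _ ≤ (I.grammar.scfg.size + I.input.length + (3 * I.d4 * I.Q : ℕ) : ℝ) := by
        gcongr
        exact two_rpow_maxLog_le
    _ ≤ _ := by exact_mod_cast key

theorem add_length_le (hm : 1 ≤ m) (hD : I.D ≤ 8 * m) :
    I.grammar.numNT + I.grammar.numT + I.rules.length + I.text.length + 2 ≤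
      (m + W + 2) ^ 15 := by
  have h1 : I.grammar.numNT = 2 + 2 * I.d + I.d4 + I.d4 := rfl
  have h2 : I.grammar.numT = 2 * I.d + 1 := rfl
  have h3 := I.length_add_le
  have h4 := D_mul_D_le hD
  have h5 := I.d4_le
  have h6 := I.d_le_d2
  have h7 := I.d2_le_d4
  have h8 := I.d_pos
  have h3N : 3 ≤ m + W + 2 := by omega
  have hmm : m * m ≤ (m + W + 2) ^ 2 := by nlinarith
  generalize m + W + 2 = N at *
  calc I.grammar.numNT + I.grammar.numT + I.rules.length + I.text.length + 2
      ≤ 3 ^ 13 * (m * m) := by omega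
    _ ≤ N ^ 13 * N ^ 2 := by gcongr
    _ = N ^ 15 := by ring

/-- The constant is at most `N ^ 13` for `N ≥ 3`, so the bound on stored words is at most `N ^ 17`;
expressions have size at most `40`, and `17 * 40 = 680`. -/
theorem ample_of_le {B : ℕ} (hm : 1 ≤ m) (hB : (m + W + 2) ^ 680 ≤ B) :
    Ample (1000000 * ((m : ℤ) + W + 2) ^ 4) B := by
  have h3 : (3 : ℤ) ≤ (m : ℤ) + W + 2 := by omega
  have hB' : ((m : ℤ) + W + 2) ^ 680 ≤ B := by exact_mod_cast hB
  generalize (m : ℤ) + W + 2 = N at *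
  have h1 : (1 : ℤ) ≤ N ^ 4 := one_le_pow₀ (by omega)
  have h13 : (1000000 : ℤ) ≤ N ^ 13 :=
    (by norm_num : (1000000 : ℤ) ≤ 3 ^ 13).trans (pow_le_pow_left₀ (by norm_num) h3 13)
  refine ⟨by omega, ?_⟩
  calc (1000000 * N ^ 4) ^ 40 ≤ (N ^ 13 * N ^ 4) ^ 40 := by gcongr
    _ = N ^ 680 := by rw [← pow_add, ← pow_mul]
    _ ≤ B := hB'

theorem pow_mul_add_le (hm : 1 ≤ m) (k : ℕ) :
    (m + W + 2) ^ k * m + m ≤ (m + W + 2) ^ (k + 2) := by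
  have h1 : 1 ≤ (m + W + 2) ^ k := Nat.one_le_pow _ _ (by omega)
  have h2 : m ≤ (m + W + 2) ^ k * m := Nat.le_mul_of_pos_left _ h1
  calc (m + W + 2) ^ k * m + m ≤ (m + W + 2) ^ k * (m * 2) := by nlinarith
    _ ≤ (m + W + 2) ^ k * ((m + W + 2) * (m + W + 2)) := by gcongr <;> omega
    _ = _ := by ring

end Bounds

section Logarithms

variable {m W : ℕ}

theorem one_le_logb_succ (hm : 1 ≤ m) : 1 ≤ Real.logb 2 ((m : ℝ) + 1) := by
  rw [Real.le_logb_iff_rpow_le (by norm_num) (by positivity), Real.rpow_one]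
  have : (1 : ℝ) ≤ m := by exact_mod_cast hm
  linarith

theorem one_le_logb_add_two : 1 ≤ Real.logb 2 ((W : ℝ) + 2) := by
  rw [Real.le_logb_iff_rpow_le (by norm_num) (by positivity), Real.rpow_one]
  linarith [W.cast_nonneg (α := ℝ)]

theorem clog_le_logb {n : ℕ} (hn : 1 ≤ n) {x : ℝ} (hx : n ≤ x) :
    (Nat.clog 2 n : ℝ) ≤ Real.logb 2 x + 1 := by
  have h0 : (1 : ℝ) ≤ n := by exact_mod_cast hn
  rcases Nat.eq_zero_or_pos (Nat.clog 2 n) with h | h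
  · rw [h, Nat.cast_zero]
    have := Real.logb_nonneg one_lt_two (h0.trans hx)
    linarith
  · have h1 : 2 ^ (Nat.clog 2 n - 1) < n := Nat.pow_lt_of_lt_clog (by omega)
    have h2 : ((Nat.clog 2 n - 1 : ℕ) : ℝ) ≤ Real.logb 2 x := by
      rw [Real.le_logb_iff_rpow_le (by norm_num) (by linarith), Real.rpow_natCast]
      exact le_trans (by exact_mod_cast h1.le) hx
    rw [Nat.cast_sub h, Nat.cast_one] at h2
    linarith

/-- Both logarithms are at least `1`, so their sum, and any constant, can be estimated by multiples
of their product. The price is one logarithmic factor. -/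
theorem logb_mul_pow_le {k i j : ℕ} (hm : 1 ≤ m) :
    Real.logb 2 (2 ^ k * ((m : ℝ) + 1) ^ i * ((W : ℝ) + 2) ^ j) ≤
      (k + i + j) * (Real.logb 2 ((m : ℝ) + 1) * Real.logb 2 ((W : ℝ) + 2)) := by
  have hx : (0 : ℝ) < (m : ℝ) + 1 := by positivity
  have hy : (0 : ℝ) < (W : ℝ) + 2 := by positivity
  rw [Real.logb_mul (by positivity) (by positivity), Real.logb_mul (by positivity) (by positivity),
    Real.logb_pow, Real.logb_pow, Real.logb_pow, Real.logb_self_eq_one one_lt_two]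
  have h1 := one_le_logb_succ hm
  have h2 := one_le_logb_add_two (W := W)
  generalize Real.logb 2 ((m : ℝ) + 1) = x at *
  generalize Real.logb 2 ((W : ℝ) + 2) = y at *
  have hi : (0 : ℝ) ≤ i := i.cast_nonneg
  have hj : (0 : ℝ) ≤ j := j.cast_nonneg
  have hk : (0 : ℝ) ≤ k := k.cast_nonneg
  have p1 : x ≤ x * y := le_mul_of_one_le_right (by linarith) h2
  have p2 : y ≤ x * y := le_mul_of_one_le_left (by linarith) h1
  have p3 : 1 ≤ x * y := h1.trans p1
  nlinarith [mul_le_mul_of_nonneg_left p1 hi, mul_le_mul_of_nonneg_left p2 hj,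
    mul_le_mul_of_nonneg_left p3 hk]

end Logarithms

end StochasticParsing

/-! ### Running time and the reduction -/

namespace StochasticParsing

section Time

variable {m W : ℕ} {δ : ℝ}

theorem maxLog_le_logb_mul_logb {I : MatrixInstance} (hm : 1 ≤ m) (hD : I.D ≤ 8 * m)
    (hQ : I.Q ≤ 32 * (2 * m * W + 1) * (2 * m * W + 1)) :
    I.grammar.scfg.maxLog ≤ 21 * (Real.logb 2 ((m : ℝ) + 1) * Real.logb 2 ((W : ℝ) + 2)) := by
  have h0 : (0 : ℝ) < 3 * I.d4 * I.Q := by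
    have h4 : (0 : ℝ) < I.d4 := by exact_mod_cast I.d4_pos
    have hQ : (0 : ℝ) < I.Q := by exact_mod_cast I.Q_pos
    positivity
  have h1 : 3 * I.d4 * I.Q ≤ 2 ^ 15 * (m + 1) ^ 4 * (W + 2) ^ 2 := by
    calc 3 * I.d4 * I.Q ≤ 6144 * (m * m) * ((2 * m * W + 1) * (2 * m * W + 1)) :=
          three_mul_d4_mul_Q_le hD hQ
      _ ≤ 8192 * ((m + 1) * (m + 1)) *
          ((2 * ((m + 1) * (W + 2))) * (2 * ((m + 1) * (W + 2)))) := by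
          gcongr <;> first | omega | nlinarith
      _ = _ := by ring
  -- The constant `21` is `15 + 4 + 2`, from the exponents in `h1`.
  have h2 := logb_mul_pow_le (W := W) (k := 15) (i := 4) (j := 2) hm
  norm_num at h2 ⊢
  refine I.maxLog_le.trans (le_trans ?_ h2)
  refine Real.logb_le_logb_of_le one_lt_two h0 ?_
  norm_num at h1
  exact_mod_cast h1

/-- The cube of the length is `O(d³) = O(m)`, and `n ^ (3 - δ)` is the power of this cube with
exponent `1 - δ / 3`. The exponent must be nonnegative for the estimate, whence `δ ≤ 3`. -/
theorem length_rpow_le {I : MatrixInstance} (hδ : 0 < δ) (hδ' : δ ≤ 3) (hD : I.D ≤ 8 * m) :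
    (I.input.length : ℝ) ^ (3 - δ) ≤ 1000 * (m : ℝ) ^ (1 - δ / 3) := by
  have h1 : (I.input.length : ℝ) ^ 3 ≤ 1000 * m := by
    have h2 : I.input.length ≤ 5 * I.d := by
      have := I.d_pos
      rw [I.length_input]
      omega
    have h3 : I.input.length ^ 3 ≤ 1000 * m := by
      calc I.input.length ^ 3 ≤ (5 * I.d) ^ 3 := by gcongr
        _ = 125 * I.D := by unfold MatrixInstance.D MatrixInstance.d2; ring
        _ ≤ 1000 * m := by omega
    exact_mod_cast h3
  calc (I.input.length : ℝ) ^ (3 - δ) = ((I.input.length : ℝ) ^ 3) ^ (1 - δ / 3) := by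
        rw [← Real.rpow_natCast, ← Real.rpow_mul (by positivity)]
        congr 1
        push_cast
        ring
    _ ≤ (1000 * (m : ℝ)) ^ (1 - δ / 3) := by
        gcongr
        linarith
    _ = (1000 : ℝ) ^ (1 - δ / 3) * (m : ℝ) ^ (1 - δ / 3) :=
        Real.mul_rpow (by norm_num) (by positivity)
    _ ≤ (1000 : ℝ) ^ (1 : ℝ) * (m : ℝ) ^ (1 - δ / 3) := by
        gcongr
        · norm_num
        · linarith
    _ = _ := by rw [Real.rpow_one]

/-- Writing the grammar and querying all entries takes about `m²` steps, up to a logarithm for the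
search; this is dominated by the claimed time. -/
theorem mul_self_le_rpow (hδ' : δ ≤ 3) (hm : 1 ≤ m) :
    ((m * m : ℕ) : ℝ) ≤ (m : ℝ) ^ (3 - δ / 3) := by
  calc ((m * m : ℕ) : ℝ) = (m : ℝ) ^ (2 : ℝ) := by push_cast; rw [Real.rpow_two]; ring
    _ ≤ _ := Real.rpow_le_rpow_of_exponent_le (by exact_mod_cast hm) (by linarith)

/-- The grammar contributes `m²`, the string `m ^ (1 - δ / 3)`, and the exponents add up to `3 - δ /
3`. The constant is `3072 * 1000 * 21`. -/
theorem parsing_time_le {I : MatrixInstance} (C : ℝ) (hm : 1 ≤ m) (hδ : 0 < δ) (hδ' : δ ≤ 3)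
    (hD : I.D ≤ 8 * m) (hQ : I.Q ≤ 32 * (2 * m * W + 1) * (2 * m * W + 1)) :
    C * (I.grammar.scfg.size * (I.input.length : ℝ) ^ (3 - δ) * I.grammar.scfg.maxLog) ≤
      |C| * 64512000 * ((m : ℝ) ^ (3 - δ / 3) *
        (Real.logb 2 ((m : ℝ) + 1) * Real.logb 2 ((W : ℝ) + 2))) := by
  have hm0 : (0 : ℝ) < m := by exact_mod_cast hm
  have h1 : (I.grammar.scfg.size : ℝ) ≤ 3072 * (m : ℝ) ^ (2 : ℝ) := by
    have : I.grammar.scfg.size ≤ 3072 * m ^ 2 :=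
      I.size_le.trans (by have := D_mul_D_le hD; rw [pow_two]; omega)
    rw [Real.rpow_two]
    exact_mod_cast this
  have h2 := length_rpow_le hδ hδ' hD
  have h3 := maxLog_le_logb_mul_logb hm hD hQ
  have h4 : 0 ≤ I.grammar.scfg.maxLog := zero_le_one.trans (RawGrammar.one_le_maxLog _)
  have e : (m : ℝ) ^ (3 - δ / 3) = (m : ℝ) ^ (2 : ℝ) * (m : ℝ) ^ (1 - δ / 3) := by
    rw [← Real.rpow_add hm0]
    congr 1
    ring
  generalize I.grammar.scfg.maxLog = l at *
  generalize I.grammar.scfg.size = s at *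
  calc C * (s * (I.input.length : ℝ) ^ (3 - δ) * l)
      ≤ |C| * (s * (I.input.length : ℝ) ^ (3 - δ) * l) := by
        gcongr
        exact le_abs_self C
    _ ≤ |C| * (3072 * (m : ℝ) ^ (2 : ℝ) * (1000 * (m : ℝ) ^ (1 - δ / 3)) *
        (21 * (Real.logb 2 ((m : ℝ) + 1) * Real.logb 2 ((W : ℝ) + 2)))) := by gcongr
    _ = _ := by rw [e]; ring

theorem apspTime_le {b Kp t N : ℕ} {K : ℝ} (hm : 1 ≤ m) (hδ' : δ ≤ 3)
    (hKp : Kp ≤ K * ((m : ℝ) ^ (3 - δ / 3) *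
        (Real.logb 2 ((m : ℝ) + 1) * Real.logb 2 ((W : ℝ) + 2))))
    (hN : N ≤ 7 * (Real.logb 2 ((m : ℝ) + 1) * Real.logb 2 ((W : ℝ) + 2))) :
    (apspTime m b Kp t N : ℝ) ≤ (305650 + 2 * (8000000 + 81 * (9300 + 3 * t) + 2 * b + 2250 +
      3 * K)) * ((m : ℝ) ^ (3 - δ / 3) * Real.logb 2 ((m : ℝ) + 1) ^ 2 *
        Real.logb 2 ((W : ℝ) + 2)) := by
  have hx := one_le_logb_succ hm
  have hy := one_le_logb_add_two (W := W)
  have hs := mul_self_le_rpow hδ' hm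
  have hc : (Nat.clog 2 m : ℝ) ≤ 2 * Real.logb 2 ((m : ℝ) + 1) := by
    have := clog_le_logb hm (x := (m : ℝ) + 1) (by linarith)
    linarith
  have hsq : 0 ≤ (squareTime m b Kp t N : ℝ) := Nat.cast_nonneg _
  have hms : m ≤ m * m := Nat.le_mul_of_pos_left _ hm
  have hout : (m + 1) * ((m + 1) * (750 + 400) + 400) ≤ 5400 * (m * m) := by
    calc (m + 1) * ((m + 1) * (750 + 400) + 400)
        ≤ (2 * m) * ((2 * m) * (750 + 400) + 400) := by gcongr <;> omega
      _ = 4600 * (m * m) + 800 * m := by ring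
      _ ≤ _ := by omega
  have hout' : (((m + 1) * ((m + 1) * (750 + 400) + 400) : ℕ) : ℝ) ≤ 5400 * (m * m : ℕ) := by
    exact_mod_cast hout
  have hs1 : (1 : ℝ) ≤ (m * m : ℕ) := by exact_mod_cast hm.trans hms
  have esq : (squareTime m b Kp t N : ℝ) =
      (8000000 + 81 * (2300 + 3 * t + 1000 * N)) * (m * m : ℕ) + 2 * b + 2000 + 3 * Kp := by
    simp [squareTime]
  have e : (apspTime m b Kp t N : ℝ) = 300000 * (m * m : ℕ) +
      ((Nat.clog 2 m : ℝ) * (squareTime m b Kp t N + 250) + 250 +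
        ((m + 1) * ((m + 1) * (750 + 400) + 400) : ℕ)) := by
    simp [apspTime]
  rw [e]
  generalize (((m + 1) * ((m + 1) * (750 + 400) + 400) : ℕ) : ℝ) = u at *
  generalize (squareTime m b Kp t N : ℝ) = q at *
  generalize ((m * m : ℕ) : ℝ) = s at *
  generalize (m : ℝ) ^ (3 - δ / 3) = M at *
  generalize Real.logb 2 ((m : ℝ) + 1) = x at *
  generalize Real.logb 2 ((W : ℝ) + 2) = y at *
  have hP : 1 ≤ x * y := one_le_mul_of_one_le_of_one_le hx hy
  have hM : 1 ≤ M := hs1.trans hs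
  have hMP : M ≤ M * (x * y) := le_mul_of_one_le_right (by linarith) hP
  -- One factor `x` comes from the number of squarings, the other from the cost of a single
  -- squaring.
  have hT : M * x ^ 2 * y = x * (M * (x * y)) := by ring
  have hMT : M * (x * y) ≤ x * (M * (x * y)) := le_mul_of_one_le_left (by linarith) hx
  have ht : (0 : ℝ) ≤ t := t.cast_nonneg
  have hb : (0 : ℝ) ≤ b := b.cast_nonneg
  have hA : q + 250 ≤ (8000000 + 81 * (9300 + 3 * t) + 2 * b + 2250 + 3 * K) * (M * (x * y)) := by
    have h1 : 8000000 + 81 * (2300 + 3 * t + 1000 * N) ≤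
        (8000000 + 81 * (9300 + 3 * t)) * (x * y) := by
      nlinarith [mul_le_mul_of_nonneg_left hP ht]
    have h2 : (8000000 + 81 * (2300 + 3 * t + 1000 * N)) * s ≤
        (8000000 + 81 * (9300 + 3 * t)) * (x * y) * M := by
      gcongr
    have h3 : 1 ≤ M * (x * y) := hM.trans hMP
    nlinarith [mul_le_mul_of_nonneg_left h3 hb]
  have hcq : (Nat.clog 2 m : ℝ) * (q + 250) ≤ (2 * x) *
      ((8000000 + 81 * (9300 + 3 * t) + 2 * b + 2250 + 3 * K) * (M * (x * y))) := by
    gcongr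
  rw [hT]
  linarith

end Time

/-- All pairs shortest paths reduce to parsing. -/
theorem SolvesParsing.solvesAPSP {X : Extension} {δ : ℝ} (hδ : 0 < δ)
    {C : ℝ} (h : SolvesParsing X fun g n => C * (g.size * (n : ℝ) ^ (3 - δ) * g.maxLog)) :
    ∃ (C : ℝ) (e : ℕ), SolvesAPSP X
      (fun m W => C * ((m : ℝ) ^ (3 - δ / 3) * Real.logb 2 (m + 1) ^ e *
        Real.logb 2 (W + 2))) := by
  have hδ' := h.le_three
  obtain ⟨pre, qry, t, cp, h⟩ := h
  obtain ⟨b₁, hb₁⟩ := Program.exists_below pre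
  obtain ⟨b₂, hb₂⟩ := Program.exists_below qry
  let b := b₁ + b₂ + 1
  -- The exponent of the word bound has to cover the relocated parser, which needs `15 * cp + 17`,
  -- and the expressions, which need `680`.
  refine ⟨305650 + 2 * (8000000 + 81 * (9300 + 3 * t) + 2 * b + 2250 + 3 * (|C| * 64512000)), 2,
    apsp b pre qry, 15 * cp + 700, fun m W w hm hW hw B hB => ?_⟩
  let Kp := ⌊|C| * 64512000 * ((m : ℝ) ^ (3 - δ / 3) *
        (Real.logb 2 ((m : ℝ) + 1) * Real.logb 2 ((W : ℝ) + 2)))⌋₊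
  -- The least number of rounds that suffices to search an interval of `8 * o + 1 = 16 * m * W + 9`
  -- numbers.
  let N := Nat.clog 2 (16 * m * W + 9)
  have hN1 : 1 ≤ m + W + 2 := by omega
  have hN : 8 * (2 * m * W + 1) < 2 ^ N :=
    lt_of_lt_of_le (by nlinarith) (Nat.le_pow_clog one_lt_two (16 * m * W + 9))
  have hBB : (m + W + 2) ^ (15 * cp + 15) * m + m ≤ B :=
    (pow_mul_add_le hm _).trans ((Nat.pow_le_pow_right hN1 (by omega)).trans hB)
  have lm := one_le_logb_succ hm
  have lw := one_le_logb_add_two (W := W)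
  have hP : 1 ≤ Real.logb 2 ((m : ℝ) + 1) * Real.logb 2 ((W : ℝ) + 2) :=
    one_le_mul_of_one_le_of_one_le lm lw
  have hpre : ∀ I : MatrixInstance, I.D ≤ 8 * m →
      I.Q ≤ 32 * (2 * m * W + 1) * (2 * m * W + 1) →
      Parses ((m + W + 2) ^ (15 * cp + 15)) pre qry Kp t I := by
    intro I hD hQ
    have hlen := I.length_input
    obtain ⟨τ, k, hx, hk, ho⟩ := h I.grammar.scfg I.grammar.isCNF I.allReachable
      I.grammar.ruleList I.grammar.ruleList_nodup I.grammar.mem_ruleList_iff I.input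
      (List.ne_nil_of_length_pos (by omega)) ((m + W + 2) ^ (15 * cp + 15)) (by
        refine (pow_le_pow_left₀ (by positivity) (parser_bound hm hD hQ) cp).trans ?_
        rw [← Nat.cast_pow, ← pow_mul]
        exact_mod_cast Nat.pow_le_pow_right hN1 (by omega))
    exact ⟨(add_length_le hm hD).trans (Nat.pow_le_pow_right hN1 (by omega)), τ, k, hx,
      Nat.le_floor (hk.trans (parsing_time_le C hm hδ hδ' hD hQ)), ho⟩
  obtain ⟨τ, k, hx, hk, hsol⟩ := exec_apsp (b := b)
    (ample_of_le hm ((Nat.pow_le_pow_right hN1 (by omega)).trans hB)) hW hw hm le_rfl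
    (hb₁.mono (by omega)) (hb₂.mono (by omega)) (by omega) hBB hpre hN
  refine ⟨τ, k, hx, le_trans (Nat.cast_le.2 hk) (apspTime_le hm hδ' (K := |C| * 64512000)
    (Nat.floor_le (by positivity)) ?_), hsol⟩
  -- The exponents give `4 + 1 + 1 = 6`; rounding up in `clog_le_logb` adds `1`, which yields the
  -- constant `7` in the bound on `N`.
  have h1 := logb_mul_pow_le (W := W) (k := 4) (i := 1) (j := 1) hm
  have h2 : ((16 * m * W + 9 : ℕ) : ℝ) ≤ 2 ^ 4 * ((m : ℝ) + 1) ^ 1 * ((W : ℝ) + 2) ^ 1 := by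
    have : 16 * m * W + 9 ≤ 2 ^ 4 * (m + 1) ^ 1 * (W + 2) ^ 1 := by nlinarith
    exact_mod_cast this
  have h3 := clog_le_logb (by omega) h2
  push_cast at h1
  linarith

end StochasticParsing

theorem mainTheorem4 (X : StochasticParsing.Extension) (δ : ℝ) (hδ : 0 < δ)
    (hparse : ∃ C : ℝ, StochasticParsing.SolvesParsing X
      (fun g n => C * (g.size * (n : ℝ) ^ (3 - δ) * g.maxLog))) :
    ∃ (C : ℝ) (e : ℕ), StochasticParsing.SolvesAPSP X
      (fun m W => C * ((m : ℝ) ^ (3 - δ / 3) * Real.logb 2 (m + 1) ^ e *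
        Real.logb 2 (W + 2))) := by
  obtain ⟨C, h⟩ := hparse
  exact h.solvesAPSP hδ
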